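/- Let $(X,\otimes,I)$ be a monoidal category in a fixed 2-category $\mathsf{Cat}$ of small categories. A *monoidal fibration over $X$* is a fibration $P\colon A\to X$ where $A$ is a monoidal category, $P$ is a strict monoidal functor, and the tensor product of $A$ preserves cartesian morphisms: $\varphi\otimes\psi$ is cartesian whenever $\varphi$ and $\psi$ are. The 2-category $\mathsf{MonFib}(X)$ has these as objects. Its 1-cells from $P\colon A\to X$ to $Q\colon B\to X$ are the strong monoidal functors $H\colon A\to B$ with $QH=P$ that preserve cartesian morphisms and whose structure isomorphisms $I_B\to H I_A$ and $Ha\otimes Hb\to H(a\otimes b)$ are sent by $Q$ to identities. Its 2-cells are the monoidal natural transformations $\beta$ with $Q\beta=1_P$. The 2-category $\mathsf{MonOpFib}(X)$ of monoidal opfibrations is defined in the same way, with opfibrations and cocartesian morphisms in place of fibrations and cartesian morphisms. For a monoidal category $C$, let $\mathsf{Mon2Cat}_{ps}(C,\mathsf{Cat})$ be the 2-category of (weakly) lax monoidal pseudofunctors $M\colon(C,\otimes,I)\to(\mathsf{Cat},\times,1)$, monoidal pseudonatural transformations and monoidal modifications. Such an $M$ is a pseudofunctor with functors $\mu_{x,y}\colon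 Mx\times My\to M(x\otimes y)$, pseudonatural in $x,y$, an object $\mu_0\in MI$, and invertible modifications $\omega,\zeta,\xi$ for associativity and the right and left unit laws, subject to the usual two coherence axioms. A monoidal pseudonatural transformation $\tau\colon M\Rightarrow N$, where $N$ has laxators $\nu,\nu_0$, is a pseudonatural transformation with invertible comparison modifications $u_{x,y}\colon\nu_{x,y}(\tau_x\times\tau_y)\cong\tau_{x\otimes y}\,\mu_{x,y}$ and $u_0\colon\nu_0\cong\tau_I\mu_0$, compatible with $\omega,\zeta,\xi$. A monoidal modification is a modification compatible with $u$ and $u_0$. Then there are 2-equivalences (2-functors in both directions, with 2-natural isomorphisms from the composites to the identities) $$\mathsf{MonFib}(X)\simeq\mathsf{Mon2Cat}_{ps}(X^{\mathrm{op}},\mathsf{Cat}),\qquad \mathsf{MonOpFib}(X)\simeq\mathsf{Mon2Cat}_{ps}(X,\mathsf{Cat}),$$ which restrict the Grothendieck construction to the fixed base $X$. That is, the 2-functors from right to left act on underlying categories over $X$ as the Grothendieck construction $M\mapsto(\int M\to X)$ does on pseudofunctors, pseudonatural transformations and modifications. The total category $\int M$ carries the tensor product $(x,a)\otimes(y,b)=(x\otimes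 y,\mu_{x,y}(a,b))$ and unit $(I,\mu_0)$, with the tensor product of morphisms induced by $\mu$ and its pseudonaturality constraints, and with associativity and unit constraints given by those of $X$ together with $\omega,\zeta,\xi$. The functor $\int\tau$ carries the strong monoidal structure given by $u,u_0$. -/

import Mathlib

open CategoryTheory MonoidalCategory Bicategory Opposite
open scoped Pseudofunctor.StrongTrans Prod

universe v u v₁ u₁ v₂ u₂

namespace MonGroth

/-! ### Components of pseudofunctors, transformations and modifications into `Cat`

For a pseudofunctor `F : C ⥤ Cat` on an ordinary category `C` (regarded as a locally discrete
2-category) we write out the components of the structure maps at objects. -/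

section Components

variable {C : Type u₁} [Category.{v₁} C]

/-- The functor `F f : F x ⥤ F y`. -/
abbrev push (F : LocallyDiscrete C ⥤ᵖ Cat.{v₂, u₂}) {x y : C} (f : x ⟶ y) :
    F.obj ⟨x⟩ ⥤ F.obj ⟨y⟩ :=
  (F.map f.toLoc).toFunctor

/-- The unit constraint `(F f) a ≅ a` of `F` for an arrow `f` that is an identity. -/
def pushId (F : LocallyDiscrete C ⥤ᵖ Cat.{v₂, u₂}) {x : C} (f : x ⟶ x) (w : f = 𝟙 x)
    (a : F.obj ⟨x⟩) : (push F f).obj a ≅ a :=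
  (Cat.Hom.toNatIso (F.mapId' f.toLoc (by rw [w]; rfl))).app a

/-- The composition constraint `(F h) a ≅ (F g) ((F f) a)` of `F` for `h = f ≫ g`. -/
def pushComp (F : LocallyDiscrete C ⥤ᵖ Cat.{v₂, u₂}) {x y z : C} (f : x ⟶ y) (g : y ⟶ z)
    (h : x ⟶ z) (w : f ≫ g = h) (a : F.obj ⟨x⟩) :
    (push F h).obj a ≅ (push F g).obj ((push F f).obj a) :=
  (Cat.Hom.toNatIso (F.mapComp' f.toLoc g.toLoc h.toLoc (by rw [← w]; rfl))).app a

variable {F G : LocallyDiscrete C ⥤ᵖ Cat.{v₂, u₂}}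

/-- The component functor `τ_x : F x ⥤ G x` of a pseudonatural transformation. -/
abbrev comp₁ (τ : F ⟶ G) (x : C) : F.obj ⟨x⟩ ⥤ G.obj ⟨x⟩ :=
  (τ.app ⟨x⟩).toFunctor

/-- The pseudonaturality constraint `τ_y ((F f) a) ≅ (G f) (τ_x a)`. -/
def natIso (τ : F ⟶ G) {x y : C} (f : x ⟶ y) (a : F.obj ⟨x⟩) :
    (comp₁ τ y).obj ((push F f).obj a) ≅ (push G f).obj ((comp₁ τ x).obj a) :=
  (Cat.Hom.toNatIso (τ.naturality f.toLoc)).app a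

/-- The component `τ_x a ⟶ σ_x a` of a modification. -/
abbrev comp₂ {τ σ : F ⟶ G} (m : τ ⟶ σ) {x : C} (a : F.obj ⟨x⟩) :
    (comp₁ τ x).obj a ⟶ (comp₁ σ x).obj a :=
  (m.as.app ⟨x⟩).toNatTrans.app a

end Components

/-! ### The 2-category of lax monoidal pseudofunctors into `(Cat, ×, 1)` -/

section LaxMonoidal

variable (C : Type u₁) [Category.{v₁} C] [MonoidalCategory C]

/-- A (weakly) lax monoidal pseudofunctor `M : (C, ⊗, I) ⥤ (Cat, ×, 1)`: a pseudofunctor with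
pseudonatural `μ_{x,y} : M x × M y ⥤ M (x ⊗ y)` and `μ₀ : 1 ⥤ M I` (given by an object of `M I`),
and invertible modifications `ω`, `ζ`, `ξ` satisfying the two coherence axioms of a lax monoidal
homomorphism. -/
structure LaxMonoidalPseudofunctor where
  /-- the underlying pseudofunctor -/
  toPs : LocallyDiscrete C ⥤ᵖ Cat.{v₂, u₂}
  /-- the laxator -/
  mu (x y : C) : toPs.obj ⟨x⟩ × toPs.obj ⟨y⟩ ⥤ toPs.obj ⟨x ⊗ y⟩
  /-- the pseudonaturality constraint of the laxator -/
  muMap {x x' y y' : C} (f : x ⟶ x') (g : y ⟶ y') (a : toPs.obj ⟨x⟩) (b : toPs.obj ⟨y⟩) :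
    (push toPs (f ⊗ₘ g)).obj ((mu x y).obj (a, b)) ≅
      (mu x' y').obj ((push toPs f).obj a, (push toPs g).obj b)
  muMap_natural {x x' y y' : C} (f : x ⟶ x') (g : y ⟶ y') {a a' : toPs.obj ⟨x⟩}
    {b b' : toPs.obj ⟨y⟩} (k : a ⟶ a') (l : b ⟶ b') :
    (push toPs (f ⊗ₘ g)).map ((mu x y).map (k ×ₘ l)) ≫ (muMap f g a' b').hom =
      (muMap f g a b).hom ≫ (mu x' y').map ((push toPs f).map k ×ₘ (push toPs g).map l)
  muMap_id {x y : C} (a : toPs.obj ⟨x⟩) (b : toPs.obj ⟨y⟩) :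
    (muMap (𝟙 x) (𝟙 y) a b).hom ≫
        (mu x y).map ((pushId toPs (𝟙 x) rfl a).hom ×ₘ (pushId toPs (𝟙 y) rfl b).hom) =
      (pushId toPs (𝟙 x ⊗ₘ 𝟙 y) (by simp) ((mu x y).obj (a, b))).hom
  muMap_comp {x x' x'' y y' y'' : C} (f : x ⟶ x') (f' : x' ⟶ x'') (g : y ⟶ y') (g' : y' ⟶ y'')
    (a : toPs.obj ⟨x⟩) (b : toPs.obj ⟨y⟩) :
    (muMap (f ≫ f') (g ≫ g') a b).hom ≫
        (mu x'' y'').map ((pushComp toPs f f' _ rfl a).hom ×ₘ (pushComp toPs g g' _ rfl b).hom) =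
      (pushComp toPs (f ⊗ₘ g) (f' ⊗ₘ g') ((f ≫ f') ⊗ₘ (g ≫ g')) (by simp)
          ((mu x y).obj (a, b))).hom ≫
        (push toPs (f' ⊗ₘ g')).map (muMap f g a b).hom ≫ (muMap f' g' _ _).hom
  /-- the unitor -/
  mu0 : toPs.obj ⟨𝟙_ C⟩
  /-- the associativity modification -/
  omega {x y z : C} (a : toPs.obj ⟨x⟩) (b : toPs.obj ⟨y⟩) (c : toPs.obj ⟨z⟩) :
    (push toPs (α_ x y z).hom).obj ((mu (x ⊗ y) z).obj ((mu x y).obj (a, b), c)) ≅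
      (mu x (y ⊗ z)).obj (a, (mu y z).obj (b, c))
  omega_natural {x y z : C} {a a' : toPs.obj ⟨x⟩} {b b' : toPs.obj ⟨y⟩} {c c' : toPs.obj ⟨z⟩}
    (k : a ⟶ a') (l : b ⟶ b') (m : c ⟶ c') :
    (push toPs (α_ x y z).hom).map ((mu (x ⊗ y) z).map ((mu x y).map (k ×ₘ l) ×ₘ m)) ≫
        (omega a' b' c').hom =
      (omega a b c).hom ≫ (mu x (y ⊗ z)).map (k ×ₘ (mu y z).map (l ×ₘ m))
  omega_modification {x x' y y' z z' : C} (f : x ⟶ x') (g : y ⟶ y') (h : z ⟶ z')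
    (a : toPs.obj ⟨x⟩) (b : toPs.obj ⟨y⟩) (c : toPs.obj ⟨z⟩) :
    (push toPs (f ⊗ₘ (g ⊗ₘ h))).map (omega a b c).hom ≫ (muMap f (g ⊗ₘ h) a _).hom ≫
        (mu x' (y' ⊗ z')).map (𝟙 _ ×ₘ (muMap g h b c).hom) =
      (pushComp toPs (α_ x y z).hom (f ⊗ₘ (g ⊗ₘ h)) _ rfl _).inv ≫
        (pushComp toPs ((f ⊗ₘ g) ⊗ₘ h) (α_ x' y' z').hom _ (by simp) _).hom ≫
          (push toPs (α_ x' y' z').hom).map ((muMap (f ⊗ₘ g) h _ c).hom ≫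
            (mu (x' ⊗ y') z').map ((muMap f g a b).hom ×ₘ 𝟙 _)) ≫
              (omega ((push toPs f).obj a) ((push toPs g).obj b) ((push toPs h).obj c)).hom
  /-- the right unit modification -/
  zeta {x : C} (a : toPs.obj ⟨x⟩) :
    (push toPs (ρ_ x).hom).obj ((mu x (𝟙_ C)).obj (a, mu0)) ≅ a
  zeta_natural {x : C} {a a' : toPs.obj ⟨x⟩} (k : a ⟶ a') :
    (push toPs (ρ_ x).hom).map ((mu x (𝟙_ C)).map (k ×ₘ 𝟙 mu0)) ≫ (zeta a').hom =
      (zeta a).hom ≫ k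
  zeta_modification {x x' : C} (f : x ⟶ x') (a : toPs.obj ⟨x⟩) :
    (push toPs f).map (zeta a).hom =
      (pushComp toPs (ρ_ x).hom f _ rfl _).inv ≫
        (pushComp toPs (f ⊗ₘ 𝟙 (𝟙_ C)) (ρ_ x').hom _ (by simp) _).hom ≫
          (push toPs (ρ_ x').hom).map ((muMap f (𝟙 (𝟙_ C)) a mu0).hom ≫
            (mu x' (𝟙_ C)).map (𝟙 _ ×ₘ (pushId toPs (𝟙 (𝟙_ C)) rfl mu0).hom)) ≫
              (zeta ((push toPs f).obj a)).hom
  /-- the left unit modification -/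
  xi {x : C} (a : toPs.obj ⟨x⟩) :
    (push toPs (λ_ x).hom).obj ((mu (𝟙_ C) x).obj (mu0, a)) ≅ a
  xi_natural {x : C} {a a' : toPs.obj ⟨x⟩} (k : a ⟶ a') :
    (push toPs (λ_ x).hom).map ((mu (𝟙_ C) x).map (𝟙 mu0 ×ₘ k)) ≫ (xi a').hom =
      (xi a).hom ≫ k
  xi_modification {x x' : C} (f : x ⟶ x') (a : toPs.obj ⟨x⟩) :
    (push toPs f).map (xi a).hom =
      (pushComp toPs (λ_ x).hom f _ rfl _).inv ≫
        (pushComp toPs (𝟙 (𝟙_ C) ⊗ₘ f) (λ_ x').hom _ (by simp) _).hom ≫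
          (push toPs (λ_ x').hom).map ((muMap (𝟙 (𝟙_ C)) f mu0 a).hom ≫
            (mu (𝟙_ C) x').map ((pushId toPs (𝟙 (𝟙_ C)) rfl mu0).hom ×ₘ 𝟙 _)) ≫
              (xi ((push toPs f).obj a)).hom
  /-- the associativity coherence axiom: the two ways of reassociating `((ab)c)d` to `a(b(cd))` -/
  pentagon {w x y z : C} (a : toPs.obj ⟨w⟩) (b : toPs.obj ⟨x⟩) (c : toPs.obj ⟨y⟩)
    (d : toPs.obj ⟨z⟩) :
    (pushComp toPs ((α_ w x y).hom ⊗ₘ 𝟙 z) ((α_ w (x ⊗ y) z).hom ≫ (𝟙 w ⊗ₘ (α_ x y z).hom))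
        ((α_ (w ⊗ x) y z).hom ≫ (α_ w x (y ⊗ z)).hom) (by simp)
        ((mu _ z).obj ((mu _ y).obj ((mu w x).obj (a, b), c), d))).hom ≫
      (push toPs _).map ((muMap (α_ w x y).hom (𝟙 z) _ d).hom ≫
        (mu _ z).map ((omega a b c).hom ×ₘ (pushId toPs (𝟙 z) rfl d).hom)) ≫
      (pushComp toPs (α_ w (x ⊗ y) z).hom (𝟙 w ⊗ₘ (α_ x y z).hom) _ rfl _).hom ≫
      (push toPs (𝟙 w ⊗ₘ (α_ x y z).hom)).map (omega a ((mu x y).obj (b, c)) d).hom ≫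
      (muMap (𝟙 w) (α_ x y z).hom a _).hom ≫
      (mu w _).map ((pushId toPs (𝟙 w) rfl a).hom ×ₘ (omega b c d).hom) =
    (pushComp toPs (α_ (w ⊗ x) y z).hom (α_ w x (y ⊗ z)).hom _ rfl _).hom ≫
      (push toPs (α_ w x (y ⊗ z)).hom).map (omega ((mu w x).obj (a, b)) c d).hom ≫
      (omega a b ((mu y z).obj (c, d))).hom
  /-- the unit coherence axiom: the two ways of reducing `(a1)b` to `ab` -/
  triangle {x y : C} (a : toPs.obj ⟨x⟩) (b : toPs.obj ⟨y⟩) :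
    (pushComp toPs (α_ x (𝟙_ C) y).hom (𝟙 x ⊗ₘ (λ_ y).hom) ((ρ_ x).hom ⊗ₘ 𝟙 y) (by simp)
        ((mu _ y).obj ((mu x _).obj (a, mu0), b))).hom ≫
      (push toPs (𝟙 x ⊗ₘ (λ_ y).hom)).map (omega a mu0 b).hom ≫
      (muMap (𝟙 x) (λ_ y).hom a _).hom ≫
      (mu x y).map ((pushId toPs (𝟙 x) rfl a).hom ×ₘ (xi b).hom) =
    (muMap (ρ_ x).hom (𝟙 y) _ b).hom ≫
      (mu x y).map ((zeta a).hom ×ₘ (pushId toPs (𝟙 y) rfl b).hom)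

end LaxMonoidal

section Cells

variable {C : Type u₁} [Category.{v₁} C] [MonoidalCategory C]

/-- A (weakly) monoidal pseudonatural transformation: a pseudonatural transformation `τ` with
invertible modifications `u : ν ∘ (τ × τ) ≅ τ ∘ μ` and `u₀ : ν₀ ≅ τ ∘ μ₀` compatible with
`ω`, `ζ` and `ξ`. -/
structure MonoidalTrans (M N : LaxMonoidalPseudofunctor.{v₁, u₁, v₂, u₂} C) where
  /-- the underlying pseudonatural transformation -/
  toTrans : M.toPs ⟶ N.toPs
  /-- compatibility with the laxators -/
  u {x y : C} (a : M.toPs.obj ⟨x⟩) (b : M.toPs.obj ⟨y⟩) :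
    (N.mu x y).obj ((comp₁ toTrans x).obj a, (comp₁ toTrans y).obj b) ≅
      (comp₁ toTrans (x ⊗ y)).obj ((M.mu x y).obj (a, b))
  u_natural {x y : C} {a a' : M.toPs.obj ⟨x⟩} {b b' : M.toPs.obj ⟨y⟩} (k : a ⟶ a') (l : b ⟶ b') :
    (N.mu x y).map ((comp₁ toTrans x).map k ×ₘ (comp₁ toTrans y).map l) ≫ (u a' b').hom =
      (u a b).hom ≫ (comp₁ toTrans (x ⊗ y)).map ((M.mu x y).map (k ×ₘ l))
  u_modification {x x' y y' : C} (f : x ⟶ x') (g : y ⟶ y') (a : M.toPs.obj ⟨x⟩)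
    (b : M.toPs.obj ⟨y⟩) :
    (push N.toPs (f ⊗ₘ g)).map (u a b).hom ≫ (natIso toTrans (f ⊗ₘ g) _).inv ≫
        (comp₁ toTrans (x' ⊗ y')).map (M.muMap f g a b).hom =
      (N.muMap f g _ _).hom ≫
        (N.mu x' y').map ((natIso toTrans f a).inv ×ₘ (natIso toTrans g b).inv) ≫
          (u ((push M.toPs f).obj a) ((push M.toPs g).obj b)).hom
  /-- compatibility with the unitors -/
  u0 : N.mu0 ≅ (comp₁ toTrans (𝟙_ C)).obj M.mu0
  u_assoc {x y z : C} (a : M.toPs.obj ⟨x⟩) (b : M.toPs.obj ⟨y⟩) (c : M.toPs.obj ⟨z⟩) :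
    (N.omega ((comp₁ toTrans x).obj a) ((comp₁ toTrans y).obj b) ((comp₁ toTrans z).obj c)).hom ≫
        (N.mu x (y ⊗ z)).map (𝟙 _ ×ₘ (u b c).hom) ≫ (u a ((M.mu y z).obj (b, c))).hom =
      (push N.toPs (α_ x y z).hom).map
          ((N.mu (x ⊗ y) z).map ((u a b).hom ×ₘ 𝟙 _) ≫ (u ((M.mu x y).obj (a, b)) c).hom) ≫
        (natIso toTrans (α_ x y z).hom _).inv ≫
          (comp₁ toTrans (x ⊗ (y ⊗ z))).map (M.omega a b c).hom
  u_right {x : C} (a : M.toPs.obj ⟨x⟩) :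
    (N.zeta ((comp₁ toTrans x).obj a)).hom =
      (push N.toPs (ρ_ x).hom).map
          ((N.mu x (𝟙_ C)).map (𝟙 _ ×ₘ u0.hom) ≫ (u a M.mu0).hom) ≫
        (natIso toTrans (ρ_ x).hom _).inv ≫ (comp₁ toTrans x).map (M.zeta a).hom
  u_left {x : C} (a : M.toPs.obj ⟨x⟩) :
    (N.xi ((comp₁ toTrans x).obj a)).hom =
      (push N.toPs (λ_ x).hom).map
          ((N.mu (𝟙_ C) x).map (u0.hom ×ₘ 𝟙 _) ≫ (u M.mu0 a).hom) ≫
        (natIso toTrans (λ_ x).hom _).inv ≫ (comp₁ toTrans x).map (M.xi a).hom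

/-- A monoidal modification. -/
@[ext]
structure MonoidalModification {M N : LaxMonoidalPseudofunctor.{v₁, u₁, v₂, u₂} C}
    (τ σ : MonoidalTrans M N) where
  /-- the underlying modification -/
  toModification : τ.toTrans ⟶ σ.toTrans
  tensor {x y : C} (a : M.toPs.obj ⟨x⟩) (b : M.toPs.obj ⟨y⟩) :
    (τ.u a b).hom ≫ comp₂ toModification ((M.mu x y).obj (a, b)) =
      (N.mu x y).map (comp₂ toModification a ×ₘ comp₂ toModification b) ≫ (σ.u a b).hom
  unit : τ.u0.hom ≫ comp₂ toModification M.mu0 = σ.u0.hom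

end Cells
section Bicat

variable {C : Type u₁} [Category.{v₁} C]

section
variable {F G H : LocallyDiscrete C ⥤ᵖ Cat.{v₂, u₂}}

theorem natIso_id (F : LocallyDiscrete C ⥤ᵖ Cat.{v₂, u₂}) {x y : C} (f : x ⟶ y)
    (a : F.obj ⟨x⟩) : (natIso (𝟙 F) f a).inv = 𝟙 ((push F f).obj a) :=
  Category.comp_id (𝟙 ((push F f).obj a))

theorem natIso_comp (τ : F ⟶ G) (σ : G ⟶ H) {x y : C} (f : x ⟶ y) (a : F.obj ⟨x⟩) :
    (natIso (τ ≫ σ) f a).inv =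
      (natIso σ f ((comp₁ τ x).obj a)).inv ≫ (comp₁ σ y).map (natIso τ f a).inv := by
  have h : (τ ≫ σ).naturality f.toLoc =
      (Bicategory.associator _ _ _).symm ≪≫ whiskerRightIso (τ.naturality f.toLoc) _ ≪≫
        (Bicategory.associator _ _ _) ≪≫ whiskerLeftIso _ (σ.naturality f.toLoc) ≪≫
          (Bicategory.associator _ _ _).symm := by
    ext1; simp; rfl
  simp only [natIso, h]
  dsimp
  simp
  rfl

theorem natIso_naturality (τ : F ⟶ G) {x y : C} (f : x ⟶ y) {a b : F.obj ⟨x⟩} (k : a ⟶ b) :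
    (push G f).map ((comp₁ τ x).map k) ≫ (natIso τ f b).inv =
      (natIso τ f a).inv ≫ (comp₁ τ y).map ((push F f).map k) :=
  (τ.naturality f.toLoc).inv.toNatTrans.naturality k

theorem comp₂_natural {τ σ : F ⟶ G} (m : τ ⟶ σ) {x : C} {a b : F.obj ⟨x⟩} (k : a ⟶ b) :
    (comp₁ τ x).map k ≫ comp₂ m b = comp₂ m a ≫ (comp₁ σ x).map k :=
  (m.as.app ⟨x⟩).toNatTrans.naturality k

end

theorem map_left_comp {A B D : Type*} [Category* A] [Category* B] [Category* D] (F : A × B ⥤ D)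
    {a a' a'' : A} (p : a ⟶ a') (q : a' ⟶ a'') (b : B) :
    F.map ((p ≫ q) ×ₘ 𝟙 b) = F.map (p ×ₘ 𝟙 b) ≫ F.map (q ×ₘ 𝟙 b) := by
  rw [← F.map_comp]; simp

theorem map_right_comp {A B D : Type*} [Category* A] [Category* B] [Category* D] (F : A × B ⥤ D)
    (a : A) {b b' b'' : B} (p : b ⟶ b') (q : b' ⟶ b'') :
    F.map (𝟙 a ×ₘ (p ≫ q)) = F.map (𝟙 a ×ₘ p) ≫ F.map (𝟙 a ×ₘ q) := by
  rw [← F.map_comp]; simp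

section
theorem toTrans_ext' {F G : LocallyDiscrete C ⥤ᵖ Cat.{v₂, u₂}} {τ σ : F ⟶ G}
    (h : τ.app = σ.app) (h' : ∀ {x y : C} (f : x ⟶ y) (a : F.obj ⟨x⟩),
      (natIso τ f a).inv ≍ (natIso σ f a).inv) : τ = σ := by
  obtain ⟨a, n, _, _, _⟩ := τ
  obtain ⟨a', n', _, _, _⟩ := σ
  obtain rfl : a = a' := h
  obtain rfl : @n = @n' := by
    funext x y f
    obtain ⟨x⟩ := x
    obtain ⟨y⟩ := y
    obtain ⟨f⟩ := f
    apply Iso.ext_inv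
    apply Cat.Hom₂.ext
    ext b
    exact eq_of_heq (h' f b)
  rfl

theorem trans_assoc {F G H K : LocallyDiscrete C ⥤ᵖ Cat.{v₂, u₂}} (τ : F ⟶ G) (σ : G ⟶ H)
    (ρ : H ⟶ K) : (τ ≫ σ) ≫ ρ = τ ≫ σ ≫ ρ :=
  toTrans_ext' rfl (fun f a => by
    rw [natIso_comp, natIso_comp, natIso_comp, natIso_comp]
    refine heq_of_eq ?_
    change (natIso ρ f _).inv ≫ (comp₁ ρ _).map ((natIso σ f _).inv ≫
        (comp₁ σ _).map (natIso τ f a).inv) =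
      ((natIso ρ f _).inv ≫ (comp₁ ρ _).map (natIso σ f _).inv) ≫
        (comp₁ ρ _).map ((comp₁ σ _).map (natIso τ f a).inv)
    rw [Functor.map_comp, Category.assoc])

theorem trans_id_comp {F G : LocallyDiscrete C ⥤ᵖ Cat.{v₂, u₂}} (τ : F ⟶ G) : 𝟙 F ≫ τ = τ :=
  toTrans_ext' rfl (fun f a => by
    rw [natIso_comp, natIso_id]
    refine heq_of_eq ?_
    change (natIso τ f a).inv ≫ (comp₁ τ _).map (𝟙 _) = (natIso τ f a).inv
    rw [CategoryTheory.Functor.map_id, Category.comp_id])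

theorem trans_comp_id {F G : LocallyDiscrete C ⥤ᵖ Cat.{v₂, u₂}} (τ : F ⟶ G) : τ ≫ 𝟙 G = τ :=
  toTrans_ext' rfl (fun f a => by
    rw [natIso_comp, natIso_id]
    exact heq_of_eq (Category.id_comp _))

theorem modification_eqToHom {F G : LocallyDiscrete C ⥤ᵖ Cat.{v₂, u₂}} {τ σ : F ⟶ G} (h : τ = σ)
    (x : LocallyDiscrete C) :
    (eqToHom h : τ ⟶ σ).as.app x = eqToHom (by rw [h]) := by
  subst h; rfl

instance : Bicategory.Strict (LocallyDiscrete C ⥤ᵖ Cat.{v₂, u₂}) where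
  id_comp := trans_id_comp
  comp_id := trans_comp_id
  assoc := trans_assoc
  leftUnitor_eqToIso τ := by
    ext x
    simp [modification_eqToHom, Strict.leftUnitor_eqToIso]
    rfl
  rightUnitor_eqToIso τ := by
    ext x
    simp [modification_eqToHom, Strict.rightUnitor_eqToIso]
    rfl
  associator_eqToIso τ σ ρ := by
    ext x
    simp [modification_eqToHom, Strict.associator_eqToIso]
    rfl

end

variable [MonoidalCategory C]

namespace MonoidalTrans

variable {M N P : LaxMonoidalPseudofunctor.{v₁, u₁, v₂, u₂} C}

theorem u_natural_left (τ : MonoidalTrans M N) {x y : C} {a a' : M.toPs.obj ⟨x⟩} (k : a ⟶ a')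
    (b : M.toPs.obj ⟨y⟩) :
    (N.mu x y).map ((comp₁ τ.toTrans x).map k ×ₘ 𝟙 ((comp₁ τ.toTrans y).obj b)) ≫ (τ.u a' b).hom =
      (τ.u a b).hom ≫ (comp₁ τ.toTrans (x ⊗ y)).map ((M.mu x y).map (k ×ₘ 𝟙 b)) := by
  rw [← τ.u_natural, CategoryTheory.Functor.map_id]

theorem u_natural_right (τ : MonoidalTrans M N) {x y : C} (a : M.toPs.obj ⟨x⟩)
    {b b' : M.toPs.obj ⟨y⟩} (l : b ⟶ b') :
    (N.mu x y).map (𝟙 ((comp₁ τ.toTrans x).obj a) ×ₘ (comp₁ τ.toTrans y).map l) ≫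
        (τ.u a b').hom =
      (τ.u a b).hom ≫ (comp₁ τ.toTrans (x ⊗ y)).map ((M.mu x y).map (𝟙 a ×ₘ l)) := by
  rw [← τ.u_natural, CategoryTheory.Functor.map_id]

/-- The identity monoidal pseudonatural transformation. -/
def id (M : LaxMonoidalPseudofunctor.{v₁, u₁, v₂, u₂} C) : MonoidalTrans M M where
  toTrans := 𝟙 M.toPs
  u a b := Iso.refl ((M.mu _ _).obj (a, b))
  u_natural {x y a a' b b'} k l := by
    change (M.mu x y).map (k ×ₘ l) ≫ 𝟙 _ = 𝟙 _ ≫ (M.mu x y).map (k ×ₘ l)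
    simp
  u_modification f g a b := by
    rw [natIso_id, natIso_id, natIso_id]
    change (push M.toPs (f ⊗ₘ g)).map (𝟙 _) ≫ 𝟙 _ ≫ (M.muMap f g a b).hom =
      (M.muMap f g a b).hom ≫ (M.mu _ _).map (𝟙 (_, _)) ≫ 𝟙 _
    simp
  u0 := Iso.refl M.mu0
  u_assoc {x y z} a b c := by
    rw [natIso_id]
    change (M.omega a b c).hom ≫ (M.mu x (y ⊗ z)).map (𝟙 (_, _)) ≫ 𝟙 _ =
      (push M.toPs _).map ((M.mu (x ⊗ y) z).map (𝟙 (_, _)) ≫ 𝟙 _) ≫ 𝟙 _ ≫ (M.omega a b c).hom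
    simp
  u_right {x} a := by
    rw [natIso_id]
    change (M.zeta a).hom = (push M.toPs _).map ((M.mu x (𝟙_ C)).map (𝟙 (_, _)) ≫ 𝟙 _) ≫
      𝟙 _ ≫ (M.zeta a).hom
    simp
  u_left {x} a := by
    rw [natIso_id]
    change (M.xi a).hom = (push M.toPs _).map ((M.mu (𝟙_ C) x).map (𝟙 (_, _)) ≫ 𝟙 _) ≫
      𝟙 _ ≫ (M.xi a).hom
    simp

/-- The composite of monoidal pseudonatural transformations. -/
def comp (τ : MonoidalTrans M N) (σ : MonoidalTrans N P) : MonoidalTrans M P where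
  toTrans := τ.toTrans ≫ σ.toTrans
  u {x y} a b := σ.u ((comp₁ τ.toTrans x).obj a) ((comp₁ τ.toTrans y).obj b) ≪≫
    (comp₁ σ.toTrans (x ⊗ y)).mapIso (τ.u a b)
  u_natural {x y a a' b b'} k l := by
    change (P.mu x y).map ((comp₁ σ.toTrans x).map ((comp₁ τ.toTrans x).map k) ×ₘ
        (comp₁ σ.toTrans y).map ((comp₁ τ.toTrans y).map l)) ≫ (σ.u _ _).hom ≫
          (comp₁ σ.toTrans (x ⊗ y)).map (τ.u a' b').hom =
      ((σ.u _ _).hom ≫ (comp₁ σ.toTrans (x ⊗ y)).map (τ.u a b).hom) ≫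
        (comp₁ σ.toTrans (x ⊗ y)).map ((comp₁ τ.toTrans (x ⊗ y)).map ((M.mu x y).map (k ×ₘ l)))
    rw [reassoc_of% σ.u_natural, Category.assoc, ← Functor.map_comp, τ.u_natural,
      Functor.map_comp]
  u_modification {x x' y y'} f g a b := by
    rw [natIso_comp, natIso_comp, natIso_comp]
    change (push P.toPs (f ⊗ₘ g)).map ((σ.u _ _).hom ≫ (comp₁ σ.toTrans _).map (τ.u a b).hom) ≫
        ((natIso σ.toTrans (f ⊗ₘ g) _).inv ≫
          (comp₁ σ.toTrans _).map (natIso τ.toTrans (f ⊗ₘ g) _).inv) ≫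
        (comp₁ σ.toTrans _).map ((comp₁ τ.toTrans _).map (M.muMap f g a b).hom) =
      (P.muMap f g _ _).hom ≫
        (P.mu x' y').map (((natIso σ.toTrans f _).inv ×ₘ (natIso σ.toTrans g _).inv) ≫
          ((comp₁ σ.toTrans x').map (natIso τ.toTrans f a).inv ×ₘ
            (comp₁ σ.toTrans y').map (natIso τ.toTrans g b).inv)) ≫
          ((σ.u _ _).hom ≫ (comp₁ σ.toTrans _).map (τ.u _ _).hom)
    rw [Functor.map_comp, Functor.map_comp, Category.assoc, Category.assoc, Category.assoc,
      reassoc_of% (natIso_naturality σ.toTrans), ← Functor.map_comp, ← Functor.map_comp,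
      τ.u_modification, Functor.map_comp, Functor.map_comp,
      reassoc_of% (σ.u_modification f g), reassoc_of% σ.u_natural]
  u0 := σ.u0 ≪≫ (comp₁ σ.toTrans (𝟙_ C)).mapIso τ.u0
  u_assoc {x y z} a b c := by
    rw [natIso_comp]
    change (P.omega _ _ _).hom ≫
        (P.mu x (y ⊗ z)).map (𝟙 ((comp₁ σ.toTrans x).obj ((comp₁ τ.toTrans x).obj a)) ×ₘ
          ((σ.u _ _).hom ≫ (comp₁ σ.toTrans _).map (τ.u b c).hom)) ≫
        (σ.u _ _).hom ≫ (comp₁ σ.toTrans _).map (τ.u a _).hom =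
      (push P.toPs (α_ x y z).hom).map
          ((P.mu (x ⊗ y) z).map (((σ.u _ _).hom ≫ (comp₁ σ.toTrans _).map (τ.u a b).hom) ×ₘ
              𝟙 ((comp₁ σ.toTrans z).obj ((comp₁ τ.toTrans z).obj c))) ≫
            (σ.u _ _).hom ≫ (comp₁ σ.toTrans _).map (τ.u _ c).hom) ≫
        ((natIso σ.toTrans _ _).inv ≫ (comp₁ σ.toTrans _).map (natIso τ.toTrans _ _).inv) ≫
          (comp₁ σ.toTrans _).map ((comp₁ τ.toTrans _).map (M.omega a b c).hom)
    rw [map_right_comp, map_left_comp, Category.assoc, Category.assoc,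
      reassoc_of% σ.u_natural_right, reassoc_of% σ.u_natural_left, reassoc_of% σ.u_assoc,
      ← Functor.map_comp, ← Functor.map_comp, ← Functor.map_comp, τ.u_assoc]
    simp only [Functor.map_comp, Category.assoc]
    rw [reassoc_of% (natIso_naturality σ.toTrans), reassoc_of% (natIso_naturality σ.toTrans)]
  u_right {x} a := by
    rw [natIso_comp]
    change (P.zeta _).hom =
      (push P.toPs (ρ_ x).hom).map
          ((P.mu x _).map (𝟙 ((comp₁ σ.toTrans x).obj ((comp₁ τ.toTrans x).obj a)) ×ₘ
              (σ.u0.hom ≫ (comp₁ σ.toTrans _).map τ.u0.hom)) ≫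
            (σ.u _ _).hom ≫ (comp₁ σ.toTrans _).map (τ.u a _).hom) ≫
        ((natIso σ.toTrans _ _).inv ≫ (comp₁ σ.toTrans _).map (natIso τ.toTrans _ _).inv) ≫
          (comp₁ σ.toTrans _).map ((comp₁ τ.toTrans _).map (M.zeta a).hom)
    rw [map_right_comp, Category.assoc, reassoc_of% σ.u_natural_right, σ.u_right, τ.u_right]
    simp only [Functor.map_comp, Category.assoc]
    rw [reassoc_of% (natIso_naturality σ.toTrans), reassoc_of% (natIso_naturality σ.toTrans)]
  u_left {x} a := by
    rw [natIso_comp]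
    change (P.xi _).hom =
      (push P.toPs (λ_ x).hom).map
          ((P.mu _ x).map ((σ.u0.hom ≫ (comp₁ σ.toTrans _).map τ.u0.hom) ×ₘ
              𝟙 ((comp₁ σ.toTrans x).obj ((comp₁ τ.toTrans x).obj a))) ≫
            (σ.u _ _).hom ≫ (comp₁ σ.toTrans _).map (τ.u _ a).hom) ≫
        ((natIso σ.toTrans _ _).inv ≫ (comp₁ σ.toTrans _).map (natIso τ.toTrans _ _).inv) ≫
          (comp₁ σ.toTrans _).map ((comp₁ τ.toTrans _).map (M.xi a).hom)
    rw [map_left_comp, Category.assoc, reassoc_of% σ.u_natural_left, σ.u_left, τ.u_left]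
    simp only [Functor.map_comp, Category.assoc]
    rw [reassoc_of% (natIso_naturality σ.toTrans), reassoc_of% (natIso_naturality σ.toTrans)]

end MonoidalTrans

namespace MonoidalModification

variable {M N P : LaxMonoidalPseudofunctor.{v₁, u₁, v₂, u₂} C}

/-- Monoidal modifications compose vertically. -/
instance : Category (MonoidalTrans M N) where
  Hom τ σ := MonoidalModification τ σ
  id τ :=
    { toModification := 𝟙 τ.toTrans
      tensor := fun {x y} a b => by
        change (τ.u a b).hom ≫ 𝟙 _ = (N.mu x y).map (𝟙 (_, _)) ≫ (τ.u a b).hom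
        simp
      unit := Category.comp_id _ }
  comp {τ σ ρ} m n :=
    { toModification := m.toModification ≫ n.toModification
      tensor := fun {x y} a b => by
        change (τ.u a b).hom ≫ comp₂ m.toModification _ ≫ comp₂ n.toModification _ =
          (N.mu x y).map ((comp₂ m.toModification a ×ₘ comp₂ m.toModification b) ≫
            (comp₂ n.toModification a ×ₘ comp₂ n.toModification b)) ≫ (ρ.u a b).hom
        rw [reassoc_of% m.tensor, n.tensor, Functor.map_comp, Category.assoc]
      unit := by
        change τ.u0.hom ≫ comp₂ m.toModification _ ≫ comp₂ n.toModification _ = ρ.u0.hom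
        rw [reassoc_of% m.unit, n.unit] }
  id_comp m := MonoidalModification.ext (Category.id_comp m.toModification)
  comp_id m := MonoidalModification.ext (Category.comp_id m.toModification)
  assoc m n p := MonoidalModification.ext
    (Category.assoc m.toModification n.toModification p.toModification)

/-- An isomorphism of monoidal pseudonatural transformations from an invertible modification that
is monoidal in both directions. -/
def isoMk {τ σ : MonoidalTrans M N} (m : τ ⟶ σ) (n : σ ⟶ τ)
    (h : m.toModification ≫ n.toModification = 𝟙 _)
    (h' : n.toModification ≫ m.toModification = 𝟙 _) : τ ≅ σ where
  hom := m
  inv := n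
  hom_inv_id := MonoidalModification.ext h
  inv_hom_id := MonoidalModification.ext h'

end MonoidalModification

namespace LaxMonoidalPseudofunctor

variable {M N P Q : LaxMonoidalPseudofunctor.{v₁, u₁, v₂, u₂} C}

/-- Whiskering of monoidal modifications on the left. -/
def whiskerLeft (τ : MonoidalTrans M N) {σ ρ : MonoidalTrans N P} (m : σ ⟶ ρ) :
    τ.comp σ ⟶ τ.comp ρ where
  toModification := τ.toTrans ◁ m.toModification
  tensor {x y} a b := by
    change ((σ.u _ _).hom ≫ (comp₁ σ.toTrans _).map (τ.u a b).hom) ≫ comp₂ m.toModification _ =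
      (P.mu x y).map (comp₂ m.toModification _ ×ₘ comp₂ m.toModification _) ≫
        (ρ.u _ _).hom ≫ (comp₁ ρ.toTrans _).map (τ.u a b).hom
    rw [Category.assoc, comp₂_natural, reassoc_of% m.tensor]
  unit := by
    change (σ.u0.hom ≫ (comp₁ σ.toTrans _).map τ.u0.hom) ≫ comp₂ m.toModification _ =
      ρ.u0.hom ≫ (comp₁ ρ.toTrans _).map τ.u0.hom
    rw [Category.assoc, comp₂_natural, reassoc_of% m.unit]

/-- Whiskering of monoidal modifications on the right. -/
def whiskerRight {τ σ : MonoidalTrans M N} (m : τ ⟶ σ) (ρ : MonoidalTrans N P) :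
    τ.comp ρ ⟶ σ.comp ρ where
  toModification := m.toModification ▷ ρ.toTrans
  tensor {x y} a b := by
    change ((ρ.u _ _).hom ≫ (comp₁ ρ.toTrans _).map (τ.u a b).hom) ≫
        (comp₁ ρ.toTrans _).map (comp₂ m.toModification _) =
      (P.mu x y).map ((comp₁ ρ.toTrans _).map (comp₂ m.toModification a) ×ₘ
          (comp₁ ρ.toTrans _).map (comp₂ m.toModification b)) ≫
        (ρ.u _ _).hom ≫ (comp₁ ρ.toTrans _).map (σ.u a b).hom
    rw [Category.assoc, ← Functor.map_comp, m.tensor, reassoc_of% ρ.u_natural, Functor.map_comp]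
  unit := by
    change (ρ.u0.hom ≫ (comp₁ ρ.toTrans _).map τ.u0.hom) ≫
        (comp₁ ρ.toTrans _).map (comp₂ m.toModification _) =
      ρ.u0.hom ≫ (comp₁ ρ.toTrans _).map σ.u0.hom
    rw [Category.assoc, ← Functor.map_comp, m.unit]

/-- The associator. -/
def assocIso (τ : MonoidalTrans M N) (σ : MonoidalTrans N P) (ρ : MonoidalTrans P Q) :
    (τ.comp σ).comp ρ ≅ τ.comp (σ.comp ρ) :=
  MonoidalModification.isoMk
    { toModification := (Bicategory.associator τ.toTrans σ.toTrans ρ.toTrans).hom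
      tensor := fun {x y} a b => by
        change ((ρ.u _ _).hom ≫ (comp₁ ρ.toTrans _).map
            ((σ.u _ _).hom ≫ (comp₁ σ.toTrans _).map (τ.u a b).hom)) ≫ 𝟙 _ =
          (Q.mu x y).map (𝟙 (_, _)) ≫ ((ρ.u _ _).hom ≫ (comp₁ ρ.toTrans _).map (σ.u _ _).hom) ≫
            (comp₁ ρ.toTrans _).map ((comp₁ σ.toTrans _).map (τ.u a b).hom)
        simp
      unit := by
        change (ρ.u0.hom ≫ (comp₁ ρ.toTrans _).map
            (σ.u0.hom ≫ (comp₁ σ.toTrans _).map τ.u0.hom)) ≫ 𝟙 _ =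
          (ρ.u0.hom ≫ (comp₁ ρ.toTrans _).map σ.u0.hom) ≫
            (comp₁ ρ.toTrans _).map ((comp₁ σ.toTrans _).map τ.u0.hom)
        simp }
    { toModification := (Bicategory.associator τ.toTrans σ.toTrans ρ.toTrans).inv
      tensor := fun {x y} a b => by
        change (((ρ.u _ _).hom ≫ (comp₁ ρ.toTrans _).map (σ.u _ _).hom) ≫
            (comp₁ ρ.toTrans _).map ((comp₁ σ.toTrans _).map (τ.u a b).hom)) ≫ 𝟙 _ =
          (Q.mu x y).map (𝟙 (_, _)) ≫ (ρ.u _ _).hom ≫ (comp₁ ρ.toTrans _).map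
            ((σ.u _ _).hom ≫ (comp₁ σ.toTrans _).map (τ.u a b).hom)
        simp
      unit := by
        change ((ρ.u0.hom ≫ (comp₁ ρ.toTrans _).map σ.u0.hom) ≫
            (comp₁ ρ.toTrans _).map ((comp₁ σ.toTrans _).map τ.u0.hom)) ≫ 𝟙 _ =
          ρ.u0.hom ≫ (comp₁ ρ.toTrans _).map
            (σ.u0.hom ≫ (comp₁ σ.toTrans _).map τ.u0.hom)
        simp }
    (Iso.hom_inv_id _) (Iso.inv_hom_id _)

/-- The left unitor. -/
def leftIso (τ : MonoidalTrans M N) : (MonoidalTrans.id M).comp τ ≅ τ :=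
  MonoidalModification.isoMk
    { toModification := (Bicategory.leftUnitor τ.toTrans).hom
      tensor := fun {x y} a b => by
        change ((τ.u a b).hom ≫ (comp₁ τ.toTrans _).map (𝟙 _)) ≫ 𝟙 _ =
          (N.mu x y).map (𝟙 (_, _)) ≫ (τ.u a b).hom
        simp
      unit := by
        change (τ.u0.hom ≫ (comp₁ τ.toTrans _).map (𝟙 _)) ≫ 𝟙 _ = τ.u0.hom
        simp }
    { toModification := (Bicategory.leftUnitor τ.toTrans).inv
      tensor := fun {x y} a b => by
        change (τ.u a b).hom ≫ 𝟙 _ =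
          (N.mu x y).map (𝟙 (_, _)) ≫ (τ.u a b).hom ≫ (comp₁ τ.toTrans _).map (𝟙 _)
        simp
      unit := by
        change τ.u0.hom ≫ 𝟙 _ = τ.u0.hom ≫ (comp₁ τ.toTrans _).map (𝟙 _)
        simp }
    (Iso.hom_inv_id _) (Iso.inv_hom_id _)

/-- The right unitor. -/
def rightIso (τ : MonoidalTrans M N) : τ.comp (MonoidalTrans.id N) ≅ τ :=
  MonoidalModification.isoMk
    { toModification := (Bicategory.rightUnitor τ.toTrans).hom
      tensor := fun {x y} a b => by
        change (𝟙 _ ≫ (τ.u a b).hom) ≫ 𝟙 _ = (N.mu x y).map (𝟙 (_, _)) ≫ (τ.u a b).hom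
        simp
      unit := by
        change (𝟙 _ ≫ τ.u0.hom) ≫ 𝟙 _ = τ.u0.hom
        simp }
    { toModification := (Bicategory.rightUnitor τ.toTrans).inv
      tensor := fun {x y} a b => by
        change (τ.u a b).hom ≫ 𝟙 _ = (N.mu x y).map (𝟙 (_, _)) ≫ 𝟙 _ ≫ (τ.u a b).hom
        simp
      unit := by
        change τ.u0.hom ≫ 𝟙 _ = 𝟙 _ ≫ τ.u0.hom
        simp }
    (Iso.hom_inv_id _) (Iso.inv_hom_id _)

/-- The 2-category of lax monoidal pseudofunctors `C ⥤ Cat`, monoidal pseudonatural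
transformations and monoidal modifications. -/
instance : Bicategory (LaxMonoidalPseudofunctor.{v₁, u₁, v₂, u₂} C) where
  Hom M N := MonoidalTrans M N
  id M := MonoidalTrans.id M
  comp τ σ := τ.comp σ
  whiskerLeft τ _ _ m := whiskerLeft τ m
  whiskerRight m ρ := whiskerRight m ρ
  associator τ σ ρ := assocIso τ σ ρ
  leftUnitor τ := leftIso τ
  rightUnitor τ := rightIso τ
  whiskerLeft_id _ _ := MonoidalModification.ext (Bicategory.whiskerLeft_id _ _)
  whiskerLeft_comp _ _ _ _ _ _ := MonoidalModification.ext (Bicategory.whiskerLeft_comp _ _ _)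
  id_whiskerLeft _ := MonoidalModification.ext (Bicategory.id_whiskerLeft _)
  comp_whiskerLeft _ _ _ _ _ := MonoidalModification.ext (Bicategory.comp_whiskerLeft _ _ _)
  id_whiskerRight _ _ := MonoidalModification.ext (Bicategory.id_whiskerRight _ _)
  comp_whiskerRight _ _ _ := MonoidalModification.ext (Bicategory.comp_whiskerRight _ _ _)
  whiskerRight_id _ := MonoidalModification.ext (Bicategory.whiskerRight_id _)
  whiskerRight_comp _ _ _ := MonoidalModification.ext (Bicategory.whiskerRight_comp _ _ _)
  whisker_assoc _ _ _ _ _ := MonoidalModification.ext (Bicategory.whisker_assoc _ _ _)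
  whisker_exchange _ _ := MonoidalModification.ext (Bicategory.whisker_exchange _ _)
  pentagon _ _ _ _ := MonoidalModification.ext (Bicategory.pentagon _ _ _ _)
  triangle _ _ := MonoidalModification.ext (Bicategory.triangle _ _)

theorem trans_ext {τ σ : MonoidalTrans M N} (h : τ.toTrans = σ.toTrans)
    (hu : ∀ {x y : C} (a : M.toPs.obj ⟨x⟩) (b : M.toPs.obj ⟨y⟩),
      (τ.u a b).hom ≍ (σ.u a b).hom) (hu0 : τ.u0.hom ≍ σ.u0.hom) : τ = σ := by
  obtain ⟨t, u, _, _, u0, _, _, _⟩ := τ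
  obtain ⟨t', u', _, _, u0', _, _, _⟩ := σ
  obtain rfl : t = t' := h
  obtain rfl : @u = @u' := by
    funext x y a b
    exact Iso.ext (eq_of_heq (hu a b))
  obtain rfl : u0 = u0' := Iso.ext (eq_of_heq hu0)
  rfl

theorem eqToHom_toModification {τ σ : M ⟶ N} (h : τ = σ) :
    MonoidalModification.toModification (eqToHom h) =
      eqToHom (congrArg MonoidalTrans.toTrans h) := by
  subst h; rfl

instance : Bicategory.Strict (LaxMonoidalPseudofunctor.{v₁, u₁, v₂, u₂} C) where
  id_comp {M N} (τ : MonoidalTrans M N) := by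
    refine trans_ext (trans_id_comp _) (fun a b => heq_of_eq ?_) (heq_of_eq ?_)
    · change (τ.u a b).hom ≫ (comp₁ τ.toTrans _).map (𝟙 _) = (τ.u a b).hom
      simp
    · change τ.u0.hom ≫ (comp₁ τ.toTrans _).map (𝟙 _) = τ.u0.hom
      simp
  comp_id {M N} (τ : MonoidalTrans M N) := by
    refine trans_ext (trans_comp_id _) (fun a b => heq_of_eq ?_) (heq_of_eq ?_)
    · exact Category.id_comp (τ.u a b).hom
    · exact Category.id_comp τ.u0.hom
  assoc {M N P Q} (τ : MonoidalTrans M N) (σ : MonoidalTrans N P) (ρ : MonoidalTrans P Q) := by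
    refine trans_ext (trans_assoc _ _ _) (fun a b => heq_of_eq ?_) (heq_of_eq ?_)
    · change (ρ.u _ _).hom ≫ (comp₁ ρ.toTrans _).map
            ((σ.u _ _).hom ≫ (comp₁ σ.toTrans _).map (τ.u a b).hom) =
          ((ρ.u _ _).hom ≫ (comp₁ ρ.toTrans _).map (σ.u _ _).hom) ≫
            (comp₁ ρ.toTrans _).map ((comp₁ σ.toTrans _).map (τ.u a b).hom)
      simp
    · change ρ.u0.hom ≫ (comp₁ ρ.toTrans _).map
            (σ.u0.hom ≫ (comp₁ σ.toTrans _).map τ.u0.hom) =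
          (ρ.u0.hom ≫ (comp₁ ρ.toTrans _).map σ.u0.hom) ≫
            (comp₁ ρ.toTrans _).map ((comp₁ σ.toTrans _).map τ.u0.hom)
      simp
  leftUnitor_eqToIso τ := by
    apply Iso.ext
    apply MonoidalModification.ext
    rw [eqToIso.hom, eqToHom_toModification]
    exact congrArg Iso.hom (Strict.leftUnitor_eqToIso τ.toTrans)
  rightUnitor_eqToIso τ := by
    apply Iso.ext
    apply MonoidalModification.ext
    rw [eqToIso.hom, eqToHom_toModification]
    exact congrArg Iso.hom (Strict.rightUnitor_eqToIso τ.toTrans)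
  associator_eqToIso τ σ ρ := by
    apply Iso.ext
    apply MonoidalModification.ext
    rw [eqToIso.hom, eqToHom_toModification]
    exact congrArg Iso.hom (Strict.associator_eqToIso τ.toTrans σ.toTrans ρ.toTrans)

/-- The forgetful 2-functor to pseudofunctors, pseudonatural transformations and modifications. -/
def forget (C : Type u₁) [Category.{v₁} C] [MonoidalCategory C] :
    StrictPseudofunctor (LaxMonoidalPseudofunctor.{v₁, u₁, v₂, u₂} C)
      (LocallyDiscrete C ⥤ᵖ Cat.{v₂, u₂}) :=
  StrictPseudofunctor.mk''
    { obj := fun M => M.toPs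
      map := fun τ => τ.toTrans
      map₂ := fun m => m.toModification
      map_id := fun _ => rfl
      map_comp := fun _ _ => rfl
      map₂_id := fun _ => rfl
      map₂_comp := fun _ _ => rfl
      map₂_whisker_left := fun _ _ _ _ => ((Category.id_comp _).trans (Category.comp_id _)).symm
      map₂_whisker_right := fun _ _ => ((Category.id_comp _).trans (Category.comp_id _)).symm }

end LaxMonoidalPseudofunctor
end Bicat

/-! ### Sub-2-categories -/

section SubTwoCategory

/-- A locally full sub-2-category of `B`: a class of objects and a class of 1-cells between them,
closed under identities and composition. -/
structure SubTwoCategory (B : Type*) [Bicategory B] where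
  /-- the objects of the sub-2-category -/
  objProp : B → Prop
  /-- the 1-cells of the sub-2-category -/
  homProp : ∀ {a b : B}, (a ⟶ b) → Prop
  id_mem : ∀ a : B, homProp (𝟙 a)
  comp_mem : ∀ {a b c : B} (f : a ⟶ b) (g : b ⟶ c), homProp f → homProp g → homProp (f ≫ g)

namespace SubTwoCategory

variable {B : Type*} [Bicategory B] (S : SubTwoCategory B)

/-- Objects of a sub-2-category. -/
@[ext]
structure Obj where
  /-- the underlying object -/
  obj : B
  property : S.objProp obj

variable {S}

/-- 1-cells of a sub-2-category. -/
@[ext]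
structure Hom (a b : S.Obj) where
  /-- the underlying 1-cell -/
  hom : a.obj ⟶ b.obj
  property : S.homProp hom

/-- Composition of 1-cells. -/
def Hom.comp {a b c : S.Obj} (f : Hom a b) (g : Hom b c) : Hom a c :=
  ⟨f.hom ≫ g.hom, S.comp_mem _ _ f.property g.property⟩

/-- 2-cells of a sub-2-category are all 2-cells of the ambient 2-category. -/
instance (a b : S.Obj) : Category (Hom a b) where
  Hom f g := f.hom ⟶ g.hom
  id f := 𝟙 f.hom
  comp η θ := η ≫ θ

/-- The 2-cells are those of the ambient 2-category. -/
def isoMk {a b : S.Obj} {f g : Hom a b} (e : f.hom ≅ g.hom) : f ≅ g where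
  hom := e.hom
  inv := e.inv
  hom_inv_id := e.hom_inv_id
  inv_hom_id := e.inv_hom_id

/-- Left whiskering. -/
def whiskerLeft {a b c : S.Obj} (f : Hom a b) {g h : Hom b c} (η : g ⟶ h) :
    f.comp g ⟶ f.comp h :=
  Bicategory.whiskerLeft f.hom (show g.hom ⟶ h.hom from η)

/-- Right whiskering. -/
def whiskerRight {a b c : S.Obj} {f g : Hom a b} (η : f ⟶ g) (h : Hom b c) :
    f.comp h ⟶ g.comp h :=
  Bicategory.whiskerRight (show f.hom ⟶ g.hom from η) h.hom

instance : Bicategory S.Obj where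
  Hom a b := Hom a b
  id a := ⟨𝟙 a.obj, S.id_mem a.obj⟩
  comp f g := Hom.comp f g
  whiskerLeft f _ _ η := whiskerLeft f η
  whiskerRight η h := whiskerRight η h
  associator (f : Hom _ _) (g : Hom _ _) (h : Hom _ _) :=
    isoMk (Bicategory.associator f.hom g.hom h.hom)
  leftUnitor (f : Hom _ _) := isoMk (Bicategory.leftUnitor f.hom)
  rightUnitor (f : Hom _ _) := isoMk (Bicategory.rightUnitor f.hom)
  whiskerLeft_id _ _ := Bicategory.whiskerLeft_id _ _
  whiskerLeft_comp _ _ _ _ _ _ := Bicategory.whiskerLeft_comp _ _ _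
  id_whiskerLeft _ := Bicategory.id_whiskerLeft _
  comp_whiskerLeft _ _ _ _ _ := Bicategory.comp_whiskerLeft _ _ _
  id_whiskerRight _ _ := Bicategory.id_whiskerRight _ _
  comp_whiskerRight _ _ _ := Bicategory.comp_whiskerRight _ _ _
  whiskerRight_id _ := Bicategory.whiskerRight_id _
  whiskerRight_comp _ _ _ := Bicategory.whiskerRight_comp _ _ _
  whisker_assoc _ _ _ _ _ := Bicategory.whisker_assoc _ _ _
  whisker_exchange _ _ := Bicategory.whisker_exchange _ _
  pentagon _ _ _ _ := Bicategory.pentagon _ _ _ _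
  triangle _ _ := Bicategory.triangle _ _

theorem eqToHom_eq {a b : S.Obj} {f g : a ⟶ b} (h : f = g) :
    (eqToHom h : f ⟶ g) = (eqToHom (congrArg Hom.hom h) : Hom.hom f ⟶ Hom.hom g) := by
  subst h; rfl

instance [Bicategory.Strict B] : Bicategory.Strict S.Obj where
  id_comp f := Hom.ext (Strict.id_comp (Hom.hom f))
  comp_id f := Hom.ext (Strict.comp_id (Hom.hom f))
  assoc f g h := Hom.ext (Strict.assoc (Hom.hom f) (Hom.hom g) (Hom.hom h))
  leftUnitor_eqToIso f := by
    apply Iso.ext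
    rw [eqToIso.hom, eqToHom_eq]
    exact congrArg Iso.hom (Strict.leftUnitor_eqToIso (Hom.hom f))
  rightUnitor_eqToIso f := by
    apply Iso.ext
    rw [eqToIso.hom, eqToHom_eq]
    exact congrArg Iso.hom (Strict.rightUnitor_eqToIso (Hom.hom f))
  associator_eqToIso f g h := by
    apply Iso.ext
    rw [eqToIso.hom, eqToHom_eq]
    exact congrArg Iso.hom (Strict.associator_eqToIso (Hom.hom f) (Hom.hom g) (Hom.hom h))

/-- The inclusion 2-functor of a sub-2-category. -/
def incl (S : SubTwoCategory B) [Bicategory.Strict B] : StrictPseudofunctor S.Obj B :=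
  StrictPseudofunctor.mk''
    { obj := fun a => a.obj
      map := fun f => Hom.hom f
      map₂ := fun η => η
      map_id := fun _ => rfl
      map_comp := fun _ _ => rfl
      map₂_id := fun _ => rfl
      map₂_comp := fun _ _ => rfl
      map₂_whisker_left := fun _ _ _ _ => ((Category.id_comp _).trans (Category.comp_id _)).symm
      map₂_whisker_right := fun _ _ => ((Category.id_comp _).trans (Category.comp_id _)).symm }

end SubTwoCategory
end SubTwoCategory

/-! ### Monoidal categories over a monoidal base, monoidal fibrations and opfibrations -/

section Over

/-- A functor between monoidal categories is strict monoidal if it preserves the unit, the tensor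
product and the constraints on the nose. -/
class IsStrictMonoidal {A : Type u₁} [Category.{v₁} A] [MonoidalCategory A] {X : Type u₂}
    [Category.{v₂} X] [MonoidalCategory X] (P : A ⥤ X) : Prop where
  obj_unit : P.obj (𝟙_ A) = 𝟙_ X
  obj_tensor (a b : A) : P.obj (a ⊗ b) = P.obj a ⊗ P.obj b
  map_tensor {a a' b b' : A} (f : a ⟶ a') (g : b ⟶ b') :
    P.map (f ⊗ₘ g) = eqToHom (obj_tensor a b) ≫ (P.map f ⊗ₘ P.map g) ≫
      eqToHom (obj_tensor a' b').symm
  map_associator (a b c : A) :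
    P.map (MonoidalCategory.associator a b c).hom =
      eqToHom (by rw [obj_tensor, obj_tensor]) ≫
        (MonoidalCategory.associator (P.obj a) (P.obj b) (P.obj c)).hom ≫
          eqToHom (by rw [obj_tensor, obj_tensor])
  map_leftUnitor (a : A) :
    P.map (MonoidalCategory.leftUnitor a).hom =
      eqToHom (by rw [obj_tensor, obj_unit]) ≫ (MonoidalCategory.leftUnitor (P.obj a)).hom
  map_rightUnitor (a : A) :
    P.map (MonoidalCategory.rightUnitor a).hom =
      eqToHom (by rw [obj_tensor, obj_unit]) ≫ (MonoidalCategory.rightUnitor (P.obj a)).hom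

variable (X : Type u) [Category.{v} X] [MonoidalCategory X]

/-- A monoidal category `A` with a strict monoidal functor `P : A ⥤ X`. -/
structure MonoidalOver where
  /-- the category `A` with the functor `P` -/
  based : BasedCategory.{v, u} X
  /-- the monoidal structure of `A` -/
  monoidal : MonoidalCategory based.obj
  strict : IsStrictMonoidal based.p

attribute [instance] MonoidalOver.monoidal MonoidalOver.strict

variable {X}

/-- A strong monoidal functor `H : A ⥤ B` over `X`: `Q H = P`, and `Q` sends the structure
isomorphisms of `H` to identities. -/
structure MonoidalOverHom (A B : MonoidalOver.{v, u} X) where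
  /-- the underlying functor over `X` -/
  based : A.based ⟶ B.based
  /-- the strong monoidal structure -/
  monoidal : based.toFunctor.Monoidal
  lift_ε : B.based.p.IsHomLift (𝟙 (𝟙_ X)) (Functor.LaxMonoidal.ε based.toFunctor)
  lift_μ (a b : A.based.obj) :
    B.based.p.IsHomLift (𝟙 (A.based.p.obj a ⊗ A.based.p.obj b))
      (Functor.LaxMonoidal.μ based.toFunctor a b)

attribute [instance] MonoidalOverHom.monoidal

/-- The unit constraint `I ⟶ H I`. -/
def MonoidalOverHom.unitMap {A B : MonoidalOver.{v, u} X} (H : MonoidalOverHom A B) :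
    𝟙_ B.based.obj ⟶ H.based.toFunctor.obj (𝟙_ A.based.obj) :=
  Functor.LaxMonoidal.ε H.based.toFunctor

/-- The tensor constraint `H a ⊗ H b ⟶ H (a ⊗ b)`. -/
def MonoidalOverHom.tensorMap {A B : MonoidalOver.{v, u} X} (H : MonoidalOverHom A B)
    (a b : A.based.obj) :
    H.based.toFunctor.obj a ⊗ H.based.toFunctor.obj b ⟶ H.based.toFunctor.obj (a ⊗ b) :=
  Functor.LaxMonoidal.μ H.based.toFunctor a b

/-- A monoidal natural transformation over the identity of `X`. -/
@[ext]
structure MonoidalOverHom₂ {A B : MonoidalOver.{v, u} X} (H K : MonoidalOverHom A B) where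
  /-- the underlying natural transformation over `X` -/
  based : H.based ⟶ K.based
  monoidal : NatTrans.IsMonoidal (F₁ := H.based.toFunctor) (F₂ := K.based.toFunctor)
    based.toNatTrans

attribute [instance] MonoidalOverHom₂.monoidal

instance (A B : MonoidalOver.{v, u} X) : Category (MonoidalOverHom A B) where
  Hom H K := MonoidalOverHom₂ H K
  id H := ⟨𝟙 H.based, NatTrans.IsMonoidal.id (F₁ := H.based.toFunctor)⟩
  comp {H K L} α β := ⟨α.based ≫ β.based, NatTrans.IsMonoidal.comp (F₁ := H.based.toFunctor)
    (F₂ := K.based.toFunctor) (F₃ := L.based.toFunctor) α.based.toNatTrans β.based.toNatTrans⟩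
  id_comp α := MonoidalOverHom₂.ext (Category.id_comp α.based)
  comp_id α := MonoidalOverHom₂.ext (Category.comp_id α.based)
  assoc α β γ := MonoidalOverHom₂.ext (Category.assoc α.based β.based γ.based)

namespace MonoidalOver

variable {A B D E : MonoidalOver.{v, u} X}

/-- The identity. -/
def idHom (A : MonoidalOver.{v, u} X) : MonoidalOverHom A A where
  based := 𝟙 A.based
  monoidal := (inferInstance : (𝟭 A.based.obj).Monoidal)
  lift_ε := IsHomLift.id IsStrictMonoidal.obj_unit
  lift_μ a b := IsHomLift.id (IsStrictMonoidal.obj_tensor a b)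

/-- Composition. -/
def compHom (H : MonoidalOverHom A B) (K : MonoidalOverHom B D) : MonoidalOverHom A D where
  based := H.based ≫ K.based
  monoidal := (inferInstance : (H.based.toFunctor ⋙ K.based.toFunctor).Monoidal)
  lift_ε := by
    have := K.lift_ε
    have := H.lift_ε
    have := BasedFunctor.preserves_isHomLift K.based (𝟙 (𝟙_ X))
      (Functor.LaxMonoidal.ε H.based.toFunctor)
    have h : D.based.p.IsHomLift (𝟙 (𝟙_ X) ≫ 𝟙 (𝟙_ X))
      (Functor.LaxMonoidal.ε K.based.toFunctor ≫
        K.based.toFunctor.map (Functor.LaxMonoidal.ε H.based.toFunctor)) := inferInstance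
    rw [Category.comp_id] at h
    exact h
  lift_μ a b := by
    have h₁ := K.lift_μ (H.based.toFunctor.obj a) (H.based.toFunctor.obj b)
    rw [BasedFunctor.w_obj, BasedFunctor.w_obj] at h₁
    have := H.lift_μ a b
    have := BasedFunctor.preserves_isHomLift K.based (𝟙 (A.based.p.obj a ⊗ A.based.p.obj b))
      (Functor.LaxMonoidal.μ H.based.toFunctor a b)
    have h : D.based.p.IsHomLift
      (𝟙 (A.based.p.obj a ⊗ A.based.p.obj b) ≫ 𝟙 (A.based.p.obj a ⊗ A.based.p.obj b))
      (Functor.LaxMonoidal.μ K.based.toFunctor _ _ ≫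
        K.based.toFunctor.map (Functor.LaxMonoidal.μ H.based.toFunctor a b)) := inferInstance
    rw [Category.comp_id] at h
    exact h

/-- Whiskering on the left. -/
def whiskerLeft (H : MonoidalOverHom A B) {K L : MonoidalOverHom B D} (α : K ⟶ L) :
    compHom H K ⟶ compHom H L where
  based := BasedCategory.whiskerLeft H.based α.based
  monoidal :=
    { unit := by
        change (Functor.LaxMonoidal.ε K.based.toFunctor ≫
            K.based.toFunctor.map (Functor.LaxMonoidal.ε H.based.toFunctor)) ≫
            α.based.toNatTrans.app _ =
          Functor.LaxMonoidal.ε L.based.toFunctor ≫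
            L.based.toFunctor.map (Functor.LaxMonoidal.ε H.based.toFunctor)
        rw [Category.assoc, α.based.toNatTrans.naturality, ← Category.assoc]
        congr 1
        exact NatTrans.IsMonoidal.unit (F₁ := K.based.toFunctor) (F₂ := L.based.toFunctor)
      tensor := fun a b => by
        change (Functor.LaxMonoidal.μ K.based.toFunctor _ _ ≫
            K.based.toFunctor.map (Functor.LaxMonoidal.μ H.based.toFunctor a b)) ≫
            α.based.toNatTrans.app _ =
          (α.based.toNatTrans.app _ ⊗ₘ α.based.toNatTrans.app _) ≫
          Functor.LaxMonoidal.μ L.based.toFunctor _ _ ≫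
            L.based.toFunctor.map (Functor.LaxMonoidal.μ H.based.toFunctor a b)
        rw [Category.assoc, α.based.toNatTrans.naturality, ← Category.assoc, ← Category.assoc]
        congr 1
        exact NatTrans.IsMonoidal.tensor (F₁ := K.based.toFunctor) (F₂ := L.based.toFunctor) _ _ }

/-- Whiskering on the right. -/
def whiskerRight {H K : MonoidalOverHom A B} (α : H ⟶ K) (L : MonoidalOverHom B D) :
    compHom H L ⟶ compHom K L where
  based := BasedCategory.whiskerRight α.based L.based
  monoidal :=
    { unit := by
        change (Functor.LaxMonoidal.ε L.based.toFunctor ≫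
            L.based.toFunctor.map (Functor.LaxMonoidal.ε H.based.toFunctor)) ≫
            L.based.toFunctor.map (α.based.toNatTrans.app _) =
          Functor.LaxMonoidal.ε L.based.toFunctor ≫
            L.based.toFunctor.map (Functor.LaxMonoidal.ε K.based.toFunctor)
        rw [Category.assoc, ← Functor.map_comp]
        congr 2
        exact NatTrans.IsMonoidal.unit (F₁ := H.based.toFunctor) (F₂ := K.based.toFunctor)
      tensor := fun a b => by
        change (Functor.LaxMonoidal.μ L.based.toFunctor _ _ ≫
            L.based.toFunctor.map (Functor.LaxMonoidal.μ H.based.toFunctor a b)) ≫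
            L.based.toFunctor.map (α.based.toNatTrans.app _) =
          (L.based.toFunctor.map (α.based.toNatTrans.app _) ⊗ₘ
            L.based.toFunctor.map (α.based.toNatTrans.app _)) ≫
          Functor.LaxMonoidal.μ L.based.toFunctor _ _ ≫
            L.based.toFunctor.map (Functor.LaxMonoidal.μ K.based.toFunctor a b)
        rw [Category.assoc, ← Functor.map_comp,
          Functor.LaxMonoidal.μ_natural_assoc, ← Functor.map_comp]
        congr 2
        exact NatTrans.IsMonoidal.tensor (F₁ := H.based.toFunctor) (F₂ := K.based.toFunctor) _ _ }

/-- An isomorphism of strong monoidal functors over `X` from an isomorphism of functors over `X`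
that is monoidal in both directions. -/
def isoMk {H K : MonoidalOverHom A B} (α : H ⟶ K) (β : K ⟶ H) (h : α.based ≫ β.based = 𝟙 _)
    (h' : β.based ≫ α.based = 𝟙 _) : H ≅ K where
  hom := α
  inv := β
  hom_inv_id := MonoidalOverHom₂.ext h
  inv_hom_id := MonoidalOverHom₂.ext h'

/-- The associator. -/
def assocIso (H : MonoidalOverHom A B) (K : MonoidalOverHom B D) (L : MonoidalOverHom D E) :
    compHom (compHom H K) L ≅ compHom H (compHom K L) :=
  isoMk
    { based := (Bicategory.associator H.based K.based L.based).hom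
      monoidal :=
        { unit := by
            change (Functor.LaxMonoidal.ε L.based.toFunctor ≫ L.based.toFunctor.map
                (Functor.LaxMonoidal.ε K.based.toFunctor ≫
                  K.based.toFunctor.map (Functor.LaxMonoidal.ε H.based.toFunctor))) ≫ 𝟙 _ =
              (Functor.LaxMonoidal.ε L.based.toFunctor ≫
                L.based.toFunctor.map (Functor.LaxMonoidal.ε K.based.toFunctor)) ≫
                L.based.toFunctor.map (K.based.toFunctor.map
                  (Functor.LaxMonoidal.ε H.based.toFunctor))
            simp
          tensor := fun a b => by
            change (Functor.LaxMonoidal.μ L.based.toFunctor _ _ ≫ L.based.toFunctor.map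
                (Functor.LaxMonoidal.μ K.based.toFunctor _ _ ≫
                  K.based.toFunctor.map (Functor.LaxMonoidal.μ H.based.toFunctor a b))) ≫ 𝟙 _ =
              (𝟙 _ ⊗ₘ 𝟙 _) ≫ (Functor.LaxMonoidal.μ L.based.toFunctor _ _ ≫
                L.based.toFunctor.map (Functor.LaxMonoidal.μ K.based.toFunctor _ _)) ≫
                L.based.toFunctor.map (K.based.toFunctor.map
                  (Functor.LaxMonoidal.μ H.based.toFunctor a b))
            simp } }
    { based := (Bicategory.associator H.based K.based L.based).inv
      monoidal :=
        { unit := by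
            change ((Functor.LaxMonoidal.ε L.based.toFunctor ≫
                L.based.toFunctor.map (Functor.LaxMonoidal.ε K.based.toFunctor)) ≫
                L.based.toFunctor.map (K.based.toFunctor.map
                  (Functor.LaxMonoidal.ε H.based.toFunctor))) ≫ 𝟙 _ =
              Functor.LaxMonoidal.ε L.based.toFunctor ≫ L.based.toFunctor.map
                (Functor.LaxMonoidal.ε K.based.toFunctor ≫
                  K.based.toFunctor.map (Functor.LaxMonoidal.ε H.based.toFunctor))
            simp
          tensor := fun a b => by
            change ((Functor.LaxMonoidal.μ L.based.toFunctor _ _ ≫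
                L.based.toFunctor.map (Functor.LaxMonoidal.μ K.based.toFunctor _ _)) ≫
                L.based.toFunctor.map (K.based.toFunctor.map
                  (Functor.LaxMonoidal.μ H.based.toFunctor a b))) ≫ 𝟙 _ =
              (𝟙 _ ⊗ₘ 𝟙 _) ≫ Functor.LaxMonoidal.μ L.based.toFunctor _ _ ≫ L.based.toFunctor.map
                (Functor.LaxMonoidal.μ K.based.toFunctor _ _ ≫
                  K.based.toFunctor.map (Functor.LaxMonoidal.μ H.based.toFunctor a b))
            simp } }
    (Iso.hom_inv_id _) (Iso.inv_hom_id _)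

/-- The left unitor. -/
def leftIso (H : MonoidalOverHom A B) : compHom (idHom A) H ≅ H :=
  isoMk
    { based := (Bicategory.leftUnitor H.based).hom
      monoidal :=
        { unit := by
            change (Functor.LaxMonoidal.ε H.based.toFunctor ≫ H.based.toFunctor.map (𝟙 _)) ≫
              𝟙 _ = Functor.LaxMonoidal.ε H.based.toFunctor
            simp
          tensor := fun a b => by
            change (Functor.LaxMonoidal.μ H.based.toFunctor a b ≫ H.based.toFunctor.map (𝟙 _)) ≫
              𝟙 _ = (𝟙 _ ⊗ₘ 𝟙 _) ≫ Functor.LaxMonoidal.μ H.based.toFunctor a b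
            simp } }
    { based := (Bicategory.leftUnitor H.based).inv
      monoidal :=
        { unit := by
            change Functor.LaxMonoidal.ε H.based.toFunctor ≫ 𝟙 _ =
              Functor.LaxMonoidal.ε H.based.toFunctor ≫ H.based.toFunctor.map (𝟙 _)
            simp
          tensor := fun a b => by
            change Functor.LaxMonoidal.μ H.based.toFunctor a b ≫ 𝟙 _ = (𝟙 _ ⊗ₘ 𝟙 _) ≫
              Functor.LaxMonoidal.μ H.based.toFunctor a b ≫ H.based.toFunctor.map (𝟙 _)
            simp } }
    (Iso.hom_inv_id _) (Iso.inv_hom_id _)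

/-- The right unitor. -/
def rightIso (H : MonoidalOverHom A B) : compHom H (idHom B) ≅ H :=
  isoMk
    { based := (Bicategory.rightUnitor H.based).hom
      monoidal :=
        { unit := by
            change (𝟙 _ ≫ Functor.LaxMonoidal.ε H.based.toFunctor) ≫ 𝟙 _ =
              Functor.LaxMonoidal.ε H.based.toFunctor
            simp
          tensor := fun a b => by
            change (𝟙 _ ≫ Functor.LaxMonoidal.μ H.based.toFunctor a b) ≫ 𝟙 _ =
              (𝟙 _ ⊗ₘ 𝟙 _) ≫ Functor.LaxMonoidal.μ H.based.toFunctor a b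
            simp } }
    { based := (Bicategory.rightUnitor H.based).inv
      monoidal :=
        { unit := by
            change Functor.LaxMonoidal.ε H.based.toFunctor ≫ 𝟙 _ =
              𝟙 _ ≫ Functor.LaxMonoidal.ε H.based.toFunctor
            simp
          tensor := fun a b => by
            change Functor.LaxMonoidal.μ H.based.toFunctor a b ≫ 𝟙 _ =
              (𝟙 _ ⊗ₘ 𝟙 _) ≫ 𝟙 _ ≫ Functor.LaxMonoidal.μ H.based.toFunctor a b
            simp } }
    (Iso.hom_inv_id _) (Iso.inv_hom_id _)

/-- The 2-category of monoidal categories over `X`. -/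
instance : Bicategory (MonoidalOver.{v, u} X) where
  Hom A B := MonoidalOverHom A B
  id A := idHom A
  comp H K := compHom H K
  whiskerLeft H _ _ α := whiskerLeft H α
  whiskerRight α L := whiskerRight α L
  associator H K L := assocIso H K L
  leftUnitor H := leftIso H
  rightUnitor H := rightIso H
  whiskerLeft_id (H : MonoidalOverHom _ _) (K : MonoidalOverHom _ _) :=
    MonoidalOverHom₂.ext (Bicategory.whiskerLeft_id H.based K.based)
  whiskerLeft_comp {_ _ _} (H : MonoidalOverHom _ _) {K L N} (α : MonoidalOverHom₂ K L)
      (β : MonoidalOverHom₂ L N) :=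
    MonoidalOverHom₂.ext (Bicategory.whiskerLeft_comp H.based α.based β.based)
  id_whiskerLeft {_ _ H K} (α : MonoidalOverHom₂ H K) :=
    MonoidalOverHom₂.ext (Bicategory.id_whiskerLeft α.based)
  comp_whiskerLeft {_ _ _ _} (H : MonoidalOverHom _ _) (K : MonoidalOverHom _ _) {L N}
      (α : MonoidalOverHom₂ L N) :=
    MonoidalOverHom₂.ext (Bicategory.comp_whiskerLeft H.based K.based α.based)
  id_whiskerRight (H : MonoidalOverHom _ _) (K : MonoidalOverHom _ _) :=
    MonoidalOverHom₂.ext (Bicategory.id_whiskerRight H.based K.based)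
  comp_whiskerRight {_ _ _ H K L} (α : MonoidalOverHom₂ H K) (β : MonoidalOverHom₂ K L)
      (N : MonoidalOverHom _ _) :=
    MonoidalOverHom₂.ext (Bicategory.comp_whiskerRight α.based β.based N.based)
  whiskerRight_id {_ _ H K} (α : MonoidalOverHom₂ H K) :=
    MonoidalOverHom₂.ext (Bicategory.whiskerRight_id α.based)
  whiskerRight_comp {_ _ _ _ H K} (α : MonoidalOverHom₂ H K) (L : MonoidalOverHom _ _)
      (N : MonoidalOverHom _ _) :=
    MonoidalOverHom₂.ext (Bicategory.whiskerRight_comp α.based L.based N.based)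
  whisker_assoc {_ _ _ _} (H : MonoidalOverHom _ _) {K L} (α : MonoidalOverHom₂ K L)
      (N : MonoidalOverHom _ _) :=
    MonoidalOverHom₂.ext (Bicategory.whisker_assoc H.based α.based N.based)
  whisker_exchange {_ _ _ H K L N} (α : MonoidalOverHom₂ H K) (β : MonoidalOverHom₂ L N) :=
    MonoidalOverHom₂.ext (Bicategory.whisker_exchange α.based β.based)
  pentagon (H : MonoidalOverHom _ _) (K : MonoidalOverHom _ _) (L : MonoidalOverHom _ _)
      (N : MonoidalOverHom _ _) :=
    MonoidalOverHom₂.ext (Bicategory.pentagon H.based K.based L.based N.based)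
  triangle (H : MonoidalOverHom _ _) (K : MonoidalOverHom _ _) :=
    MonoidalOverHom₂.ext (Bicategory.triangle H.based K.based)

theorem hom_ext {H K : MonoidalOverHom A B} (h : H.based = K.based)
    (h₀ : Functor.LaxMonoidal.ε H.based.toFunctor ≍ Functor.LaxMonoidal.ε K.based.toFunctor)
    (h₁ : ∀ a b, Functor.LaxMonoidal.μ H.based.toFunctor a b ≍
      Functor.LaxMonoidal.μ K.based.toFunctor a b) : H = K := by
  obtain ⟨f, m, _, _⟩ := H
  obtain ⟨f', m', _, _⟩ := K
  obtain rfl : f = f' := h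
  obtain rfl : m = m' := by
    apply Functor.Monoidal.toLaxMonoidal_injective
    apply Functor.LaxMonoidal.ext
    · exact eq_of_heq h₀
    · exact funext fun a => funext fun b => eq_of_heq (h₁ a b)
  rfl

theorem eqToHom_based {H K : A ⟶ B} (h : H = K) :
    MonoidalOverHom₂.based (eqToHom h) = eqToHom (congrArg MonoidalOverHom.based h) := by
  subst h; rfl

instance : Bicategory.Strict (MonoidalOver.{v, u} X) where
  id_comp {A B} (H : MonoidalOverHom A B) := by
    refine hom_ext rfl (heq_of_eq ?_) (fun a b => heq_of_eq ?_)
    · change Functor.LaxMonoidal.ε H.based.toFunctor ≫ H.based.toFunctor.map (𝟙 _) =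
        Functor.LaxMonoidal.ε H.based.toFunctor
      simp
    · change Functor.LaxMonoidal.μ H.based.toFunctor a b ≫ H.based.toFunctor.map (𝟙 _) =
        Functor.LaxMonoidal.μ H.based.toFunctor a b
      simp
  comp_id {A B} (H : MonoidalOverHom A B) :=
    hom_ext rfl (heq_of_eq (Category.id_comp (Functor.LaxMonoidal.ε H.based.toFunctor)))
      (fun a b => heq_of_eq (Category.id_comp (Functor.LaxMonoidal.μ H.based.toFunctor a b)))
  assoc {A B D E} (H : MonoidalOverHom A B) (K : MonoidalOverHom B D)
      (L : MonoidalOverHom D E) := by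
    refine hom_ext rfl (heq_of_eq ?_) (fun a b => heq_of_eq ?_)
    · change Functor.LaxMonoidal.ε L.based.toFunctor ≫ L.based.toFunctor.map
            (Functor.LaxMonoidal.ε K.based.toFunctor ≫
              K.based.toFunctor.map (Functor.LaxMonoidal.ε H.based.toFunctor)) =
          (Functor.LaxMonoidal.ε L.based.toFunctor ≫
            L.based.toFunctor.map (Functor.LaxMonoidal.ε K.based.toFunctor)) ≫
            L.based.toFunctor.map (K.based.toFunctor.map
              (Functor.LaxMonoidal.ε H.based.toFunctor))
      simp
    · change Functor.LaxMonoidal.μ L.based.toFunctor _ _ ≫ L.based.toFunctor.map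
            (Functor.LaxMonoidal.μ K.based.toFunctor _ _ ≫
              K.based.toFunctor.map (Functor.LaxMonoidal.μ H.based.toFunctor a b)) =
          (Functor.LaxMonoidal.μ L.based.toFunctor _ _ ≫
            L.based.toFunctor.map (Functor.LaxMonoidal.μ K.based.toFunctor _ _)) ≫
            L.based.toFunctor.map (K.based.toFunctor.map
              (Functor.LaxMonoidal.μ H.based.toFunctor a b))
      simp
  leftUnitor_eqToIso H := by
    apply Iso.ext
    apply MonoidalOverHom₂.ext
    rw [eqToIso.hom, eqToHom_based]
    exact congrArg Iso.hom (Strict.leftUnitor_eqToIso H.based)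
  rightUnitor_eqToIso H := by
    apply Iso.ext
    apply MonoidalOverHom₂.ext
    rw [eqToIso.hom, eqToHom_based]
    exact congrArg Iso.hom (Strict.rightUnitor_eqToIso H.based)
  associator_eqToIso H K L := by
    apply Iso.ext
    apply MonoidalOverHom₂.ext
    rw [eqToIso.hom, eqToHom_based]
    exact congrArg Iso.hom (Strict.associator_eqToIso H.based K.based L.based)

/-- The forgetful 2-functor to categories over `X`. -/
def forget (X : Type u) [Category.{v} X] [MonoidalCategory X] :
    StrictPseudofunctor (MonoidalOver.{v, u} X) (BasedCategory.{v, u} X) :=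
  StrictPseudofunctor.mk''
    { obj := fun A => A.based
      map := fun H => MonoidalOverHom.based H
      map₂ := fun α => MonoidalOverHom₂.based α
      map_id := fun _ => rfl
      map_comp := fun _ _ => rfl
      map₂_id := fun _ => rfl
      map₂_comp := fun _ _ => rfl
      map₂_whisker_left := fun _ _ _ _ => ((Category.id_comp _).trans (Category.comp_id _)).symm
      map₂_whisker_right := fun _ _ => ((Category.id_comp _).trans (Category.comp_id _)).symm }

end MonoidalOver
end Over

/-! ### The Grothendieck construction as a 2-functor -/

section Grothendieck

open scoped Pseudofunctor.CoGrothendieck Pseudofunctor.Grothendieck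

theorem mapId_inv_hom {C : Type u₁} [Category.{v₁} C] (F : LocallyDiscrete C ⥤ᵖ Cat.{v₂, u₂})
    (x : C) (b : F.obj ⟨x⟩) :
    (F.mapId ⟨x⟩).inv.toNatTrans.app b ≫ (F.mapId ⟨x⟩).hom.toNatTrans.app b = 𝟙 b := by
  rw [← Cat.Hom₂.comp_app]
  simp

theorem modification_natural {C : Type u₁} [Category.{v₁} C]
    {F G : LocallyDiscrete C ⥤ᵖ Cat.{v₂, u₂}}
    {τ σ : F ⟶ G} (m : τ ⟶ σ) {x y : C} (f : x ⟶ y) (a : F.obj ⟨x⟩) :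
    comp₂ m ((push F f).obj a) ≫ (natIso σ f a).hom =
      (natIso τ f a).hom ≫ (push G f).map (comp₂ m a) :=
  congr($(m.as.naturality f.toLoc).toNatTrans.app a)

theorem basedFunctor_ext {S : Type u₁} [Category.{v₁} S] {A B : BasedCategory.{v₂, u₂} S}
    {H K : A ⟶ B} (h : H.toFunctor = K.toFunctor) : H = K := by
  obtain ⟨H, _⟩ := H
  obtain ⟨K, _⟩ := K
  obtain rfl : H = K := h
  rfl

theorem based_eqToHom_app {S : Type u₁} [Category.{v₁} S] {A B : BasedCategory.{v₂, u₂} S}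
    {H K : A ⟶ B} (h : H = K) (a : A.obj) :
    (eqToHom h : H ⟶ K).toNatTrans.app a =
      eqToHom (by rw [h] : H.toFunctor.obj a = K.toFunctor.obj a) := by
  subst h; rfl

namespace Contra

variable {X : Type u₁} [Category.{v₁} X] {F G H : LocallyDiscrete Xᵒᵖ ⥤ᵖ Cat.{v₂, u₂}}

/-- The vertical morphism of `∫ᶜ F` given by a morphism of the fibre. -/
def vert {x : X} {a b : F.obj ⟨op x⟩} (k : a ⟶ b) : (⟨x, a⟩ : ∫ᶜ F) ⟶ ⟨x, b⟩ where
  base := 𝟙 x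
  fiber := k ≫ (F.mapId ⟨op x⟩).inv.toNatTrans.app b

theorem vert_comp {x : X} {a c : F.obj ⟨op x⟩} {b : ∫ᶜ F} (k : a ⟶ c)
    (f : (⟨x, c⟩ : ∫ᶜ F) ⟶ b) :
    (vert k : (⟨x, a⟩ : ∫ᶜ F) ⟶ ⟨x, c⟩) ≫ f = ⟨f.base, k ≫ f.fiber⟩ := by
  refine Pseudofunctor.CoGrothendieck.Hom.ext _ _ (Category.id_comp _) ?_
  simp [vert, F.mapComp_id_right_inv_app, Strict.rightUnitor_eqToIso, ← NatTrans.naturality_assoc,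
    PrelaxFunctor.map₂_eqToHom]

theorem comp_vert {y : X} {a : ∫ᶜ F} {b c : F.obj ⟨op y⟩} (f : a ⟶ ⟨y, b⟩) (k : b ⟶ c) :
    f ≫ (vert k : (⟨y, b⟩ : ∫ᶜ F) ⟶ ⟨y, c⟩) =
      ⟨f.base, f.fiber ≫ (F.map f.base.op.toLoc).toFunctor.map k⟩ := by
  refine Pseudofunctor.CoGrothendieck.Hom.ext _ _ (Category.comp_id _) ?_
  simp [vert, F.mapComp_id_left_inv_app, Strict.leftUnitor_eqToIso,
    PrelaxFunctor.map₂_eqToHom]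
  have h : (push F f.base.op).map ((F.mapId ⟨op y⟩).inv.toNatTrans.app c) ≫
      (push F f.base.op).map ((F.mapId ⟨op y⟩).hom.toNatTrans.app c) = 𝟙 _ :=
    ((push F f.base.op).map_comp _ _).symm.trans
      ((congrArg _ (mapId_inv_hom F (op y) c)).trans ((push F f.base.op).map_id c))
  refine f.fiber ≫= ?_
  refine (push F f.base.op).map k ≫= ?_
  exact ((Category.assoc _ _ _).symm.trans (h =≫ _)).trans (Category.id_comp _)

theorem vert_vert {x : X} {a b c : F.obj ⟨op x⟩} (k : a ⟶ b) (l : b ⟶ c) :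
    vert k ≫ vert l = vert (k ≫ l) := by
  refine (vert_comp k (vert l)).trans ?_
  simp [vert]

theorem vert_id {x : X} (a : F.obj ⟨op x⟩) : vert (𝟙 a) = 𝟙 (⟨x, a⟩ : ∫ᶜ F) :=
  Pseudofunctor.CoGrothendieck.Hom.ext _ _ rfl
    ((Category.id_comp _).trans (Category.comp_id _).symm)

theorem map_vert (τ : F ⟶ G) {x : X} {a b : F.obj ⟨op x⟩} (k : a ⟶ b) :
    (Pseudofunctor.CoGrothendieck.map τ).map (vert k) = vert ((comp₁ τ (op x)).map k) := by
  refine Pseudofunctor.CoGrothendieck.Hom.ext _ _ rfl ?_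
  refine Eq.trans ?_ (Category.comp_id _).symm
  simp [vert, Pseudofunctor.StrongTrans.naturality_id_hom_app]
  have h : (comp₁ τ (op x)).map ((F.mapId ⟨op x⟩).inv.toNatTrans.app b) ≫
      (comp₁ τ (op x)).map ((F.mapId ⟨op x⟩).hom.toNatTrans.app b) = 𝟙 _ :=
    ((comp₁ τ (op x)).map_comp _ _).symm.trans
      ((congrArg _ (mapId_inv_hom F (op x) b)).trans ((comp₁ τ (op x)).map_id b))
  refine (comp₁ τ (op x)).map k ≫= ?_
  exact ((Category.assoc _ _ _).symm.trans (h =≫ _)).trans (Category.id_comp _)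

/-- The natural transformation over `X` given by a modification. -/
def gr₂ {τ σ : F ⟶ G} (m : τ ⟶ σ) :
    Pseudofunctor.CoGrothendieck.map τ ⟶ Pseudofunctor.CoGrothendieck.map σ where
  app a := vert (comp₂ m a.fiber)
  naturality a b f := by
    refine (comp_vert _ _).trans (Eq.trans ?_ (vert_comp _ _).symm)
    refine Pseudofunctor.CoGrothendieck.Hom.ext _ _ rfl ?_
    refine Eq.trans ?_ (Category.comp_id _).symm
    change ((comp₁ τ _).map f.fiber ≫ (natIso τ f.base.op b.fiber).hom) ≫
        (push G f.base.op).map (comp₂ m b.fiber) =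
      comp₂ m a.fiber ≫ (comp₁ σ _).map f.fiber ≫ (natIso σ f.base.op b.fiber).hom
    rw [Category.assoc, ← modification_natural]
    exact (NatTrans.naturality_assoc (m.as.app ⟨op a.base⟩).toNatTrans f.fiber _)

/-- The Grothendieck construction, as a 2-functor from pseudofunctors `Xᵒᵖ ⥤ Cat` to categories
over `X`. -/
def gr (X : Type u₁) [Category.{v₁} X] :
    StrictPseudofunctor (LocallyDiscrete Xᵒᵖ ⥤ᵖ Cat.{v₂, u₂})
      (BasedCategory.{max v₁ v₂, max u₁ u₂} X) :=
  StrictPseudofunctor.mk''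
    { obj := fun F => BasedCategory.ofFunctor (Pseudofunctor.CoGrothendieck.forget F)
      map := fun τ => { toFunctor := Pseudofunctor.CoGrothendieck.map τ, w := rfl }
      map₂ := fun m =>
        { toNatTrans := gr₂ m
          isHomLift' := fun a => IsHomLift.map (Pseudofunctor.CoGrothendieck.forget _)
            ((gr₂ m).app a) }
      map_id := fun F => basedFunctor_ext (Pseudofunctor.CoGrothendieck.map_id_eq F)
      map_comp := fun τ σ => basedFunctor_ext (Pseudofunctor.CoGrothendieck.map_comp_eq τ σ)
      map₂_id := fun {F G} τ => BasedNatTrans.ext _ _ (by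
        ext a
        exact vert_id ((comp₁ τ (op a.base)).obj a.fiber))
      map₂_comp := fun m n => BasedNatTrans.ext _ _ (by
        ext a
        exact (vert_vert (comp₂ m a.fiber) (comp₂ n a.fiber)).symm)
      map₂_whisker_left := fun {F G H} τ {σ ρ} m => BasedNatTrans.ext _ _ (by
        ext a
        refine Eq.trans ?_ (congrArg₂ (· ≫ ·) (based_eqToHom_app _ a).symm
          (congrArg₂ (· ≫ ·) rfl (based_eqToHom_app _ a).symm))
        exact ((Category.id_comp _).trans (Category.comp_id _)).symm)
      map₂_whisker_right := fun {F G H} {τ σ} m ρ => BasedNatTrans.ext _ _ (by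
        ext a
        refine Eq.trans ?_ (congrArg₂ (· ≫ ·) (based_eqToHom_app _ a).symm
          (congrArg₂ (· ≫ ·) (map_vert ρ _).symm (based_eqToHom_app _ a).symm))
        exact ((Category.id_comp _).trans (Category.comp_id _)).symm) }

/-- A morphism of `∫ᶜ F` over an isomorphism whose fibre component is an isomorphism is an
isomorphism. -/
theorem isIso_of_isIso {a b : ∫ᶜ F} (f : a ⟶ b) [IsIso f.base] [IsIso f.fiber] : IsIso f := by
  have h : f = vert f.fiber ≫ Pseudofunctor.CoGrothendieck.cartesianLift b.fiber f.base := by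
    refine Eq.trans ?_ (vert_comp _ _).symm
    exact Pseudofunctor.CoGrothendieck.Hom.ext _ _ rfl
      ((Category.comp_id _).trans (Category.comp_id _)).symm
  have h₁ : IsIso (vert f.fiber) :=
    ⟨vert (inv f.fiber), by rw [vert_vert, IsIso.hom_inv_id, vert_id],
      by rw [vert_vert, IsIso.inv_hom_id, vert_id]⟩
  have := Pseudofunctor.CoGrothendieck.isStronglyCartesian_homCartesianLift b.fiber f.base
  have h₂ := Functor.IsStronglyCartesian.isIso_of_base_isIso
    (Pseudofunctor.CoGrothendieck.forget F) f.base
    (Pseudofunctor.CoGrothendieck.cartesianLift b.fiber f.base)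
  rw [h]
  infer_instance

/-- The isomorphism of `∫ᶜ F` given by an isomorphism of the base and one of the fibre. -/
noncomputable def isoMk {x y : X} {a : F.obj ⟨op x⟩} {b : F.obj ⟨op y⟩} (e : x ≅ y)
    (k : a ≅ (push F e.hom.op).obj b) : (⟨x, a⟩ : ∫ᶜ F) ≅ ⟨y, b⟩ :=
  have := isIso_of_isIso (F := F) (a := ⟨x, a⟩) (b := ⟨y, b⟩) ⟨e.hom, k.hom⟩
  @asIso _ _ _ _ ⟨e.hom, k.hom⟩ this

end Contra

namespace Co

variable {X : Type u₁} [Category.{v₁} X] {F G H : LocallyDiscrete X ⥤ᵖ Cat.{v₂, u₂}}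

/-- The vertical morphism of `∫ F` given by a morphism of the fibre. -/
def vert {x : X} {a b : F.obj ⟨x⟩} (k : a ⟶ b) : (⟨x, a⟩ : ∫ F) ⟶ ⟨x, b⟩ where
  base := 𝟙 x
  fiber := (F.mapId ⟨x⟩).hom.toNatTrans.app a ≫ k

theorem vert_comp {x : X} {a c : F.obj ⟨x⟩} {b : ∫ F} (k : a ⟶ c)
    (f : (⟨x, c⟩ : ∫ F) ⟶ b) :
    (vert k : (⟨x, a⟩ : ∫ F) ⟶ ⟨x, c⟩) ≫ f =
      ⟨f.base, (F.map f.base.toLoc).toFunctor.map k ≫ f.fiber⟩ := by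
  refine Pseudofunctor.Grothendieck.Hom.ext _ _ (Category.id_comp _) ?_
  simp [vert, F.mapComp_id_left_hom_app, Strict.leftUnitor_eqToIso,
    PrelaxFunctor.map₂_eqToHom]
  have h : (push F f.base).map ((F.mapId ⟨x⟩).inv.toNatTrans.app a) ≫
      (push F f.base).map ((F.mapId ⟨x⟩).hom.toNatTrans.app a) = 𝟙 _ :=
    ((push F f.base).map_comp _ _).symm.trans
      ((congrArg _ (mapId_inv_hom F x a)).trans ((push F f.base).map_id a))
  refine (eqToHom_trans_assoc _ _ _).trans ((Category.id_comp _).trans ?_)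
  exact ((Category.assoc _ _ _).symm.trans (h =≫ _)).trans (Category.id_comp _)

theorem comp_vert {y : X} {a : ∫ F} {b c : F.obj ⟨y⟩} (f : a ⟶ ⟨y, b⟩) (k : b ⟶ c) :
    f ≫ (vert k : (⟨y, b⟩ : ∫ F) ⟶ ⟨y, c⟩) = ⟨f.base, f.fiber ≫ k⟩ := by
  refine Pseudofunctor.Grothendieck.Hom.ext _ _ (Category.comp_id _) ?_
  simp [vert, F.mapComp_id_right_hom_app, Strict.rightUnitor_eqToIso,
    PrelaxFunctor.map₂_eqToHom]
  exact (eqToHom_trans_assoc _ _ _).trans (Category.id_comp _)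

theorem vert_vert {x : X} {a b c : F.obj ⟨x⟩} (k : a ⟶ b) (l : b ⟶ c) :
    vert k ≫ vert l = vert (k ≫ l) := by
  refine (comp_vert (vert k) l).trans ?_
  simp [vert]

theorem vert_id {x : X} (a : F.obj ⟨x⟩) : vert (𝟙 a) = 𝟙 (⟨x, a⟩ : ∫ F) :=
  Pseudofunctor.Grothendieck.Hom.ext _ _ rfl
    ((Category.id_comp _).trans (Category.comp_id _))

theorem map_vert (τ : F ⟶ G) {x : X} {a b : F.obj ⟨x⟩} (k : a ⟶ b) :
    (Pseudofunctor.Grothendieck.map τ).map (vert k) = vert ((comp₁ τ x).map k) := by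
  refine Pseudofunctor.Grothendieck.Hom.ext _ _ rfl ?_
  refine (Category.id_comp _).trans ?_
  simp [vert, Pseudofunctor.StrongTrans.naturality_id_inv_app]
  have h : (comp₁ τ x).map ((F.mapId ⟨x⟩).inv.toNatTrans.app a) ≫
      (comp₁ τ x).map ((F.mapId ⟨x⟩).hom.toNatTrans.app a) = 𝟙 _ :=
    ((comp₁ τ x).map_comp _ _).symm.trans
      ((congrArg _ (mapId_inv_hom F x a)).trans ((comp₁ τ x).map_id a))
  refine _ ≫= ?_
  exact ((Category.assoc _ _ _).symm.trans (h =≫ _)).trans (Category.id_comp _)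

/-- The natural transformation over `X` given by a modification. -/
def gr₂ {τ σ : F ⟶ G} (m : τ ⟶ σ) :
    Pseudofunctor.Grothendieck.map τ ⟶ Pseudofunctor.Grothendieck.map σ where
  app a := vert (comp₂ m a.fiber)
  naturality a b f := by
    refine (comp_vert _ _).trans (Eq.trans ?_ (vert_comp _ _).symm)
    refine Pseudofunctor.Grothendieck.Hom.ext _ _ rfl ?_
    refine (Category.id_comp _).trans ?_
    change ((natIso τ f.base a.fiber).inv ≫ (comp₁ τ _).map f.fiber) ≫ comp₂ m b.fiber =
      (push G f.base).map (comp₂ m a.fiber) ≫ (natIso σ f.base a.fiber).inv ≫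
        (comp₁ σ _).map f.fiber
    have h := (NatTrans.naturality (m.as.app ⟨b.base⟩).toNatTrans f.fiber)
    rw [Category.assoc, Iso.inv_comp_eq]
    refine h.trans ?_
    rw [← reassoc_of% modification_natural, Iso.hom_inv_id_assoc]

/-- The Grothendieck construction, as a 2-functor from pseudofunctors `X ⥤ Cat` to categories
over `X`. -/
def gr (X : Type u₁) [Category.{v₁} X] :
    StrictPseudofunctor (LocallyDiscrete X ⥤ᵖ Cat.{v₂, u₂})
      (BasedCategory.{max v₁ v₂, max u₁ u₂} X) :=
  StrictPseudofunctor.mk''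
    { obj := fun F => BasedCategory.ofFunctor (Pseudofunctor.Grothendieck.forget F)
      map := fun τ => { toFunctor := Pseudofunctor.Grothendieck.map τ, w := rfl }
      map₂ := fun m =>
        { toNatTrans := gr₂ m
          isHomLift' := fun a => IsHomLift.map (Pseudofunctor.Grothendieck.forget _)
            ((gr₂ m).app a) }
      map_id := fun F => basedFunctor_ext (Pseudofunctor.Grothendieck.map_id_eq F)
      map_comp := fun τ σ => basedFunctor_ext (Pseudofunctor.Grothendieck.map_comp_eq τ σ)
      map₂_id := fun {F G} τ => BasedNatTrans.ext _ _ (by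
        ext a
        exact vert_id ((comp₁ τ a.base).obj a.fiber))
      map₂_comp := fun m n => BasedNatTrans.ext _ _ (by
        ext a
        exact (vert_vert (comp₂ m a.fiber) (comp₂ n a.fiber)).symm)
      map₂_whisker_left := fun {F G H} τ {σ ρ} m => BasedNatTrans.ext _ _ (by
        ext a
        refine Eq.trans ?_ (congrArg₂ (· ≫ ·) (based_eqToHom_app _ a).symm
          (congrArg₂ (· ≫ ·) rfl (based_eqToHom_app _ a).symm))
        exact ((Category.id_comp _).trans (Category.comp_id _)).symm)
      map₂_whisker_right := fun {F G H} {τ σ} m ρ => BasedNatTrans.ext _ _ (by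
        ext a
        refine Eq.trans ?_ (congrArg₂ (· ≫ ·) (based_eqToHom_app _ a).symm
          (congrArg₂ (· ≫ ·) (map_vert ρ _).symm (based_eqToHom_app _ a).symm))
        exact ((Category.id_comp _).trans (Category.comp_id _)).symm) }

theorem eqToHom_pushComp (F : LocallyDiscrete X ⥤ᵖ Cat.{v₂, u₂}) {x y z : X} (f : x ⟶ y)
    (g : y ⟶ z) (h : x ⟶ z) (w : f ≫ g = h) (a : F.obj ⟨x⟩) :
    eqToHom (by rw [← w]; rfl) ≫ (F.mapComp f.toLoc g.toLoc).hom.toNatTrans.app a =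
      (pushComp F f g h w a).hom := by
  subst w
  refine (Category.id_comp _).trans ?_
  exact congr(($((F.mapComp'_eq_mapComp f.toLoc g.toLoc).symm)).hom.toNatTrans.app a)

theorem pushId_hom (F : LocallyDiscrete X ⥤ᵖ Cat.{v₂, u₂}) (x : X) (a : F.obj ⟨x⟩) :
    (pushId F (𝟙 x) rfl a).hom = (F.mapId ⟨x⟩).hom.toNatTrans.app a := by
  exact congr(($(F.mapId'_eq_mapId ⟨x⟩)).hom.toNatTrans.app a)

theorem exists_rightInverse {a b : ∫ F} (f : a ⟶ b) [IsIso f.base] [IsIso f.fiber] :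
    ∃ g : b ⟶ a, IsIso g.base ∧ IsIso g.fiber ∧ f ≫ g = 𝟙 a := by
  let p : (push F (inv f.base)).obj ((push F f.base).obj a.fiber) ≅ a.fiber :=
    (pushComp F f.base (inv f.base) (𝟙 a.base) (by simp) a.fiber).symm ≪≫
      pushId F (𝟙 a.base) rfl a.fiber
  refine ⟨⟨inv f.base, (push F (inv f.base)).map (inv f.fiber) ≫ p.hom⟩,
    inferInstance, inferInstance, ?_⟩
  refine Pseudofunctor.Grothendieck.Hom.ext _ _ (IsIso.hom_inv_id f.base) ?_
  have h : (push F (inv f.base)).map f.fiber ≫ (push F (inv f.base)).map (inv f.fiber) = 𝟙 _ := by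
    rw [← Functor.map_comp, IsIso.hom_inv_id, CategoryTheory.Functor.map_id]
  refine (_ ≫= (_ ≫= ((Category.assoc _ _ _).symm.trans
    ((h =≫ p.hom).trans (Category.id_comp _))))).trans ?_
  refine (Category.assoc _ _ _).symm.trans ?_
  refine ((eqToHom_pushComp F f.base (inv f.base) (𝟙 a.base) (by simp) a.fiber) =≫ _).trans ?_
  refine (Iso.hom_inv_id_assoc _ _).trans ?_
  exact pushId_hom F a.base a.fiber

/-- A morphism of `∫ F` over an isomorphism whose fibre component is an isomorphism is an
isomorphism. -/
theorem isIso_of_isIso {a b : ∫ F} (f : a ⟶ b) [IsIso f.base] [IsIso f.fiber] : IsIso f := by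
  obtain ⟨g, _, _, hg⟩ := exists_rightInverse f
  obtain ⟨h, _, _, hh⟩ := exists_rightInverse g
  have e : f = h := by rw [← Category.comp_id f, ← hh, reassoc_of% hg]
  exact ⟨g, hg, by rw [e, hh]⟩

/-- The isomorphism of `∫ F` given by an isomorphism of the base and one of the fibre. -/
noncomputable def isoMk {x y : X} {a : F.obj ⟨x⟩} {b : F.obj ⟨y⟩} (e : x ≅ y)
    (k : (push F e.hom).obj a ≅ b) : (⟨x, a⟩ : ∫ F) ≅ ⟨y, b⟩ :=
  have := isIso_of_isIso (F := F) (a := ⟨x, a⟩) (b := ⟨y, b⟩) ⟨e.hom, k.hom⟩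
  @asIso _ _ _ _ ⟨e.hom, k.hom⟩ this

end Co
end Grothendieck

/-! ### Monoidal fibrations and opfibrations over a fixed monoidal base -/

section Fixed

/-- A morphism of `A` that is cartesian with respect to `P : A ⥤ X`. -/
def IsCart {A : Type u₁} [Category.{v₁} A] {X : Type u₂} [Category.{v₂} X] (P : A ⥤ X) {a b : A}
    (φ : a ⟶ b) : Prop :=
  P.IsStronglyCartesian (P.map φ) φ

/-- A morphism of `A` that is cocartesian with respect to `P : A ⥤ X`. -/
def IsCocart {A : Type u₁} [Category.{v₁} A] {X : Type u₂} [Category.{v₂} X] (P : A ⥤ X)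
    {a b : A} (φ : a ⟶ b) : Prop :=
  P.IsStronglyCocartesian (P.map φ) φ

/-- `P : A ⥤ X` is an opfibration: every `f : P a ⟶ y` has a cocartesian lift with domain `a`. -/
def IsOpfibration {A : Type u₁} [Category.{v₁} A] {X : Type u₂} [Category.{v₂} X] (P : A ⥤ X) :
    Prop :=
  ∀ (a : A) (y : X) (f : P.obj a ⟶ y), ∃ (b : A) (φ : a ⟶ b), P.IsStronglyCocartesian f φ

variable (X : Type u) [Category.{v} X] [MonoidalCategory X]

/-- The sub-2-category of monoidal fibrations over `X`: the objects are those monoidal categories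
with a strict monoidal functor to `X` that is a fibration and whose tensor product preserves
cartesian morphisms; the 1-cells are the strong monoidal functors over `X` that preserve cartesian
morphisms. -/
def monFib : SubTwoCategory (MonoidalOver.{v, u} X) where
  objProp A := A.based.p.IsFibered ∧
    ∀ {a b a' b' : A.based.obj} (φ : a ⟶ b) (ψ : a' ⟶ b'),
      IsCart A.based.p φ → IsCart A.based.p ψ → IsCart A.based.p (φ ⊗ₘ ψ)
  homProp {A B} (H : MonoidalOverHom A B) := ∀ {a b : A.based.obj} (φ : a ⟶ b),
    IsCart A.based.p φ → IsCart B.based.p (H.based.toFunctor.map φ)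
  id_mem _ _ _ _ h := h
  comp_mem _ _ hf hg _ _ _ h := hg _ (hf _ h)

/-- The sub-2-category of monoidal opfibrations over `X`, defined dually. -/
def monOpFib : SubTwoCategory (MonoidalOver.{v, u} X) where
  objProp A := IsOpfibration A.based.p ∧
    ∀ {a b a' b' : A.based.obj} (φ : a ⟶ b) (ψ : a' ⟶ b'),
      IsCocart A.based.p φ → IsCocart A.based.p ψ → IsCocart A.based.p (φ ⊗ₘ ψ)
  homProp {A B} (H : MonoidalOverHom A B) := ∀ {a b : A.based.obj} (φ : a ⟶ b),
    IsCocart A.based.p φ → IsCocart B.based.p (H.based.toFunctor.map φ)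
  id_mem _ _ _ _ h := h
  comp_mem _ _ hf hg _ _ _ h := hg _ (hf _ h)

/-- The 2-category of monoidal fibrations over `X`. -/
abbrev MonFib : Type _ := (monFib.{v, u} X).Obj

/-- The 2-category of monoidal opfibrations over `X`. -/
abbrev MonOpFib : Type _ := (monOpFib.{v, u} X).Obj

end Fixed

/-! ### 2-equivalences -/

section TwoEquivalence

variable {B C : Type*} [Bicategory B] [Bicategory.Strict B] [Bicategory C] [Bicategory.Strict C]

/-- A 2-natural isomorphism between 2-functors. -/
structure TwoNatIso (F G : StrictPseudofunctor B C) where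
  /-- the components -/
  hom (a : B) : F.obj a ⟶ G.obj a
  /-- the inverse components -/
  inv (a : B) : G.obj a ⟶ F.obj a
  hom_inv_id (a : B) : hom a ≫ inv a = 𝟙 (F.obj a)
  inv_hom_id (a : B) : inv a ≫ hom a = 𝟙 (G.obj a)
  naturality {a b : B} (f : a ⟶ b) : F.map f ≫ hom b = hom a ≫ G.map f
  naturality₂ {a b : B} {f g : a ⟶ b} (η : f ⟶ g) :
    F.map₂ η ▷ hom b ≫ eqToHom (naturality g) = eqToHom (naturality f) ≫ hom a ◁ G.map₂ η

variable (B C)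

/-- A 2-equivalence: 2-functors in both directions with 2-natural isomorphisms `1 ≅ G F` and
`F G ≅ 1`. -/
structure TwoEquivalence where
  /-- the 2-functor -/
  functor : StrictPseudofunctor B C
  /-- the 2-functor in the other direction -/
  inverse : StrictPseudofunctor C B
  /-- the unit -/
  unit : TwoNatIso (StrictPseudofunctor.id B) (functor.comp inverse)
  /-- the counit -/
  counit : TwoNatIso (inverse.comp functor) (StrictPseudofunctor.id C)

end TwoEquivalence

/-! ### The monoidal structure on the Grothendieck construction -/

section Tensor

open scoped Pseudofunctor.CoGrothendieck Pseudofunctor.Grothendieck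

/-- The structure maps `S` on `A` satisfy the axioms of a monoidal category. -/
def IsMonoidalStruct {A : Type u₁} [Category.{v₁} A] (S : MonoidalCategoryStruct A) : Prop :=
  ∃ m : MonoidalCategory A, m.toMonoidalCategoryStruct = S

/-- The monoidal category with given structure maps. -/
abbrev monoidalOfStruct {A : Type u₁} [Category.{v₁} A] (S : MonoidalCategoryStruct A)
    (h : IsMonoidalStruct S) : MonoidalCategory A where
  toMonoidalCategoryStruct := S
  tensorHom_def := by obtain ⟨m, rfl⟩ := h; exact m.tensorHom_def
  id_tensorHom_id := by obtain ⟨m, rfl⟩ := h; exact m.id_tensorHom_id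
  tensorHom_comp_tensorHom := by obtain ⟨m, rfl⟩ := h; exact m.tensorHom_comp_tensorHom
  whiskerLeft_id := by obtain ⟨m, rfl⟩ := h; exact m.whiskerLeft_id
  id_whiskerRight := by obtain ⟨m, rfl⟩ := h; exact m.id_whiskerRight
  associator_naturality := by obtain ⟨m, rfl⟩ := h; exact m.associator_naturality
  leftUnitor_naturality := by obtain ⟨m, rfl⟩ := h; exact m.leftUnitor_naturality
  rightUnitor_naturality := by obtain ⟨m, rfl⟩ := h; exact m.rightUnitor_naturality
  pentagon := by obtain ⟨m, rfl⟩ := h; exact m.pentagon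
  triangle := by obtain ⟨m, rfl⟩ := h; exact m.triangle

namespace Contra

variable {X : Type u₁} [Category.{v₁} X] [MonoidalCategory X]
  (M : LaxMonoidalPseudofunctor.{v₁, u₁, v₂, u₂} Xᵒᵖ)

/-- The tensor product `(x, a) ⊗ (y, b) = (x ⊗ y, μ_{x,y}(a, b))` of objects of `∫ᶜ M`. -/
def tensorObj (A B : ∫ᶜ M.toPs) : ∫ᶜ M.toPs :=
  ⟨A.base ⊗ B.base, (M.mu (op A.base) (op B.base)).obj (A.fiber, B.fiber)⟩

/-- The unit object `(I, μ₀)` of `∫ᶜ M`. -/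
def tensorUnit : ∫ᶜ M.toPs := ⟨𝟙_ X, M.mu0⟩

/-- The tensor product of morphisms of `∫ᶜ M`. -/
def tensorHom {A A' B B' : ∫ᶜ M.toPs} (f : A ⟶ A') (g : B ⟶ B') :
    tensorObj M A B ⟶ tensorObj M A' B' where
  base := f.base ⊗ₘ g.base
  fiber := (M.mu (op A.base) (op B.base)).map (f.fiber ×ₘ g.fiber) ≫
    (M.muMap f.base.op g.base.op A'.fiber B'.fiber).inv

/-- The structure maps of the monoidal structure on `∫ᶜ M`; the constraints are given by those of
`X` and by `ω`, `ξ`, `ζ`. -/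
noncomputable abbrev tensorStruct : MonoidalCategoryStruct (∫ᶜ M.toPs) where
  tensorObj := tensorObj M
  tensorUnit := tensorUnit M
  tensorHom := tensorHom M
  whiskerLeft A _ _ g := tensorHom M (𝟙 A) g
  whiskerRight f B := tensorHom M f (𝟙 B)
  associator A B D :=
    (isoMk (MonoidalCategory.associator A.base B.base D.base).symm
      (M.omega (x := op A.base) (y := op B.base) (z := op D.base)
        A.fiber B.fiber D.fiber).symm).symm
  leftUnitor A :=
    (isoMk (MonoidalCategory.leftUnitor A.base).symm (M.xi (x := op A.base) A.fiber).symm).symm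
  rightUnitor A :=
    (isoMk (MonoidalCategory.rightUnitor A.base).symm
      (M.zeta (x := op A.base) A.fiber).symm).symm

end Contra

namespace Co

variable {X : Type u₁} [Category.{v₁} X] [MonoidalCategory X]
  (M : LaxMonoidalPseudofunctor.{v₁, u₁, v₂, u₂} X)

/-- The tensor product `(x, a) ⊗ (y, b) = (x ⊗ y, μ_{x,y}(a, b))` of objects of `∫ M`. -/
def tensorObj (A B : ∫ M.toPs) : ∫ M.toPs :=
  ⟨A.base ⊗ B.base, (M.mu A.base B.base).obj (A.fiber, B.fiber)⟩

/-- The unit object `(I, μ₀)` of `∫ M`. -/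
def tensorUnit : ∫ M.toPs := ⟨𝟙_ X, M.mu0⟩

/-- The tensor product of morphisms of `∫ M`. -/
def tensorHom {A A' B B' : ∫ M.toPs} (f : A ⟶ A') (g : B ⟶ B') :
    tensorObj M A B ⟶ tensorObj M A' B' where
  base := f.base ⊗ₘ g.base
  fiber := (M.muMap f.base g.base A.fiber B.fiber).hom ≫
    (M.mu A'.base B'.base).map (f.fiber ×ₘ g.fiber)

/-- The structure maps of the monoidal structure on `∫ M`; the constraints are given by those of
`X` and by `ω`, `ξ`, `ζ`. -/
noncomputable abbrev tensorStruct : MonoidalCategoryStruct (∫ M.toPs) where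
  tensorObj := tensorObj M
  tensorUnit := tensorUnit M
  tensorHom := tensorHom M
  whiskerLeft A _ _ g := tensorHom M (𝟙 A) g
  whiskerRight f B := tensorHom M f (𝟙 B)
  associator A B D :=
    isoMk (MonoidalCategory.associator A.base B.base D.base) (M.omega A.fiber B.fiber D.fiber)
  leftUnitor A := isoMk (MonoidalCategory.leftUnitor A.base) (M.xi A.fiber)
  rightUnitor A := isoMk (MonoidalCategory.rightUnitor A.base) (M.zeta A.fiber)

end Co

variable {X : Type u} [Category.{v} X] [MonoidalCategory X]

/-- The functor `∫ᶜ M ⥤ X` as a monoidal category over `X`. -/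
noncomputable abbrev Contra.grObj (M : LaxMonoidalPseudofunctor.{v, u, v, u} Xᵒᵖ)
    (h : IsMonoidalStruct (Contra.tensorStruct M))
    (hs : @IsStrictMonoidal _ _ (monoidalOfStruct _ h) X _ _
      (Pseudofunctor.CoGrothendieck.forget M.toPs)) : MonoidalOver.{v, u} X where
  based := (Contra.gr X).obj M.toPs
  monoidal := monoidalOfStruct (Contra.tensorStruct M) h
  strict := hs

/-- The functor `∫ M ⥤ X` as a monoidal category over `X`. -/
noncomputable abbrev Co.grObj (M : LaxMonoidalPseudofunctor.{v, u, v, u} X)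
    (h : IsMonoidalStruct (Co.tensorStruct M))
    (hs : @IsStrictMonoidal _ _ (monoidalOfStruct _ h) X _ _
      (Pseudofunctor.Grothendieck.forget M.toPs)) : MonoidalOver.{v, u} X where
  based := (Co.gr X).obj M.toPs
  monoidal := monoidalOfStruct (Co.tensorStruct M) h
  strict := hs

/-- A 2-functor from lax monoidal pseudofunctors `Xᵒᵖ ⥤ Cat` to monoidal fibrations over `X` that
restricts the Grothendieck construction: on underlying categories over `X` it is the Grothendieck
construction, the total category of `M` has the monoidal structure given by `μ`, `μ₀`, `ω`, `ξ`,
`ζ`, and the functor induced by `τ` has the monoidal structure given by `u`, `u₀`. -/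
structure Contra.Restricts
    (Φ : StrictPseudofunctor (LaxMonoidalPseudofunctor.{v, u, v, u} Xᵒᵖ) (MonFib.{v, u} X)) :
    Prop where
  comp_forget : Φ.comp ((monFib.{v, u} X).incl.comp (MonoidalOver.forget X)) =
    (LaxMonoidalPseudofunctor.forget Xᵒᵖ).comp (Contra.gr X)
  obj_eq (M : LaxMonoidalPseudofunctor.{v, u, v, u} Xᵒᵖ) :
    ∃ h hs, (Φ.obj M).obj = Contra.grObj M h hs
  map_eq {M N : LaxMonoidalPseudofunctor.{v, u, v, u} Xᵒᵖ} (τ : MonoidalTrans M N) :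
    ∃ h hs h' hs', ∃ H : MonoidalOverHom (Contra.grObj M h hs) (Contra.grObj N h' hs'),
      SubTwoCategory.Hom.hom (Φ.map τ) ≍ H ∧
      H.based = (Contra.gr X).map τ.toTrans ∧
      H.unitMap ≍ Contra.vert τ.u0.hom ∧
      ∀ {x y : X} (a : M.toPs.obj ⟨op x⟩) (b : M.toPs.obj ⟨op y⟩),
        H.tensorMap ⟨x, a⟩ ⟨y, b⟩ ≍
          Contra.vert (x := x ⊗ y) (τ.u a b).hom

/-- A 2-functor from lax monoidal pseudofunctors `X ⥤ Cat` to monoidal opfibrations over `X` that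
restricts the Grothendieck construction: on underlying categories over `X` it is the Grothendieck
construction, the total category of `M` has the monoidal structure given by `μ`, `μ₀`, `ω`, `ξ`,
`ζ`, and the functor induced by `τ` has the monoidal structure given by `u`, `u₀`. -/
structure Co.Restricts
    (Φ : StrictPseudofunctor (LaxMonoidalPseudofunctor.{v, u, v, u} X) (MonOpFib.{v, u} X)) :
    Prop where
  comp_forget : Φ.comp ((monOpFib.{v, u} X).incl.comp (MonoidalOver.forget X)) =
    (LaxMonoidalPseudofunctor.forget X).comp (Co.gr X)
  obj_eq (M : LaxMonoidalPseudofunctor.{v, u, v, u} X) :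
    ∃ h hs, (Φ.obj M).obj = Co.grObj M h hs
  map_eq {M N : LaxMonoidalPseudofunctor.{v, u, v, u} X} (τ : MonoidalTrans M N) :
    ∃ h hs h' hs', ∃ H : MonoidalOverHom (Co.grObj M h hs) (Co.grObj N h' hs'),
      SubTwoCategory.Hom.hom (Φ.map τ) ≍ H ∧
      H.based = (Co.gr X).map τ.toTrans ∧
      H.unitMap ≍ Co.vert τ.u0.hom ∧
      ∀ {x y : X} (a : M.toPs.obj ⟨x⟩) (b : M.toPs.obj ⟨y⟩),
        H.tensorMap ⟨x, a⟩ ⟨y, b⟩ ≍ Co.vert (τ.u a b).hom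

end Tensor

end MonGroth

namespace MonGroth

/-! ### Recognizing 2-equivalences -/

section Recognition

section HEq

variable {B : Type*} [Bicategory B]

/-! The Grothendieck construction is refined to a strict 2-functor from lax monoidal pseudofunctors
to monoidal fibrations (or opfibrations) that is bijective on 1-cells between given objects,
bijective on 2-cells, and surjective on objects up to a strictly invertible 1-cell. Such a 2-functor
is half of a 2-equivalence: choose the invertible 1-cells, conjugate 1-cells and 2-cells by them,
and take preimages (`exists_twoEquivalence`). Surjectivity in this strict form is available because
a fibration with chosen lifts is isomorphic, not just equivalent, to the Grothendieck construction
on its fibres.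

In the covariant case an arrow of `∫ F` is a pair `hom f k` with `k : (F f) a ⟶ b` in a fibre. It is
the cocartesian lift of `f` followed by the vertical arrow `vert k`, and it is cocartesian exactly
when `k` is invertible (`Co.isCocart_hom_iff`). Structure over the base is therefore determined by
what happens to vertical arrows and to lifts. For a functor over the base that preserves cocartesian
arrows, vertical arrows give the functors between fibres and lifts give the pseudonaturality
constraints (`Co.exists_map_eq`). For a tensor product, vertical arrows give `μ`, lifts give its
pseudonaturality, and the constraints give `ω`, `ξ`, `ζ` (`Co.FiberedTensor.toLax`). The structure
isomorphisms of a strong monoidal functor over the base are vertical, and they are `u` and `u₀`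
(`Co.exists_monoidalTrans`). In each case preservation of cocartesian arrows is what makes the
constraints invertible. The axioms on the two sides correspond one to one: both `hom f` and `vert`
are injective, and the composition formula `Co.hom_comp_hom` inserts exactly the coherence
isomorphisms of the pseudofunctor that occur in the axioms.

For surjectivity on objects, a choice of lifts makes the fibres into a pseudofunctor
(`OpCleavage.pseudo`), and the comparison functor `OpCleavage.fromTotal` is bijective on objects and
on arrows. The tensor product is transported along it (`Co.exists_fiberedTensor`) and read as a lax
monoidal structure. The strict inverse of the comparison functor is again strong monoidal over the
base and preserves cocartesian arrows (`exists_inverse_monOpFib`).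

The contravariant case has the same proof with lifts on the other side: `hom f k`, now with `k : a ⟶
(F f) b`, is a vertical arrow followed by a cartesian lift. Composition then involves the inverses
of the coherence isomorphisms, so the axioms are first put in inverse form (`inv_eq_inv_of_hom`,
`comp_inv_comp_hom_eq_iff`). -/

theorem whiskerLeft_heq {a b c : B} {f f' : a ⟶ b} {g g' h h' : b ⟶ c} {η : g ⟶ h} {η' : g' ⟶ h'}
    (hf : f = f') (hg : g = g') (hh : h = h') (e : η ≍ η') : f ◁ η ≍ f' ◁ η' := by
  subst hf hg hh
  rw [eq_of_heq e]

theorem whiskerRight_heq {a b c : B} {f f' : b ⟶ c} {g g' h h' : a ⟶ b} {η : g ⟶ h} {η' : g' ⟶ h'}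
    (hf : f = f') (hg : g = g') (hh : h = h') (e : η ≍ η') : η ▷ f ≍ η' ▷ f' := by
  subst hf hg hh
  rw [eq_of_heq e]

variable [Bicategory.Strict B]

/-- In a strict 2-category the unitors and associators are `eqToHom`s, and heterogeneous equality
absorbs them. With this and the following lemmas 2-cells can be rebracketed without recording the
transports. -/
theorem id_whiskerLeft_heq {a b : B} {f g : a ⟶ b} (η : f ⟶ g) : 𝟙 a ◁ η ≍ η := by
  rw [Bicategory.id_whiskerLeft, Strict.leftUnitor_eqToIso, Strict.leftUnitor_eqToIso]
  simp only [eqToIso.hom, eqToIso.inv]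
  exact (eqToHom_comp_heq _ _).trans (comp_eqToHom_heq _ _)

theorem whiskerRight_id_heq {a b : B} {f g : a ⟶ b} (η : f ⟶ g) : η ▷ 𝟙 b ≍ η := by
  rw [Bicategory.whiskerRight_id, Strict.rightUnitor_eqToIso, Strict.rightUnitor_eqToIso]
  simp only [eqToIso.hom, eqToIso.inv]
  exact (eqToHom_comp_heq _ _).trans (comp_eqToHom_heq _ _)

theorem comp_whiskerLeft_heq {a b c d : B} (f : a ⟶ b) (g : b ⟶ c) {h k : c ⟶ d} (η : h ⟶ k) :
    (f ≫ g) ◁ η ≍ f ◁ g ◁ η := by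
  rw [Bicategory.comp_whiskerLeft, Strict.associator_eqToIso, Strict.associator_eqToIso]
  simp only [eqToIso.hom, eqToIso.inv]
  exact (eqToHom_comp_heq _ _).trans (comp_eqToHom_heq _ _)

theorem whiskerRight_comp_heq {a b c d : B} {f g : a ⟶ b} (η : f ⟶ g) (h : b ⟶ c) (k : c ⟶ d) :
    η ▷ (h ≫ k) ≍ (η ▷ h) ▷ k := by
  rw [Bicategory.whiskerRight_comp, Strict.associator_eqToIso, Strict.associator_eqToIso]
  simp only [eqToIso.hom, eqToIso.inv]
  exact (eqToHom_comp_heq _ _).trans (comp_eqToHom_heq _ _)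

theorem whisker_assoc_heq {a b c d : B} (f : a ⟶ b) {g h : b ⟶ c} (η : g ⟶ h) (k : c ⟶ d) :
    (f ◁ η) ▷ k ≍ f ◁ (η ▷ k) := by
  rw [Bicategory.whisker_assoc, Strict.associator_eqToIso, Strict.associator_eqToIso]
  simp only [eqToIso.hom, eqToIso.inv]
  exact (eqToHom_comp_heq _ _).trans (comp_eqToHom_heq _ _)

variable {C : Type*} [Bicategory C] (F : StrictPseudofunctor B C)

theorem map₂_whiskerLeft_heq {a b c : B} (f : a ⟶ b) {g h : b ⟶ c} (η : g ⟶ h) :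
    F.map₂ (f ◁ η) ≍ F.map f ◁ F.map₂ η := by
  rw [F.map₂_whisker_left, F.mapComp_eq_eqToIso, F.mapComp_eq_eqToIso]
  simp only [eqToIso.hom, eqToIso.inv]
  exact (eqToHom_comp_heq _ _).trans (comp_eqToHom_heq _ _)

theorem map₂_whiskerRight_heq {a b c : B} {f g : a ⟶ b} (η : f ⟶ g) (h : b ⟶ c) :
    F.map₂ (η ▷ h) ≍ F.map₂ η ▷ F.map h := by
  rw [F.map₂_whisker_right, F.mapComp_eq_eqToIso, F.mapComp_eq_eqToIso]
  simp only [eqToIso.hom, eqToIso.inv]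
  exact (eqToHom_comp_heq _ _).trans (comp_eqToHom_heq _ _)

/-- Makes faithfulness on 2-cells usable for 2-cells whose source and target agree only
propositionally, so that equations can be checked after applying `F`. -/
theorem map₂_heq_inj {a b : B}
    (hF : ∀ f g : a ⟶ b, Function.Injective (F.map₂ : (f ⟶ g) → (F.map f ⟶ F.map g)))
    {f f' g g' : a ⟶ b} {η : f ⟶ g} {η' : f' ⟶ g'} (hf : f = f') (hg : g = g')
    (h : F.map₂ η ≍ F.map₂ η') : η ≍ η' := by
  subst hf hg
  exact heq_of_eq (hF _ _ (eq_of_heq h))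

end HEq

variable {B C : Type*} [Bicategory B] [Bicategory.Strict B] [Bicategory C] [Bicategory.Strict C]

/-- A 2-functor that is bijective on 1-cells and on 2-cells and hits every object up to a strict
isomorphism, with chosen inverses. -/
structure StrictInverse (F : StrictPseudofunctor B C) where
  obj : C → B
  i (c : C) : c ⟶ F.obj (obj c)
  j (c : C) : F.obj (obj c) ⟶ c
  i_j (c : C) : i c ≫ j c = 𝟙 c
  j_i (c : C) : j c ≫ i c = 𝟙 _
  preim {a b : B} (f : F.obj a ⟶ F.obj b) : a ⟶ b
  map_preim {a b : B} (f : F.obj a ⟶ F.obj b) : F.map (preim f) = f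
  map_inj {a b : B} {f g : a ⟶ b} : F.map f = F.map g → f = g
  preim₂ {a b : B} {f g : a ⟶ b} (η : F.map f ⟶ F.map g) : f ⟶ g
  map_preim₂ {a b : B} {f g : a ⟶ b} (η : F.map f ⟶ F.map g) : F.map₂ (preim₂ η) = η
  map₂_inj {a b : B} (f g : a ⟶ b) :
    Function.Injective (F.map₂ : (f ⟶ g) → (F.map f ⟶ F.map g))

namespace StrictInverse

variable {F : StrictPseudofunctor B C} (S : StrictInverse F)

theorem i_j_assoc {c d : C} (f : c ⟶ d) : S.i c ≫ S.j c ≫ f = f := by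
  rw [← Strict.assoc, S.i_j, Strict.id_comp]

/-- The action on 1-cells of the inverse 2-functor. -/
def map {c d : C} (f : c ⟶ d) : S.obj c ⟶ S.obj d := S.preim (S.j c ≫ f ≫ S.i d)

theorem map_map {c d : C} (f : c ⟶ d) : F.map (S.map f) = S.j c ≫ f ≫ S.i d :=
  S.map_preim _

/-- The action on 2-cells of the inverse 2-functor. -/
def map₂ {c d : C} {f g : c ⟶ d} (η : f ⟶ g) : S.map f ⟶ S.map g :=
  S.preim₂ (eqToHom (S.map_map f) ≫ S.j c ◁ (η ▷ S.i d) ≫ eqToHom (S.map_map g).symm)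

/-- Further computations with `S.map₂` go through this description, in which the transports of the
definition no longer appear. -/
theorem map₂_map₂ {c d : C} {f g : c ⟶ d} (η : f ⟶ g) :
    F.map₂ (S.map₂ η) ≍ S.j c ◁ (η ▷ S.i d) := by
  rw [map₂, S.map_preim₂]
  exact (eqToHom_comp_heq _ _).trans (comp_eqToHom_heq _ _)

theorem map_comp {c d e : C} (f : c ⟶ d) (g : d ⟶ e) : S.map (f ≫ g) = S.map f ≫ S.map g := by
  apply S.map_inj
  rw [F.map_comp, S.map_map, S.map_map, S.map_map]
  simp only [Strict.assoc]
  rw [S.i_j_assoc]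

theorem i_j_whiskerLeft {c d : C} {f g : c ⟶ d} (η : f ⟶ g) :
    S.i c ◁ S.j c ◁ η ≍ η :=
  (comp_whiskerLeft_heq _ _ _).symm.trans
    ((whiskerLeft_heq (S.i_j c) rfl rfl HEq.rfl).trans (id_whiskerLeft_heq η))

theorem i_j_whiskerRight {c d : C} {f g : c ⟶ d} (η : f ⟶ g) :
    (η ▷ S.i d) ▷ S.j d ≍ η :=
  (whiskerRight_comp_heq _ _ _).symm.trans
    ((whiskerRight_heq (S.i_j d) rfl rfl HEq.rfl).trans (whiskerRight_id_heq η))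

/-- The inverse 2-functor. -/
def functor : StrictPseudofunctor C B :=
  StrictPseudofunctor.mk''
    { obj := S.obj
      map := S.map
      map₂ := S.map₂
      map_id := fun c => S.map_inj (by rw [S.map_map, F.map_id, Strict.id_comp, S.j_i])
      map_comp := S.map_comp
      map₂_id := fun f => by
        apply S.map₂_inj
        apply eq_of_heq
        refine (S.map₂_map₂ _).trans ?_
        rw [Bicategory.id_whiskerRight, Bicategory.whiskerLeft_id, PrelaxFunctor.map₂_id, S.map_map]
      map₂_comp := fun {c d f g h} η θ => by
        apply S.map₂_inj
        apply eq_of_heq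
        refine (S.map₂_map₂ _).trans ?_
        rw [Bicategory.comp_whiskerRight, Bicategory.whiskerLeft_comp, PrelaxFunctor.map₂_comp]
        exact heq_comp (S.map_map f).symm (S.map_map g).symm (S.map_map h).symm
          (S.map₂_map₂ η).symm (S.map₂_map₂ θ).symm
      -- After applying `F`, both sides are the whiskering of `η` by `S.j c`, `f` and `S.i e`. The
      -- side coming from the composite contains one extra pair `S.i d ≫ S.j d`, which is an
      -- identity.
      map₂_whisker_left := fun {c d e} f {g g'} η => by
        rw [conj_eqToHom_iff_heq']
        refine map₂_heq_inj F S.map₂_inj (S.map_comp f g) (S.map_comp f g') ?_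
        refine HEq.trans ?_ (map₂_whiskerLeft_heq F _ _).symm
        refine ((S.map₂_map₂ _).trans ?_).trans
          (whiskerLeft_heq (S.map_map f) (S.map_map g) (S.map_map g') (S.map₂_map₂ η)).symm
        refine HEq.trans ?_ (comp_whiskerLeft_heq _ _ _).symm
        refine whiskerLeft_heq rfl ?_ ?_ ((whisker_assoc_heq _ _ _).trans ?_)
        · rw [Strict.assoc, Strict.assoc, S.i_j_assoc]
        · rw [Strict.assoc, Strict.assoc, S.i_j_assoc]
        refine HEq.trans ?_ (comp_whiskerLeft_heq _ _ _).symm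
        exact whiskerLeft_heq rfl (S.i_j_assoc _).symm (S.i_j_assoc _).symm
          (S.i_j_whiskerLeft _).symm
      map₂_whisker_right := fun {c d e f f'} η g => by
        rw [conj_eqToHom_iff_heq']
        refine map₂_heq_inj F S.map₂_inj (S.map_comp f g) (S.map_comp f' g) ?_
        refine HEq.trans ?_ (map₂_whiskerRight_heq F _ _).symm
        refine ((S.map₂_map₂ _).trans ?_).trans
          (whiskerRight_heq (S.map_map g) (S.map_map f) (S.map_map f') (S.map₂_map₂ η)).symm
        refine HEq.trans ?_ (whisker_assoc_heq _ _ _).symm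
        refine whiskerLeft_heq rfl ?_ ?_ ?_
        · rw [Strict.assoc, Strict.assoc, S.i_j_assoc]
        · rw [Strict.assoc, Strict.assoc, S.i_j_assoc]
        refine HEq.trans ?_ (whiskerRight_comp_heq _ _ _).symm
        refine HEq.trans ?_ (whiskerRight_comp_heq _ _ _).symm
        refine whiskerRight_heq rfl ?_ ?_ (whiskerRight_heq rfl ?_ ?_
          (S.i_j_whiskerRight η).symm)
        · rw [Strict.assoc, Strict.assoc, S.i_j_assoc]
        · rw [Strict.assoc, Strict.assoc, S.i_j_assoc]
        · rw [Strict.assoc, S.i_j, Strict.comp_id]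
        · rw [Strict.assoc, S.i_j, Strict.comp_id] }

theorem preim_j_i (a : B) : S.preim (S.j (F.obj a)) ≫ S.preim (S.i (F.obj a)) = 𝟙 _ := by
  apply S.map_inj
  rw [F.map_comp, F.map_id, S.map_preim, S.map_preim, S.j_i]

theorem preim_i_j (a : B) : S.preim (S.i (F.obj a)) ≫ S.preim (S.j (F.obj a)) = 𝟙 _ := by
  apply S.map_inj
  rw [F.map_comp, F.map_id, S.map_preim, S.map_preim, S.i_j]

theorem comp_i_j {c d : C} (f : c ⟶ d) : (f ≫ S.i d) ≫ S.j d = f := by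
  rw [Strict.assoc, S.i_j, Strict.comp_id]

theorem map_comp_preim_j {a b : B} (f : a ⟶ b) :
    S.map (F.map f) ≫ S.preim (S.j (F.obj b)) = S.preim (S.j (F.obj a)) ≫ f := by
  apply S.map_inj
  rw [F.map_comp, F.map_comp, S.map_preim, S.map_preim, S.map_map, Strict.assoc, S.comp_i_j]

theorem functor_comp_naturality {c d : C} (f : c ⟶ d) :
    f ≫ S.i d = S.i c ≫ F.map (S.map f) := by
  rw [S.map_map, S.i_j_assoc]

/-- The 2-equivalence. -/
def equivalence : TwoEquivalence C B where
  functor := S.functor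
  inverse := F
  unit :=
    { hom := S.i
      inv := S.j
      hom_inv_id := S.i_j
      inv_hom_id := S.j_i
      naturality := S.functor_comp_naturality
      naturality₂ := fun {c d f g} η => by
        apply eq_of_heq
        refine (comp_eqToHom_heq _ _).trans (HEq.trans ?_ (eqToHom_comp_heq _ _).symm)
        exact (S.i_j_whiskerLeft (η ▷ S.i d)).symm.trans (whiskerLeft_heq rfl
          (S.map_map f).symm (S.map_map g).symm (S.map₂_map₂ η).symm) }
  -- The counit at `a` has to lie in `B`, so it is the preimage under `F` of the chosen isomorphism
  -- at `F.obj a`. Its laws are checked after applying `F`, which is injective on 1-cells and on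
  -- 2-cells.
  counit :=
    { hom := fun a => S.preim (S.j (F.obj a))
      inv := fun a => S.preim (S.i (F.obj a))
      hom_inv_id := S.preim_j_i
      inv_hom_id := S.preim_i_j
      naturality := S.map_comp_preim_j
      naturality₂ := fun {a b f g} η => by
        apply eq_of_heq
        refine (comp_eqToHom_heq _ _).trans (HEq.trans ?_ (eqToHom_comp_heq _ _).symm)
        refine map₂_heq_inj F S.map₂_inj (S.map_comp_preim_j f) (S.map_comp_preim_j g) ?_
        refine (map₂_whiskerRight_heq F _ _).trans (HEq.trans ?_ (map₂_whiskerLeft_heq F _ _).symm)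
        refine (whiskerRight_heq (S.map_preim _) (S.map_map (F.map f)) (S.map_map (F.map g))
          (S.map₂_map₂ (F.map₂ η))).trans ?_
        refine HEq.trans ?_ (whiskerLeft_heq (S.map_preim _) rfl rfl HEq.rfl).symm
        refine (whisker_assoc_heq _ _ _).trans ?_
        exact whiskerLeft_heq rfl (S.comp_i_j _) (S.comp_i_j _) (S.i_j_whiskerRight _) }

end StrictInverse

/-- A 2-functor that is bijective on 1-cells and on 2-cells and hits every object up to a strict
isomorphism is a 2-equivalence. -/
theorem exists_twoEquivalence (F : StrictPseudofunctor B C)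
    (h₀ : ∀ c : C, ∃ (b : B) (i : c ⟶ F.obj b) (j : F.obj b ⟶ c), i ≫ j = 𝟙 c ∧ j ≫ i = 𝟙 _)
    (h₁ : ∀ a b : B, Function.Bijective (F.map : (a ⟶ b) → (F.obj a ⟶ F.obj b)))
    (h₂ : ∀ {a b : B} (f g : a ⟶ b),
      Function.Bijective (F.map₂ : (f ⟶ g) → (F.map f ⟶ F.map g))) :
    ∃ E : TwoEquivalence C B, E.inverse = F := by
  choose obj i j hij hji using h₀
  choose p hp using fun a b => (h₁ a b).2
  choose q hq using fun {a b : B} (f g : a ⟶ b) => (h₂ f g).2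
  exact ⟨StrictInverse.equivalence
    { obj := obj
      i := i
      j := j
      i_j := hij
      j_i := hji
      preim := p _ _
      map_preim := hp _ _
      map_inj := fun h => (h₁ _ _).1 h
      preim₂ := q _ _
      map_preim₂ := hq _ _
      map₂_inj := fun f g => (h₂ f g).1 }, rfl⟩

end Recognition

end MonGroth

/-! ### The tensor product on the total category of a covariant lax monoidal pseudofunctor -/

namespace MonGroth

open scoped Pseudofunctor.CoGrothendieck Pseudofunctor.Grothendieck

namespace Co

section Lifts

variable {X : Type u₁} [Category.{v₁} X] {F G : LocallyDiscrete X ⥤ᵖ Cat.{v₂, u₂}}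

/-- The morphism of `∫ F` with given components. -/
abbrev hom {x y : X} {a : F.obj ⟨x⟩} {b : F.obj ⟨y⟩} (f : x ⟶ y) (k : (push F f).obj a ⟶ b) :
    (⟨x, a⟩ : ∫ F) ⟶ ⟨y, b⟩ := ⟨f, k⟩

/-- The base arrow `h` is free, subject to `f ≫ g = h`, so the two sides of a commuting square can
both be written over the same arrow. Comparing them then amounts to comparing fibre components, with
no transport. -/
theorem hom_comp_hom {x y z : X} {a : F.obj ⟨x⟩} {b : F.obj ⟨y⟩} {c : F.obj ⟨z⟩} (f : x ⟶ y)
    (k : (push F f).obj a ⟶ b) (g : y ⟶ z) (l : (push F g).obj b ⟶ c) (h : x ⟶ z)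
    (w : f ≫ g = h) :
    hom f k ≫ hom g l = hom h ((pushComp F f g h w a).hom ≫ (push F g).map k ≫ l) := by
  subst w
  refine Pseudofunctor.Grothendieck.Hom.ext _ _ rfl ?_
  refine (Category.id_comp _).trans ?_
  refine Eq.trans ?_ (congrArg (· ≫ (push F g).map k ≫ l) (eqToHom_pushComp F f g _ rfl a))
  exact ((Category.id_comp _) =≫ _).symm

theorem id_eq_hom (x : X) (a : F.obj ⟨x⟩) (f : x ⟶ x) (w : f = 𝟙 x) :
    𝟙 (⟨x, a⟩ : ∫ F) = hom f (pushId F f w a).hom := by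
  subst w
  exact Pseudofunctor.Grothendieck.Hom.ext _ _ rfl
    ((Category.id_comp _).trans (pushId_hom F x a).symm)

theorem vert_eq_hom {x : X} {a b : F.obj ⟨x⟩} (k : a ⟶ b) (f : x ⟶ x) (w : f = 𝟙 x) :
    vert k = hom f ((pushId F f w a).hom ≫ k) := by
  subst w
  exact Pseudofunctor.Grothendieck.Hom.ext _ _ rfl
    ((Category.id_comp _).trans (congrArg (· ≫ k) (pushId_hom F x a).symm))

/-- The cocartesian lift of `f`. -/
abbrev lift (F : LocallyDiscrete X ⥤ᵖ Cat.{v₂, u₂}) {x y : X} (f : x ⟶ y) (a : F.obj ⟨x⟩) :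
    (⟨x, a⟩ : ∫ F) ⟶ ⟨y, (push F f).obj a⟩ := ⟨f, 𝟙 _⟩

theorem lift_comp_vert {x y : X} (f : x ⟶ y) (a : F.obj ⟨x⟩) {b : F.obj ⟨y⟩}
    (k : (push F f).obj a ⟶ b) : lift F f a ≫ vert k = hom f k :=
  (comp_vert _ _).trans (congrArg (hom f) (Category.id_comp _))

theorem hom_comp_vert {x y : X} {a : F.obj ⟨x⟩} {b c : F.obj ⟨y⟩} (f : x ⟶ y)
    (k : (push F f).obj a ⟶ b) (l : b ⟶ c) :
    hom f k ≫ vert l = hom f (k ≫ l) :=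
  comp_vert _ _

theorem vert_comp_hom {x y : X} {a c : F.obj ⟨x⟩} {b : F.obj ⟨y⟩} (k : a ⟶ c) (f : x ⟶ y)
    (l : (push F f).obj c ⟶ b) :
    (vert k : (⟨x, a⟩ : ∫ F) ⟶ ⟨x, c⟩) ≫ hom f l = hom f ((push F f).map k ≫ l) :=
  vert_comp _ _

/-- Read backwards, this turns an equation of composites in the total category into an axiom about
fibres; it is how structure on the total category is translated back. -/
theorem hom_injective {x y : X} {a : F.obj ⟨x⟩} {b : F.obj ⟨y⟩} {f : x ⟶ y}
    {k l : (push F f).obj a ⟶ b} (h : hom f k = hom f l) : k = l := by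
  injection h

theorem vert_injective {x : X} {a b : F.obj ⟨x⟩} {k l : a ⟶ b} (h : vert k = vert l) : k = l := by
  rw [vert_eq_hom k _ rfl, vert_eq_hom l _ rfl] at h
  exact (cancel_epi _).1 (hom_injective h)

end Lifts

section Tensor

variable {X : Type u₁} [Category.{v₁} X] [MonoidalCategory X]
  (M : LaxMonoidalPseudofunctor.{v₁, u₁, v₂, u₂} X)

theorem tensorHom_hom {x x' y y' : X} {a : M.toPs.obj ⟨x⟩} {a' : M.toPs.obj ⟨x'⟩}
    {b : M.toPs.obj ⟨y⟩} {b' : M.toPs.obj ⟨y'⟩} (f : x ⟶ x') (k : (push M.toPs f).obj a ⟶ a')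
    (g : y ⟶ y') (l : (push M.toPs g).obj b ⟶ b') :
    tensorHom M (hom f k) (hom g l) =
      hom (f ⊗ₘ g) ((M.muMap f g a b).hom ≫ (M.mu x' y').map (k ×ₘ l)) := rfl

theorem tensorHom_id (A B : ∫ M.toPs) : tensorHom M (𝟙 A) (𝟙 B) = 𝟙 (tensorObj M A B) := by
  obtain ⟨x, a⟩ := A
  obtain ⟨y, b⟩ := B
  rw [id_eq_hom x a _ rfl, id_eq_hom y b _ rfl, tensorHom_hom, M.muMap_id]
  exact (id_eq_hom (x ⊗ y) _ _ _).symm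

/-- `muMap_comp` accounts for the base arrows, and `muMap_natural` moves the first pair of fibre
components past the second constraint. -/
theorem tensorHom_comp {A A' A'' B B' B'' : ∫ M.toPs} (f : A ⟶ A') (f' : A' ⟶ A'') (g : B ⟶ B')
    (g' : B' ⟶ B'') :
    tensorHom M f g ≫ tensorHom M f' g' = tensorHom M (f ≫ f') (g ≫ g') := by
  obtain ⟨x, a⟩ := A
  obtain ⟨x', a'⟩ := A'
  obtain ⟨x'', a''⟩ := A''
  obtain ⟨y, b⟩ := B
  obtain ⟨y', b'⟩ := B'
  obtain ⟨y'', b''⟩ := B''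
  obtain ⟨f, k⟩ := f
  obtain ⟨f', k'⟩ := f'
  obtain ⟨g, l⟩ := g
  obtain ⟨g', l'⟩ := g'
  dsimp only at k k' l l'
  refine (hom_comp_hom _ _ _ _ ((f ≫ f') ⊗ₘ (g ≫ g')) (by simp)).trans ?_
  refine Eq.trans ?_ (congrArg₂ (tensorHom M) (hom_comp_hom f k f' k' _ rfl)
    (hom_comp_hom g l g' l' _ rfl)).symm
  rw [tensorHom_hom]
  refine congrArg (hom _) ?_
  have e : (M.mu x'' y'').map (((pushComp M.toPs f f' _ rfl a).hom ≫
      (push M.toPs f').map k ≫ k') ×ₘ ((pushComp M.toPs g g' _ rfl b).hom ≫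
      (push M.toPs g').map l ≫ l')) = (M.mu x'' y'').map
      ((pushComp M.toPs f f' _ rfl a).hom ×ₘ (pushComp M.toPs g g' _ rfl b).hom) ≫
      (M.mu x'' y'').map ((push M.toPs f').map k ×ₘ (push M.toPs g').map l) ≫
      (M.mu x'' y'').map (k' ×ₘ l') := by
    rw [← Functor.map_comp, ← Functor.map_comp]; rfl
  change (pushComp M.toPs (f ⊗ₘ g) (f' ⊗ₘ g') _ _ _).hom ≫
    (push M.toPs (f' ⊗ₘ g')).map ((M.muMap f g a b).hom ≫ (M.mu x' y').map (k ×ₘ l)) ≫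
      (M.muMap f' g' a' b').hom ≫ (M.mu x'' y'').map (k' ×ₘ l') = _
  rw [e, reassoc_of% M.muMap_comp, Functor.map_comp, Category.assoc, reassoc_of% M.muMap_natural]

/-- `omega_modification` is naturality in the base arrows and `omega_natural` is naturality in the
fibre components; an arbitrary arrow combines the two. The unitors are treated in the same way
below. -/
theorem associator_naturality {A A' B B' D D' : ∫ M.toPs} (f : A ⟶ A') (g : B ⟶ B') (h : D ⟶ D') :
    tensorHom M (tensorHom M f g) h ≫ ((tensorStruct M).associator A' B' D').hom =
      ((tensorStruct M).associator A B D).hom ≫ tensorHom M f (tensorHom M g h) := by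
  obtain ⟨x, a⟩ := A
  obtain ⟨x', a'⟩ := A'
  obtain ⟨y, b⟩ := B
  obtain ⟨y', b'⟩ := B'
  obtain ⟨z, d⟩ := D
  obtain ⟨z', d'⟩ := D'
  obtain ⟨f, k⟩ := f
  obtain ⟨g, l⟩ := g
  obtain ⟨h, m⟩ := h
  refine (hom_comp_hom _ _ _ _ ((α_ x y z).hom ≫ (f ⊗ₘ (g ⊗ₘ h)))
    (MonoidalCategory.associator_naturality f g h)).trans ?_
  refine Eq.trans ?_ (hom_comp_hom _ _ _ _ _ rfl).symm
  refine congrArg (hom _) ?_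
  dsimp only at k l m
  have e : (M.mu x' (y' ⊗ z')).map (k ×ₘ ((M.muMap g h b d).hom ≫ (M.mu y' z').map (l ×ₘ m))) =
      (M.mu x' (y' ⊗ z')).map (𝟙 _ ×ₘ (M.muMap g h b d).hom) ≫
        (M.mu x' (y' ⊗ z')).map (k ×ₘ (M.mu y' z').map (l ×ₘ m)) := by
    rw [← Functor.map_comp]; simp
  have e' : (M.mu (x' ⊗ y') z').map (((M.muMap f g a b).hom ≫ (M.mu x' y').map (k ×ₘ l)) ×ₘ m) =
      (M.mu (x' ⊗ y') z').map ((M.muMap f g a b).hom ×ₘ 𝟙 _) ≫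
        (M.mu (x' ⊗ y') z').map ((M.mu x' y').map (k ×ₘ l) ×ₘ m) := by
    rw [← Functor.map_comp]; simp
  change (pushComp M.toPs ((f ⊗ₘ g) ⊗ₘ h) (α_ x' y' z').hom _ _ _).hom ≫
      (push M.toPs (α_ x' y' z').hom).map ((M.muMap (f ⊗ₘ g) h _ d).hom ≫
        (M.mu (x' ⊗ y') z').map (((M.muMap f g a b).hom ≫ (M.mu x' y').map (k ×ₘ l)) ×ₘ m)) ≫
          (M.omega a' b' d').hom =
    (pushComp M.toPs (α_ x y z).hom (f ⊗ₘ (g ⊗ₘ h)) _ rfl _).hom ≫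
      (push M.toPs (f ⊗ₘ (g ⊗ₘ h))).map (M.omega a b d).hom ≫ (M.muMap f (g ⊗ₘ h) a _).hom ≫
        (M.mu x' (y' ⊗ z')).map (k ×ₘ ((M.muMap g h b d).hom ≫ (M.mu y' z').map (l ×ₘ m)))
  rw [e, e', reassoc_of% M.omega_modification, Iso.hom_inv_id_assoc, ← M.omega_natural]
  simp only [Functor.map_comp, Category.assoc]

theorem leftUnitor_naturality {A A' : ∫ M.toPs} (f : A ⟶ A') :
    tensorHom M (𝟙 (tensorUnit M)) f ≫ ((tensorStruct M).leftUnitor A').hom =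
      ((tensorStruct M).leftUnitor A).hom ≫ f := by
  obtain ⟨x, a⟩ := A
  obtain ⟨x', a'⟩ := A'
  obtain ⟨f, k⟩ := f
  dsimp only at k
  refine (congrArg (fun t => tensorHom M t (hom f k) ≫ _) (id_eq_hom _ _ _ rfl)).trans ?_
  refine (hom_comp_hom _ _ _ _ ((λ_ x).hom ≫ f) (by simp)).trans ?_
  refine Eq.trans ?_ (hom_comp_hom _ _ _ _ _ rfl).symm
  refine congrArg (hom _) ?_
  have e : (M.mu (𝟙_ X) x').map ((pushId M.toPs (𝟙 (𝟙_ X)) rfl M.mu0).hom ×ₘ k) =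
      (M.mu (𝟙_ X) x').map ((pushId M.toPs (𝟙 (𝟙_ X)) rfl M.mu0).hom ×ₘ 𝟙 _) ≫
        (M.mu (𝟙_ X) x').map (𝟙 _ ×ₘ k) := by
    rw [← Functor.map_comp]; simp
  change (pushComp M.toPs (𝟙 (𝟙_ X) ⊗ₘ f) (λ_ x').hom _ _ _).hom ≫
      (push M.toPs (λ_ x').hom).map ((M.muMap (𝟙 (𝟙_ X)) f M.mu0 a).hom ≫
        (M.mu (𝟙_ X) x').map ((pushId M.toPs (𝟙 (𝟙_ X)) rfl M.mu0).hom ×ₘ k)) ≫ (M.xi a').hom =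
    (pushComp M.toPs (λ_ x).hom f _ rfl _).hom ≫ (push M.toPs f).map (M.xi a).hom ≫ k
  rw [e, M.xi_modification]
  simp only [Functor.map_comp, Category.assoc, Iso.hom_inv_id_assoc, M.xi_natural]

theorem rightUnitor_naturality {A A' : ∫ M.toPs} (f : A ⟶ A') :
    tensorHom M f (𝟙 (tensorUnit M)) ≫ ((tensorStruct M).rightUnitor A').hom =
      ((tensorStruct M).rightUnitor A).hom ≫ f := by
  obtain ⟨x, a⟩ := A
  obtain ⟨x', a'⟩ := A'
  obtain ⟨f, k⟩ := f
  dsimp only at k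
  refine (congrArg (fun t => tensorHom M (hom f k) t ≫ _) (id_eq_hom _ _ _ rfl)).trans ?_
  refine (hom_comp_hom _ _ _ _ ((ρ_ x).hom ≫ f) (by simp)).trans ?_
  refine Eq.trans ?_ (hom_comp_hom _ _ _ _ _ rfl).symm
  refine congrArg (hom _) ?_
  have e : (M.mu x' (𝟙_ X)).map (k ×ₘ (pushId M.toPs (𝟙 (𝟙_ X)) rfl M.mu0).hom) =
      (M.mu x' (𝟙_ X)).map (𝟙 _ ×ₘ (pushId M.toPs (𝟙 (𝟙_ X)) rfl M.mu0).hom) ≫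
        (M.mu x' (𝟙_ X)).map (k ×ₘ 𝟙 _) := by
    rw [← Functor.map_comp]; simp
  change (pushComp M.toPs (f ⊗ₘ 𝟙 (𝟙_ X)) (ρ_ x').hom _ _ _).hom ≫
      (push M.toPs (ρ_ x').hom).map ((M.muMap f (𝟙 (𝟙_ X)) a M.mu0).hom ≫
        (M.mu x' (𝟙_ X)).map (k ×ₘ (pushId M.toPs (𝟙 (𝟙_ X)) rfl M.mu0).hom)) ≫ (M.zeta a').hom =
    (pushComp M.toPs (ρ_ x).hom f _ rfl _).hom ≫ (push M.toPs f).map (M.zeta a).hom ≫ k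
  rw [e, M.zeta_modification]
  simp only [Functor.map_comp, Category.assoc, Iso.hom_inv_id_assoc, M.zeta_natural]

/-- Over the common base arrow, the fibre components of the two sides are the two sides of
`M.pentagon`. The factors `pushId` in that axiom are the fibre components of the identity arrows
being tensored. -/
theorem pentagon (A B D E : ∫ M.toPs) :
    tensorHom M ((tensorStruct M).associator A B D).hom (𝟙 E) ≫
        ((tensorStruct M).associator A (tensorObj M B D) E).hom ≫
          tensorHom M (𝟙 A) ((tensorStruct M).associator B D E).hom =
      ((tensorStruct M).associator (tensorObj M A B) D E).hom ≫
        ((tensorStruct M).associator A B (tensorObj M D E)).hom := by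
  obtain ⟨w, a⟩ := A
  obtain ⟨x, b⟩ := B
  obtain ⟨y, c⟩ := D
  obtain ⟨z, d⟩ := E
  have e₁ : tensorHom M ((tensorStruct M).associator ⟨w, a⟩ ⟨x, b⟩ ⟨y, c⟩).hom (𝟙 ⟨z, d⟩) =
      hom ((α_ w x y).hom ⊗ₘ 𝟙 z) ((M.muMap (α_ w x y).hom (𝟙 z) _ d).hom ≫
        (M.mu _ z).map ((M.omega a b c).hom ×ₘ (pushId M.toPs (𝟙 z) rfl d).hom)) :=
    congrArg (fun t => tensorHom M ((tensorStruct M).associator ⟨w, a⟩ ⟨x, b⟩ ⟨y, c⟩).hom t)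
      (id_eq_hom z d _ rfl)
  have e₂ : tensorHom M (𝟙 ⟨w, a⟩) ((tensorStruct M).associator ⟨x, b⟩ ⟨y, c⟩ ⟨z, d⟩).hom =
      hom (𝟙 w ⊗ₘ (α_ x y z).hom) ((M.muMap (𝟙 w) (α_ x y z).hom a _).hom ≫
      (M.mu w _).map ((pushId M.toPs (𝟙 w) rfl a).hom ×ₘ (M.omega b c d).hom)) :=
    congrArg (fun t => tensorHom M t ((tensorStruct M).associator ⟨x, b⟩ ⟨y, c⟩ ⟨z, d⟩).hom)
      (id_eq_hom w a _ rfl)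
  rw [e₁, e₂]
  refine (_ ≫= hom_comp_hom _ _ _ _ _ rfl).trans ?_
  refine (hom_comp_hom _ _ _ _ ((α_ (w ⊗ x) y z).hom ≫ (α_ w x (y ⊗ z)).hom)
    (show ((α_ w x y).hom ⊗ₘ 𝟙 z) ≫ (α_ w (x ⊗ y) z).hom ≫ (𝟙 w ⊗ₘ (α_ x y z).hom) = _ by simp)).trans ?_
  refine Eq.trans ?_ (hom_comp_hom _ _ _ _ _ rfl).symm
  exact congrArg (hom _) (M.pentagon a b c d)

theorem triangle (A B : ∫ M.toPs) :
    ((tensorStruct M).associator A (tensorUnit M) B).hom ≫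
        tensorHom M (𝟙 A) ((tensorStruct M).leftUnitor B).hom =
      tensorHom M ((tensorStruct M).rightUnitor A).hom (𝟙 B) := by
  obtain ⟨x, a⟩ := A
  obtain ⟨y, b⟩ := B
  have e₁ : tensorHom M (𝟙 ⟨x, a⟩) ((tensorStruct M).leftUnitor ⟨y, b⟩).hom =
      hom (𝟙 x ⊗ₘ (λ_ y).hom) ((M.muMap (𝟙 x) (λ_ y).hom a _).hom ≫
      (M.mu x y).map ((pushId M.toPs (𝟙 x) rfl a).hom ×ₘ (M.xi b).hom)) :=
    congrArg (fun t => tensorHom M t ((tensorStruct M).leftUnitor ⟨y, b⟩).hom)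
      (id_eq_hom x a _ rfl)
  have e₂ : tensorHom M ((tensorStruct M).rightUnitor ⟨x, a⟩).hom (𝟙 ⟨y, b⟩) =
      hom ((ρ_ x).hom ⊗ₘ 𝟙 y) ((M.muMap (ρ_ x).hom (𝟙 y) _ b).hom ≫
      (M.mu x y).map ((M.zeta a).hom ×ₘ (pushId M.toPs (𝟙 y) rfl b).hom)) :=
    congrArg (fun t => tensorHom M ((tensorStruct M).rightUnitor ⟨x, a⟩).hom t)
      (id_eq_hom y b _ rfl)
  rw [e₁, e₂]
  refine (hom_comp_hom _ _ _ _ ((ρ_ x).hom ⊗ₘ 𝟙 y)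
    (show (α_ x (𝟙_ X) y).hom ≫ (𝟙 x ⊗ₘ (λ_ y).hom) = _ by simp)).trans ?_
  exact congrArg (hom _) (M.triangle a b)

theorem isMonoidalStruct : IsMonoidalStruct (tensorStruct M) :=
  ⟨{ toMonoidalCategoryStruct := tensorStruct M
     tensorHom_def := fun f g => by
       refine Eq.trans ?_ (tensorHom_comp M _ _ _ _).symm
       rw [Category.comp_id, Category.id_comp]
       rfl
     id_tensorHom_id := tensorHom_id M
     tensorHom_comp_tensorHom := fun f g f' g' => tensorHom_comp M f f' g g'
     whiskerLeft_id := tensorHom_id M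
     id_whiskerRight := tensorHom_id M
     associator_naturality := associator_naturality M
     leftUnitor_naturality := leftUnitor_naturality M
     rightUnitor_naturality := rightUnitor_naturality M
     pentagon := pentagon M
     triangle := triangle M }, rfl⟩

/-- The base components of all structure maps are those of `X` by definition, so the required
transports are identities. -/
theorem isStrictMonoidal : @IsStrictMonoidal _ _ (monoidalOfStruct _ (isMonoidalStruct M)) X _ _
    (Pseudofunctor.Grothendieck.forget M.toPs) :=
  letI := monoidalOfStruct _ (isMonoidalStruct M)
  { obj_unit := rfl
    obj_tensor := fun _ _ => rfl
    map_tensor := fun _ _ => ((Category.id_comp _).trans (Category.comp_id _)).symm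
    map_associator := fun _ _ _ => ((Category.id_comp _).trans (Category.comp_id _)).symm
    map_leftUnitor := fun _ => (Category.id_comp _).symm
    map_rightUnitor := fun _ => (Category.id_comp _).symm }

end Tensor

end Co

end MonGroth

/-! ### Cocartesian morphisms and induced strong monoidal functors, covariant case -/

namespace MonGroth

open scoped Pseudofunctor.CoGrothendieck Pseudofunctor.Grothendieck

namespace Co

section Cocartesian

variable {X : Type u₁} [Category.{v₁} X] {F G : LocallyDiscrete X ⥤ᵖ Cat.{v₂, u₂}}

theorem base_eq_of_isHomLift {A B : ∫ F} {f : A.base ⟶ B.base} (φ : A ⟶ B)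
    (h : (Pseudofunctor.Grothendieck.forget F).IsHomLift f φ) : φ.base = f :=
  (@IsHomLift.eq_of_isHomLift _ _ _ _ (Pseudofunctor.Grothendieck.forget F) A B f φ h).symm

theorem exists_hom_of_isHomLift {x y : X} {a : F.obj ⟨x⟩} {b : F.obj ⟨y⟩} {f : x ⟶ y}
    (φ : (⟨x, a⟩ : ∫ F) ⟶ ⟨y, b⟩) (h : (Pseudofunctor.Grothendieck.forget F).IsHomLift f φ) :
    ∃ k, φ = hom f k := by
  obtain ⟨g, k⟩ := φ
  obtain rfl := base_eq_of_isHomLift _ h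
  exact ⟨k, rfl⟩

theorem exists_vert_of_isHomLift {x : X} {a b : F.obj ⟨x⟩}
    (φ : (⟨x, a⟩ : ∫ F) ⟶ ⟨x, b⟩) (h : (Pseudofunctor.Grothendieck.forget F).IsHomLift (𝟙 x) φ) :
    ∃ k : a ⟶ b, φ = vert k := by
  obtain ⟨k, rfl⟩ := exists_hom_of_isHomLift φ h
  -- The fibre component starts at `(F 𝟙) a` rather than at `a`; the unit constraint of `F` corrects
  -- the source.
  refine ⟨(pushId F (𝟙 x) rfl a).inv ≫ k, ?_⟩
  rw [vert_eq_hom _ _ rfl, Iso.hom_inv_id_assoc]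

theorem vert_isHomLift {x : X} {a b : F.obj ⟨x⟩} (k : a ⟶ b) :
    (Pseudofunctor.Grothendieck.forget F).IsHomLift (𝟙 x) (vert k) :=
  IsHomLift.map (Pseudofunctor.Grothendieck.forget F) (vert k)

/-- The isomorphism of `∫ F` given by an isomorphism of the fibre. -/
def vertIso {x : X} {a b : F.obj ⟨x⟩} (k : a ≅ b) : (⟨x, a⟩ : ∫ F) ≅ ⟨x, b⟩ where
  hom := vert k.hom
  inv := vert k.inv
  hom_inv_id := by rw [vert_vert, k.hom_inv_id, vert_id]
  inv_hom_id := by rw [vert_vert, k.inv_hom_id, vert_id]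

/-- The inverse of an isomorphism over an identity again lies over that identity, so it is vertical
and supplies the inverse in the fibre. -/
theorem isIso_of_isIso_vert {x : X} {a b : F.obj ⟨x⟩} (k : a ⟶ b)
    (h : IsIso (vert k : (⟨x, a⟩ : ∫ F) ⟶ ⟨x, b⟩)) : IsIso k := by
  have : (Pseudofunctor.Grothendieck.forget F).IsHomLift (𝟙 x) (asIso (vert k)).hom :=
    vert_isHomLift k
  have e : (Pseudofunctor.Grothendieck.forget F).IsHomLift (𝟙 x) (asIso (vert k)).inv :=
    IsHomLift.lift_id_inv (Pseudofunctor.Grothendieck.forget F) x (asIso (vert k))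
  obtain ⟨l, hl⟩ := exists_vert_of_isHomLift _ e
  refine ⟨l, vert_injective ?_, vert_injective ?_⟩
  · rw [← vert_vert, ← hl, vert_id]
    exact (asIso (vert k)).hom_inv_id
  · rw [← vert_vert, ← hl, vert_id]
    exact (asIso (vert k)).inv_hom_id

/-- An arrow over `f ≫ g` has a fibre component out of `(F (f ≫ g)) a`. The composition constraint
of `F` identifies this object with `(F g) ((F f) a)`, which produces the unique factorization. -/
theorem lift_isStronglyCocartesian {x y : X} (f : x ⟶ y) (a : F.obj ⟨x⟩) :
    (Pseudofunctor.Grothendieck.forget F).IsStronglyCocartesian f (lift F f a) where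
  toIsHomLift := IsHomLift.map (Pseudofunctor.Grothendieck.forget F) (lift F f a)
  universal_property' {b'} g φ hφ := by
    obtain ⟨z, c⟩ := b'
    change y ⟶ z at g
    obtain ⟨k, rfl⟩ := exists_hom_of_isHomLift φ hφ
    refine ⟨hom g ((pushComp F f g _ rfl a).inv ≫ k), ⟨IsHomLift.map
      (Pseudofunctor.Grothendieck.forget F) (hom g ((pushComp F f g _ rfl a).inv ≫ k)), ?_⟩, ?_⟩
    · refine (hom_comp_hom _ _ _ _ _ rfl).trans (congrArg (hom _) ?_)
      refine (_ ≫= ((CategoryTheory.Functor.map_id _ _ =≫ _).trans (Category.id_comp _))).trans ?_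
      exact Iso.hom_inv_id_assoc (pushComp F f g _ rfl a) _
    · rintro χ ⟨hχ, h⟩
      obtain ⟨l, rfl⟩ := exists_hom_of_isHomLift χ hχ
      rw [hom_comp_hom _ _ _ _ _ rfl, CategoryTheory.Functor.map_id, Category.id_comp] at h
      rw [← hom_injective h, Iso.inv_hom_id_assoc]

theorem isOpfibration_forget : IsOpfibration (Pseudofunctor.Grothendieck.forget F) :=
  fun A y f => ⟨⟨y, (push F f).obj A.fiber⟩, lift F f A.fiber, lift_isStronglyCocartesian f A.fiber⟩

/-- `hom f k` is the cocartesian `lift` followed by `vert k`. By composition and cancellation it is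
cocartesian exactly when `vert k` is, and a cocartesian arrow over an identity is an isomorphism. -/
theorem isCocart_hom_iff {x y : X} {a : F.obj ⟨x⟩} {b : F.obj ⟨y⟩} (f : x ⟶ y)
    (k : (push F f).obj a ⟶ b) :
    IsCocart (Pseudofunctor.Grothendieck.forget F) (hom f k) ↔ IsIso k := by
  have h₁ := lift_isStronglyCocartesian f a
  have h₂ := vert_isHomLift k
  have h₃ := lift_comp_vert f a k
  change (Pseudofunctor.Grothendieck.forget F).IsStronglyCocartesian f _ ↔ _
  constructor
  · intro h
    rw [← h₃] at h
    have h' : (Pseudofunctor.Grothendieck.forget F).IsStronglyCocartesian (f ≫ 𝟙 y)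
        (lift F f a ≫ vert k) := by rwa [Category.comp_id]
    have := Functor.IsStronglyCocartesian.of_comp
      (p := Pseudofunctor.Grothendieck.forget F) (f := f) (g := 𝟙 y) (φ := lift F f a) (ψ := vert k)
    exact isIso_of_isIso_vert k (Functor.IsStronglyCocartesian.isIso_of_base_isIso
      (Pseudofunctor.Grothendieck.forget F) (𝟙 y) (vert k))
  · intro h
    have : IsIso (vert k) := (vertIso (asIso k)).isIso_hom
    have := Functor.IsStronglyCocartesian.comp
      (p := Pseudofunctor.Grothendieck.forget F) (f := f) (g := 𝟙 y) (φ := lift F f a) (ψ := vert k)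
    rwa [Category.comp_id, h₃] at this

theorem map_hom (τ : F ⟶ G) {x y : X} {a : F.obj ⟨x⟩} {b : F.obj ⟨y⟩} (f : x ⟶ y)
    (k : (push F f).obj a ⟶ b) :
    (Pseudofunctor.Grothendieck.map τ).map (hom f k) =
      hom f ((natIso τ f a).inv ≫ (comp₁ τ y).map k) := rfl

/-- The fibre component of the image is a pseudonaturality isomorphism followed by the image of the
old component, so invertibility is preserved. -/
theorem isCocart_map (τ : F ⟶ G) {A B : ∫ F} (φ : A ⟶ B)
    (h : IsCocart (Pseudofunctor.Grothendieck.forget F) φ) :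
    IsCocart (Pseudofunctor.Grothendieck.forget G) ((Pseudofunctor.Grothendieck.map τ).map φ) := by
  have := (isCocart_hom_iff _ _).1 h
  exact (isCocart_hom_iff (F := G) (a := (comp₁ τ A.base).obj A.fiber)
    (b := (comp₁ τ B.base).obj B.fiber) φ.base
    ((natIso τ φ.base A.fiber).inv ≫ (comp₁ τ B.base).map φ.fiber)).2 inferInstance

theorem comp_vert_comp_vert {x y : X} {a : F.obj ⟨x⟩}
    {b c d : F.obj ⟨y⟩} (f : x ⟶ y) (k : (push F f).obj a ⟶ b) (l : b ⟶ c) (m : c ⟶ d) :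
    hom f k ≫ vert l ≫ vert m = hom f (k ≫ l ≫ m) := by
  rw [vert_vert, hom_comp_vert]

end Cocartesian

section MonoidalFunctor

variable {X : Type u₁} [Category.{v₁} X] [MonoidalCategory X]

theorem isCocart_tensorHom (M : LaxMonoidalPseudofunctor.{v₁, u₁, v₂, u₂} X)
    {A A' B B' : ∫ M.toPs} (φ : A ⟶ A') (ψ : B ⟶ B')
    (h : IsCocart (Pseudofunctor.Grothendieck.forget M.toPs) φ)
    (h' : IsCocart (Pseudofunctor.Grothendieck.forget M.toPs) ψ) :
    IsCocart (Pseudofunctor.Grothendieck.forget M.toPs) (tensorHom M φ ψ) := by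
  have := (isCocart_hom_iff _ _).1 h
  have := (isCocart_hom_iff _ _).1 h'
  refine (isCocart_hom_iff (F := M.toPs) (φ.base ⊗ₘ ψ.base)
    ((M.muMap φ.base ψ.base A.fiber B.fiber).hom ≫
      (M.mu A'.base B'.base).map (φ.fiber ×ₘ ψ.fiber))).2 ?_
  have : IsIso (φ.fiber ×ₘ ψ.fiber) := (Iso.prod (asIso φ.fiber) (asIso ψ.fiber)).isIso_hom
  infer_instance

/-- The tensor of two vertical arrows is a priori over `𝟙 x ⊗ₘ 𝟙 y`, not over `𝟙 (x ⊗ y)`. Unit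
constraints are allowed for any arrow equal to an identity, so `muMap_id` applies directly. -/
theorem tensorHom_vert (M : LaxMonoidalPseudofunctor.{v₁, u₁, v₂, u₂} X) {x y : X}
    {a a' : M.toPs.obj ⟨x⟩} {b b' : M.toPs.obj ⟨y⟩} (k : a ⟶ a') (l : b ⟶ b') :
    tensorHom M (vert k) (vert l) = vert ((M.mu x y).map (k ×ₘ l)) := by
  rw [vert_eq_hom k _ rfl, vert_eq_hom l _ rfl, tensorHom_hom,
    vert_eq_hom _ (𝟙 x ⊗ₘ 𝟙 y) (by simp), ← M.muMap_id, Category.assoc, ← Functor.map_comp]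
  rfl

theorem tensorHom_vert_id (M : LaxMonoidalPseudofunctor.{v₁, u₁, v₂, u₂} X) {x y : X}
    {a a' : M.toPs.obj ⟨x⟩} (k : a ⟶ a') (b : M.toPs.obj ⟨y⟩) :
    tensorHom M (vert k) (𝟙 ⟨y, b⟩) = vert ((M.mu x y).map (k ×ₘ 𝟙 b)) := by
  rw [← tensorHom_vert, vert_id]

theorem tensorHom_id_vert (M : LaxMonoidalPseudofunctor.{v₁, u₁, v₂, u₂} X) {x y : X}
    (a : M.toPs.obj ⟨x⟩) {b b' : M.toPs.obj ⟨y⟩} (l : b ⟶ b') :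
    tensorHom M (𝟙 ⟨x, a⟩) (vert l) = vert ((M.mu x y).map (𝟙 a ×ₘ l)) := by
  rw [← tensorHom_vert, vert_id]

variable {M N : LaxMonoidalPseudofunctor.{v₁, u₁, v₂, u₂} X} (τ : M.toPs ⟶ N.toPs)
  (u : ∀ {x y : X} (a : M.toPs.obj ⟨x⟩) (b : M.toPs.obj ⟨y⟩),
    (N.mu x y).obj ((comp₁ τ x).obj a, (comp₁ τ y).obj b) ⟶
      (comp₁ τ (x ⊗ y)).obj ((M.mu x y).obj (a, b)))
  (u0 : N.mu0 ⟶ (comp₁ τ (𝟙_ X)).obj M.mu0)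

/-- This and the next lemmas compute both sides of each monoidal functor axiom for an arbitrary
family `u`, no axiom being assumed. They can thus be read in both directions: to build a monoidal
functor from a transformation, and to extract the transformation from a monoidal functor. -/
theorem map_tensorHom_comp_vert {x x' y y' : X} {a : M.toPs.obj ⟨x⟩} {a' : M.toPs.obj ⟨x'⟩}
    {b : M.toPs.obj ⟨y⟩} {b' : M.toPs.obj ⟨y'⟩} (f : x ⟶ x') (k : (push M.toPs f).obj a ⟶ a')
    (g : y ⟶ y') (l : (push M.toPs g).obj b ⟶ b') :
    tensorHom N ((Pseudofunctor.Grothendieck.map τ).map (hom f k))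
        ((Pseudofunctor.Grothendieck.map τ).map (hom g l)) ≫ vert (u a' b') =
      hom (f ⊗ₘ g) ((N.muMap f g _ _).hom ≫
        (N.mu x' y').map ((natIso τ f a).inv ×ₘ (natIso τ g b).inv) ≫
          (N.mu x' y').map ((comp₁ τ x').map k ×ₘ (comp₁ τ y').map l) ≫ u a' b') := by
  refine (hom_comp_vert _ _ _).trans (congrArg (hom _) ?_)
  refine (Category.assoc _ _ _).trans (_ ≫= ?_)
  rw [← Functor.map_comp_assoc]
  rfl

theorem vert_comp_map_tensorHom {x x' y y' : X} {a : M.toPs.obj ⟨x⟩} {a' : M.toPs.obj ⟨x'⟩}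
    {b : M.toPs.obj ⟨y⟩} {b' : M.toPs.obj ⟨y'⟩} (f : x ⟶ x') (k : (push M.toPs f).obj a ⟶ a')
    (g : y ⟶ y') (l : (push M.toPs g).obj b ⟶ b') :
    vert (u a b) ≫ (Pseudofunctor.Grothendieck.map τ).map (tensorHom M (hom f k) (hom g l)) =
      hom (f ⊗ₘ g) ((push N.toPs (f ⊗ₘ g)).map (u a b) ≫ (natIso τ (f ⊗ₘ g) _).inv ≫
        (comp₁ τ (x' ⊗ y')).map (M.muMap f g a b).hom ≫
          (comp₁ τ (x' ⊗ y')).map ((M.mu x' y').map (k ×ₘ l))) := by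
  refine (vert_comp_hom _ _ _).trans (congrArg (hom _) ?_)
  refine _ ≫= (_ ≫= ?_)
  exact Functor.map_comp _ _ _

theorem vert_comp_vert_comp_map_associator {x y z : X} (a : M.toPs.obj ⟨x⟩) (b : M.toPs.obj ⟨y⟩)
    (c : M.toPs.obj ⟨z⟩) :
    tensorHom N (vert (u a b)) (𝟙 ⟨z, (comp₁ τ z).obj c⟩) ≫ vert (u ((M.mu x y).obj (a, b)) c) ≫
        (Pseudofunctor.Grothendieck.map τ).map
          ((tensorStruct M).associator ⟨x, a⟩ ⟨y, b⟩ ⟨z, c⟩).hom =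
      hom (α_ x y z).hom ((push N.toPs (α_ x y z).hom).map
          ((N.mu (x ⊗ y) z).map (u a b ×ₘ 𝟙 _) ≫ u ((M.mu x y).obj (a, b)) c) ≫
        (natIso τ (α_ x y z).hom _).inv ≫
          (comp₁ τ (x ⊗ (y ⊗ z))).map (M.omega a b c).hom) := by
  rw [tensorHom_vert_id]
  exact (Category.assoc _ _ _).symm.trans ((vert_vert _ _ =≫ _).trans (vert_comp_hom _ _ _))

theorem associator_comp_vert_comp_vert {x y z : X} (a : M.toPs.obj ⟨x⟩) (b : M.toPs.obj ⟨y⟩)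
    (c : M.toPs.obj ⟨z⟩) :
    ((tensorStruct N).associator ⟨x, (comp₁ τ x).obj a⟩ ⟨y, (comp₁ τ y).obj b⟩
          ⟨z, (comp₁ τ z).obj c⟩).hom ≫
        tensorHom N (𝟙 (⟨x, (comp₁ τ x).obj a⟩ : ∫ N.toPs)) (vert (u b c)) ≫
          vert (F := N.toPs) (x := x ⊗ (y ⊗ z)) (u a ((M.mu y z).obj (b, c))) =
      hom (α_ x y z).hom
        ((N.omega ((comp₁ τ x).obj a) ((comp₁ τ y).obj b) ((comp₁ τ z).obj c)).hom ≫
        (N.mu x (y ⊗ z)).map (𝟙 _ ×ₘ u b c) ≫ u a ((M.mu y z).obj (b, c))) := by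
  exact (_ ≫= (tensorHom_id_vert N _ (u b c) =≫ _)).trans (comp_vert_comp_vert _ _ _ _)

theorem vert_comp_vert_comp_map_rightUnitor {x : X} (a : M.toPs.obj ⟨x⟩) :
    tensorHom N (𝟙 ⟨x, (comp₁ τ x).obj a⟩) (vert u0) ≫ vert (u a M.mu0) ≫
        (Pseudofunctor.Grothendieck.map τ).map ((tensorStruct M).rightUnitor ⟨x, a⟩).hom =
      hom (ρ_ x).hom ((push N.toPs (ρ_ x).hom).map
          ((N.mu x (𝟙_ X)).map (𝟙 _ ×ₘ u0) ≫ u a M.mu0) ≫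
        (natIso τ (ρ_ x).hom _).inv ≫ (comp₁ τ x).map (M.zeta a).hom) := by
  rw [tensorHom_id_vert]
  exact (Category.assoc _ _ _).symm.trans ((vert_vert _ _ =≫ _).trans (vert_comp_hom _ _ _))

theorem vert_comp_vert_comp_map_leftUnitor {x : X} (a : M.toPs.obj ⟨x⟩) :
    tensorHom N (vert u0) (𝟙 ⟨x, (comp₁ τ x).obj a⟩) ≫ vert (u M.mu0 a) ≫
        (Pseudofunctor.Grothendieck.map τ).map ((tensorStruct M).leftUnitor ⟨x, a⟩).hom =
      hom (λ_ x).hom ((push N.toPs (λ_ x).hom).map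
          ((N.mu (𝟙_ X) x).map (u0 ×ₘ 𝟙 _) ≫ u M.mu0 a) ≫
        (natIso τ (λ_ x).hom _).inv ≫ (comp₁ τ x).map (M.xi a).hom) := by
  rw [tensorHom_vert_id]
  exact (Category.assoc _ _ _).symm.trans ((vert_vert _ _ =≫ _).trans (vert_comp_hom _ _ _))

end MonoidalFunctor

section TwoFunctor

variable {X : Type u} [Category.{v} X] [MonoidalCategory X]

/-- The monoidal category `∫ M` over `X`. -/
noncomputable def total (M : LaxMonoidalPseudofunctor.{v, u, v, u} X) : MonoidalOver.{v, u} X :=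
  grObj M (isMonoidalStruct M) (isStrictMonoidal M)

variable {M N P : LaxMonoidalPseudofunctor.{v, u, v, u} X}

/-- Naturality of the tensor constraint in arbitrary arrows is `u_natural` for the fibre components
together with `u_modification` for the base arrows. -/
theorem map_tensorHom_comp_u (τ : MonoidalTrans M N) {A A' B B' : ∫ M.toPs} (f : A ⟶ A')
    (g : B ⟶ B') :
    tensorHom N ((Pseudofunctor.Grothendieck.map τ.toTrans).map f)
        ((Pseudofunctor.Grothendieck.map τ.toTrans).map g) ≫
          vert (τ.u A'.fiber B'.fiber).hom =
      vert (τ.u A.fiber B.fiber).hom ≫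
        (Pseudofunctor.Grothendieck.map τ.toTrans).map (tensorHom M f g) := by
  refine (map_tensorHom_comp_vert τ.toTrans (fun a b => (τ.u a b).hom) _ _ _ _).trans
    (Eq.trans (congrArg (hom _) ?_)
      (vert_comp_map_tensorHom τ.toTrans (fun a b => (τ.u a b).hom) _ _ _ _).symm)
  rw [τ.u_natural, reassoc_of% τ.u_modification]

/-- The functor `∫ τ` over `X`. -/
noncomputable def totalBased (τ : M.toPs ⟶ N.toPs) : (total M).based ⟶ (total N).based :=
  (gr X).map τ

/-- The functor `∫ τ` over `X` with the monoidal structure given by `u` and `u₀`. -/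
noncomputable def mapCore (τ : MonoidalTrans M N) :
    Functor.CoreMonoidal (totalBased τ.toTrans).toFunctor where
  εIso := vertIso τ.u0
  μIso A B := vertIso (τ.u A.fiber B.fiber)
  μIso_hom_natural_left {A B} f D := by
    exact (congrArg (fun t => tensorHom N _ t ≫ _)
      ((Pseudofunctor.Grothendieck.map τ.toTrans).map_id D).symm).trans
        (map_tensorHom_comp_u τ f (𝟙 D))
  μIso_hom_natural_right {A B} D f := by
    exact (congrArg (fun t => tensorHom N t _ ≫ _)
      ((Pseudofunctor.Grothendieck.map τ.toTrans).map_id D).symm).trans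
        (map_tensorHom_comp_u τ (𝟙 D) f)
  -- Both composites lie over the associator of `X`, and their fibre components are the two sides of
  -- `u_assoc`. The unit laws reduce to `u_left` and `u_right` in the same way.
  associativity A B D := by
    refine (vert_comp_vert_comp_map_associator τ.toTrans (fun a b => (τ.u a b).hom)
      A.fiber B.fiber D.fiber).trans (Eq.trans ?_ (associator_comp_vert_comp_vert τ.toTrans
        (fun a b => (τ.u a b).hom) A.fiber B.fiber D.fiber).symm)
    exact congrArg (hom _) (τ.u_assoc _ _ _).symm
  left_unitality A := (congrArg (hom _) (τ.u_left A.fiber)).trans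
    (vert_comp_vert_comp_map_leftUnitor τ.toTrans (fun a b => (τ.u a b).hom) τ.u0.hom A.fiber).symm
  right_unitality A := (congrArg (hom _) (τ.u_right A.fiber)).trans
    (vert_comp_vert_comp_map_rightUnitor τ.toTrans (fun a b => (τ.u a b).hom) τ.u0.hom A.fiber).symm

/-- The strong monoidal functor `∫ τ` over `X`. -/
noncomputable def totalMap (τ : MonoidalTrans M N) : MonoidalOverHom (total M) (total N) where
  based := totalBased τ.toTrans
  monoidal := (mapCore τ).toMonoidal
  lift_ε := vert_isHomLift τ.u0.hom
  lift_μ A B := vert_isHomLift (τ.u A.fiber B.fiber).hom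

/-- The monoidal natural transformation over `X` given by a monoidal modification. -/
noncomputable def totalMap₂ {τ σ : MonoidalTrans M N} (m : τ ⟶ σ) : totalMap τ ⟶ totalMap σ where
  based := (gr X).map₂ m.toModification
  monoidal :=
    { unit := (vert_vert _ _).trans (congrArg vert m.unit)
      tensor := fun A B => (vert_vert _ _).trans ((congrArg vert (m.tensor A.fiber B.fiber)).trans
        ((vert_vert _ _).symm.trans (congrArg (· ≫ _) (tensorHom_vert N _ _).symm))) }

theorem totalMap_id : totalMap (MonoidalTrans.id M) = MonoidalOver.idHom (total M) := by
  refine MonoidalOver.hom_ext ((gr X).map_id M.toPs) (heq_of_eq ?_) (fun A B => heq_of_eq ?_)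
  · exact vert_id _
  · exact vert_id _

/-- The constraints of the composite transformation are composites in a fibre. They match those of
the composite functor because `∫ σ` sends vertical arrows to vertical arrows. -/
theorem totalMap_comp (τ : MonoidalTrans M N) (σ : MonoidalTrans N P) :
    totalMap (τ.comp σ) = MonoidalOver.compHom (totalMap τ) (totalMap σ) := by
  refine MonoidalOver.hom_ext ((gr X).map_comp τ.toTrans σ.toTrans) (heq_of_eq ?_)
    (fun A B => heq_of_eq ?_)
  · exact (vert_vert _ _).symm.trans (congrArg (_ ≫ ·) (map_vert σ.toTrans _).symm)
  · exact (vert_vert _ _).symm.trans (congrArg (_ ≫ ·) (map_vert σ.toTrans _).symm)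

/-- The monoidal opfibration `∫ M`. -/
noncomputable def totalObj (M : LaxMonoidalPseudofunctor.{v, u, v, u} X) : MonOpFib.{v, u} X :=
  ⟨total M, isOpfibration_forget, isCocart_tensorHom M⟩

end TwoFunctor

end Co

end MonGroth

/-! ### The Grothendieck construction as a 2-functor, covariant case -/

namespace MonGroth

open scoped Pseudofunctor.CoGrothendieck Pseudofunctor.Grothendieck

/-- Two strict pseudofunctors with the same underlying prelax functor are equal. -/
theorem strictPseudofunctor_ext {B C : Type*} [Bicategory B] [Bicategory C]
    {F G : StrictPseudofunctor B C} (h : F.toPrelaxFunctor = G.toPrelaxFunctor) : F = G := by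
  obtain ⟨⟨⟨P, mapId, mapComp, _, _, _, _, _⟩, _, hId⟩, _, hComp⟩ := F
  obtain ⟨⟨⟨P', mapId', mapComp', _, _, _, _, _⟩, _, hId'⟩, _, hComp'⟩ := G
  obtain rfl : P = P' := h
  -- In a strict pseudofunctor the unit and composition isomorphisms are `eqToIso`s, so they carry
  -- no information beyond the prelax functor.
  obtain rfl : mapId = mapId' := funext fun a => (hId a).trans (hId' a).symm
  obtain rfl : @mapComp = @mapComp' := by
    funext a b c f g
    exact (hComp f g).trans (hComp' f g).symm
  rfl

/-- Lying over `X` and being monoidal are properties, so a 2-cell is determined by its components.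
The heterogeneous form is needed for the whiskering laws, where the boundary 1-cells agree only
through functoriality. -/
theorem monoidalOver_hom₂_heq {X : Type u} [Category.{v} X] [MonoidalCategory X]
    {S : SubTwoCategory (MonoidalOver.{v, u} X)} {A B : S.Obj} {H H' K K' : A ⟶ B} (h : H = H')
    (h' : K = K') {α : H ⟶ K} {β : H' ⟶ K'}
    (e : ∀ a : A.obj.based.obj, (MonoidalOverHom₂.based α).toNatTrans.app a ≍
      (MonoidalOverHom₂.based β).toNatTrans.app a) : α ≍ β := by
  subst h h'
  exact heq_of_eq (MonoidalOverHom₂.ext (BasedNatTrans.ext _ _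
    (NatTrans.ext (funext fun a => eq_of_heq (e a)))))

namespace Co

section

variable {X : Type u} [Category.{v} X] [MonoidalCategory X]
  {M N P : LaxMonoidalPseudofunctor.{v, u, v, u} X}

/-- The morphism of monoidal opfibrations `∫ τ`. -/
noncomputable def totalHom (τ : M ⟶ N) : totalObj M ⟶ totalObj N :=
  SubTwoCategory.Hom.mk (S := monOpFib X) (a := totalObj M) (b := totalObj N) (totalMap τ)
    (isCocart_map (MonoidalTrans.toTrans τ))

/-- The 2-cell of monoidal opfibrations given by a monoidal modification. -/
noncomputable def totalHom₂ {τ σ : M ⟶ N} (m : τ ⟶ σ) : totalHom τ ⟶ totalHom σ :=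
  totalMap₂ m

theorem totalHom_id (M : LaxMonoidalPseudofunctor.{v, u, v, u} X) :
    totalHom (𝟙 M) = 𝟙 (totalObj M) :=
  SubTwoCategory.Hom.ext (totalMap_id (M := M))

theorem totalHom_comp (τ : M ⟶ N) (σ : N ⟶ P) :
    totalHom (τ ≫ σ) = totalHom τ ≫ totalHom σ :=
  SubTwoCategory.Hom.ext (totalMap_comp τ σ)

end

/-- The Grothendieck construction as a 2-functor from lax monoidal pseudofunctors to monoidal
opfibrations. -/
noncomputable def twoFunctor (X : Type u) [Category.{v} X] [MonoidalCategory X] :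
    StrictPseudofunctor (LaxMonoidalPseudofunctor.{v, u, v, u} X) (MonOpFib.{v, u} X) :=
  StrictPseudofunctor.mk''
    { obj := totalObj
      map := totalHom
      map₂ := totalHom₂
      map_id := totalHom_id
      map_comp := totalHom_comp
      map₂_id := fun τ => MonoidalOverHom₂.ext ((gr X).map₂_id (MonoidalTrans.toTrans τ))
      map₂_comp := fun m n => MonoidalOverHom₂.ext ((gr X).map₂_comp
        (MonoidalModification.toModification m) (MonoidalModification.toModification n))
      map₂_whisker_left := fun {M N P} τ {σ ρ} m => by
        rw [conj_eqToHom_iff_heq']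
        exact monoidalOver_hom₂_heq (totalHom_comp τ σ) (totalHom_comp τ ρ) (fun a => HEq.rfl)
      map₂_whisker_right := fun {M N P} {τ σ} m ρ => by
        rw [conj_eqToHom_iff_heq']
        exact monoidalOver_hom₂_heq (totalHom_comp τ ρ) (totalHom_comp σ ρ)
          (fun a => heq_of_eq (map_vert (MonoidalTrans.toTrans ρ) _).symm) }

theorem restricts_twoFunctor (X : Type u) [Category.{v} X] [MonoidalCategory X] :
    Restricts (twoFunctor.{v, u} X) where
  comp_forget := strictPseudofunctor_ext rfl
  obj_eq M := ⟨isMonoidalStruct M, isStrictMonoidal M, rfl⟩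
  map_eq {M N} τ := ⟨isMonoidalStruct M, isStrictMonoidal M, isMonoidalStruct N,
    isStrictMonoidal N, totalMap τ, HEq.rfl, rfl, HEq.rfl, fun _ _ => HEq.rfl⟩

end Co

end MonGroth

/-! ### Pseudonatural transformations and modifications from their components -/

namespace MonGroth

section PseudofunctorConstructors

variable {C : Type u₁} [Category.{v₁} C] {F G : LocallyDiscrete C ⥤ᵖ Cat.{v₂, u₂}}

theorem pushComp_hom (F : LocallyDiscrete C ⥤ᵖ Cat.{v₂, u₂}) {x y z : C} (f : x ⟶ y) (g : y ⟶ z)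
    (a : F.obj ⟨x⟩) : (pushComp F f g _ rfl a).hom =
      (F.mapComp f.toLoc g.toLoc).hom.toNatTrans.app a :=
  congr(($((F.mapComp'_eq_mapComp f.toLoc g.toLoc))).hom.toNatTrans.app a)

/-- A pseudonatural transformation given by its components. -/
def mkTrans (obj : ∀ x : C, F.obj ⟨x⟩ ⥤ G.obj ⟨x⟩)
    (iso : ∀ {x y : C} (f : x ⟶ y) (a : F.obj ⟨x⟩),
      (obj y).obj ((push F f).obj a) ≅ (push G f).obj ((obj x).obj a))
    (natural : ∀ {x y : C} (f : x ⟶ y) {a b : F.obj ⟨x⟩} (k : a ⟶ b),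
      (obj y).map ((push F f).map k) ≫ (iso f b).hom =
        (iso f a).hom ≫ (push G f).map ((obj x).map k))
    (id : ∀ {x : C} (a : F.obj ⟨x⟩), (iso (𝟙 x) a).hom ≫ (pushId G (𝟙 x) rfl _).hom =
      (obj x).map (pushId F (𝟙 x) rfl a).hom)
    (comp : ∀ {x y z : C} (f : x ⟶ y) (g : y ⟶ z) (a : F.obj ⟨x⟩),
      (iso (f ≫ g) a).hom ≫ (pushComp G f g _ rfl _).hom =
        (obj z).map (pushComp F f g _ rfl a).hom ≫ (iso g _).hom ≫
          (push G g).map (iso f a).hom) : F ⟶ G where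
  app x := (obj x.as).toCatHom
  naturality {x y} f := Cat.Hom.isoMk (NatIso.ofComponents (F := push F f.as ⋙ obj y.as)
    (G := obj x.as ⋙ push G f.as) (iso f.as) (natural f.as))
  naturality_naturality {x y f g} η := by
    obtain rfl : f = g := LocallyDiscrete.eq_of_hom η
    obtain rfl : η = 𝟙 f := Subsingleton.elim _ _
    rw [PrelaxFunctor.map₂_id, PrelaxFunctor.map₂_id]
    exact ((Bicategory.id_whiskerRight _ _ =≫ _).trans (Category.id_comp _)).trans
      ((_ ≫= Bicategory.whiskerLeft_id _ _).trans (Category.comp_id _)).symm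
  naturality_id x := by
    apply Cat.Hom₂.ext
    ext a
    refine Eq.trans ?_ ((id a).trans ?_)
    · exact _ ≫= (Co.pushId_hom G _ _).symm
    · refine (congrArg _ (Co.pushId_hom F _ a)).trans ?_
      exact (Category.comp_id _).symm.trans (_ ≫= (Category.comp_id _).symm)
  naturality_comp {x y z} f g := by
    apply Cat.Hom₂.ext
    ext a
    refine Eq.trans ?_ ((comp f.as g.as a).trans ?_)
    · exact _ ≫= (pushComp_hom G f.as g.as _).symm
    · refine (congrArg (fun t => (obj z.as).map t ≫ _) (pushComp_hom F f.as g.as a)).trans ?_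
      refine _ ≫= ?_
      -- The identities inserted here and in the following lines are components of the associators
      -- of `Cat`.
      refine Eq.trans ?_ (Category.id_comp _).symm
      refine _ ≫= ?_
      refine Eq.trans ?_ (Category.id_comp _).symm
      exact (Category.comp_id _).symm

/-- A modification given by its components. -/
def mkModification {τ σ : F ⟶ G} (app : ∀ {x : C} (a : F.obj ⟨x⟩),
      (comp₁ τ x).obj a ⟶ (comp₁ σ x).obj a)
    (natural : ∀ {x : C} {a b : F.obj ⟨x⟩} (k : a ⟶ b),
      (comp₁ τ x).map k ≫ app b = app a ≫ (comp₁ σ x).map k)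
    (mod : ∀ {x y : C} (f : x ⟶ y) (a : F.obj ⟨x⟩),
      app ((push F f).obj a) ≫ (natIso σ f a).hom = (natIso τ f a).hom ≫ (push G f).map (app a)) :
    τ ⟶ σ where
  as :=
    { app := fun x => NatTrans.toCatHom₂ { app := fun a => app a, naturality := fun _ _ k => natural k }
      naturality := fun {x y} f => by
        apply Cat.Hom₂.ext
        ext a
        exact mod f.as a }

theorem modification_ext {τ σ : F ⟶ G} {m n : τ ⟶ σ}
    (h : ∀ {x : C} (a : F.obj ⟨x⟩), comp₂ m a = comp₂ n a) : m = n := by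
  obtain ⟨m⟩ := m
  obtain ⟨n⟩ := n
  congr 1
  ext x a
  exact h a

end PseudofunctorConstructors

end MonGroth

/-! ### Full faithfulness of the Grothendieck construction over the base, covariant case -/

namespace MonGroth

open scoped Pseudofunctor.CoGrothendieck Pseudofunctor.Grothendieck

namespace Co

section FullyFaithful

variable {X : Type u₁} [Category.{v₁} X] {F G : LocallyDiscrete X ⥤ᵖ Cat.{v₂, u₂}}

theorem map_lift (τ : F ⟶ G) {x y : X} (f : x ⟶ y) (a : F.obj ⟨x⟩) :
    (Pseudofunctor.Grothendieck.map τ).map (lift F f a) = hom f (natIso τ f a).inv := by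
  refine (map_hom τ f _).trans (congrArg (hom f) ?_)
  exact (_ ≫= CategoryTheory.Functor.map_id _ _).trans (Category.comp_id _)

theorem gr₂_injective {τ σ : F ⟶ G} {m n : τ ⟶ σ} (h : gr₂ m = gr₂ n) : m = n :=
  modification_ext fun {x} a => vert_injective (congr(($h).app ⟨x, a⟩))

/-- A transformation over the base has vertical components, that is, arrows of fibres. Its
naturality at vertical arrows makes these natural in each fibre; its naturality at lifts is the
modification axiom. -/
theorem exists_gr₂_eq {τ σ : F ⟶ G}
    (β : Pseudofunctor.Grothendieck.map τ ⟶ Pseudofunctor.Grothendieck.map σ)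
    (h : ∀ {x : X} (a : F.obj ⟨x⟩),
      (Pseudofunctor.Grothendieck.forget G).IsHomLift (𝟙 x) (β.app ⟨x, a⟩)) :
    ∃ m : τ ⟶ σ, gr₂ m = β := by
  choose k hk using fun {x : X} (a : F.obj ⟨x⟩) =>
    exists_vert_of_isHomLift (x := x) (a := (comp₁ τ x).obj a) (b := (comp₁ σ x).obj a) _ (h a)
  refine ⟨mkModification k ?_ ?_, ?_⟩
  · intro x a b l
    apply vert_injective
    rw [← vert_vert, ← vert_vert, ← map_vert, ← map_vert, ← hk, ← hk]
    exact β.naturality (vert l)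
  · intro x y f a
    have e := β.naturality (lift F f a)
    have e' : hom f (natIso τ f a).inv ≫ vert (k ((push F f).obj a)) =
        (vert (k a) : (⟨x, _⟩ : ∫ G) ⟶ _) ≫ hom f (natIso σ f a).inv := by
      rw [← map_lift, ← map_lift, ← hk, ← hk]
      exact e
    rw [hom_comp_vert, vert_comp_hom] at e'
    rw [← Iso.inv_comp_eq, ← Category.assoc, hom_injective e', Category.assoc, Iso.inv_hom_id,
      Category.comp_id]
  · exact NatTrans.ext (funext fun ⟨x, a⟩ => (hk a).symm)

/-- Heterogeneous equality is needed when two functors are compared before their actions on fibre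
objects have been identified. -/
theorem hom_heq_injective {x y : X} {a a' : F.obj ⟨x⟩} {b b' : F.obj ⟨y⟩} {f : x ⟶ y}
    (ha : a = a') (hb : b = b') {k : (push F f).obj a ⟶ b} {l : (push F f).obj a' ⟶ b'}
    (h : hom f k ≍ hom f l) : k ≍ l := by
  subst ha hb
  exact heq_of_eq (hom_injective (eq_of_heq h))

theorem vert_heq_injective {x : X} {a a' b b' : F.obj ⟨x⟩}
    (ha : a = a') (hb : b = b') {k : a ⟶ b} {l : a' ⟶ b'}
    (h : vert k ≍ vert l) : k ≍ l := by
  subst ha hb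
  exact heq_of_eq (vert_injective (eq_of_heq h))

/-- The total functor remembers everything: its values on objects and on vertical arrows are the
component functors, and its values on lifts are the inverses of the pseudonaturality constraints. -/
theorem map_injective {τ σ : F ⟶ G}
    (h : Pseudofunctor.Grothendieck.map τ = Pseudofunctor.Grothendieck.map σ) : τ = σ := by
  have h₀ : ∀ {x : X} (a : F.obj ⟨x⟩), (comp₁ τ x).obj a = (comp₁ σ x).obj a := fun {x} a => by
    have e := congrArg (fun H => H.obj (⟨x, a⟩ : ∫ F)) h
    injection e
  have h₁ : ∀ {A B : ∫ F} (φ : A ⟶ B), (Pseudofunctor.Grothendieck.map τ).map φ ≍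
      (Pseudofunctor.Grothendieck.map σ).map φ := fun φ => by rw [h]
  refine toTrans_ext' (funext fun ⟨x⟩ => ?_) (fun {x y} f a => ?_)
  · refine Cat.Hom.ext (Functor.hext (fun a => h₀ a) (fun a b k => ?_))
    have e := h₁ (vert k)
    rw [map_vert, map_vert] at e
    exact vert_heq_injective (h₀ a) (h₀ b) e
  · have e := h₁ (lift F f a)
    rw [map_lift, map_lift] at e
    exact hom_heq_injective (h₀ _) (h₀ _) e

/-- A functor over the base sends `(x, a)` to some `(x, t x a)`. On vertical arrows it gives
functors `t x` between fibres; on lifts it gives arrows `n f a` from `(G f) (t x a)` to `t y ((F f)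
a)`, whose inverses are the pseudonaturality constraints. Since every arrow is a lift followed by a
vertical arrow, `K` is recovered from these data. -/
theorem exists_map_eq (K : (∫ F) ⥤ (∫ G))
    (w : K ⋙ Pseudofunctor.Grothendieck.forget G = Pseudofunctor.Grothendieck.forget F)
    (h : ∀ {A B : ∫ F} (φ : A ⟶ B), IsCocart (Pseudofunctor.Grothendieck.forget F) φ →
      IsCocart (Pseudofunctor.Grothendieck.forget G) (K.map φ)) :
    ∃ τ : F ⟶ G, Pseudofunctor.Grothendieck.map τ = K := by
  obtain ⟨obj, map, map_id, map_comp⟩ := K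
  have h₀ : ∀ (x : X) (a : F.obj ⟨x⟩), ∃ b : G.obj ⟨x⟩, obj ⟨x, a⟩ = ⟨x, b⟩ := fun x a => by
    have e : (obj ⟨x, a⟩).base = x := Functor.congr_obj w ⟨x, a⟩
    generalize obj ⟨x, a⟩ = A at e
    obtain ⟨y, b⟩ := A
    obtain rfl : y = x := e
    exact ⟨b, rfl⟩
  choose t ht using h₀
  -- Replacing the object map by its explicit form makes the bases of images definitionally correct,
  -- so the rest of the argument needs no transport along object equalities.
  obtain rfl : obj = fun A => ⟨A.base, t A.base A.fiber⟩ := funext fun ⟨x, a⟩ => ht x a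
  have hb : ∀ {A B : ∫ F} (φ : A ⟶ B), (map φ).base = φ.base := fun {A B} φ => by
    have e := Functor.congr_hom w φ
    exact e.trans ((Category.id_comp _).trans (Category.comp_id _))
  have h_hom : ∀ {x y : X} {a : F.obj ⟨x⟩} {b : F.obj ⟨y⟩} (f : x ⟶ y)
      (k : (push F f).obj a ⟶ b), ∃ l : (push G f).obj (t x a) ⟶ t y b, map (hom f k) = hom f l := by
    intro x y a b f k
    rcases hm : map (hom f k) with ⟨g, l⟩
    obtain rfl : g = f := (congrArg Pseudofunctor.Grothendieck.Hom.base hm).symm.trans (hb _)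
    exact ⟨l, rfl⟩
  have h_vert : ∀ {x : X} {a b : F.obj ⟨x⟩} (k : a ⟶ b), ∃ l : t x a ⟶ t x b,
      map (vert k) = vert l := by
    intro x a b k
    obtain ⟨l, hl⟩ := h_hom (𝟙 x) ((pushId F (𝟙 x) rfl a).hom ≫ k)
    refine ⟨(pushId G (𝟙 x) rfl _).inv ≫ l, ?_⟩
    rw [vert_eq_hom k _ rfl, vert_eq_hom _ _ rfl, Iso.hom_inv_id_assoc]
    exact hl
  choose l hl using @h_vert
  choose n hn using fun {x y : X} (f : x ⟶ y) (a : F.obj ⟨x⟩) => h_hom f (𝟙 ((push F f).obj a))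
  -- The only place where preservation of cocartesian arrows is used.
  have n_iso : ∀ {x y : X} (f : x ⟶ y) (a : F.obj ⟨x⟩), IsIso (n f a) := fun f a => by
    have e := h (lift F f a) (lift_isStronglyCocartesian f a)
    exact (isCocart_hom_iff f (n f a)).1 ((hn f a) ▸ e)
  have l_id : ∀ {x : X} (a : F.obj ⟨x⟩), l (𝟙 a) = 𝟙 _ := fun {x} a => by
    apply vert_injective
    rw [← hl, vert_id, vert_id]
    exact map_id _
  have l_comp : ∀ {x : X} {a b c : F.obj ⟨x⟩} (k : a ⟶ b) (k' : b ⟶ c),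
      l (k ≫ k') = l k ≫ l k' := fun k k' => by
    apply vert_injective
    rw [← hl, ← vert_vert, ← vert_vert, ← hl, ← hl]
    exact map_comp _ _
  have map_eq : ∀ {x y : X} {a : F.obj ⟨x⟩} {b : F.obj ⟨y⟩} (f : x ⟶ y)
      (k : (push F f).obj a ⟶ b), map (hom f k) = hom f (n f a ≫ l k) := fun f k => by
    rw [← lift_comp_vert, ← hom_comp_vert, ← hl, ← hn]
    exact map_comp _ _
  have n_natural : ∀ {x y : X} (f : x ⟶ y) {a b : F.obj ⟨x⟩} (k : a ⟶ b),
      (push G f).map (l k) ≫ n f b = n f a ≫ l ((push F f).map k) := by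
    intro x y f a b k
    apply hom_injective
    rw [← vert_comp_hom, ← map_eq, ← hl, ← hn]
    refine (map_comp _ _).symm.trans (congrArg map ((vert_comp_hom _ _ _).trans ?_))
    rw [Category.comp_id]
  have n_id : ∀ {x : X} (a : F.obj ⟨x⟩), n (𝟙 x) a ≫ l (pushId F (𝟙 x) rfl a).hom =
      (pushId G (𝟙 x) rfl (t x a)).hom := fun {x} a => by
    apply hom_injective
    rw [← map_eq, ← id_eq_hom, ← id_eq_hom]
    exact map_id _
  -- Functoriality of `K` at a composite of two lifts; such a composite is the lift of the composite
  -- up to the composition constraint of `F`.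
  have n_comp : ∀ {x y z : X} (f : x ⟶ y) (g : y ⟶ z) (a : F.obj ⟨x⟩),
      n (f ≫ g) a ≫ l (pushComp F f g _ rfl a).hom =
        (pushComp G f g _ rfl (t x a)).hom ≫ (push G g).map (n f a) ≫ n g _ := fun f g a => by
    apply hom_injective
    rw [← map_eq, ← hom_comp_hom, ← hn, ← hn]
    refine Eq.trans ?_ (map_comp (lift F f a) (lift F g _))
    refine congrArg map (Eq.trans ?_ (hom_comp_hom _ _ _ _ _ rfl).symm)
    rw [CategoryTheory.Functor.map_id, Category.comp_id, Category.comp_id]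
  refine ⟨mkTrans (fun x => { obj := t x, map := l, map_id := l_id, map_comp := l_comp })
    (fun f a => (asIso (n f a)).symm) ?_ ?_ ?_, ?_⟩
  · intro x y f a b k
    have := n_iso f a
    have := n_iso f b
    refine (IsIso.comp_inv_eq (n f b)).2 ?_
    refine Eq.trans ?_ (Category.assoc _ _ _).symm
    refine Eq.trans ?_ (_ ≫= (n_natural f k).symm)
    exact (IsIso.inv_hom_id_assoc (n f a) _).symm
  · intro x a
    have := n_iso (𝟙 x) a
    exact (IsIso.inv_comp_eq (n (𝟙 x) a)).2 (n_id a).symm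
  · intro x y z f g a
    have := n_iso (f ≫ g) a
    have := n_iso f a
    have := n_iso g ((push F f).obj a)
    refine (IsIso.inv_comp_eq (n (f ≫ g) a)).2 ?_
    refine Eq.trans ?_ (Category.assoc _ _ _)
    refine Eq.trans ?_ ((n_comp f g a).symm =≫ _)
    change _ = ((pushComp G f g _ rfl (t x a)).hom ≫ (push G g).map (n f a) ≫ n g _) ≫
      inv (n g _) ≫ (push G g).map (inv (n f a))
    simp only [Category.assoc, IsIso.hom_inv_id_assoc]
    rw [← Functor.map_comp, IsIso.hom_inv_id, CategoryTheory.Functor.map_id, Category.comp_id]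
  · refine CategoryTheory.Functor.ext (fun _ => rfl) ?_
    rintro ⟨x, a⟩ ⟨y, b⟩ ⟨f, k⟩
    refine Eq.trans ?_ ((Category.id_comp _).trans (Category.comp_id _)).symm
    exact (map_eq f k).symm

end FullyFaithful

end Co

end MonGroth

/-! ### Bijectivity on 1-cells and on 2-cells, covariant case -/

namespace MonGroth

open scoped Pseudofunctor.CoGrothendieck Pseudofunctor.Grothendieck

namespace Co

section FullyFaithful

variable {X : Type u} [Category.{v} X] [MonoidalCategory X]
  {M N : LaxMonoidalPseudofunctor.{v, u, v, u} X}

/-- The monoidality conditions on a transformation over the base are equations between vertical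
arrows, so they are equivalent to the tensor and unit conditions on the modification. -/
theorem totalHom₂_bijective (τ σ : M ⟶ N) :
    Function.Bijective (totalHom₂ : (τ ⟶ σ) → (totalHom τ ⟶ totalHom σ)) := by
  constructor
  · intro m n h
    refine MonoidalModification.ext (gr₂_injective ?_)
    exact congrArg (fun β : MonoidalOverHom₂ (totalMap τ) (totalMap σ) => β.based.toNatTrans) h
  · intro β
    obtain ⟨⟨β, hβ⟩, mon⟩ := (β : MonoidalOverHom₂ (totalMap τ) (totalMap σ))
    obtain ⟨m, rfl⟩ := exists_gr₂_eq β (fun {x} a => hβ ⟨x, a⟩)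
    refine ⟨⟨m, fun {x y} a b => ?_, ?_⟩, rfl⟩
    · apply vert_injective
      rw [← vert_vert, ← vert_vert, ← tensorHom_vert]
      exact mon.tensor ⟨x, a⟩ ⟨y, b⟩
    · apply vert_injective
      rw [← vert_vert]
      exact mon.unit

theorem totalHom_injective : Function.Injective (totalHom : (M ⟶ N) → _) := by
  intro τ σ h
  replace h : totalMap τ = totalMap σ := congrArg SubTwoCategory.Hom.hom h
  have h₀ : MonoidalTrans.toTrans τ = MonoidalTrans.toTrans σ :=
    map_injective (congrArg (fun H => H.based.toFunctor) h)
  have h₁ : ∀ {x : X} (a : M.toPs.obj ⟨x⟩),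
      (comp₁ (MonoidalTrans.toTrans τ) x).obj a = (comp₁ (MonoidalTrans.toTrans σ) x).obj a :=
    fun a => by rw [h₀]
  refine LaxMonoidalPseudofunctor.trans_ext h₀ (fun {x y} a b => ?_) ?_
  · refine vert_heq_injective (by rw [h₁, h₁]) (h₁ _) ?_
    have e : (totalMap τ).tensorMap ⟨x, a⟩ ⟨y, b⟩ ≍ (totalMap σ).tensorMap ⟨x, a⟩ ⟨y, b⟩ := by
      rw [h]
    exact e
  · refine vert_heq_injective rfl (h₁ _) ?_
    have e : (totalMap τ).unitMap ≍ (totalMap σ).unitMap := by rw [h]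
    exact e

theorem exists_vertIso_of_isHomLift {x : X} {a b : M.toPs.obj ⟨x⟩}
    (φ : (⟨x, a⟩ : ∫ M.toPs) ⟶ ⟨x, b⟩)
    (h : (Pseudofunctor.Grothendieck.forget M.toPs).IsHomLift (𝟙 x) φ) (h' : IsIso φ) :
    ∃ k : a ≅ b, φ = vert k.hom := by
  obtain ⟨k, rfl⟩ := exists_vert_of_isHomLift φ h
  have := isIso_of_isIso_vert k h'
  exact ⟨asIso k, rfl⟩

/-- Since the structure isomorphisms of the functor lie over identities, they are vertical and
define `u` and `u0`. Naturality at vertical arrows gives `u_natural`, naturality at lifts gives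
`u_modification`, and the associativity and unit laws give the remaining axioms. -/
theorem exists_monoidalTrans (τ : M.toPs ⟶ N.toPs)
    (m : (totalBased τ : (total M).based ⟶ (total N).based).toFunctor.Monoidal)
    (h₀ : (total N).based.p.IsHomLift (𝟙 (𝟙_ X))
      (Functor.LaxMonoidal.ε (totalBased τ : (total M).based ⟶ (total N).based).toFunctor))
    (h₁ : ∀ a b : (total M).based.obj, (total N).based.p.IsHomLift
      (𝟙 ((total M).based.p.obj a ⊗ (total M).based.p.obj b))
      (Functor.LaxMonoidal.μ (totalBased τ : (total M).based ⟶ (total N).based).toFunctor a b)) :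
    ∃ σ : MonoidalTrans M N, totalMap σ = ⟨totalBased τ, m, h₀, h₁⟩ := by
  let K := (totalBased τ : (total M).based ⟶ (total N).based).toFunctor
  obtain ⟨u0, hu0⟩ : ∃ k : N.mu0 ≅ (comp₁ τ (𝟙_ X)).obj M.mu0,
      Functor.LaxMonoidal.ε K = vert k.hom :=
    exists_vertIso_of_isHomLift _ h₀ (Functor.Monoidal.εIso K).isIso_hom
  choose u hu using fun {x y : X} (a : M.toPs.obj ⟨x⟩) (b : M.toPs.obj ⟨y⟩) =>
    exists_vertIso_of_isHomLift (M := N) (x := x ⊗ y)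
      (a := (N.mu x y).obj ((comp₁ τ x).obj a, (comp₁ τ y).obj b))
      (b := (comp₁ τ (x ⊗ y)).obj ((M.mu x y).obj (a, b))) _ (h₁ ⟨x, a⟩ ⟨y, b⟩)
        (Functor.Monoidal.μIso K ⟨x, a⟩ ⟨y, b⟩).isIso_hom
  have h_natural : ∀ {x x' y y' : X} {a : M.toPs.obj ⟨x⟩} {a' : M.toPs.obj ⟨x'⟩}
      {b : M.toPs.obj ⟨y⟩} {b' : M.toPs.obj ⟨y'⟩} (φ : (⟨x, a⟩ : ∫ M.toPs) ⟶ ⟨x', a'⟩)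
      (ψ : (⟨y, b⟩ : ∫ M.toPs) ⟶ ⟨y', b'⟩),
      tensorHom N ((Pseudofunctor.Grothendieck.map τ).map φ)
          ((Pseudofunctor.Grothendieck.map τ).map ψ) ≫ vert (u a' b').hom =
        vert (u a b).hom ≫ (Pseudofunctor.Grothendieck.map τ).map (tensorHom M φ ψ) := by
    intro x x' y y' a a' b b' φ ψ
    exact (_ ≫= (hu a' b').symm).trans ((Functor.LaxMonoidal.μ_natural K φ ψ).trans (hu a b =≫ _))
  refine ⟨{ toTrans := τ
            u := u
            u_natural := ?_
            u_modification := ?_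
            u0 := u0
            u_assoc := ?_
            u_right := ?_
            u_left := ?_ }, ?_⟩
  · intro x y a a' b b' k l
    apply vert_injective
    refine (vert_vert _ _).symm.trans (Eq.trans ?_ (vert_vert _ _))
    refine ((((congrArg₂ (tensorHom N) (map_vert τ k) (map_vert τ l)).trans
      (tensorHom_vert N _ _)).symm =≫ _).trans (h_natural (vert k) (vert l))).trans (_ ≫= ?_)
    exact (congrArg _ (tensorHom_vert M k l)).trans (map_vert τ _)
  · intro x x' y y' f g a b
    -- Naturality is evaluated at two lifts, whose fibre components are identities. Removing the
    -- images of these identities leaves the modification axiom.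
    have e := (map_tensorHom_comp_vert τ (fun a b => (u a b).hom) f (𝟙 _) g (𝟙 _)).symm.trans
      ((h_natural (lift M.toPs f a) (lift M.toPs g b)).trans
        (vert_comp_map_tensorHom τ (fun a b => (u a b).hom) f (𝟙 _) g (𝟙 _)))
    refine Eq.trans ?_ ((hom_injective e).symm.trans ?_)
    · refine _ ≫= (_ ≫= ((Category.comp_id _).symm.trans (_ ≫= ?_)))
      exact ((congrArg _ ((M.mu x' y').map_id _)).trans (CategoryTheory.Functor.map_id _ _)).symm
    · refine _ ≫= (_ ≫= (((?_ : _ = 𝟙 _) =≫ _).trans (Category.id_comp _)))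
      rw [CategoryTheory.Functor.map_id, CategoryTheory.Functor.map_id]
      exact (N.mu x' y').map_id _
  · intro x y z a b c
    apply hom_injective (f := (α_ x y z).hom)
    refine (associator_comp_vert_comp_vert τ (fun a b => (u a b).hom) a b c).symm.trans
      (Eq.trans ?_ (vert_comp_vert_comp_map_associator τ (fun a b => (u a b).hom) a b c))
    refine Eq.trans ?_ ((Functor.LaxMonoidal.associativity K (⟨x, a⟩ : ∫ M.toPs)
      (⟨y, b⟩ : ∫ M.toPs) (⟨z, c⟩ : ∫ M.toPs)).symm.trans ?_)
    · exact (_ ≫= congrArg₂ (· ≫ ·) (congrArg (tensorHom N (𝟙 _)) (hu b c)) (hu a _)).symm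
    · exact congrArg₂ (· ≫ ·) (congrArg (fun t => tensorHom N t (𝟙 _)) (hu a b)) ((hu _ c) =≫ _)
  · intro x a
    apply hom_injective (f := (ρ_ x).hom)
    refine Eq.trans ?_ (vert_comp_vert_comp_map_rightUnitor τ (fun a b => (u a b).hom) u0.hom a)
    refine (Functor.LaxMonoidal.right_unitality K (⟨x, a⟩ : ∫ M.toPs)).trans ?_
    exact congrArg₂ (· ≫ ·) (congrArg (tensorHom N (𝟙 _)) hu0) ((hu _ _) =≫ _)
  · intro x a
    apply hom_injective (f := (λ_ x).hom)
    refine Eq.trans ?_ (vert_comp_vert_comp_map_leftUnitor τ (fun a b => (u a b).hom) u0.hom a)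
    refine (Functor.LaxMonoidal.left_unitality K (⟨x, a⟩ : ∫ M.toPs)).trans ?_
    exact congrArg₂ (· ≫ ·) (congrArg (fun t => tensorHom N t (𝟙 _)) hu0) ((hu _ _) =≫ _)
  · exact MonoidalOver.hom_ext rfl (heq_of_eq hu0.symm)
      (fun ⟨x, a⟩ ⟨y, b⟩ => heq_of_eq (hu a b).symm)

theorem totalHom_surjective : Function.Surjective (totalHom : (M ⟶ N) → _) := by
  intro K
  obtain ⟨⟨⟨K, w⟩, m, h₀, h₁⟩, hc⟩ :=
    (K : SubTwoCategory.Hom (S := monOpFib X) (totalObj M) (totalObj N))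
  obtain ⟨τ, rfl⟩ := exists_map_eq K w hc
  obtain ⟨σ, hσ⟩ := exists_monoidalTrans τ m h₀ h₁
  exact ⟨σ, SubTwoCategory.Hom.ext hσ⟩

end FullyFaithful

end Co

end MonGroth

/-! ### Strict inverses of strong monoidal functors over the base -/

namespace MonGroth

section StrictInverse

/-- Bijectivity on objects, as opposed to essential surjectivity, is what makes both composites
equal to identity functors. Arrows are conjugated by the resulting object equalities before taking
preimages. -/
theorem exists_strict_inverse {A : Type u₁} [Category.{v₁} A] {B : Type u₂} [Category.{v₂} B]
    (K : A ⥤ B) (h₁ : Function.Bijective K.obj)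
    (h₂ : ∀ a b : A, Function.Bijective (K.map : (a ⟶ b) → (K.obj a ⟶ K.obj b))) :
    ∃ J : B ⥤ A, K ⋙ J = 𝟭 A ∧ J ⋙ K = 𝟭 B := by
  choose o ho using h₁.2
  choose m hm using fun {a b : A} => (h₂ a b).2
  have m_eq : ∀ {a b : A} (f : a ⟶ b), m (K.map f) = f := fun f => (h₂ _ _).1 (hm _)
  let J : B ⥤ A :=
    { obj := o
      map := fun {a b} f => m (eqToHom (ho a) ≫ f ≫ eqToHom (ho b).symm)
      map_id := fun a => (h₂ _ _).1 (by rw [hm, K.map_id]; simp)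
      map_comp := fun f g => (h₂ _ _).1 (by rw [hm, K.map_comp, hm, hm]; simp) }
  refine ⟨J, CategoryTheory.Functor.ext (fun a => h₁.1 (ho _)) (fun a b f => (h₂ _ _).1 ?_),
    CategoryTheory.Functor.ext ho (fun a b f => hm _)⟩
  refine (hm _).trans ?_
  simp [eqToHom_map]

section Monoidal

variable {A : Type u₁} [Category.{v₁} A] {B : Type u₂} [Category.{v₂} B]

/-- An equivalence of categories given by a strictly invertible functor. -/
def equivalenceOfStrict (K : A ⥤ B) (J : B ⥤ A) (h : K ⋙ J = 𝟭 A) (h' : J ⋙ K = 𝟭 B) : A ≌ B where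
  functor := K
  inverse := J
  unitIso := eqToIso h.symm
  counitIso := eqToIso h'
  functor_unitIso_comp a := by simp [eqToHom_map]

theorem eq_eqToHom_of_eqToHom_comp_eq {a b c : A} {p : a ⟶ b} {f : b ⟶ c} {q : a ⟶ c}
    {h : a = b} {h' : a = c} (hp : p = eqToHom h) (hq : q = eqToHom h') (w : p ≫ f = q) :
    f = eqToHom (h.symm.trans h') := by
  subst h h' hp hq
  simpa using w

theorem eq_eqToHom_of_comp_eqToHom_eq {a b c : A} {f : a ⟶ b} {q : b ⟶ c} {p : a ⟶ c}
    {h : a = c} {h' : b = c} (hp : p = eqToHom h) (hq : q = eqToHom h') (w : f ≫ q = p) :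
    f = eqToHom (h.trans h'.symm) := by
  subst h h' hp hq
  simpa using w

theorem tensorHom_eq_eqToHom [MonoidalCategory A] {a b c d : A} {f : a ⟶ b} {g : c ⟶ d}
    {h : a = b} {h' : c = d} (hf : f = eqToHom h) (hg : g = eqToHom h') :
    f ⊗ₘ g = eqToHom (by rw [h, h']) := by
  subst h h' hf hg
  simp

variable [MonoidalCategory A] [MonoidalCategory B]

/-- `J` receives the monoidal structure for which the adjunction `K ⊣ J` is monoidal. As its unit
and counit are `eqToHom`s, so are the composite constraints. The four equations say that both
composites are identities as monoidal functors; the last two also show that the constraints of `J`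
lie over identities when those of `K` do. -/
theorem exists_monoidal_inverse (K : A ⥤ B) [K.Monoidal] (J : B ⥤ A) (h : K ⋙ J = 𝟭 A)
    (h' : J ⋙ K = 𝟭 B) : ∃ _ : J.Monoidal,
      Functor.LaxMonoidal.ε J ≫ J.map (Functor.LaxMonoidal.ε K) =
        eqToHom (congrArg (fun F => F.obj (𝟙_ A)) h.symm) ∧
      (∀ a b : A, Functor.LaxMonoidal.μ J (K.obj a) (K.obj b) ≫
          J.map (Functor.LaxMonoidal.μ K a b) =
        eqToHom (by change (K ⋙ J).obj a ⊗ (K ⋙ J).obj b = (K ⋙ J).obj (a ⊗ b); rw [h]; rfl)) ∧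
      Functor.LaxMonoidal.ε K ≫ K.map (Functor.LaxMonoidal.ε J) =
        eqToHom (congrArg (fun F => F.obj (𝟙_ B)) h'.symm) ∧
      (∀ a b : B, Functor.LaxMonoidal.μ K (J.obj a) (J.obj b) ≫
          K.map (Functor.LaxMonoidal.μ J a b) =
        eqToHom (by change (J ⋙ K).obj a ⊗ (J ⋙ K).obj b = (J ⋙ K).obj (a ⊗ b); rw [h']; rfl)) := by
  let e := equivalenceOfStrict K J h h'
  let : e.functor.Monoidal := (inferInstance : K.Monoidal)
  let m : e.inverse.Monoidal := e.inverseMonoidal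
  have hm : e.toAdjunction.IsMonoidal := ⟨rfl, fun _ _ => rfl⟩
  have unit_app : ∀ a, e.toAdjunction.unit.app a =
    eqToHom (congrArg (fun F => F.obj a) h.symm) := fun a => eqToHom_app h.symm a
  have counit_app : ∀ b, e.toAdjunction.counit.app b =
    eqToHom (congrArg (fun F => F.obj b) h') := fun a => eqToHom_app h' _
  refine ⟨m, ?_, fun a b => ?_, ?_, fun a b => ?_⟩
  · rw [← unit_app]
    exact e.toAdjunction.ε_comp_map_ε
  · refine eq_eqToHom_of_eqToHom_comp_eq
      (tensorHom_eq_eqToHom (unit_app a) (unit_app b)) (unit_app (a ⊗ b)) ?_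
    have e₁ := e.toAdjunction.unit_app_tensor_comp_map_δ a b
    -- The compatibility of the unit with tensor products is phrased with the inverse constraint
    -- `δ`; composing with the image of `μ` removes it.
    have e₂ : e.inverse.map (Functor.OplaxMonoidal.δ e.functor a b) ≫
        J.map (Functor.LaxMonoidal.μ K a b) = 𝟙 _ :=
      (e.inverse.map_comp _ _).symm.trans
        ((congrArg _ (Functor.Monoidal.δ_μ e.functor a b)).trans (e.inverse.map_id _))
    exact (Category.assoc _ _ _).symm.trans ((e₁.symm =≫ _).trans
      ((Category.assoc _ _ _).trans ((_ ≫= e₂).trans (Category.comp_id _))))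
  · refine eq_eqToHom_of_comp_eqToHom_eq (p := 𝟙 _) (eqToHom_refl _ rfl).symm (counit_app (𝟙_ B)) ?_
    exact (Category.assoc _ _ _).trans ((_ ≫= e.toAdjunction.map_ε_comp_counit_app_unit).trans
      (Functor.Monoidal.ε_η e.functor))
  · refine eq_eqToHom_of_comp_eqToHom_eq
      (tensorHom_eq_eqToHom (counit_app a) (counit_app b)) (counit_app (a ⊗ b)) ?_
    exact (Category.assoc _ _ _).trans
      ((_ ≫= e.toAdjunction.map_μ_comp_counit_app_tensor a b).trans
        (Functor.Monoidal.μ_δ_assoc K (J.obj a) (J.obj b) _))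

end Monoidal

variable {X : Type u} [Category.{v} X] [MonoidalCategory X] {A B : MonoidalOver.{v, u} X}

/-- Up to the object equality, `f` is the inverse of an isomorphism over an identity. -/
theorem isHomLift_of_comp_eq_eqToHom {A : Type u₁} [Category.{v₁} A] {Y : Type u₂}
    [Category.{v₂} Y] {P : A ⥤ Y} {a b c : A} {x : Y} (i : a ≅ b) (hi : P.IsHomLift (𝟙 x) i.hom)
    {f : b ⟶ c} {h : a = c} (w : i.hom ≫ f = eqToHom h) : P.IsHomLift (𝟙 x) f := by
  subst h
  rw [← Iso.eq_inv_comp] at w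
  subst w
  have := IsHomLift.lift_id_inv P x i
  simpa using this

theorem exists_inverse (K : MonoidalOverHom A B)
    (h₁ : Function.Bijective K.based.toFunctor.obj)
    (h₂ : ∀ a b, Function.Bijective (K.based.toFunctor.map : (a ⟶ b) → _)) :
    ∃ J : MonoidalOverHom B A, MonoidalOver.compHom K J = MonoidalOver.idHom A ∧
      MonoidalOver.compHom J K = MonoidalOver.idHom B := by
  obtain ⟨J, hJ, hJ'⟩ := exists_strict_inverse K.based.toFunctor h₁ h₂
  obtain ⟨m, e₁, e₂, e₃, e₄⟩ := exists_monoidal_inverse K.based.toFunctor J hJ hJ'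
  have w : J ⋙ A.based.p = B.based.p := by
    rw [← K.based.w, ← Functor.assoc, hJ', Functor.id_comp]
  have hε : A.based.p.IsHomLift (𝟙 (𝟙_ X)) (Functor.LaxMonoidal.ε J) := by
    -- Lying over an identity may be tested after applying `K`, where the constraint of `J` is
    -- inverse to that of `K` up to an `eqToHom`.
    rw [← BasedFunctor.isHomLift_iff K.based]
    exact isHomLift_of_comp_eq_eqToHom (Functor.Monoidal.εIso K.based.toFunctor) K.lift_ε e₃
  have hμ : ∀ a b, A.based.p.IsHomLift (𝟙 (B.based.p.obj a ⊗ B.based.p.obj b))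
      (Functor.LaxMonoidal.μ J a b) := by
    intro a b
    rw [← BasedFunctor.isHomLift_iff K.based]
    have e : ∀ a, A.based.p.obj (J.obj a) = B.based.p.obj a := fun a => congr(($w).obj a)
    have := K.lift_μ (J.obj a) (J.obj b)
    rw [e, e] at this
    exact isHomLift_of_comp_eq_eqToHom (Functor.Monoidal.μIso K.based.toFunctor (J.obj a) (J.obj b))
      this (e₄ a b)
  refine ⟨⟨⟨J, w⟩, m, hε, hμ⟩, ?_, ?_⟩
  · refine MonoidalOver.hom_ext (basedFunctor_ext hJ) ?_ (fun a b => ?_)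
    · exact (heq_of_eq e₁).trans (eqToHom_heq_id_dom _ _ _)
    · exact (heq_of_eq (e₂ a b)).trans
        ((eqToHom_heq_id_cod _ _ _).trans
          (congr_arg_heq (fun c => 𝟙 c) (congr(($hJ).obj (a ⊗ b)) :)))
  · refine MonoidalOver.hom_ext (basedFunctor_ext hJ') ?_ (fun a b => ?_)
    · exact (heq_of_eq e₃).trans (eqToHom_heq_id_dom _ _ _)
    · exact (heq_of_eq (e₄ a b)).trans
        ((eqToHom_heq_id_cod _ _ _).trans
          (congr_arg_heq (fun c => 𝟙 c) (congr(($hJ').obj (a ⊗ b)) :)))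

end StrictInverse

end MonGroth

/-! ### Cartesian and cocartesian morphisms under strict isomorphisms over the base -/

namespace MonGroth

section Reflect

variable {A : Type u₁} [Category.{v₁} A] {B : Type u₂} [Category.{v₂} B] {X : Type u}
  [Category.{v} X]

theorem isHomLift_comp_iff (K : A ⥤ B) (p : B ⥤ X) {a b : A} (f : p.obj (K.obj a) ⟶ p.obj (K.obj b))
    (φ : a ⟶ b) : (K ⋙ p).IsHomLift f φ ↔ p.IsHomLift f (K.map φ) := by
  constructor
  · intro h
    obtain rfl := @IsHomLift.eq_of_isHomLift _ _ _ _ (K ⋙ p) a b f φ h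
    exact IsHomLift.map p (K.map φ)
  · intro h
    obtain rfl := @IsHomLift.eq_of_isHomLift _ _ _ _ p (K.obj a) (K.obj b) f (K.map φ) h
    exact IsHomLift.map (K ⋙ p) φ

/-- Full faithfulness is enough to reflect the universal property, because the fillers between
images are exactly the images of fillers. -/
theorem isCocart_of_isCocart_map (K : A ⥤ B) (p : B ⥤ X)
    (hK : ∀ a b, Function.Bijective (K.map : (a ⟶ b) → _)) {a b : A} (φ : a ⟶ b)
    (h : IsCocart p (K.map φ)) : IsCocart (K ⋙ p) φ := by
  refine { toIsHomLift := IsHomLift.map (K ⋙ p) φ, universal_property' := fun {b'} g φ' h' => ?_ }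
  obtain ⟨χ, ⟨h₁, h₂⟩, h₃⟩ := @h.universal_property' (K.obj b') g (K.map φ')
    ((isHomLift_comp_iff K p (p.map (K.map φ) ≫ g) φ').1 h')
  obtain ⟨χ, rfl⟩ := (hK _ _).2 χ
  refine ⟨χ, ⟨(isHomLift_comp_iff K p g χ).2 h₁, (hK _ _).1 (by rw [K.map_comp, h₂])⟩,
    fun θ hθ => (hK _ _).1 (h₃ _ ⟨(isHomLift_comp_iff K p g θ).1 hθ.1, ?_⟩)⟩
  rw [← K.map_comp, hθ.2]

/-- To preserve the universal property `K` must in addition hit every object, since that property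
quantifies over all possible targets. -/
theorem isCocart_map_of_bijective (K : A ⥤ B) (p : B ⥤ X) (h₀ : Function.Surjective K.obj)
    (hK : ∀ a b, Function.Bijective (K.map : (a ⟶ b) → _)) {a b : A} (φ : a ⟶ b)
    (h : IsCocart (K ⋙ p) φ) : IsCocart p (K.map φ) := by
  refine { toIsHomLift := IsHomLift.map p (K.map φ), universal_property' := fun {b'} g φ' h' => ?_ }
  obtain ⟨b', rfl⟩ := h₀ b'
  obtain ⟨φ', rfl⟩ := (hK _ _).2 φ'
  obtain ⟨χ, ⟨h₁, h₂⟩, h₃⟩ := @h.universal_property' b' g φ'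
    ((isHomLift_comp_iff K p (p.map (K.map φ) ≫ g) φ').2 h')
  refine ⟨K.map χ, ⟨(isHomLift_comp_iff K p g χ).1 h₁, by rw [← K.map_comp, h₂]⟩, fun θ hθ => ?_⟩
  obtain ⟨θ, rfl⟩ := (hK _ _).2 θ
  rw [h₃ θ ⟨(isHomLift_comp_iff K p g θ).2 hθ.1, (hK _ _).1 (by rw [K.map_comp, hθ.2])⟩]

theorem isCart_map_of_bijective (K : A ⥤ B) (p : B ⥤ X) (h₀ : Function.Surjective K.obj)
    (hK : ∀ a b, Function.Bijective (K.map : (a ⟶ b) → _)) {a b : A} (φ : a ⟶ b)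
    (h : IsCart (K ⋙ p) φ) : IsCart p (K.map φ) := by
  refine { toIsHomLift := IsHomLift.map p (K.map φ), universal_property' := fun {b'} g φ' h' => ?_ }
  obtain ⟨b', rfl⟩ := h₀ b'
  obtain ⟨φ', rfl⟩ := (hK _ _).2 φ'
  obtain ⟨χ, ⟨h₁, h₂⟩, h₃⟩ := @h.universal_property' b' g φ'
    ((isHomLift_comp_iff K p (g ≫ p.map (K.map φ)) φ').2 h')
  refine ⟨K.map χ, ⟨(isHomLift_comp_iff K p g χ).1 h₁, by rw [← K.map_comp, h₂]⟩, fun θ hθ => ?_⟩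
  obtain ⟨θ, rfl⟩ := (hK _ _).2 θ
  rw [h₃ θ ⟨(isHomLift_comp_iff K p g θ).2 hθ.1, (hK _ _).1 (by rw [K.map_comp, hθ.2])⟩]

theorem isCart_of_isCart_map (K : A ⥤ B) (p : B ⥤ X)
    (hK : ∀ a b, Function.Bijective (K.map : (a ⟶ b) → _)) {a b : A} (φ : a ⟶ b)
    (h : IsCart p (K.map φ)) : IsCart (K ⋙ p) φ := by
  refine { toIsHomLift := IsHomLift.map (K ⋙ p) φ, universal_property' := fun {b'} g φ' h' => ?_ }
  obtain ⟨χ, ⟨h₁, h₂⟩, h₃⟩ := @h.universal_property' (K.obj b') g (K.map φ')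
    ((isHomLift_comp_iff K p (g ≫ p.map (K.map φ)) φ').1 h')
  obtain ⟨χ, rfl⟩ := (hK _ _).2 χ
  refine ⟨χ, ⟨(isHomLift_comp_iff K p g χ).2 h₁, (hK _ _).1 (by rw [K.map_comp, h₂])⟩,
    fun θ hθ => (hK _ _).1 (h₃ _ ⟨(isHomLift_comp_iff K p g θ).1 hθ.1, ?_⟩)⟩
  rw [← K.map_comp, hθ.2]

/-- Stated for an endofunctor equal to the identity because the round trip through a strict inverse
is an identity only propositionally. -/
theorem isCocart_map_of_eq_id (p : B ⥤ X) (K : B ⥤ B) (h : K = 𝟭 B) {a b : B} (φ : a ⟶ b)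
    (hφ : IsCocart p φ) : IsCocart p (K.map φ) := by
  subst h
  exact hφ

theorem isCart_map_of_eq_id (p : B ⥤ X) (K : B ⥤ B) (h : K = 𝟭 B) {a b : B} (φ : a ⟶ b)
    (hφ : IsCart p φ) : IsCart p (K.map φ) := by
  subst h
  exact hφ

end Reflect

section Invert

variable {X : Type u} [Category.{v} X] [MonoidalCategory X]

theorem exists_inverse_monOpFib {A B : MonOpFib.{v, u} X} (K : SubTwoCategory.Hom A B)
    (h₁ : Function.Bijective K.hom.based.toFunctor.obj)
    (h₂ : ∀ a b, Function.Bijective (K.hom.based.toFunctor.map : (a ⟶ b) → _)) :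
    ∃ (i : A ⟶ B) (j : B ⟶ A), i ≫ j = 𝟙 A ∧ j ≫ i = 𝟙 B := by
  obtain ⟨J, e₁, e₂⟩ := exists_inverse K.hom h₁ h₂
  refine ⟨K, ⟨J, fun φ hφ => ?_⟩, SubTwoCategory.Hom.ext e₁, SubTwoCategory.Hom.ext e₂⟩
  -- The inverse `J` preserves cocartesian arrows because `K` reflects them and `J ⋙ K` is the
  -- identity.
  have h := isCocart_of_isCocart_map K.hom.based.toFunctor B.obj.based.p h₂
    (J.based.toFunctor.map φ) (isCocart_map_of_eq_id B.obj.based.p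
      (J.based.toFunctor ⋙ K.hom.based.toFunctor) (congrArg (fun H => H.based.toFunctor) e₂) φ hφ)
  rwa [K.hom.based.w] at h

theorem exists_inverse_monFib {A B : MonFib.{v, u} X} (K : SubTwoCategory.Hom A B)
    (h₁ : Function.Bijective K.hom.based.toFunctor.obj)
    (h₂ : ∀ a b, Function.Bijective (K.hom.based.toFunctor.map : (a ⟶ b) → _)) :
    ∃ (i : A ⟶ B) (j : B ⟶ A), i ≫ j = 𝟙 A ∧ j ≫ i = 𝟙 B := by
  obtain ⟨J, e₁, e₂⟩ := exists_inverse K.hom h₁ h₂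
  refine ⟨K, ⟨J, fun φ hφ => ?_⟩, SubTwoCategory.Hom.ext e₁, SubTwoCategory.Hom.ext e₂⟩
  have h := isCart_of_isCart_map K.hom.based.toFunctor B.obj.based.p h₂
    (J.based.toFunctor.map φ) (isCart_map_of_eq_id B.obj.based.p
      (J.based.toFunctor ⋙ K.hom.based.toFunctor) (congrArg (fun H => H.based.toFunctor) e₂) φ hφ)
  rwa [K.hom.based.w] at h

end Invert

end MonGroth

/-! ### The pseudofunctor of an opfibration with chosen lifts -/

namespace MonGroth

section PseudofunctorOfComponents

variable {C : Type u₁} [Category.{v₁} C]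

/-- A pseudofunctor to `Cat` given by its components. -/
def mkPseudo (obj : C → Type u₂) [∀ x, Category.{v₂} (obj x)]
    (map : ∀ {x y : C}, (x ⟶ y) → obj x ⥤ obj y)
    (mapId : ∀ {x : C} (a : obj x), (map (𝟙 x)).obj a ≅ a)
    (mapId_natural : ∀ {x : C} {a b : obj x} (k : a ⟶ b),
      (map (𝟙 x)).map k ≫ (mapId b).hom = (mapId a).hom ≫ k)
    (mapComp : ∀ {x y z : C} (f : x ⟶ y) (g : y ⟶ z) (a : obj x),
      (map (f ≫ g)).obj a ≅ (map g).obj ((map f).obj a))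
    (mapComp_natural : ∀ {x y z : C} (f : x ⟶ y) (g : y ⟶ z) {a b : obj x} (k : a ⟶ b),
      (map (f ≫ g)).map k ≫ (mapComp f g b).hom = (mapComp f g a).hom ≫ (map g).map ((map f).map k))
    (assoc : ∀ {w x y z : C} (f : w ⟶ x) (g : x ⟶ y) (h : y ⟶ z) (a : obj w),
      (mapComp (f ≫ g) h a).hom ≫ (map h).map (mapComp f g a).hom =
        eqToHom (by rw [Category.assoc]) ≫ (mapComp f (g ≫ h) a).hom ≫ (mapComp g h _).hom)
    (id_comp : ∀ {x y : C} (f : x ⟶ y) (a : obj x),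
      (mapComp (𝟙 x) f a).hom ≫ (map f).map (mapId a).hom = eqToHom (by rw [Category.id_comp]))
    (comp_id : ∀ {x y : C} (f : x ⟶ y) (a : obj x),
      (mapComp f (𝟙 y) a).hom ≫ (mapId _).hom = eqToHom (by rw [Category.comp_id])) :
    LocallyDiscrete C ⥤ᵖ Cat.{v₂, u₂} :=
  LocallyDiscrete.mkPseudofunctor (fun x => Cat.of (obj x)) (fun f => (map f).toCatHom)
    (fun x => Cat.Hom.isoMk (NatIso.ofComponents (F := map (𝟙 x)) (G := 𝟭 _) mapId mapId_natural))
    (fun f g => Cat.Hom.isoMk (NatIso.ofComponents (F := map (f ≫ g)) (G := map f ⋙ map g)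
      (mapComp f g) (mapComp_natural f g)))
    (fun f g h => by
      apply Cat.Hom₂.ext
      ext a
      refine Eq.trans ?_ (Cat.eqToHom_app _ _ _ a).symm
      -- The coherence law is required as one composite of constraints and inverse constraints equal
      -- to an `eqToHom`; the identity factor is a component of the associator of `Cat`.
      have e : ∀ a : obj _, (mapComp (f ≫ g) h a).hom ≫ (map h).map (mapComp f g a).hom ≫ 𝟙 _ ≫
          (mapComp g h ((map f).obj a)).inv ≫ (mapComp f (g ≫ h) a).inv =
          eqToHom (by rw [Category.assoc]) := fun a => by
        rw [reassoc_of% assoc, Category.id_comp, Iso.hom_inv_id_assoc, Iso.hom_inv_id,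
          Category.comp_id]
      exact e a)
    (fun f => by
      apply Cat.Hom₂.ext
      ext a
      refine Eq.trans ?_ (Cat.eqToHom_app _ _ _ a).symm
      exact (_ ≫= Category.comp_id _).trans (id_comp f a))
    (fun f => by
      apply Cat.Hom₂.ext
      ext a
      refine Eq.trans ?_ (Cat.eqToHom_app _ _ _ a).symm
      exact (_ ≫= Category.comp_id _).trans (comp_id f a))

end PseudofunctorOfComponents


section Cleavage

variable {A : Type u₁} [Category.{v₁} A] {X : Type u₂} [Category.{v₂} X]

/-- A choice of cocartesian lifts. -/
structure OpCleavage (p : A ⥤ X) where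
  /-- the codomain of the chosen lift -/
  obj {x y : X} (f : x ⟶ y) (a : p.Fiber x) : p.Fiber y
  /-- the chosen lift -/
  lift {x y : X} (f : x ⟶ y) (a : p.Fiber x) : a.1 ⟶ (obj f a).1
  isCocart {x y : X} (f : x ⟶ y) (a : p.Fiber x) : p.IsStronglyCocartesian f (lift f a)

theorem IsOpfibration.nonempty_opCleavage {p : A ⥤ X} (h : IsOpfibration p) :
    Nonempty (OpCleavage p) := by
  have : ∀ {x y : X} (f : x ⟶ y) (a : p.Fiber x), ∃ (b : p.Fiber y) (φ : a.1 ⟶ b.1),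
      p.IsStronglyCocartesian f φ := by
    rintro x y f ⟨a, rfl⟩
    obtain ⟨b, φ, hφ⟩ := h a y f
    exact ⟨⟨b, IsHomLift.codomain_eq p f φ⟩, φ, hφ⟩
  choose b φ h using @this
  exact ⟨⟨b, φ, h⟩⟩

namespace OpCleavage

variable {p : A ⥤ X} (c : OpCleavage p) {x y z : X}

instance (f : x ⟶ y) (a : p.Fiber x) : p.IsStronglyCocartesian f (c.lift f a) := c.isCocart f a

instance {a b : p.Fiber x} (k : a ⟶ b) : p.IsHomLift (𝟙 x) k.1 := k.2

/-- The morphism of the fibre induced by a morphism over `f`. -/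
noncomputable def desc (f : x ⟶ y) {a : p.Fiber x} {b : p.Fiber y} (φ : a.1 ⟶ b.1)
    (_ : p.IsHomLift f φ) : c.obj f a ⟶ b :=
  ⟨Functor.IsStronglyCocartesian.map p f (c.lift f a) (Category.comp_id f).symm φ, inferInstance⟩

theorem lift_desc (f : x ⟶ y) {a : p.Fiber x} {b : p.Fiber y} (φ : a.1 ⟶ b.1)
    (h : p.IsHomLift f φ) : c.lift f a ≫ (c.desc f φ h).1 = φ :=
  Functor.IsStronglyCocartesian.fac p f (c.lift f a) (Category.comp_id f).symm φ

/-- A cocartesian lift is epic with respect to arrows of the fibre. Equations in fibres are proved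
by precomposing with the lift, where each constructed arrow has a defining factorization. -/
theorem hom_ext (f : x ⟶ y) {a : p.Fiber x} {b : p.Fiber y} {k l : c.obj f a ⟶ b}
    (h : c.lift f a ≫ k.1 = c.lift f a ≫ l.1) : k = l :=
  Subtype.ext (Functor.IsStronglyCocartesian.ext p f (c.lift f a) (𝟙 y) h)

/-- The isomorphism of the fibre induced by a cocartesian morphism over `f`. -/
noncomputable def descIso (f : x ⟶ y) {a : p.Fiber x} {b : p.Fiber y} (φ : a.1 ⟶ b.1)
    (h : p.IsStronglyCocartesian f φ) : c.obj f a ≅ b where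
  hom := c.desc f φ inferInstance
  inv := ⟨Functor.IsStronglyCocartesian.map p f φ (Category.comp_id f).symm (c.lift f a),
    inferInstance⟩
  hom_inv_id := c.hom_ext f <| by
    refine (Category.assoc _ _ _).symm.trans ((c.lift_desc f φ inferInstance =≫ _).trans ?_)
    exact (Functor.IsStronglyCocartesian.fac p f φ (Category.comp_id f).symm (c.lift f a)).trans
      (Category.comp_id _).symm
  inv_hom_id := Subtype.ext <| by
    have h₁ : p.IsHomLift (𝟙 y) (Functor.IsStronglyCocartesian.map p f φ
      (Category.comp_id f).symm (c.lift f a) ≫ (c.desc f φ inferInstance).1) := inferInstance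
    have h₂ : p.IsHomLift (𝟙 y) (𝟙 b.1) := IsHomLift.id b.2
    refine Functor.IsStronglyCocartesian.ext p f φ (𝟙 y) ?_
    refine (Category.assoc _ _ _).symm.trans ((Functor.IsStronglyCocartesian.fac p f φ
      (Category.comp_id f).symm (c.lift f a) =≫ _).trans ?_)
    exact (c.lift_desc f φ inferInstance).trans (Category.comp_id _).symm

theorem lift_descIso (f : x ⟶ y) {a : p.Fiber x} {b : p.Fiber y} (φ : a.1 ⟶ b.1)
    (h : p.IsStronglyCocartesian f φ) : c.lift f a ≫ (c.descIso f φ h).hom.1 = φ :=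
  c.lift_desc f φ inferInstance

/-- Push-forward along `f`. -/
noncomputable def map (f : x ⟶ y) : p.Fiber x ⥤ p.Fiber y where
  obj a := c.obj f a
  map {a b} k := c.desc f (k.1 ≫ c.lift f b) inferInstance
  map_id a := c.hom_ext f <| (c.lift_desc f _ _).trans
    ((Category.id_comp _).trans (Category.comp_id _).symm)
  map_comp {a b d} k l := c.hom_ext f <| by
    refine (c.lift_desc f _ _).trans (Eq.trans ?_ (Category.assoc _ _ _))
    rw [lift_desc, Category.assoc, lift_desc]
    exact Category.assoc _ _ _

theorem lift_map (f : x ⟶ y) {a b : p.Fiber x} (k : a ⟶ b) :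
    c.lift f a ≫ ((c.map f).map k).1 = k.1 ≫ c.lift f b :=
  c.lift_desc f _ _

theorem isCocart_id (a : p.Fiber x) : p.IsStronglyCocartesian (𝟙 x) (𝟙 a.1) := by
  have : p.IsHomLift (𝟙 x) (𝟙 a.1) := IsHomLift.id a.2
  exact inferInstance

/-- Needed for the coherence laws: they compare push-forwards along base arrows, such as `(f ≫ g) ≫
h` and `f ≫ g ≫ h`, that are equal but not definitionally so. -/
theorem lift_eqToHom {f f' : x ⟶ y} (h : f = f') (a : p.Fiber x) :
    c.lift f a ≫ (eqToHom (congrArg (fun f => c.obj f a) h) : c.obj f a ⟶ c.obj f' a).1 =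
      c.lift f' a := by
  subst h
  exact Category.comp_id _

theorem isCocart_comp (f : x ⟶ y) (g : y ⟶ z) (a : p.Fiber x) :
    p.IsStronglyCocartesian (f ≫ g) (c.lift f a ≫ c.lift g (c.obj f a)) :=
  inferInstance

/-- The pseudofunctor of an opfibration with chosen lifts. -/
noncomputable def pseudo : LocallyDiscrete X ⥤ᵖ Cat.{v₁, max u₁ 0} :=
  mkPseudo (fun x => p.Fiber x) c.map
    (fun {x} a => c.descIso (𝟙 x) (𝟙 a.1) (isCocart_id a))
    (fun {x a b} k => c.hom_ext (𝟙 x) <| by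
      refine (Category.assoc _ _ _).symm.trans ((c.lift_map (𝟙 x) k =≫ _).trans ?_)
      refine (Category.assoc _ _ _).trans ((_ ≫= c.lift_descIso _ _ (isCocart_id b)).trans ?_)
      refine (Category.comp_id _).trans ((Category.id_comp _).symm.trans ?_)
      exact ((c.lift_descIso _ _ (isCocart_id a)).symm =≫ _).trans (Category.assoc _ _ _))
    (fun f g a => c.descIso (f ≫ g) (c.lift f a ≫ c.lift g (c.obj f a)) (c.isCocart_comp f g a))
    (fun f g a b k => c.hom_ext (f ≫ g) <| by
      refine (Category.assoc _ _ _).symm.trans ((c.lift_map (f ≫ g) k =≫ _).trans ?_)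
      refine (Category.assoc _ _ _).trans ((_ ≫= c.lift_descIso _ _ (c.isCocart_comp f g b)).trans ?_)
      refine Eq.trans ?_ ((c.lift_descIso _ _ (c.isCocart_comp f g a)).symm =≫ _ |>.trans
        (Category.assoc _ _ _))
      refine Eq.trans ?_ (Category.assoc _ _ _).symm
      refine Eq.trans ?_ (_ ≫= c.lift_map g _).symm
      exact ((Category.assoc _ _ _).symm.trans (((c.lift_map f k).symm =≫ _).trans
        (Category.assoc _ _ _))))
    -- Precomposed with the lift of the triple composite, both sides become the composite of the
    -- three successive lifts.
    (fun f g h a => c.hom_ext _ <| by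
      refine (Category.assoc _ _ _).symm.trans
        ((c.lift_descIso _ _ (c.isCocart_comp (f ≫ g) h a) =≫ _).trans ?_)
      refine (Category.assoc _ _ _).trans ((_ ≫= c.lift_map h _).trans ?_)
      refine (Category.assoc _ _ _).symm.trans
        ((c.lift_descIso _ _ (c.isCocart_comp f g a) =≫ _).trans ?_)
      refine Eq.trans ?_ (Category.assoc _ _ _)
      refine Eq.trans ?_ (c.lift_eqToHom (Category.assoc f g h) a =≫ _).symm
      refine Eq.trans ?_ (Category.assoc _ _ _)
      refine Eq.trans ?_ (c.lift_descIso _ _ (c.isCocart_comp f (g ≫ h) a) =≫ _).symm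
      refine Eq.trans ?_ (Category.assoc _ _ _).symm
      refine Eq.trans ?_ (_ ≫= c.lift_descIso _ _ (c.isCocart_comp g h _)).symm
      exact Category.assoc _ _ _)
    (fun f a => c.hom_ext _ <| by
      refine (Category.assoc _ _ _).symm.trans
        ((c.lift_descIso _ _ (c.isCocart_comp (𝟙 _) f a) =≫ _).trans ?_)
      refine Eq.trans ?_ (c.lift_eqToHom (Category.id_comp f) a).symm
      refine (Category.assoc _ _ _).trans ((_ ≫= c.lift_map f _).trans ?_)
      exact (Category.assoc _ _ _).symm.trans
        ((c.lift_descIso _ _ (isCocart_id a) =≫ _).trans (Category.id_comp _)))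
    (fun f a => c.hom_ext _ <| by
      refine (Category.assoc _ _ _).symm.trans
        ((c.lift_descIso _ _ (c.isCocart_comp f (𝟙 _) a) =≫ _).trans ?_)
      refine Eq.trans ?_ (c.lift_eqToHom (Category.comp_id f) a).symm
      exact (Category.assoc _ _ _).trans ((_ ≫= c.lift_descIso _ _ (isCocart_id _)).trans
        (Category.comp_id _)))

theorem lift_pushId (a : p.Fiber x) :
    c.lift (𝟙 x) a ≫ (pushId c.pseudo (𝟙 x) rfl a).hom.1 = 𝟙 a.1 :=
  (congrArg (fun k : c.obj (𝟙 x) a ⟶ a => c.lift (𝟙 x) a ≫ k.1) (Co.pushId_hom c.pseudo x a)).trans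
    (c.lift_descIso _ _ (isCocart_id a))

theorem lift_pushComp (f : x ⟶ y) (g : y ⟶ z) (a : p.Fiber x) :
    c.lift (f ≫ g) a ≫ (pushComp c.pseudo f g _ rfl a).hom.1 = c.lift f a ≫ c.lift g (c.obj f a) :=
  (congrArg (fun k : c.obj (f ≫ g) a ⟶ c.obj g (c.obj f a) => c.lift (f ≫ g) a ≫ k.1)
    (pushComp_hom c.pseudo f g a)).trans (c.lift_descIso _ _ (c.isCocart_comp f g a))

open scoped Pseudofunctor.Grothendieck

/-- The comparison functor from the Grothendieck construction. -/
noncomputable def fromTotal : (∫ c.pseudo) ⥤ A where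
  obj a := a.fiber.1
  map {a b} φ := c.lift φ.base a.fiber ≫ φ.fiber.1
  map_id a := by
    refine Eq.trans ?_ (c.lift_pushId a.fiber)
    exact congrArg (fun φ : a ⟶ a => c.lift φ.base a.fiber ≫ φ.fiber.1)
      (Co.id_eq_hom (F := c.pseudo) a.base a.fiber (𝟙 _) rfl)
  map_comp {a b d} φ ψ := by
    refine (congrArg (fun φ : a ⟶ d => c.lift φ.base a.fiber ≫ φ.fiber.1)
      (Co.hom_comp_hom (F := c.pseudo) (a := a.fiber) (b := b.fiber) (c := d.fiber)
        φ.base φ.fiber ψ.base ψ.fiber _ rfl)).trans ?_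
    refine (Category.assoc _ _ _).symm.trans
      ((c.lift_pushComp φ.base ψ.base a.fiber =≫ _).trans ?_)
    refine (Category.assoc _ _ _).trans (Eq.trans ?_ (Category.assoc _ _ _).symm)
    refine _ ≫= ((Category.assoc _ _ _).symm.trans ((c.lift_map ψ.base φ.fiber =≫ _).trans ?_))
    exact Category.assoc _ _ _

theorem isHomLift_fromTotal_map {a b : ∫ c.pseudo} (φ : a ⟶ b) :
    p.IsHomLift φ.base (c.fromTotal.map φ) := by
  have h₁ : p.IsHomLift (𝟙 b.base) φ.fiber.1 := φ.fiber.2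
  have h₂ : p.IsHomLift φ.base (c.lift φ.base a.fiber) := (c.isCocart φ.base a.fiber).toIsHomLift
  have h := @IsHomLift.comp _ _ _ _ p _ _ _ _ _ _ φ.base (𝟙 b.base) (c.lift φ.base a.fiber)
    φ.fiber.1 h₂ h₁
  rwa [Category.comp_id] at h

theorem fromTotal_comp : c.fromTotal ⋙ p = Pseudofunctor.Grothendieck.forget c.pseudo :=
  CategoryTheory.Functor.ext (fun a => a.fiber.2) (fun a b φ => by
    have := c.isHomLift_fromTotal_map φ
    exact IsHomLift.fac' p φ.base (c.fromTotal.map φ))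

/-- Fibres are taken strictly, so each object of `A` belongs to exactly one of them. -/
theorem fromTotal_obj_bijective : Function.Bijective c.fromTotal.obj := by
  constructor
  · rintro ⟨x, ⟨a, hx⟩⟩ ⟨y, ⟨b, hy⟩⟩ (h : a = b)
    change p.obj a = x at hx
    change p.obj b = y at hy
    subst hx hy h
    rfl
  · intro a
    exact ⟨⟨p.obj a, ⟨a, rfl⟩⟩, rfl⟩

/-- The base arrow is recovered by applying `p`, and the fibre component is then the unique
factorization through the chosen lift. -/
theorem fromTotal_map_bijective (a b : ∫ c.pseudo) :
    Function.Bijective (c.fromTotal.map : (a ⟶ b) → _) := by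
  constructor
  · intro φ ψ h
    have h₁ := c.isHomLift_fromTotal_map φ
    have h₂ := c.isHomLift_fromTotal_map ψ
    rw [h] at h₁
    obtain ⟨f, k⟩ := φ
    obtain ⟨g, l⟩ := ψ
    obtain rfl : f = g := (@IsHomLift.fac _ _ _ _ p _ _ _ _ f _ h₁).trans (@IsHomLift.fac _ _ _ _ p _ _ _ _ g _ h₂).symm
    exact congrArg (Co.hom (F := c.pseudo) f) (c.hom_ext f h)
  · intro ψ
    obtain ⟨x, ⟨a, hx⟩⟩ := a
    obtain ⟨y, ⟨b, hy⟩⟩ := b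
    change p.obj a = x at hx
    change p.obj b = y at hy
    subst hx hy
    change a ⟶ b at ψ
    exact ⟨⟨p.map ψ, c.desc (p.map ψ) ψ (IsHomLift.map p ψ)⟩, c.lift_desc _ _ _⟩

end OpCleavage

end Cleavage

end MonGroth

/-! ### Lax monoidal structures from tensor products on the total category, covariant case -/

namespace MonGroth

open scoped Pseudofunctor.CoGrothendieck Pseudofunctor.Grothendieck

/-- The structure maps of a monoidal category whose whiskerings are given by the tensor product
of morphisms. -/
abbrev tensorStructOf {A : Type u₁} [Category.{v₁} A] (obj : A → A → A) (unit : A)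
    (map : ∀ {a a' b b' : A}, (a ⟶ a') → (b ⟶ b') → (obj a b ⟶ obj a' b'))
    (ass : ∀ a b c, obj (obj a b) c ≅ obj a (obj b c)) (left : ∀ a, obj unit a ≅ a)
    (right : ∀ a, obj a unit ≅ a) : MonoidalCategoryStruct A where
  tensorObj := obj
  tensorUnit := unit
  tensorHom := map
  whiskerLeft a _ _ g := map (𝟙 a) g
  whiskerRight f b := map f (𝟙 b)
  associator := ass
  leftUnitor := left
  rightUnitor := right

/-- The action on objects is shared by both structures, so the arrows can be compared by plain
equalities. -/
theorem tensorStructOf_congr {A : Type u₁} [Category.{v₁} A] {obj : A → A → A} {unit : A}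
    {map map' : ∀ {a a' b b' : A}, (a ⟶ a') → (b ⟶ b') → (obj a b ⟶ obj a' b')}
    {ass ass' : ∀ a b c, obj (obj a b) c ≅ obj a (obj b c)} {left left' : ∀ a, obj unit a ≅ a}
    {right right' : ∀ a, obj a unit ≅ a}
    (h : ∀ {a a' b b' : A} (f : a ⟶ a') (g : b ⟶ b'), map f g = map' f g)
    (h₁ : ∀ a b c, ass a b c = ass' a b c) (h₂ : ∀ a, left a = left' a)
    (h₃ : ∀ a, right a = right' a) :
    tensorStructOf obj unit map ass left right = tensorStructOf obj unit map' ass' left' right' := by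
  obtain rfl : @map = @map' := by
    funext a a' b b' f g
    exact h f g
  obtain rfl : ass = ass' := by
    funext a b c
    exact h₁ a b c
  obtain rfl : left = left' := funext h₂
  obtain rfl : right = right' := funext h₃
  rfl

namespace Co

section Morphisms

variable {X : Type u₁} [Category.{v₁} X] {F : LocallyDiscrete X ⥤ᵖ Cat.{v₂, u₂}}

theorem exists_hom_eq {x y : X} {a : F.obj ⟨x⟩} {b : F.obj ⟨y⟩} (φ : (⟨x, a⟩ : ∫ F) ⟶ ⟨y, b⟩)
    (f : x ⟶ y) (h : φ.base = f) : ∃ k, hom f k = φ := by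
  subst h
  exact ⟨φ.fiber, rfl⟩

theorem exists_vert_eq {x : X} {a b : F.obj ⟨x⟩} (φ : (⟨x, a⟩ : ∫ F) ⟶ ⟨x, b⟩)
    (h : φ.base = 𝟙 x) : ∃ k : a ⟶ b, vert k = φ := by
  obtain ⟨k, rfl⟩ := exists_hom_eq φ _ h
  refine ⟨(pushId F (𝟙 x) rfl a).inv ≫ k, ?_⟩
  rw [vert_eq_hom _ _ rfl, Iso.hom_inv_id_assoc]

/-- An isomorphism is cocartesian, so the criterion for cocartesian arrows makes its fibre component
invertible. -/
theorem isIso_of_isIso_hom {x y : X} {a : F.obj ⟨x⟩} {b : F.obj ⟨y⟩} (f : x ⟶ y)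
    (k : (push F f).obj a ⟶ b) (h : IsIso (hom f k)) : IsIso k := by
  refine (isCocart_hom_iff f k).1 ?_
  have : (Pseudofunctor.Grothendieck.forget F).IsHomLift f (hom f k) :=
    IsHomLift.map (Pseudofunctor.Grothendieck.forget F) (hom f k)
  exact Functor.IsStronglyCocartesian.of_isIso (Pseudofunctor.Grothendieck.forget F) f (hom f k)

theorem vert_comp_lift {x y : X} (f : x ⟶ y) {a b : F.obj ⟨x⟩} (k : a ⟶ b) :
    (vert k : (⟨x, a⟩ : ∫ F) ⟶ _) ≫ lift F f b = lift F f a ≫ vert ((push F f).map k) := by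
  rw [vert_comp_hom, lift_comp_vert, Category.comp_id]

theorem lift_comp_lift {x y z : X} (f : x ⟶ y) (g : y ⟶ z) (a : F.obj ⟨x⟩) :
    lift F f a ≫ lift F g _ = hom (f ≫ g) (pushComp F f g _ rfl a).hom := by
  refine (hom_comp_hom _ _ _ _ _ rfl).trans (congrArg (hom _) ?_)
  rw [CategoryTheory.Functor.map_id, Category.comp_id, Category.comp_id]

theorem exists_iso_of_base {A B : ∫ F} (e : A ≅ B) (f : A.base ⟶ B.base) (h : e.hom.base = f) :
    ∃ k : (push F f).obj A.fiber ≅ B.fiber, hom f k.hom = e.hom := by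
  obtain ⟨k, hk⟩ := exists_hom_eq (a := A.fiber) (b := B.fiber) e.hom f h
  have := isIso_of_isIso_hom f k (by rw [hk]; exact e.isIso_hom)
  exact ⟨asIso k, hk⟩

end Morphisms

section FiberedTensor

variable {X : Type u₁} [Category.{v₁} X] [MonoidalCategory X]

/-- A monoidal structure on `∫ F` strictly over that of `X` and preserving cocartesian
morphisms. -/
structure FiberedTensor (F : LocallyDiscrete X ⥤ᵖ Cat.{v₂, u₂}) where
  /-- the tensor product on fibres -/
  obj {x y : X} (a : F.obj ⟨x⟩) (b : F.obj ⟨y⟩) : F.obj ⟨x ⊗ y⟩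
  /-- the unit -/
  unit : F.obj ⟨𝟙_ X⟩
  /-- the tensor product of morphisms -/
  map {A A' B B' : ∫ F} (φ : A ⟶ A') (ψ : B ⟶ B') :
    (⟨A.base ⊗ B.base, obj A.fiber B.fiber⟩ : ∫ F) ⟶ ⟨A'.base ⊗ B'.base, obj A'.fiber B'.fiber⟩
  map_base {A A' B B' : ∫ F} (φ : A ⟶ A') (ψ : B ⟶ B') : (map φ ψ).base = φ.base ⊗ₘ ψ.base
  isCocart_map {A A' B B' : ∫ F} (φ : A ⟶ A') (ψ : B ⟶ B') :
    IsCocart (Pseudofunctor.Grothendieck.forget F) φ →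
    IsCocart (Pseudofunctor.Grothendieck.forget F) ψ →
    IsCocart (Pseudofunctor.Grothendieck.forget F) (map φ ψ)
  /-- the associator -/
  ass (A B D : ∫ F) : (⟨(A.base ⊗ B.base) ⊗ D.base, obj (obj A.fiber B.fiber) D.fiber⟩ : ∫ F) ≅
    ⟨A.base ⊗ (B.base ⊗ D.base), obj A.fiber (obj B.fiber D.fiber)⟩
  ass_base (A B D : ∫ F) : (ass A B D).hom.base = (α_ A.base B.base D.base).hom
  /-- the left unitor -/
  left (A : ∫ F) : (⟨𝟙_ X ⊗ A.base, obj unit A.fiber⟩ : ∫ F) ≅ A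
  left_base (A : ∫ F) : (left A).hom.base = (λ_ A.base).hom
  /-- the right unitor -/
  right (A : ∫ F) : (⟨A.base ⊗ 𝟙_ X, obj A.fiber unit⟩ : ∫ F) ≅ A
  right_base (A : ∫ F) : (right A).hom.base = (ρ_ A.base).hom
  isMonoidal : IsMonoidalStruct (tensorStructOf (A := ∫ F)
    (fun A B => ⟨A.base ⊗ B.base, obj A.fiber B.fiber⟩) ⟨𝟙_ X, unit⟩ map ass left right)

namespace FiberedTensor

variable {F : LocallyDiscrete X ⥤ᵖ Cat.{v₂, u₂}} (t : FiberedTensor F)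

/-- The monoidal structure on `∫ F`. -/
abbrev monoidal : MonoidalCategory (∫ F) := monoidalOfStruct _ t.isMonoidal

theorem map_id (A B : ∫ F) : t.map (𝟙 A) (𝟙 B) = 𝟙 _ := t.monoidal.id_tensorHom_id A B

theorem map_comp {A A' A'' B B' B'' : ∫ F} (φ : A ⟶ A') (φ' : A' ⟶ A'') (ψ : B ⟶ B')
    (ψ' : B' ⟶ B'') : t.map (φ ≫ φ') (ψ ≫ ψ') = t.map φ ψ ≫ t.map φ' ψ' :=
  (t.monoidal.tensorHom_comp_tensorHom φ ψ φ' ψ').symm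

theorem exists_mapVert {x y : X} {a a' : F.obj ⟨x⟩} {b b' : F.obj ⟨y⟩} (k : a ⟶ a') (l : b ⟶ b') :
    ∃ m : t.obj a b ⟶ t.obj a' b', vert m = t.map (vert k) (vert l) :=
  exists_vert_eq _ ((t.map_base _ _).trans (id_tensorHom_id x y))

/-- The tensor product of morphisms of fibres. -/
noncomputable def mapVert {x y : X} {a a' : F.obj ⟨x⟩} {b b' : F.obj ⟨y⟩} (k : a ⟶ a')
    (l : b ⟶ b') : t.obj a b ⟶ t.obj a' b' := (t.exists_mapVert k l).choose

theorem vert_mapVert {x y : X} {a a' : F.obj ⟨x⟩} {b b' : F.obj ⟨y⟩} (k : a ⟶ a') (l : b ⟶ b') :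
    vert (t.mapVert k l) = t.map (vert k) (vert l) := (t.exists_mapVert k l).choose_spec

/-- The laxator. -/
noncomputable def mu (x y : X) : F.obj ⟨x⟩ × F.obj ⟨y⟩ ⥤ F.obj ⟨x ⊗ y⟩ where
  obj p := t.obj p.1 p.2
  map k := t.mapVert k.1 k.2
  map_id p := vert_injective <| by
    rw [vert_mapVert, vert_id]
    exact (congrArg₂ t.map (vert_id _) (vert_id _)).trans (t.map_id _ _)
  map_comp k l := vert_injective <| by
    rw [← vert_vert, vert_mapVert, vert_mapVert, vert_mapVert, ← map_comp, vert_vert, vert_vert]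
    rfl

/-- The tensor of two cocartesian lifts is cocartesian over `f ⊗ₘ g`, hence has an invertible fibre
component. This is where compatibility of the tensor product with cocartesian arrows makes the
laxator pseudonatural, and not just lax natural. -/
theorem exists_muMap {x x' y y' : X} (f : x ⟶ x') (g : y ⟶ y') (a : F.obj ⟨x⟩) (b : F.obj ⟨y⟩) :
    ∃ k : (push F (f ⊗ₘ g)).obj (t.obj a b) ≅ t.obj ((push F f).obj a) ((push F g).obj b),
      hom (f ⊗ₘ g) k.hom = t.map (lift F f a) (lift F g b) := by
  obtain ⟨k, hk⟩ := exists_hom_eq _ _ (t.map_base (lift F f a) (lift F g b))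
  have h := t.isCocart_map (lift F f a) (lift F g b) (lift_isStronglyCocartesian f a)
    (lift_isStronglyCocartesian g b)
  rw [← hk] at h
  have := (isCocart_hom_iff _ _).1 h
  exact ⟨asIso k, hk⟩

/-- The pseudonaturality constraint of the laxator. -/
noncomputable def muMap {x x' y y' : X} (f : x ⟶ x') (g : y ⟶ y') (a : F.obj ⟨x⟩)
    (b : F.obj ⟨y⟩) : (push F (f ⊗ₘ g)).obj ((t.mu x y).obj (a, b)) ≅
      (t.mu x' y').obj ((push F f).obj a, (push F g).obj b) := (t.exists_muMap f g a b).choose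

theorem hom_muMap {x x' y y' : X} (f : x ⟶ x') (g : y ⟶ y') (a : F.obj ⟨x⟩)
    (b : F.obj ⟨y⟩) : hom (f ⊗ₘ g) (t.muMap f g a b).hom = t.map (lift F f a) (lift F g b) :=
  (t.exists_muMap f g a b).choose_spec

theorem vert_mu {x y : X} {a a' : F.obj ⟨x⟩} {b b' : F.obj ⟨y⟩} (k : a ⟶ a') (l : b ⟶ b') :
    vert ((t.mu x y).map (k ×ₘ l)) = t.map (vert k) (vert l) := t.vert_mapVert k l

/-- Each factor is a lift followed by a vertical arrow, so functoriality separates the tensor into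
the parts defining `muMap` and `mu`. The result is the formula for the tensor on the Grothendieck
construction, which makes the round trip exact. -/
theorem map_hom {x x' y y' : X} {a : F.obj ⟨x⟩} {a' : F.obj ⟨x'⟩} {b : F.obj ⟨y⟩}
    {b' : F.obj ⟨y'⟩} (f : x ⟶ x') (k : (push F f).obj a ⟶ a') (g : y ⟶ y')
    (l : (push F g).obj b ⟶ b') :
    t.map (hom f k) (hom g l) =
      hom (f ⊗ₘ g) ((t.muMap f g a b).hom ≫ (t.mu x' y').map (k ×ₘ l)) := by
  rw [← lift_comp_vert, ← lift_comp_vert, map_comp, ← hom_comp_vert, hom_muMap, vert_mu]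
  rfl

/-- The associativity modification. -/
noncomputable def omega {x y z : X} (a : F.obj ⟨x⟩) (b : F.obj ⟨y⟩) (c : F.obj ⟨z⟩) :
    (push F (α_ x y z).hom).obj ((t.mu (x ⊗ y) z).obj ((t.mu x y).obj (a, b), c)) ≅
      (t.mu x (y ⊗ z)).obj (a, (t.mu y z).obj (b, c)) :=
  (exists_iso_of_base (t.ass ⟨x, a⟩ ⟨y, b⟩ ⟨z, c⟩) _ (t.ass_base _ _ _)).choose

theorem hom_omega {x y z : X} (a : F.obj ⟨x⟩) (b : F.obj ⟨y⟩) (c : F.obj ⟨z⟩) :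
    hom (α_ x y z).hom (t.omega a b c).hom = (t.ass ⟨x, a⟩ ⟨y, b⟩ ⟨z, c⟩).hom :=
  (exists_iso_of_base (t.ass ⟨x, a⟩ ⟨y, b⟩ ⟨z, c⟩) _ (t.ass_base _ _ _)).choose_spec

/-- The right unit modification. -/
noncomputable def zeta {x : X} (a : F.obj ⟨x⟩) :
    (push F (ρ_ x).hom).obj ((t.mu x (𝟙_ X)).obj (a, t.unit)) ≅ a :=
  (exists_iso_of_base (t.right ⟨x, a⟩) _ (t.right_base _)).choose

theorem hom_zeta {x : X} (a : F.obj ⟨x⟩) :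
    hom (ρ_ x).hom (t.zeta a).hom = (t.right ⟨x, a⟩).hom :=
  (exists_iso_of_base (t.right ⟨x, a⟩) _ (t.right_base _)).choose_spec

/-- The left unit modification. -/
noncomputable def xi {x : X} (a : F.obj ⟨x⟩) :
    (push F (λ_ x).hom).obj ((t.mu (𝟙_ X) x).obj (t.unit, a)) ≅ a :=
  (exists_iso_of_base (t.left ⟨x, a⟩) _ (t.left_base _)).choose

theorem hom_xi {x : X} (a : F.obj ⟨x⟩) :
    hom (λ_ x).hom (t.xi a).hom = (t.left ⟨x, a⟩).hom :=
  (exists_iso_of_base (t.left ⟨x, a⟩) _ (t.left_base _)).choose_spec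

theorem ass_natural {A A' B B' D D' : ∫ F} (f : A ⟶ A') (g : B ⟶ B') (h : D ⟶ D') :
    t.map (t.map f g) h ≫ (t.ass A' B' D').hom = (t.ass A B D).hom ≫ t.map f (t.map g h) :=
  t.monoidal.associator_naturality f g h

theorem left_natural {A A' : ∫ F} (f : A ⟶ A') :
    t.map (𝟙 ⟨𝟙_ X, t.unit⟩) f ≫ (t.left A').hom = (t.left A).hom ≫ f :=
  t.monoidal.leftUnitor_naturality f

theorem right_natural {A A' : ∫ F} (f : A ⟶ A') :
    t.map f (𝟙 ⟨𝟙_ X, t.unit⟩) ≫ (t.right A').hom = (t.right A).hom ≫ f :=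
  t.monoidal.rightUnitor_naturality f

theorem omega_natural {x y z : X} {a a' : F.obj ⟨x⟩} {b b' : F.obj ⟨y⟩} {c c' : F.obj ⟨z⟩}
    (k : a ⟶ a') (l : b ⟶ b') (m : c ⟶ c') :
    (push F (α_ x y z).hom).map ((t.mu (x ⊗ y) z).map ((t.mu x y).map (k ×ₘ l) ×ₘ m)) ≫
        (t.omega a' b' c').hom =
      (t.omega a b c).hom ≫ (t.mu x (y ⊗ z)).map (k ×ₘ (t.mu y z).map (l ×ₘ m)) := by
  apply hom_injective (f := (α_ x y z).hom)
  rw [← vert_comp_hom, ← hom_comp_vert, hom_omega, hom_omega, vert_mu, vert_mu, vert_mu, vert_mu]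
  exact t.ass_natural _ _ _

/-- This is naturality of the associator at three lifts, read in the fibre. The unit modifications
come in the same way from naturality of the unitors at a lift. -/
theorem omega_modification {x x' y y' z z' : X} (f : x ⟶ x') (g : y ⟶ y') (h : z ⟶ z')
    (a : F.obj ⟨x⟩) (b : F.obj ⟨y⟩) (c : F.obj ⟨z⟩) :
    (push F (f ⊗ₘ (g ⊗ₘ h))).map (t.omega a b c).hom ≫ (t.muMap f (g ⊗ₘ h) a _).hom ≫
        (t.mu x' (y' ⊗ z')).map (𝟙 _ ×ₘ (t.muMap g h b c).hom) =
      (pushComp F (α_ x y z).hom (f ⊗ₘ (g ⊗ₘ h)) _ rfl _).inv ≫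
        (pushComp F ((f ⊗ₘ g) ⊗ₘ h) (α_ x' y' z').hom _ (by simp) _).hom ≫
          (push F (α_ x' y' z').hom).map ((t.muMap (f ⊗ₘ g) h _ c).hom ≫
            (t.mu (x' ⊗ y') z').map ((t.muMap f g a b).hom ×ₘ 𝟙 _)) ≫
              (t.omega ((push F f).obj a) ((push F g).obj b) ((push F h).obj c)).hom := by
  rw [Iso.eq_inv_comp]
  apply hom_injective
  rw [← hom_comp_hom, ← hom_comp_hom, hom_omega, hom_omega, ← map_hom, ← map_hom, hom_muMap,
    hom_muMap]
  exact (t.ass_natural _ _ _).symm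

theorem zeta_modification {x x' : X} (f : x ⟶ x') (a : F.obj ⟨x⟩) :
    (push F f).map (t.zeta a).hom =
      (pushComp F (ρ_ x).hom f _ rfl _).inv ≫
        (pushComp F (f ⊗ₘ 𝟙 (𝟙_ X)) (ρ_ x').hom _ (by simp) _).hom ≫
          (push F (ρ_ x').hom).map ((t.muMap f (𝟙 (𝟙_ X)) a t.unit).hom ≫
            (t.mu x' (𝟙_ X)).map (𝟙 _ ×ₘ (pushId F (𝟙 (𝟙_ X)) rfl t.unit).hom)) ≫
              (t.zeta ((push F f).obj a)).hom := by
  rw [Iso.eq_inv_comp]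
  apply hom_injective
  rw [← hom_comp_hom, hom_zeta, ← map_hom, ← id_eq_hom]
  refine Eq.trans ?_ (t.right_natural (lift F f a)).symm
  refine Eq.trans ?_ (t.hom_zeta a =≫ lift F f a)
  rw [hom_comp_hom _ _ _ _ _ rfl, Category.comp_id]

theorem xi_modification {x x' : X} (f : x ⟶ x') (a : F.obj ⟨x⟩) :
    (push F f).map (t.xi a).hom =
      (pushComp F (λ_ x).hom f _ rfl _).inv ≫
        (pushComp F (𝟙 (𝟙_ X) ⊗ₘ f) (λ_ x').hom _ (by simp) _).hom ≫
          (push F (λ_ x').hom).map ((t.muMap (𝟙 (𝟙_ X)) f t.unit a).hom ≫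
            (t.mu (𝟙_ X) x').map ((pushId F (𝟙 (𝟙_ X)) rfl t.unit).hom ×ₘ 𝟙 _)) ≫
              (t.xi ((push F f).obj a)).hom := by
  rw [Iso.eq_inv_comp]
  apply hom_injective
  rw [← hom_comp_hom, hom_xi, ← map_hom, ← id_eq_hom]
  refine Eq.trans ?_ (t.left_natural (lift F f a)).symm
  refine Eq.trans ?_ (t.hom_xi a =≫ lift F f a)
  rw [hom_comp_hom _ _ _ _ _ rfl, Category.comp_id]

theorem muMap_natural {x x' y y' : X} (f : x ⟶ x') (g : y ⟶ y') {a a' : F.obj ⟨x⟩}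
    {b b' : F.obj ⟨y⟩} (k : a ⟶ a') (l : b ⟶ b') :
    (push F (f ⊗ₘ g)).map ((t.mu x y).map (k ×ₘ l)) ≫ (t.muMap f g a' b').hom =
      (t.muMap f g a b).hom ≫ (t.mu x' y').map ((push F f).map k ×ₘ (push F g).map l) := by
  apply hom_injective
  rw [← vert_comp_hom, ← hom_comp_vert, hom_muMap, hom_muMap, vert_mu, vert_mu]
  refine (t.map_comp _ _ _ _).symm.trans (Eq.trans ?_ (t.map_comp _ _ _ _))
  exact congrArg₂ t.map (vert_comp_lift f k) (vert_comp_lift g l)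

theorem muMap_id {x y : X} (a : F.obj ⟨x⟩) (b : F.obj ⟨y⟩) :
    (t.muMap (𝟙 x) (𝟙 y) a b).hom ≫
        (t.mu x y).map ((pushId F (𝟙 x) rfl a).hom ×ₘ (pushId F (𝟙 y) rfl b).hom) =
      (pushId F (𝟙 x ⊗ₘ 𝟙 y) (by simp) ((t.mu x y).obj (a, b))).hom := by
  apply hom_injective
  rw [← map_hom, ← id_eq_hom, ← id_eq_hom, ← id_eq_hom]
  exact t.map_id _ _

/-- Functoriality of the tensor at two composable pairs of lifts. The composition constraints appear
because the composite of two lifts is not itself a chosen lift. -/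
theorem muMap_comp {x x' x'' y y' y'' : X} (f : x ⟶ x') (f' : x' ⟶ x'') (g : y ⟶ y')
    (g' : y' ⟶ y'') (a : F.obj ⟨x⟩) (b : F.obj ⟨y⟩) :
    (t.muMap (f ≫ f') (g ≫ g') a b).hom ≫
        (t.mu x'' y'').map ((pushComp F f f' _ rfl a).hom ×ₘ (pushComp F g g' _ rfl b).hom) =
      (pushComp F (f ⊗ₘ g) (f' ⊗ₘ g') ((f ≫ f') ⊗ₘ (g ≫ g')) (by simp)
          ((t.mu x y).obj (a, b))).hom ≫
        (push F (f' ⊗ₘ g')).map (t.muMap f g a b).hom ≫ (t.muMap f' g' _ _).hom := by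
  apply hom_injective
  rw [← map_hom, ← hom_comp_hom, hom_muMap, hom_muMap, ← lift_comp_lift, ← lift_comp_lift]
  exact t.map_comp _ _ _ _

theorem zeta_natural {x : X} {a a' : F.obj ⟨x⟩} (k : a ⟶ a') :
    (push F (ρ_ x).hom).map ((t.mu x (𝟙_ X)).map (k ×ₘ 𝟙 t.unit)) ≫ (t.zeta a').hom =
      (t.zeta a).hom ≫ k := by
  apply hom_injective (f := (ρ_ x).hom)
  rw [← vert_comp_hom, ← hom_comp_vert, hom_zeta, hom_zeta, vert_mu, vert_id]
  exact t.right_natural _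

theorem xi_natural {x : X} {a a' : F.obj ⟨x⟩} (k : a ⟶ a') :
    (push F (λ_ x).hom).map ((t.mu (𝟙_ X) x).map (𝟙 t.unit ×ₘ k)) ≫ (t.xi a').hom =
      (t.xi a).hom ≫ k := by
  apply hom_injective (f := (λ_ x).hom)
  rw [← vert_comp_hom, ← hom_comp_vert, hom_xi, hom_xi, vert_mu, vert_id]
  exact t.left_natural _

/-- The fibre component of the pentagon of the monoidal category `∫ F`; rewriting backwards with the
composition formula recovers its two sides. -/
theorem pentagon {w x y z : X} (a : F.obj ⟨w⟩) (b : F.obj ⟨x⟩) (c : F.obj ⟨y⟩)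
    (d : F.obj ⟨z⟩) :
    (pushComp F ((α_ w x y).hom ⊗ₘ 𝟙 z) ((α_ w (x ⊗ y) z).hom ≫ (𝟙 w ⊗ₘ (α_ x y z).hom))
        ((α_ (w ⊗ x) y z).hom ≫ (α_ w x (y ⊗ z)).hom) (by simp)
        ((t.mu _ z).obj ((t.mu _ y).obj ((t.mu w x).obj (a, b), c), d))).hom ≫
      (push F _).map ((t.muMap (α_ w x y).hom (𝟙 z) _ d).hom ≫
        (t.mu _ z).map ((t.omega a b c).hom ×ₘ (pushId F (𝟙 z) rfl d).hom)) ≫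
      (pushComp F (α_ w (x ⊗ y) z).hom (𝟙 w ⊗ₘ (α_ x y z).hom) _ rfl _).hom ≫
      (push F (𝟙 w ⊗ₘ (α_ x y z).hom)).map (t.omega a ((t.mu x y).obj (b, c)) d).hom ≫
      (t.muMap (𝟙 w) (α_ x y z).hom a _).hom ≫
      (t.mu w _).map ((pushId F (𝟙 w) rfl a).hom ×ₘ (t.omega b c d).hom) =
    (pushComp F (α_ (w ⊗ x) y z).hom (α_ w x (y ⊗ z)).hom _ rfl _).hom ≫
      (push F (α_ w x (y ⊗ z)).hom).map (t.omega ((t.mu w x).obj (a, b)) c d).hom ≫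
      (t.omega a b ((t.mu y z).obj (c, d))).hom := by
  apply hom_injective
  rw [← hom_comp_hom, ← hom_comp_hom, ← hom_comp_hom, ← map_hom, ← map_hom, ← id_eq_hom,
    ← id_eq_hom, hom_omega, hom_omega, hom_omega, hom_omega, hom_omega]
  exact t.monoidal.pentagon ⟨w, a⟩ ⟨x, b⟩ ⟨y, c⟩ ⟨z, d⟩

theorem triangle {x y : X} (a : F.obj ⟨x⟩) (b : F.obj ⟨y⟩) :
    (pushComp F (α_ x (𝟙_ X) y).hom (𝟙 x ⊗ₘ (λ_ y).hom) ((ρ_ x).hom ⊗ₘ 𝟙 y) (by simp)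
        ((t.mu _ y).obj ((t.mu x _).obj (a, t.unit), b))).hom ≫
      (push F (𝟙 x ⊗ₘ (λ_ y).hom)).map (t.omega a t.unit b).hom ≫
      (t.muMap (𝟙 x) (λ_ y).hom a _).hom ≫
      (t.mu x y).map ((pushId F (𝟙 x) rfl a).hom ×ₘ (t.xi b).hom) =
    (t.muMap (ρ_ x).hom (𝟙 y) _ b).hom ≫
      (t.mu x y).map ((t.zeta a).hom ×ₘ (pushId F (𝟙 y) rfl b).hom) := by
  apply hom_injective
  rw [← hom_comp_hom, ← map_hom, ← map_hom, ← id_eq_hom, ← id_eq_hom, hom_omega, hom_xi, hom_zeta]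
  exact t.monoidal.triangle ⟨x, a⟩ ⟨y, b⟩

/-- The lax monoidal pseudofunctor given by a monoidal structure on `∫ F`. -/
noncomputable def toLax : LaxMonoidalPseudofunctor.{v₁, u₁, v₂, u₂} X where
  toPs := F
  mu := t.mu
  muMap := t.muMap
  muMap_natural := t.muMap_natural
  muMap_id := t.muMap_id
  muMap_comp := t.muMap_comp
  mu0 := t.unit
  omega := t.omega
  omega_natural := t.omega_natural
  omega_modification := t.omega_modification
  zeta := t.zeta
  zeta_natural := t.zeta_natural
  zeta_modification := t.zeta_modification
  xi := t.xi
  xi_natural := t.xi_natural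
  xi_modification := t.xi_modification
  pentagon := t.pentagon
  triangle := t.triangle

/-- The reconstructed tensor product is the original one on the nose, not up to isomorphism, so a
functor monoidal for one structure is monoidal for the other. -/
theorem tensorStruct_toLax : tensorStruct t.toLax = tensorStructOf (A := ∫ F)
    (fun A B => ⟨A.base ⊗ B.base, t.obj A.fiber B.fiber⟩) ⟨𝟙_ X, t.unit⟩ t.map t.ass t.left
      t.right := by
  exact tensorStructOf_congr
    (fun φ ψ => (t.map_hom φ.base φ.fiber ψ.base ψ.fiber).symm)
    (fun A B D => Iso.ext (t.hom_omega A.fiber B.fiber D.fiber))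
    (fun A => Iso.ext (t.hom_xi A.fiber)) (fun A => Iso.ext (t.hom_zeta A.fiber))

end FiberedTensor

end FiberedTensor

end Co

end MonGroth

/-! ### Transport of a tensor product along a strict isomorphism over the base, covariant case -/

namespace MonGroth

section Conj

variable {A : Type u₁} [Category.{v₁} A] {X : Type u₂} [Category.{v₂} X] (p : A ⥤ X)

theorem isHomLift_conj {a b a' b' : A} {x y : X} {f : x ⟶ y} {φ : a ⟶ b} (h : p.IsHomLift f φ)
    (e : a = a') (e' : b = b') : p.IsHomLift f (eqToHom e.symm ≫ φ ≫ eqToHom e') := by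
  subst e e'
  simpa using h

theorem isCocart_conj {a b a' b' : A} {φ : a ⟶ b} (h : IsCocart p φ)
    (e : a = a') (e' : b = b') : IsCocart p (eqToHom e.symm ≫ φ ≫ eqToHom e') := by
  subst e e'
  simpa using h

theorem isCart_conj {a b a' b' : A} {φ : a ⟶ b} (h : IsCart p φ)
    (e : a = a') (e' : b = b') : IsCart p (eqToHom e.symm ≫ φ ≫ eqToHom e') := by
  subst e e'
  simpa using h

theorem isHomLift_id_comp {a b c : A} {R S T : X} {f : S ⟶ T} {φ : a ⟶ b} {ψ : b ⟶ c}
    (h : p.IsHomLift (𝟙 R) φ) (h' : p.IsHomLift f ψ) : p.IsHomLift f (φ ≫ ψ) :=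
  IsHomLift.comp_lift_id_left' p R φ f ψ

theorem isHomLift_comp_id {a b c : A} {R S T : X} {f : S ⟶ T} {φ : a ⟶ b} {ψ : b ⟶ c}
    (h : p.IsHomLift f φ) (h' : p.IsHomLift (𝟙 R) ψ) : p.IsHomLift f (φ ≫ ψ) :=
  IsHomLift.comp_lift_id_right' p f φ R ψ

theorem exists_iso_map_eq {B : Type u} [Category.{v} B] (K : B ⥤ A)
    (hK : ∀ a b, Function.Bijective (K.map : (a ⟶ b) → _)) {a b : B} (e : K.obj a ≅ K.obj b) :
    ∃ e' : a ≅ b, K.map e'.hom = e.hom := by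
  obtain ⟨f, hf⟩ := (hK _ _).2 e.hom
  obtain ⟨g, hg⟩ := (hK _ _).2 e.inv
  exact ⟨⟨f, g, (hK _ _).1 (by simp [hf, hg]), (hK _ _).1 (by simp [hf, hg])⟩, hf⟩

end Conj

section StrictMonoidal

variable {A : Type u₁} [Category.{v₁} A] [MonoidalCategory A] {X : Type u₂} [Category.{v₂} X]
  [MonoidalCategory X] (p : A ⥤ X) [IsStrictMonoidal p]

/-- Strict monoidality in terms of `IsHomLift`, where the object equalities of `IsStrictMonoidal`
are hidden. The next lemmas do the same for the constraints. -/
theorem isHomLift_tensorHom {a a' b b' : A} {x x' y y' : X} {f : x ⟶ x'} {g : y ⟶ y'} {φ : a ⟶ a'}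
    {ψ : b ⟶ b'} (h : p.IsHomLift f φ) (h' : p.IsHomLift g ψ) :
    p.IsHomLift (f ⊗ₘ g) (φ ⊗ₘ ψ) := by
  cases h
  cases h'
  exact IsHomLift.of_fac' p _ _ (IsStrictMonoidal.obj_tensor _ _) (IsStrictMonoidal.obj_tensor _ _)
    (IsStrictMonoidal.map_tensor φ ψ)

theorem isHomLift_associator {a b c : A} {x y z : X} (ha : p.obj a = x) (hb : p.obj b = y)
    (hc : p.obj c = z) :
    p.IsHomLift (MonoidalCategory.associator x y z).hom (MonoidalCategory.associator a b c).hom := by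
  subst ha hb hc
  exact IsHomLift.of_fac' p _ _ (by simp only [IsStrictMonoidal.obj_tensor])
    (by simp only [IsStrictMonoidal.obj_tensor]) (IsStrictMonoidal.map_associator a b c)

theorem isHomLift_leftUnitor {a : A} {x : X} (ha : p.obj a = x) :
    p.IsHomLift (MonoidalCategory.leftUnitor x).hom (MonoidalCategory.leftUnitor a).hom := by
  subst ha
  exact IsHomLift.of_fac' p _ _ _ rfl ((IsStrictMonoidal.map_leftUnitor a).trans
    (_ ≫= (Category.comp_id _).symm))

theorem isHomLift_rightUnitor {a : A} {x : X} (ha : p.obj a = x) :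
    p.IsHomLift (MonoidalCategory.rightUnitor x).hom (MonoidalCategory.rightUnitor a).hom := by
  subst ha
  exact IsHomLift.of_fac' p _ _ _ rfl ((IsStrictMonoidal.map_rightUnitor a).trans
    (_ ≫= (Category.comp_id _).symm))

end StrictMonoidal

open scoped Pseudofunctor.CoGrothendieck Pseudofunctor.Grothendieck

namespace Co

/-- The structure maps of the monoidal structure on `∫ F`. -/
abbrev FiberedTensor.struct {X : Type u₁} [Category.{v₁} X] [MonoidalCategory X]
    {F : LocallyDiscrete X ⥤ᵖ Cat.{v₂, u₂}} (t : FiberedTensor F) : MonoidalCategoryStruct (∫ F) :=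
  tensorStructOf (fun A B => ⟨A.base ⊗ B.base, t.obj A.fiber B.fiber⟩) ⟨𝟙_ X, t.unit⟩ t.map t.ass
    t.left t.right

section Transport

theorem isHomLift_map_base {A : Type u₁} [Category.{v₁} A] {X : Type u₂} [Category.{v₂} X]
    {p : A ⥤ X} {F : LocallyDiscrete X ⥤ᵖ Cat.{v, u}} {K : (∫ F) ⥤ A}
    (w : K ⋙ p = Pseudofunctor.Grothendieck.forget F) {a b : ∫ F} (φ : a ⟶ b) :
    p.IsHomLift φ.base (K.map φ) :=
  IsHomLift.of_fac' p _ _ (congr(($w).obj a) :) (congr(($w).obj b) :)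
    (CategoryTheory.Functor.congr_hom w φ)

theorem base_eq_of_isHomLift_map {A : Type u₁} [Category.{v₁} A] {X : Type u₂} [Category.{v₂} X]
    {p : A ⥤ X} {F : LocallyDiscrete X ⥤ᵖ Cat.{v, u}} {K : (∫ F) ⥤ A}
    (w : K ⋙ p = Pseudofunctor.Grothendieck.forget F) {a b : ∫ F} (φ : a ⟶ b)
    {f : a.base ⟶ b.base} (h : p.IsHomLift f (K.map φ)) : φ.base = f :=
  (@IsHomLift.fac _ _ _ _ p _ _ _ _ _ _ (isHomLift_map_base w φ)).trans
    (@IsHomLift.fac _ _ _ _ p _ _ _ _ _ _ h).symm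

/-- The preimage is returned with its base in the prescribed form `x`, so tensor products of objects
can be chosen fibre by fibre. -/
theorem exists_obj_eq {A : Type u₁} [Category.{v₁} A] {X : Type u₂} [Category.{v₂} X]
    {p : A ⥤ X} {F : LocallyDiscrete X ⥤ᵖ Cat.{v, u}} {K : (∫ F) ⥤ A}
    (w : K ⋙ p = Pseudofunctor.Grothendieck.forget F) (h₀ : Function.Surjective K.obj) {x : X}
    (a : A) (ha : p.obj a = x) : ∃ b : F.obj ⟨x⟩, K.obj ⟨x, b⟩ = a := by
  obtain ⟨⟨y, b⟩, rfl⟩ := h₀ a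
  have h : p.obj (K.obj ⟨y, b⟩) = y := congr(($w).obj ⟨y, b⟩)
  obtain rfl : y = x := h.symm.trans ha
  exact ⟨b, rfl⟩

/-- Objects are chosen so that `K` preserves tensor and unit strictly; arrows and constraints are
pulled back through the bijections on hom-sets after conjugation by these equalities. Strict
monoidality of `p` puts the results over the structure maps of `X`, and `K` transfers compatibility
with cocartesian arrows. -/
theorem exists_fiberedTensor {A : Type u₁} [Category.{v₁} A] [MonoidalCategory A] {X : Type u₂}
    [Category.{v₂} X] [MonoidalCategory X] {p : A ⥤ X} [IsStrictMonoidal p]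
    {F : LocallyDiscrete X ⥤ᵖ Cat.{v₁, u}} {K : (∫ F) ⥤ A}
    (w : K ⋙ p = Pseudofunctor.Grothendieck.forget F) (h₀ : Function.Surjective K.obj)
    (hK : ∀ a b, Function.Bijective (K.map : (a ⟶ b) → _))
    (hp : ∀ {a b a' b' : A} (φ : a ⟶ b) (ψ : a' ⟶ b'), IsCocart p φ → IsCocart p ψ →
      IsCocart p (φ ⊗ₘ ψ)) :
    ∃ t : FiberedTensor F, letI := t.struct; ∃ D : Monoidal.InducingFunctorData K,
      p.IsHomLift (𝟙 (𝟙_ X)) D.εIso.hom ∧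
        ∀ (a b : ∫ F), p.IsHomLift (𝟙 (a.base ⊗ b.base)) (D.μIso a b).hom := by
  have hKp : ∀ (a : ∫ F), p.obj (K.obj a) = a.base := fun a => congr(($w).obj a)
  have hm : ∀ {x y : X} (a : F.obj ⟨x⟩) (b : F.obj ⟨y⟩), ∃ m : F.obj ⟨x ⊗ y⟩,
      K.obj ⟨x ⊗ y, m⟩ = K.obj ⟨x, a⟩ ⊗ K.obj ⟨y, b⟩ := fun a b =>
    exists_obj_eq w h₀ _ (by rw [IsStrictMonoidal.obj_tensor, hKp, hKp])
  choose m hm using @hm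
  obtain ⟨e, he⟩ := exists_obj_eq w h₀ (𝟙_ A) IsStrictMonoidal.obj_unit
  let obj : (∫ F) → (∫ F) → ∫ F := fun a b => ⟨a.base ⊗ b.base, m a.fiber b.fiber⟩
  let unit : ∫ F := ⟨𝟙_ X, e⟩
  have hobj : ∀ (a b : ∫ F), K.obj a ⊗ K.obj b = K.obj (obj a b) := fun a b => (hm _ _).symm
  -- The constraints of `K` are equalities of objects in disguise, and therefore lie over
  -- identities.
  let c : ∀ (a b : ∫ F), K.obj a ⊗ K.obj b ≅ K.obj (obj a b) := fun a b => eqToIso (hobj a b)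
  let i : 𝟙_ A ≅ K.obj unit := eqToIso he.symm
  have hc : ∀ (a b : ∫ F), p.IsHomLift (𝟙 (a.base ⊗ b.base)) (c a b).hom := fun a b =>
    IsHomLift.eqToHom_codomain_lift_id (hobj a b) (hKp (obj a b))
  have hc' : ∀ (a b : ∫ F), p.IsHomLift (𝟙 (a.base ⊗ b.base)) (c a b).inv := fun a b =>
    IsHomLift.lift_id_inv p _ (c a b)
  have hε : p.IsHomLift (𝟙 (𝟙_ X)) i.hom :=
    IsHomLift.eqToHom_codomain_lift_id he.symm (hKp unit)
  have hε' : p.IsHomLift (𝟙 (𝟙_ X)) i.inv := IsHomLift.lift_id_inv p _ i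
  have hid : ∀ (a : ∫ F), p.IsHomLift (𝟙 a.base) (𝟙 (K.obj a)) := fun a => IsHomLift.id (hKp a)
  choose T hT using fun {a a' b b' : ∫ F} (φ : a ⟶ a') (ψ : b ⟶ b') =>
    (hK (obj a b) (obj a' b')).2 ((c a b).inv ≫ (K.map φ ⊗ₘ K.map ψ) ≫ (c a' b').hom)
  choose ass hass using fun (a b d : ∫ F) => exists_iso_map_eq K hK
    (((c _ _).symm ≪≫ ((c _ _).symm ⊗ᵢ .refl _)) ≪≫
      MonoidalCategory.associator (K.obj a) (K.obj b) (K.obj d) ≪≫ ((.refl _ ⊗ᵢ c _ _) ≪≫ c _ _) :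
      K.obj (obj (obj a b) d) ≅ K.obj (obj a (obj b d)))
  choose left hleft using fun (a : ∫ F) => exists_iso_map_eq K hK
    (((c _ _).symm ≪≫ (i.symm ⊗ᵢ .refl _)) ≪≫ MonoidalCategory.leftUnitor (K.obj a) :
      K.obj (obj unit a) ≅ K.obj a)
  choose right hright using fun (a : ∫ F) => exists_iso_map_eq K hK
    (((c _ _).symm ≪≫ (.refl _ ⊗ᵢ i.symm)) ≪≫ MonoidalCategory.rightUnitor (K.obj a) :
      K.obj (obj a unit) ≅ K.obj a)
  let S : MonoidalCategoryStruct (∫ F) := tensorStructOf obj unit T ass left right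
  let D : @Monoidal.InducingFunctorData A _ _ (∫ F) _ S K :=
    { μIso := c
      εIso := i
      whiskerLeft_eq := fun a _ _ f => by
        refine (hT (𝟙 a) f).trans ?_
        rw [K.map_id, id_tensorHom]
      whiskerRight_eq := fun f a => by
        refine (hT f (𝟙 a)).trans ?_
        rw [K.map_id, MonoidalCategory.tensorHom_id]
      tensorHom_eq := hT
      associator_eq := hass
      leftUnitor_eq := hleft
      rightUnitor_eq := hright }
  have hfaith : K.Faithful := ⟨fun h => (hK _ _).1 h⟩
  -- The monoidal axioms are inherited along the faithful functor `K`. What remains is to identify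
  -- the base components and to check compatibility with cocartesian arrows.
  refine ⟨⟨m, e, T, fun φ ψ => ?_, fun {a a' b b'} φ ψ hφ hψ => ?_, ass, fun a b d => ?_, left,
    fun a => ?_, right, fun a => ?_, ⟨Monoidal.induced K D, rfl⟩⟩, D, hε, hc⟩
  · refine base_eq_of_isHomLift_map w _ ?_
    rw [hT]
    exact isHomLift_conj p (isHomLift_tensorHom p (isHomLift_map_base w φ)
      (isHomLift_map_base w ψ)) (hobj _ _) (hobj _ _)
  -- `K` reflects cocartesian arrows, and the image of the transported tensor is a conjugate of a
  -- tensor of cocartesian arrows of `A`.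
  · rw [← w]
    refine isCocart_of_isCocart_map K p hK _ ?_
    rw [hT]
    rw [← w] at hφ hψ
    exact isCocart_conj p (hp _ _ (isCocart_map_of_bijective K p h₀ hK φ hφ)
      (isCocart_map_of_bijective K p h₀ hK ψ hψ)) (hobj a b) (hobj a' b')
  · refine base_eq_of_isHomLift_map w _ ?_
    rw [hass]
    have h₁ := isHomLift_associator p (hKp a) (hKp b) (hKp d)
    have h₂ := isHomLift_tensorHom p (hid a) (hc b d)
    have h₃ := isHomLift_tensorHom p (hc' a b) (hid d)
    have h₄ := hc a (obj b d)
    have h₅ := hc' (obj a b) d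
    rw [id_tensorHom_id] at h₂ h₃
    exact isHomLift_id_comp p (isHomLift_id_comp p h₅ h₃)
      (isHomLift_comp_id p h₁ (isHomLift_id_comp p h₂ h₄))
  · refine base_eq_of_isHomLift_map w _ ?_
    rw [hleft]
    have h₁ := isHomLift_leftUnitor p (hKp a)
    have h₂ := isHomLift_tensorHom p hε' (hid a)
    rw [id_tensorHom_id] at h₂
    exact isHomLift_id_comp p (isHomLift_id_comp p (hc' unit a) h₂) h₁
  · refine base_eq_of_isHomLift_map w _ ?_
    rw [hright]
    have h₁ := isHomLift_rightUnitor p (hKp a)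
    have h₂ := isHomLift_tensorHom p (hid a) hε'
    rw [id_tensorHom_id] at h₂
    exact isHomLift_id_comp p (isHomLift_id_comp p (hc' a unit) h₂) h₁

end Transport

end Co

end MonGroth

/-! ### The 2-equivalence for opfibrations -/

namespace MonGroth

open scoped Pseudofunctor.CoGrothendieck Pseudofunctor.Grothendieck

namespace Co

variable {X : Type u} [Category.{v} X] [MonoidalCategory X]

theorem exists_monoidalOverHom (M : LaxMonoidalPseudofunctor.{v, u, v, u} X)
    (A : MonoidalOver.{v, u} X) (K : (∫ M.toPs) ⥤ A.based.obj)
    (w : K ⋙ A.based.p = Pseudofunctor.Grothendieck.forget M.toPs) (hK : K.Faithful)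
    (h : letI := tensorStruct M; ∃ D : Monoidal.InducingFunctorData K,
      A.based.p.IsHomLift (𝟙 (𝟙_ X)) D.εIso.hom ∧
        ∀ (a b : ∫ M.toPs), A.based.p.IsHomLift (𝟙 (a.base ⊗ b.base)) (D.μIso a b).hom) :
    ∃ H : MonoidalOverHom (total M) A, H.based = ⟨K, w⟩ := by
  let S := tensorStruct M
  obtain ⟨D, hε, hμ⟩ := h
  let mon := Monoidal.induced K D
  let m : K.CoreMonoidal := Monoidal.fromInducedCoreMonoidal K D
  exact ⟨⟨⟨K, w⟩, m.toMonoidal, hε, hμ⟩, rfl⟩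

/-- The comparison functor of a cleavage becomes a strong monoidal functor for the transported
tensor product. It is bijective on objects and arrows, hence strictly invertible among monoidal
opfibrations. -/
theorem exists_iso_totalObj (A : MonOpFib.{v, u} X) :
    ∃ (M : LaxMonoidalPseudofunctor.{v, u, v, u} X) (i : A ⟶ totalObj M) (j : totalObj M ⟶ A),
      i ≫ j = 𝟙 A ∧ j ≫ i = 𝟙 (totalObj M) := by
  obtain ⟨c⟩ := A.property.1.nonempty_opCleavage
  obtain ⟨t, ht⟩ := exists_fiberedTensor c.fromTotal_comp c.fromTotal_obj_bijective.2
    c.fromTotal_map_bijective A.property.2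
  have hfaith : c.fromTotal.Faithful := ⟨fun h => (c.fromTotal_map_bijective _ _).1 h⟩
  change letI := t.struct; _ at ht
  -- The transported structure is replaced by the equal structure that the lax monoidal
  -- pseudofunctor `t.toLax` induces, so the comparison functor starts at the Grothendieck
  -- construction.
  rw [FiberedTensor.struct, ← t.tensorStruct_toLax] at ht
  obtain ⟨⟨H, m, h₁, h₂⟩, hH⟩ := exists_monoidalOverHom t.toLax A.obj c.fromTotal c.fromTotal_comp hfaith ht
  obtain rfl : H = _ := hH
  let K : SubTwoCategory.Hom (totalObj t.toLax) A :=
    ⟨⟨⟨c.fromTotal, c.fromTotal_comp⟩, m, h₁, h₂⟩, fun φ hφ => by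
      refine isCocart_map_of_bijective c.fromTotal A.obj.based.p c.fromTotal_obj_bijective.2
        c.fromTotal_map_bijective φ ?_
      rw [c.fromTotal_comp]
      exact hφ⟩
  obtain ⟨i, j, h, h'⟩ := exists_inverse_monOpFib K c.fromTotal_obj_bijective
    c.fromTotal_map_bijective
  exact ⟨t.toLax, j, i, h', h⟩

theorem exists_twoEquivalence_restricts : ∃ E : TwoEquivalence (MonOpFib.{v, u} X)
    (LaxMonoidalPseudofunctor.{v, u, v, u} X), Restricts E.inverse := by
  obtain ⟨E, hE⟩ := exists_twoEquivalence (twoFunctor X) (fun A => exists_iso_totalObj A)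
    (fun M N => ⟨totalHom_injective, totalHom_surjective⟩) totalHom₂_bijective
  exact ⟨E, hE ▸ restricts_twoFunctor X⟩

end Co

end MonGroth

/-! ### Inverse forms of the axioms of a lax monoidal pseudofunctor -/

namespace MonGroth

section InverseForms

theorem inv_comp_inv_of_hom {A : Type u₁} [Category.{v₁} A] {a b c d : A} {f : a ⟶ c} {g : b ⟶ d}
    {e : a ≅ b} {e' : c ≅ d} (h : f ≫ e'.hom = e.hom ≫ g) : g ≫ e'.inv = e.inv ≫ f := by
  rw [Iso.comp_inv_eq, Category.assoc, h, Iso.inv_hom_id_assoc]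

theorem hom_comp_hom_of_inv {A : Type u₁} [Category.{v₁} A] {a b c d : A} {f : a ⟶ c} {g : b ⟶ d}
    {e : a ≅ b} {e' : c ≅ d} (h : g ≫ e'.inv = e.inv ≫ f) : f ≫ e'.hom = e.hom ≫ g :=
  inv_comp_inv_of_hom (e := e.symm) (e' := e'.symm) h

theorem inv_eq_inv_of_hom {A : Type u₁} [Category.{v₁} A] {a b : A} {i j : a ≅ b}
    (h : i.hom = j.hom) : i.inv = j.inv := by
  rw [Iso.ext h]

theorem hom_eq_hom_of_inv {A : Type u₁} [Category.{v₁} A] {a b : A} {i j : a ≅ b}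
    (h : i.inv = j.inv) : i.hom = j.hom := inv_eq_inv_of_hom (i := i.symm) (j := j.symm) h

end InverseForms

namespace LaxMonoidalPseudofunctor

variable {C : Type u₁} [Category.{v₁} C] [MonoidalCategory C]
  (M : LaxMonoidalPseudofunctor.{v₁, u₁, v₂, u₂} C)

/-- The isomorphism induced by the laxator. -/
def muIso {x y : C} {a a' : M.toPs.obj ⟨x⟩} {b b' : M.toPs.obj ⟨y⟩} (i : a ≅ a') (j : b ≅ b') :
    (M.mu x y).obj (a, b) ≅ (M.mu x y).obj (a', b') := (M.mu x y).mapIso (i.prod j)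

/-- In `∫ᶜ M` fibre components point into the pulled-back object, so the constraints of `M` enter
through their inverses. This lemma and the next ones invert the axioms once and for all. -/
theorem muMap_natural_inv {x x' y y' : C} (f : x ⟶ x') (g : y ⟶ y') {a a' : M.toPs.obj ⟨x⟩}
    {b b' : M.toPs.obj ⟨y⟩} (k : a ⟶ a') (l : b ⟶ b') :
    (M.mu x' y').map ((push M.toPs f).map k ×ₘ (push M.toPs g).map l) ≫ (M.muMap f g a' b').inv =
      (M.muMap f g a b).inv ≫ (push M.toPs (f ⊗ₘ g)).map ((M.mu x y).map (k ×ₘ l)) :=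
  inv_comp_inv_of_hom (M.muMap_natural f g k l)

theorem muMap_id_inv {x y : C} (a : M.toPs.obj ⟨x⟩) (b : M.toPs.obj ⟨y⟩) :
    (M.mu x y).map ((pushId M.toPs (𝟙 x) rfl a).inv ×ₘ (pushId M.toPs (𝟙 y) rfl b).inv) ≫
        (M.muMap (𝟙 x) (𝟙 y) a b).inv =
      (pushId M.toPs (𝟙 x ⊗ₘ 𝟙 y) (by simp) ((M.mu x y).obj (a, b))).inv :=
  inv_eq_inv_of_hom (i := M.muMap (𝟙 x) (𝟙 y) a b ≪≫ M.muIso (pushId _ _ rfl a) (pushId _ _ rfl b))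
    (M.muMap_id a b)

theorem muMap_comp_inv {x x' x'' y y' y'' : C} (f : x ⟶ x') (f' : x' ⟶ x'') (g : y ⟶ y')
    (g' : y' ⟶ y'') (a : M.toPs.obj ⟨x⟩) (b : M.toPs.obj ⟨y⟩) :
    (M.mu x'' y'').map ((pushComp M.toPs f f' _ rfl a).inv ×ₘ (pushComp M.toPs g g' _ rfl b).inv) ≫
        (M.muMap (f ≫ f') (g ≫ g') a b).inv =
      ((M.muMap f' g' _ _).inv ≫ (push M.toPs (f' ⊗ₘ g')).map (M.muMap f g a b).inv) ≫
        (pushComp M.toPs (f ⊗ₘ g) (f' ⊗ₘ g') ((f ≫ f') ⊗ₘ (g ≫ g')) (by simp)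
          ((M.mu x y).obj (a, b))).inv :=
  inv_eq_inv_of_hom
    (i := M.muMap _ _ a b ≪≫ M.muIso (pushComp _ f f' _ rfl a) (pushComp _ g g' _ rfl b))
    (j := pushComp _ _ _ _ _ _ ≪≫ (push M.toPs _).mapIso (M.muMap f g a b) ≪≫ M.muMap f' g' _ _)
    (M.muMap_comp f f' g g' a b)

theorem omega_natural_inv {x y z : C} {a a' : M.toPs.obj ⟨x⟩} {b b' : M.toPs.obj ⟨y⟩}
    {c c' : M.toPs.obj ⟨z⟩} (k : a ⟶ a') (l : b ⟶ b') (m : c ⟶ c') :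
    (M.mu x (y ⊗ z)).map (k ×ₘ (M.mu y z).map (l ×ₘ m)) ≫ (M.omega a' b' c').inv =
      (M.omega a b c).inv ≫
        (push M.toPs (α_ x y z).hom).map ((M.mu (x ⊗ y) z).map ((M.mu x y).map (k ×ₘ l) ×ₘ m)) :=
  inv_comp_inv_of_hom (M.omega_natural k l m)

/-- Both sides of `omega_modification` underlie composites of isomorphisms, so their inverses agree.
The bracketing is the one that the inverses of those composites have definitionally. -/
theorem omega_modification_inv {x x' y y' z z' : C} (f : x ⟶ x') (g : y ⟶ y') (h : z ⟶ z')
    (a : M.toPs.obj ⟨x⟩) (b : M.toPs.obj ⟨y⟩) (c : M.toPs.obj ⟨z⟩) :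
    ((M.mu x' (y' ⊗ z')).map (𝟙 _ ×ₘ (M.muMap g h b c).inv) ≫ (M.muMap f (g ⊗ₘ h) a _).inv) ≫
        (push M.toPs (f ⊗ₘ (g ⊗ₘ h))).map (M.omega a b c).inv =
      (((M.omega ((push M.toPs f).obj a) ((push M.toPs g).obj b) ((push M.toPs h).obj c)).inv ≫
        (push M.toPs (α_ x' y' z').hom).map
            ((M.mu (x' ⊗ y') z').map ((M.muMap f g a b).inv ×ₘ 𝟙 _) ≫ (M.muMap (f ⊗ₘ g) h _ c).inv)) ≫
          (pushComp M.toPs ((f ⊗ₘ g) ⊗ₘ h) (α_ x' y' z').hom _ (by simp) _).inv) ≫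
            (pushComp M.toPs (α_ x y z).hom (f ⊗ₘ (g ⊗ₘ h)) _ rfl _).hom :=
  inv_eq_inv_of_hom
    (i := (push M.toPs _).mapIso (M.omega a b c) ≪≫ M.muMap f (g ⊗ₘ h) a _ ≪≫
      M.muIso (Iso.refl _) (M.muMap g h b c))
    (j := (pushComp M.toPs (α_ x y z).hom (f ⊗ₘ (g ⊗ₘ h)) _ rfl _).symm ≪≫
      pushComp M.toPs ((f ⊗ₘ g) ⊗ₘ h) (α_ x' y' z').hom _ (by simp) _ ≪≫
        (push M.toPs _).mapIso (M.muMap (f ⊗ₘ g) h _ c ≪≫ M.muIso (M.muMap f g a b) (Iso.refl _)) ≪≫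
          M.omega _ _ _)
    (M.omega_modification f g h a b c)

theorem zeta_natural_inv {x : C} {a a' : M.toPs.obj ⟨x⟩} (k : a ⟶ a') :
    k ≫ (M.zeta a').inv =
      (M.zeta a).inv ≫ (push M.toPs (ρ_ x).hom).map ((M.mu x (𝟙_ C)).map (k ×ₘ 𝟙 M.mu0)) :=
  inv_comp_inv_of_hom (M.zeta_natural k)

theorem zeta_modification_inv {x x' : C} (f : x ⟶ x') (a : M.toPs.obj ⟨x⟩) :
    (push M.toPs f).map (M.zeta a).inv =
      (((M.zeta ((push M.toPs f).obj a)).inv ≫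
        (push M.toPs (ρ_ x').hom).map
            ((M.mu x' (𝟙_ C)).map (𝟙 _ ×ₘ (pushId M.toPs (𝟙 (𝟙_ C)) rfl M.mu0).inv) ≫
              (M.muMap f (𝟙 (𝟙_ C)) a M.mu0).inv)) ≫
          (pushComp M.toPs (f ⊗ₘ 𝟙 (𝟙_ C)) (ρ_ x').hom _ (by simp) _).inv) ≫
            (pushComp M.toPs (ρ_ x).hom f _ rfl _).hom :=
  inv_eq_inv_of_hom (i := (push M.toPs f).mapIso (M.zeta a))
    (j := (pushComp M.toPs (ρ_ x).hom f _ rfl _).symm ≪≫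
      pushComp M.toPs (f ⊗ₘ 𝟙 (𝟙_ C)) (ρ_ x').hom _ (by simp) _ ≪≫
        (push M.toPs _).mapIso (M.muMap f (𝟙 (𝟙_ C)) a M.mu0 ≪≫
          M.muIso (Iso.refl _) (pushId M.toPs (𝟙 (𝟙_ C)) rfl M.mu0)) ≪≫ M.zeta _)
    (M.zeta_modification f a)

theorem xi_natural_inv {x : C} {a a' : M.toPs.obj ⟨x⟩} (k : a ⟶ a') :
    k ≫ (M.xi a').inv =
      (M.xi a).inv ≫ (push M.toPs (λ_ x).hom).map ((M.mu (𝟙_ C) x).map (𝟙 M.mu0 ×ₘ k)) :=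
  inv_comp_inv_of_hom (M.xi_natural k)

theorem xi_modification_inv {x x' : C} (f : x ⟶ x') (a : M.toPs.obj ⟨x⟩) :
    (push M.toPs f).map (M.xi a).inv =
      (((M.xi ((push M.toPs f).obj a)).inv ≫
        (push M.toPs (λ_ x').hom).map
            ((M.mu (𝟙_ C) x').map ((pushId M.toPs (𝟙 (𝟙_ C)) rfl M.mu0).inv ×ₘ 𝟙 _) ≫
              (M.muMap (𝟙 (𝟙_ C)) f M.mu0 a).inv)) ≫
          (pushComp M.toPs (𝟙 (𝟙_ C) ⊗ₘ f) (λ_ x').hom _ (by simp) _).inv) ≫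
            (pushComp M.toPs (λ_ x).hom f _ rfl _).hom :=
  inv_eq_inv_of_hom (i := (push M.toPs f).mapIso (M.xi a))
    (j := (pushComp M.toPs (λ_ x).hom f _ rfl _).symm ≪≫
      pushComp M.toPs (𝟙 (𝟙_ C) ⊗ₘ f) (λ_ x').hom _ (by simp) _ ≪≫
        (push M.toPs _).mapIso (M.muMap (𝟙 (𝟙_ C)) f M.mu0 a ≪≫
          M.muIso (pushId M.toPs (𝟙 (𝟙_ C)) rfl M.mu0) (Iso.refl _)) ≪≫ M.xi _)
    (M.xi_modification f a)

theorem pentagon_inv {w x y z : C} (a : M.toPs.obj ⟨w⟩) (b : M.toPs.obj ⟨x⟩) (c : M.toPs.obj ⟨y⟩)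
    (d : M.toPs.obj ⟨z⟩) :
    ((((((M.mu w _).map ((pushId M.toPs (𝟙 w) rfl a).inv ×ₘ (M.omega b c d).inv) ≫
      (M.muMap (𝟙 w) (α_ x y z).hom a _).inv) ≫
      (push M.toPs (𝟙 w ⊗ₘ (α_ x y z).hom)).map (M.omega a ((M.mu x y).obj (b, c)) d).inv) ≫
      (pushComp M.toPs (α_ w (x ⊗ y) z).hom (𝟙 w ⊗ₘ (α_ x y z).hom) _ rfl _).inv) ≫
      (push M.toPs _).map ((M.mu _ z).map ((M.omega a b c).inv ×ₘ (pushId M.toPs (𝟙 z) rfl d).inv) ≫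
        (M.muMap (α_ w x y).hom (𝟙 z) _ d).inv)) ≫
      (pushComp M.toPs ((α_ w x y).hom ⊗ₘ 𝟙 z) ((α_ w (x ⊗ y) z).hom ≫ (𝟙 w ⊗ₘ (α_ x y z).hom))
        ((α_ (w ⊗ x) y z).hom ≫ (α_ w x (y ⊗ z)).hom) (by simp)
        ((M.mu _ z).obj ((M.mu _ y).obj ((M.mu w x).obj (a, b), c), d))).inv) =
    ((M.omega a b ((M.mu y z).obj (c, d))).inv ≫
      (push M.toPs (α_ w x (y ⊗ z)).hom).map (M.omega ((M.mu w x).obj (a, b)) c d).inv) ≫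
      (pushComp M.toPs (α_ (w ⊗ x) y z).hom (α_ w x (y ⊗ z)).hom _ rfl _).inv :=
  inv_eq_inv_of_hom
    (i := pushComp M.toPs ((α_ w x y).hom ⊗ₘ 𝟙 z) ((α_ w (x ⊗ y) z).hom ≫ (𝟙 w ⊗ₘ (α_ x y z).hom))
        ((α_ (w ⊗ x) y z).hom ≫ (α_ w x (y ⊗ z)).hom) (by simp) _ ≪≫
      (push M.toPs _).mapIso (M.muMap (α_ w x y).hom (𝟙 z) _ d ≪≫
        M.muIso (M.omega a b c) (pushId M.toPs (𝟙 z) rfl d)) ≪≫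
      pushComp M.toPs (α_ w (x ⊗ y) z).hom (𝟙 w ⊗ₘ (α_ x y z).hom) _ rfl _ ≪≫
      (push M.toPs (𝟙 w ⊗ₘ (α_ x y z).hom)).mapIso (M.omega a ((M.mu x y).obj (b, c)) d) ≪≫
      M.muMap (𝟙 w) (α_ x y z).hom a _ ≪≫
      M.muIso (pushId M.toPs (𝟙 w) rfl a) (M.omega b c d))
    (j := pushComp M.toPs (α_ (w ⊗ x) y z).hom (α_ w x (y ⊗ z)).hom _ rfl _ ≪≫
      (push M.toPs (α_ w x (y ⊗ z)).hom).mapIso (M.omega ((M.mu w x).obj (a, b)) c d) ≪≫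
      M.omega a b ((M.mu y z).obj (c, d)))
    (M.pentagon a b c d)

theorem triangle_inv {x y : C} (a : M.toPs.obj ⟨x⟩) (b : M.toPs.obj ⟨y⟩) :
    (((M.mu x y).map ((pushId M.toPs (𝟙 x) rfl a).inv ×ₘ (M.xi b).inv) ≫
      (M.muMap (𝟙 x) (λ_ y).hom a _).inv) ≫
      (push M.toPs (𝟙 x ⊗ₘ (λ_ y).hom)).map (M.omega a M.mu0 b).inv) ≫
      (pushComp M.toPs (α_ x (𝟙_ C) y).hom (𝟙 x ⊗ₘ (λ_ y).hom) ((ρ_ x).hom ⊗ₘ 𝟙 y) (by simp)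
        ((M.mu _ y).obj ((M.mu x _).obj (a, M.mu0), b))).inv =
    (M.mu x y).map ((M.zeta a).inv ×ₘ (pushId M.toPs (𝟙 y) rfl b).inv) ≫
      (M.muMap (ρ_ x).hom (𝟙 y) _ b).inv :=
  inv_eq_inv_of_hom
    (i := pushComp M.toPs (α_ x (𝟙_ C) y).hom (𝟙 x ⊗ₘ (λ_ y).hom) ((ρ_ x).hom ⊗ₘ 𝟙 y) (by simp) _ ≪≫
      (push M.toPs (𝟙 x ⊗ₘ (λ_ y).hom)).mapIso (M.omega a M.mu0 b) ≪≫
      M.muMap (𝟙 x) (λ_ y).hom a _ ≪≫ M.muIso (pushId M.toPs (𝟙 x) rfl a) (M.xi b))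
    (j := M.muMap (ρ_ x).hom (𝟙 y) _ b ≪≫ M.muIso (M.zeta a) (pushId M.toPs (𝟙 y) rfl b))
    (M.triangle a b)

end LaxMonoidalPseudofunctor

end MonGroth

/-! ### The tensor product on the total category of a contravariant lax monoidal pseudofunctor -/

namespace MonGroth

open scoped Pseudofunctor.CoGrothendieck Pseudofunctor.Grothendieck

namespace Contra

section Lifts

variable {X : Type u₁} [Category.{v₁} X] {F G : LocallyDiscrete Xᵒᵖ ⥤ᵖ Cat.{v₂, u₂}}

theorem pushComp_eqToHom (F : LocallyDiscrete Xᵒᵖ ⥤ᵖ Cat.{v₂, u₂}) {x y z : Xᵒᵖ} (f : x ⟶ y)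
    (g : y ⟶ z) (h : x ⟶ z) (w : f ≫ g = h) (a : F.obj ⟨x⟩) :
    (F.mapComp f.toLoc g.toLoc).inv.toNatTrans.app a ≫ eqToHom (by rw [← w]; rfl) =
      (pushComp F f g h w a).inv := by
  subst w
  refine (Category.comp_id _).trans ?_
  exact congr(($((F.mapComp'_eq_mapComp f.toLoc g.toLoc).symm)).inv.toNatTrans.app a)

theorem pushId_inv (F : LocallyDiscrete Xᵒᵖ ⥤ᵖ Cat.{v₂, u₂}) (x : Xᵒᵖ) (a : F.obj ⟨x⟩) :
    (pushId F (𝟙 x) rfl a).inv = (F.mapId ⟨x⟩).inv.toNatTrans.app a := by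
  exact congr(($(F.mapId'_eq_mapId ⟨x⟩)).inv.toNatTrans.app a)

/-- The morphism of `∫ᶜ F` with given components. -/
abbrev hom {x y : Xᵒᵖ} {a : F.obj ⟨x⟩} {b : F.obj ⟨y⟩} (f : y ⟶ x) (k : a ⟶ (push F f).obj b) :
    (⟨x.unop, a⟩ : ∫ᶜ F) ⟶ ⟨y.unop, b⟩ := ⟨f.unop, k⟩

/-- Base objects and arrows are taken in `Xᵒᵖ`, where the pseudofunctor and its monoidal structure
live, so composition is reversed in the condition on `h`. The composition constraint occurs through
its inverse. -/
theorem hom_comp_hom {x y z : Xᵒᵖ} {a : F.obj ⟨x⟩} {b : F.obj ⟨y⟩} {c : F.obj ⟨z⟩} (f : y ⟶ x)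
    (k : a ⟶ (push F f).obj b) (g : z ⟶ y) (l : b ⟶ (push F g).obj c) (h : z ⟶ x)
    (w : g ≫ f = h) :
    hom f k ≫ hom g l = hom h (k ≫ (push F f).map l ≫ (pushComp F g f h w c).inv) := by
  subst w
  refine Pseudofunctor.CoGrothendieck.Hom.ext _ _ rfl ?_
  refine Eq.trans ?_ (Category.comp_id _).symm
  refine Eq.trans ?_ (congrArg (fun t => k ≫ (push F f).map l ≫ t) (pushComp_eqToHom F g f _ rfl c))
  exact (_ ≫= (_ ≫= (Category.comp_id _))).symm

theorem id_eq_hom (x : Xᵒᵖ) (a : F.obj ⟨x⟩) (f : x ⟶ x) (w : f = 𝟙 x) :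
    𝟙 (⟨x.unop, a⟩ : ∫ᶜ F) = hom f (pushId F f w a).inv := by
  subst w
  exact Pseudofunctor.CoGrothendieck.Hom.ext _ _ rfl
    ((pushId_inv F x a).symm.trans (Category.comp_id _).symm)

theorem vert_eq_hom {x : Xᵒᵖ} {a b : F.obj ⟨x⟩} (k : a ⟶ b) (f : x ⟶ x) (w : f = 𝟙 x) :
    vert k = hom f (k ≫ (pushId F f w b).inv) := by
  subst w
  exact Pseudofunctor.CoGrothendieck.Hom.ext _ _ rfl
    ((congrArg (k ≫ ·) (pushId_inv F x b).symm).trans (Category.comp_id _).symm)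

/-- The cartesian lift of `f`. -/
abbrev lift (F : LocallyDiscrete Xᵒᵖ ⥤ᵖ Cat.{v₂, u₂}) {x y : Xᵒᵖ} (f : y ⟶ x) (b : F.obj ⟨y⟩) :
    (⟨x.unop, (push F f).obj b⟩ : ∫ᶜ F) ⟶ ⟨y.unop, b⟩ := ⟨f.unop, 𝟙 _⟩

theorem vert_comp_lift {x y : Xᵒᵖ} (f : y ⟶ x) {a : F.obj ⟨x⟩} (b : F.obj ⟨y⟩)
    (k : a ⟶ (push F f).obj b) : (vert k : (⟨x.unop, a⟩ : ∫ᶜ F) ⟶ _) ≫ lift F f b = hom f k :=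
  (vert_comp _ _).trans (congrArg (hom f) (Category.comp_id _))

theorem vert_comp_hom {x y : Xᵒᵖ} {a c : F.obj ⟨x⟩} {b : F.obj ⟨y⟩} (k : a ⟶ c) (f : y ⟶ x)
    (l : c ⟶ (push F f).obj b) :
    (vert k : (⟨x.unop, a⟩ : ∫ᶜ F) ⟶ ⟨x.unop, c⟩) ≫ hom f l = hom f (k ≫ l) :=
  vert_comp _ _

theorem hom_comp_vert {x y : Xᵒᵖ} {a : F.obj ⟨x⟩} {b c : F.obj ⟨y⟩} (f : y ⟶ x)
    (k : a ⟶ (push F f).obj b) (l : b ⟶ c) :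
    hom f k ≫ (vert l : (⟨y.unop, b⟩ : ∫ᶜ F) ⟶ ⟨y.unop, c⟩) = hom f (k ≫ (push F f).map l) :=
  comp_vert _ _

theorem hom_injective {x y : Xᵒᵖ} {a : F.obj ⟨x⟩} {b : F.obj ⟨y⟩} {f : y ⟶ x}
    {k l : a ⟶ (push F f).obj b} (h : hom f k = hom f l) : k = l := by
  injection h

theorem vert_injective {x : Xᵒᵖ} {a b : F.obj ⟨x⟩} {k l : a ⟶ b} (h : vert k = vert l) : k = l := by
  rw [vert_eq_hom k _ rfl, vert_eq_hom l _ rfl] at h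
  exact (cancel_mono _).1 (hom_injective h)

end Lifts

section Tensor

variable {X : Type u₁} [Category.{v₁} X] [MonoidalCategory X]
  (M : LaxMonoidalPseudofunctor.{v₁, u₁, v₂, u₂} Xᵒᵖ)

theorem tensorHom_hom {x x' y y' : Xᵒᵖ} {a : M.toPs.obj ⟨x⟩} {a' : M.toPs.obj ⟨x'⟩}
    {b : M.toPs.obj ⟨y⟩} {b' : M.toPs.obj ⟨y'⟩} (f : x' ⟶ x) (k : a ⟶ (push M.toPs f).obj a')
    (g : y' ⟶ y) (l : b ⟶ (push M.toPs g).obj b') :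
    tensorHom M (hom f k) (hom g l) =
      hom (f ⊗ₘ g) ((M.mu x y).map (k ×ₘ l) ≫ (M.muMap f g a' b').inv) := rfl

theorem tensorHom_id (A B : ∫ᶜ M.toPs) : tensorHom M (𝟙 A) (𝟙 B) = 𝟙 (tensorObj M A B) := by
  obtain ⟨x, a⟩ := A
  obtain ⟨y, b⟩ := B
  refine (congrArg₂ (tensorHom M) (id_eq_hom (op x) a _ rfl) (id_eq_hom (op y) b _ rfl)).trans ?_
  refine (congrArg (hom _) (M.muMap_id_inv a b)).trans ?_
  exact (id_eq_hom (op x ⊗ op y) _ _ _).symm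

theorem tensorHom_comp {A A' A'' B B' B'' : ∫ᶜ M.toPs} (f : A ⟶ A') (f' : A' ⟶ A'') (g : B ⟶ B')
    (g' : B' ⟶ B'') :
    tensorHom M f g ≫ tensorHom M f' g' = tensorHom M (f ≫ f') (g ≫ g') := by
  -- The claim is restated with base objects and arrows in `Xᵒᵖ`, so that the axioms of `M` apply
  -- literally.
  suffices ∀ {x x' x'' y y' y'' : Xᵒᵖ} {a : M.toPs.obj ⟨x⟩} {a' : M.toPs.obj ⟨x'⟩}
      {a'' : M.toPs.obj ⟨x''⟩} {b : M.toPs.obj ⟨y⟩} {b' : M.toPs.obj ⟨y'⟩} {b'' : M.toPs.obj ⟨y''⟩}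
      (f : x' ⟶ x) (k : a ⟶ (push M.toPs f).obj a') (f' : x'' ⟶ x')
      (k' : a' ⟶ (push M.toPs f').obj a'') (g : y' ⟶ y) (l : b ⟶ (push M.toPs g).obj b')
      (g' : y'' ⟶ y') (l' : b' ⟶ (push M.toPs g').obj b''),
      tensorHom M (hom f k) (hom g l) ≫ tensorHom M (hom f' k') (hom g' l') =
        tensorHom M (hom f k ≫ hom f' k') (hom g l ≫ hom g' l') from
    this f.base.op f.fiber f'.base.op f'.fiber g.base.op g.fiber g'.base.op g'.fiber
  intro x x' x'' y y' y'' a a' a'' b b' b'' f k f' k' g l g' l'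
  refine (hom_comp_hom _ _ _ _ ((f' ≫ f) ⊗ₘ (g' ≫ g))
    (MonoidalCategory.tensorHom_comp_tensorHom _ _ _ _)).trans ?_
  refine Eq.trans ?_ (congrArg₂ (tensorHom M) (hom_comp_hom f k f' k' _ rfl)
    (hom_comp_hom g l g' l' _ rfl)).symm
  rw [tensorHom_hom]
  refine congrArg (hom _) ?_
  have e : (M.mu x y).map ((k ≫ (push M.toPs f).map k' ≫ (pushComp M.toPs f' f _ rfl a'').inv) ×ₘ
      (l ≫ (push M.toPs g).map l' ≫ (pushComp M.toPs g' g _ rfl b'').inv)) =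
      (M.mu x y).map (k ×ₘ l) ≫
      (M.mu x y).map ((push M.toPs f).map k' ×ₘ (push M.toPs g).map l') ≫ (M.mu x y).map
      ((pushComp M.toPs f' f _ rfl a'').inv ×ₘ (pushComp M.toPs g' g _ rfl b'').inv) := by
    rw [← Functor.map_comp, ← Functor.map_comp]; rfl
  change ((M.mu x y).map (k ×ₘ l) ≫ (M.muMap f g a' b').inv) ≫
    (push M.toPs (f ⊗ₘ g)).map ((M.mu x' y').map (k' ×ₘ l') ≫ (M.muMap f' g' a'' b'').inv) ≫
      (pushComp M.toPs (f' ⊗ₘ g') (f ⊗ₘ g) _ _ _).inv = _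
  have E := M.muMap_comp_inv f' f g' g a'' b''
  rw [Category.assoc] at E
  rw [e, Category.assoc, Category.assoc, Category.assoc, E, Functor.map_comp, Category.assoc,
    reassoc_of% M.muMap_natural_inv]

/-- The tensor product of isomorphisms of `∫ᶜ M`. -/
def tensorIso {A A' B B' : ∫ᶜ M.toPs} (i : A ≅ A') (j : B ≅ B') :
    tensorObj M A B ≅ tensorObj M A' B' where
  hom := tensorHom M i.hom j.hom
  inv := tensorHom M i.inv j.inv
  hom_inv_id := by rw [tensorHom_comp, i.hom_inv_id, j.hom_inv_id, tensorHom_id]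
  inv_hom_id := by rw [tensorHom_comp, i.inv_hom_id, j.inv_hom_id, tensorHom_id]

/-- The associator of `∫ᶜ M` is defined through its inverse, whose fibre component is `omega.inv`;
naturality is therefore computed for the inverse and then inverted. The unitors and the coherence
axioms follow the same pattern. -/
theorem associator_naturality_inv {x x' y y' z z' : Xᵒᵖ} {a : M.toPs.obj ⟨x⟩} {a' : M.toPs.obj ⟨x'⟩}
    {b : M.toPs.obj ⟨y⟩} {b' : M.toPs.obj ⟨y'⟩} {d : M.toPs.obj ⟨z⟩} {d' : M.toPs.obj ⟨z'⟩}
    (f : x' ⟶ x) (k : a ⟶ (push M.toPs f).obj a') (g : y' ⟶ y)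
    (l : b ⟶ (push M.toPs g).obj b') (h : z' ⟶ z) (m : d ⟶ (push M.toPs h).obj d') :
    tensorHom M (hom f k) (tensorHom M (hom g l) (hom h m)) ≫
        ((tensorStruct M).associator ⟨x'.unop, a'⟩ ⟨y'.unop, b'⟩ ⟨z'.unop, d'⟩).inv =
      ((tensorStruct M).associator ⟨x.unop, a⟩ ⟨y.unop, b⟩ ⟨z.unop, d⟩).inv ≫
        tensorHom M (tensorHom M (hom f k) (hom g l)) (hom h m) := by
  refine (hom_comp_hom _ _ _ _ ((α_ x' y' z').hom ≫ (f ⊗ₘ (g ⊗ₘ h))) rfl).trans ?_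
  refine Eq.trans ?_ (hom_comp_hom _ _ _ _ _
    (MonoidalCategory.associator_naturality f g h)).symm
  refine congrArg (hom _) ?_
  have e : (M.mu x (y ⊗ z)).map (k ×ₘ ((M.mu y z).map (l ×ₘ m) ≫ (M.muMap g h b' d').inv)) =
      (M.mu x (y ⊗ z)).map (k ×ₘ (M.mu y z).map (l ×ₘ m)) ≫
        (M.mu x (y ⊗ z)).map (𝟙 _ ×ₘ (M.muMap g h b' d').inv) := by
    rw [← Functor.map_comp]; simp
  have e' : (M.mu (x ⊗ y) z).map (((M.mu x y).map (k ×ₘ l) ≫ (M.muMap f g a' b').inv) ×ₘ m) =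
      (M.mu (x ⊗ y) z).map ((M.mu x y).map (k ×ₘ l) ×ₘ m) ≫
        (M.mu (x ⊗ y) z).map ((M.muMap f g a' b').inv ×ₘ 𝟙 _) := by
    rw [← Functor.map_comp]; simp
  change ((M.mu x (y ⊗ z)).map (k ×ₘ ((M.mu y z).map (l ×ₘ m) ≫ (M.muMap g h b' d').inv)) ≫
      (M.muMap f (g ⊗ₘ h) a' _).inv) ≫ (push M.toPs (f ⊗ₘ (g ⊗ₘ h))).map (M.omega a' b' d').inv ≫
        (pushComp M.toPs (α_ x' y' z').hom (f ⊗ₘ (g ⊗ₘ h)) _ rfl _).inv =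
    (M.omega a b d).inv ≫ (push M.toPs (α_ x y z).hom).map
      ((M.mu (x ⊗ y) z).map (((M.mu x y).map (k ×ₘ l) ≫ (M.muMap f g a' b').inv) ×ₘ m) ≫
        (M.muMap (f ⊗ₘ g) h _ d').inv) ≫
          (pushComp M.toPs ((f ⊗ₘ g) ⊗ₘ h) (α_ x y z).hom _ _ _).inv
  have E := M.omega_modification_inv f g h a' b' d'
  simp only [Category.assoc, Functor.map_comp] at E
  rw [e, e']
  simp only [Category.assoc, Functor.map_comp]
  rw [reassoc_of% E, Iso.hom_inv_id, Category.comp_id, reassoc_of% M.omega_natural_inv]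

theorem associator_naturality {A A' B B' D D' : ∫ᶜ M.toPs} (f : A ⟶ A') (g : B ⟶ B') (h : D ⟶ D') :
    tensorHom M (tensorHom M f g) h ≫ ((tensorStruct M).associator A' B' D').hom =
      ((tensorStruct M).associator A B D).hom ≫ tensorHom M f (tensorHom M g h) :=
  hom_comp_hom_of_inv (associator_naturality_inv M f.base.op f.fiber g.base.op g.fiber
    h.base.op h.fiber)

theorem leftUnitor_naturality_inv {x x' : Xᵒᵖ} {a : M.toPs.obj ⟨x⟩} {a' : M.toPs.obj ⟨x'⟩}
    (f : x' ⟶ x) (k : a ⟶ (push M.toPs f).obj a') :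
    hom f k ≫ ((tensorStruct M).leftUnitor ⟨x'.unop, a'⟩).inv =
      ((tensorStruct M).leftUnitor ⟨x.unop, a⟩).inv ≫
        tensorHom M (𝟙 (tensorUnit M)) (hom f k) := by
  refine Eq.trans ?_ (congrArg (fun t => _ ≫ tensorHom M t (hom f k))
    (id_eq_hom (𝟙_ Xᵒᵖ) M.mu0 _ rfl).symm)
  refine (hom_comp_hom _ _ _ _ ((λ_ x').hom ≫ f) rfl).trans ?_
  refine Eq.trans ?_ (hom_comp_hom _ _ _ _ _
    (show (𝟙 (𝟙_ Xᵒᵖ) ⊗ₘ f) ≫ (λ_ x).hom = (λ_ x').hom ≫ f by simp)).symm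
  refine congrArg (hom _) ?_
  have e : (M.mu (𝟙_ Xᵒᵖ) x).map ((pushId M.toPs (𝟙 (𝟙_ Xᵒᵖ)) rfl M.mu0).inv ×ₘ k) =
      (M.mu (𝟙_ Xᵒᵖ) x).map (𝟙 _ ×ₘ k) ≫
        (M.mu (𝟙_ Xᵒᵖ) x).map ((pushId M.toPs (𝟙 (𝟙_ Xᵒᵖ)) rfl M.mu0).inv ×ₘ 𝟙 _) := by
    rw [← Functor.map_comp]; simp
  change k ≫ (push M.toPs f).map (M.xi a').inv ≫ (pushComp M.toPs (λ_ x').hom f _ rfl _).inv =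
    (M.xi a).inv ≫ (push M.toPs (λ_ x).hom).map
      ((M.mu (𝟙_ Xᵒᵖ) x).map ((pushId M.toPs (𝟙 (𝟙_ Xᵒᵖ)) rfl M.mu0).inv ×ₘ k) ≫
        (M.muMap (𝟙 (𝟙_ Xᵒᵖ)) f M.mu0 a').inv) ≫
          (pushComp M.toPs (𝟙 (𝟙_ Xᵒᵖ) ⊗ₘ f) (λ_ x).hom _ _ _).inv
  rw [e, M.xi_modification_inv]
  simp only [Functor.map_comp, Category.assoc, Iso.hom_inv_id, Category.comp_id]
  rw [reassoc_of% M.xi_natural_inv]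

theorem leftUnitor_naturality {A A' : ∫ᶜ M.toPs} (f : A ⟶ A') :
    tensorHom M (𝟙 (tensorUnit M)) f ≫ ((tensorStruct M).leftUnitor A').hom =
      ((tensorStruct M).leftUnitor A).hom ≫ f :=
  hom_comp_hom_of_inv (leftUnitor_naturality_inv M f.base.op f.fiber)

theorem rightUnitor_naturality_inv {x x' : Xᵒᵖ} {a : M.toPs.obj ⟨x⟩} {a' : M.toPs.obj ⟨x'⟩}
    (f : x' ⟶ x) (k : a ⟶ (push M.toPs f).obj a') :
    hom f k ≫ ((tensorStruct M).rightUnitor ⟨x'.unop, a'⟩).inv =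
      ((tensorStruct M).rightUnitor ⟨x.unop, a⟩).inv ≫
        tensorHom M (hom f k) (𝟙 (tensorUnit M)) := by
  refine Eq.trans ?_ (congrArg (fun t => _ ≫ tensorHom M (hom f k) t)
    (id_eq_hom (𝟙_ Xᵒᵖ) M.mu0 _ rfl).symm)
  refine (hom_comp_hom _ _ _ _ ((ρ_ x').hom ≫ f) rfl).trans ?_
  refine Eq.trans ?_ (hom_comp_hom _ _ _ _ _
    (show (f ⊗ₘ 𝟙 (𝟙_ Xᵒᵖ)) ≫ (ρ_ x).hom = (ρ_ x').hom ≫ f by simp)).symm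
  refine congrArg (hom _) ?_
  have e : (M.mu x (𝟙_ Xᵒᵖ)).map (k ×ₘ (pushId M.toPs (𝟙 (𝟙_ Xᵒᵖ)) rfl M.mu0).inv) =
      (M.mu x (𝟙_ Xᵒᵖ)).map (k ×ₘ 𝟙 _) ≫
        (M.mu x (𝟙_ Xᵒᵖ)).map (𝟙 _ ×ₘ (pushId M.toPs (𝟙 (𝟙_ Xᵒᵖ)) rfl M.mu0).inv) := by
    rw [← Functor.map_comp]; simp
  change k ≫ (push M.toPs f).map (M.zeta a').inv ≫ (pushComp M.toPs (ρ_ x').hom f _ rfl _).inv =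
    (M.zeta a).inv ≫ (push M.toPs (ρ_ x).hom).map
      ((M.mu x (𝟙_ Xᵒᵖ)).map (k ×ₘ (pushId M.toPs (𝟙 (𝟙_ Xᵒᵖ)) rfl M.mu0).inv) ≫
        (M.muMap f (𝟙 (𝟙_ Xᵒᵖ)) a' M.mu0).inv) ≫
          (pushComp M.toPs (f ⊗ₘ 𝟙 (𝟙_ Xᵒᵖ)) (ρ_ x).hom _ _ _).inv
  rw [e, M.zeta_modification_inv]
  simp only [Functor.map_comp, Category.assoc, Iso.hom_inv_id, Category.comp_id]
  rw [reassoc_of% M.zeta_natural_inv]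

theorem rightUnitor_naturality {A A' : ∫ᶜ M.toPs} (f : A ⟶ A') :
    tensorHom M f (𝟙 (tensorUnit M)) ≫ ((tensorStruct M).rightUnitor A').hom =
      ((tensorStruct M).rightUnitor A).hom ≫ f :=
  hom_comp_hom_of_inv (rightUnitor_naturality_inv M f.base.op f.fiber)

theorem pentagon_inv {w x y z : Xᵒᵖ} (a : M.toPs.obj ⟨w⟩) (b : M.toPs.obj ⟨x⟩)
    (c : M.toPs.obj ⟨y⟩) (d : M.toPs.obj ⟨z⟩) :
    (tensorHom M (𝟙 ⟨w.unop, a⟩)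
          ((tensorStruct M).associator ⟨x.unop, b⟩ ⟨y.unop, c⟩ ⟨z.unop, d⟩).inv ≫
        ((tensorStruct M).associator ⟨w.unop, a⟩ (tensorObj M ⟨x.unop, b⟩ ⟨y.unop, c⟩)
          ⟨z.unop, d⟩).inv) ≫
          tensorHom M ((tensorStruct M).associator ⟨w.unop, a⟩ ⟨x.unop, b⟩ ⟨y.unop, c⟩).inv
            (𝟙 ⟨z.unop, d⟩) =
      ((tensorStruct M).associator ⟨w.unop, a⟩ ⟨x.unop, b⟩
          (tensorObj M ⟨y.unop, c⟩ ⟨z.unop, d⟩)).inv ≫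
        ((tensorStruct M).associator (tensorObj M ⟨w.unop, a⟩ ⟨x.unop, b⟩)
          ⟨y.unop, c⟩ ⟨z.unop, d⟩).inv := by
  have e₁ : tensorHom M ((tensorStruct M).associator ⟨w.unop, a⟩ ⟨x.unop, b⟩ ⟨y.unop, c⟩).inv
        (𝟙 ⟨z.unop, d⟩) =
      hom ((α_ w x y).hom ⊗ₘ 𝟙 z)
        ((M.mu _ z).map ((M.omega a b c).inv ×ₘ (pushId M.toPs (𝟙 z) rfl d).inv) ≫
          (M.muMap (α_ w x y).hom (𝟙 z) _ d).inv) :=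
    congrArg (fun t => tensorHom M
      ((tensorStruct M).associator ⟨w.unop, a⟩ ⟨x.unop, b⟩ ⟨y.unop, c⟩).inv t) (id_eq_hom z d _ rfl)
  have e₂ : tensorHom M (𝟙 ⟨w.unop, a⟩)
        ((tensorStruct M).associator ⟨x.unop, b⟩ ⟨y.unop, c⟩ ⟨z.unop, d⟩).inv =
      hom (𝟙 w ⊗ₘ (α_ x y z).hom)
        ((M.mu w _).map ((pushId M.toPs (𝟙 w) rfl a).inv ×ₘ (M.omega b c d).inv) ≫
          (M.muMap (𝟙 w) (α_ x y z).hom a _).inv) :=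
    congrArg (fun t => tensorHom M t
      ((tensorStruct M).associator ⟨x.unop, b⟩ ⟨y.unop, c⟩ ⟨z.unop, d⟩).inv) (id_eq_hom w a _ rfl)
  rw [e₁, e₂]
  refine (hom_comp_hom _ _ _ _ _ rfl =≫ _).trans ?_
  refine (hom_comp_hom _ _ _ _ ((α_ (w ⊗ x) y z).hom ≫ (α_ w x (y ⊗ z)).hom)
    (show ((α_ w x y).hom ⊗ₘ 𝟙 z) ≫ (α_ w (x ⊗ y) z).hom ≫ (𝟙 w ⊗ₘ (α_ x y z).hom) = _ by
      simp)).trans ?_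
  refine Eq.trans ?_ (hom_comp_hom _ _ _ _ _ rfl).symm
  refine congrArg (hom _) ?_
  have E := M.pentagon_inv a b c d
  refine Eq.trans ?_ (E.trans (Category.assoc _ _ _))
  refine Eq.trans ?_ (Category.assoc _ _ _).symm
  refine Eq.trans ?_ ((Category.assoc _ _ _).symm =≫ _)
  rfl

theorem pentagon (A B D E : ∫ᶜ M.toPs) :
    tensorHom M ((tensorStruct M).associator A B D).hom (𝟙 E) ≫
        ((tensorStruct M).associator A (tensorObj M B D) E).hom ≫
          tensorHom M (𝟙 A) ((tensorStruct M).associator B D E).hom =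
      ((tensorStruct M).associator (tensorObj M A B) D E).hom ≫
        ((tensorStruct M).associator A B (tensorObj M D E)).hom :=
  hom_eq_hom_of_inv
    (i := tensorIso M ((tensorStruct M).associator A B D) (Iso.refl E) ≪≫
      (tensorStruct M).associator A (tensorObj M B D) E ≪≫
        tensorIso M (Iso.refl A) ((tensorStruct M).associator B D E))
    (j := (tensorStruct M).associator (tensorObj M A B) D E ≪≫
      (tensorStruct M).associator A B (tensorObj M D E))
    (pentagon_inv M A.fiber B.fiber D.fiber E.fiber)

theorem triangle_inv {x y : Xᵒᵖ} (a : M.toPs.obj ⟨x⟩) (b : M.toPs.obj ⟨y⟩) :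
    tensorHom M (𝟙 ⟨x.unop, a⟩) ((tensorStruct M).leftUnitor ⟨y.unop, b⟩).inv ≫
        ((tensorStruct M).associator ⟨x.unop, a⟩ (tensorUnit M) ⟨y.unop, b⟩).inv =
      tensorHom M ((tensorStruct M).rightUnitor ⟨x.unop, a⟩).inv (𝟙 ⟨y.unop, b⟩) := by
  have e₁ : tensorHom M (𝟙 ⟨x.unop, a⟩) ((tensorStruct M).leftUnitor ⟨y.unop, b⟩).inv =
      hom (𝟙 x ⊗ₘ (λ_ y).hom)
      ((M.mu x y).map ((pushId M.toPs (𝟙 x) rfl a).inv ×ₘ (M.xi b).inv) ≫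
        (M.muMap (𝟙 x) (λ_ y).hom a _).inv) :=
    congrArg (fun t => tensorHom M t ((tensorStruct M).leftUnitor ⟨y.unop, b⟩).inv)
      (id_eq_hom x a _ rfl)
  have e₂ : tensorHom M ((tensorStruct M).rightUnitor ⟨x.unop, a⟩).inv (𝟙 ⟨y.unop, b⟩) =
      hom ((ρ_ x).hom ⊗ₘ 𝟙 y)
      ((M.mu x y).map ((M.zeta a).inv ×ₘ (pushId M.toPs (𝟙 y) rfl b).inv) ≫
        (M.muMap (ρ_ x).hom (𝟙 y) _ b).inv) :=
    congrArg (fun t => tensorHom M ((tensorStruct M).rightUnitor ⟨x.unop, a⟩).inv t)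
      (id_eq_hom y b _ rfl)
  rw [e₁, e₂]
  refine (hom_comp_hom _ _ _ _ ((ρ_ x).hom ⊗ₘ 𝟙 y)
    (show (α_ x (𝟙_ Xᵒᵖ) y).hom ≫ (𝟙 x ⊗ₘ (λ_ y).hom) = _ by simp)).trans ?_
  refine congrArg (hom _) (Eq.trans ?_ (M.triangle_inv a b))
  exact (Category.assoc _ _ _).symm

theorem triangle (A B : ∫ᶜ M.toPs) :
    ((tensorStruct M).associator A (tensorUnit M) B).hom ≫
        tensorHom M (𝟙 A) ((tensorStruct M).leftUnitor B).hom =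
      tensorHom M ((tensorStruct M).rightUnitor A).hom (𝟙 B) :=
  hom_eq_hom_of_inv
    (i := (tensorStruct M).associator A (tensorUnit M) B ≪≫
      tensorIso M (Iso.refl A) ((tensorStruct M).leftUnitor B))
    (j := tensorIso M ((tensorStruct M).rightUnitor A) (Iso.refl B))
    (triangle_inv M A.fiber B.fiber)

theorem isMonoidalStruct : IsMonoidalStruct (tensorStruct M) :=
  ⟨{ toMonoidalCategoryStruct := tensorStruct M
     tensorHom_def := fun f g => by
       refine Eq.trans ?_ (tensorHom_comp M _ _ _ _).symm
       rw [Category.comp_id, Category.id_comp]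
       rfl
     id_tensorHom_id := tensorHom_id M
     tensorHom_comp_tensorHom := fun f g f' g' => tensorHom_comp M f f' g g'
     whiskerLeft_id := tensorHom_id M
     id_whiskerRight := tensorHom_id M
     associator_naturality := associator_naturality M
     leftUnitor_naturality := leftUnitor_naturality M
     rightUnitor_naturality := rightUnitor_naturality M
     pentagon := pentagon M
     triangle := triangle M }, rfl⟩

/-- The forward constraints are known only as inverses of explicit arrows; applying the forgetful
functor to the isomorphism recovers their base components. -/
theorem forget_map_hom_eq {A B : ∫ᶜ M.toPs} (i : A ≅ B) (e : A.base ≅ B.base)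
    (h : i.inv.base = e.inv) : i.hom.base = e.hom :=
  hom_eq_hom_of_inv (i := (Pseudofunctor.CoGrothendieck.forget M.toPs).mapIso i) (j := e) h

theorem isStrictMonoidal : @IsStrictMonoidal _ _ (monoidalOfStruct _ (isMonoidalStruct M)) X _ _
    (Pseudofunctor.CoGrothendieck.forget M.toPs) :=
  letI := monoidalOfStruct _ (isMonoidalStruct M)
  { obj_unit := rfl
    obj_tensor := fun _ _ => rfl
    map_tensor := fun _ _ => ((Category.id_comp _).trans (Category.comp_id _)).symm
    map_associator := fun A B D =>
      (forget_map_hom_eq M ((tensorStruct M).associator A B D) (α_ A.base B.base D.base) rfl).trans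
        ((Category.id_comp _).trans (Category.comp_id _)).symm
    map_leftUnitor := fun A =>
      (forget_map_hom_eq M ((tensorStruct M).leftUnitor A) (λ_ A.base) rfl).trans
        (Category.id_comp _).symm
    map_rightUnitor := fun A =>
      (forget_map_hom_eq M ((tensorStruct M).rightUnitor A) (ρ_ A.base) rfl).trans
        (Category.id_comp _).symm }

end Tensor

end Contra

end MonGroth

/-! ### Cartesian morphisms and the Grothendieck 2-functor, contravariant case -/

namespace MonGroth

open scoped Pseudofunctor.CoGrothendieck Pseudofunctor.Grothendieck

/-- Converts the axioms of a monoidal transformation, written with forward constraints of the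
pseudofunctors, to the form in which they appear as fibre components in `∫ᶜ`. Being an equivalence,
it serves both the construction of monoidal functors and the reverse passage. -/
theorem comp_inv_comp_hom_eq_iff {A : Type u₁} [Category.{v₁} A] {a b c d e : A} (B : c ≅ b)
    (C : c ≅ d) (D : a ≅ e) {p : a ⟶ b} {q : e ⟶ d} :
    p ≫ B.inv ≫ C.hom = D.hom ≫ q ↔ D.inv ≫ p = q ≫ C.inv ≫ B.hom := by
  rw [Iso.inv_comp_eq, ← Category.assoc, ← Iso.eq_comp_inv, Iso.comp_inv_eq]
  simp only [Category.assoc]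

namespace Contra

section Cartesian

variable {X : Type u₁} [Category.{v₁} X] {F G : LocallyDiscrete Xᵒᵖ ⥤ᵖ Cat.{v₂, u₂}}

theorem base_eq_of_isHomLift {A B : ∫ᶜ F} {f : A.base ⟶ B.base} (φ : A ⟶ B)
    (h : (Pseudofunctor.CoGrothendieck.forget F).IsHomLift f φ) : φ.base = f :=
  (@IsHomLift.eq_of_isHomLift _ _ _ _ (Pseudofunctor.CoGrothendieck.forget F) A B f φ h).symm

theorem exists_hom_of_isHomLift {x y : Xᵒᵖ} {a : F.obj ⟨x⟩} {b : F.obj ⟨y⟩} {f : y ⟶ x}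
    (φ : (⟨x.unop, a⟩ : ∫ᶜ F) ⟶ ⟨y.unop, b⟩)
    (h : (Pseudofunctor.CoGrothendieck.forget F).IsHomLift f.unop φ) : ∃ k, φ = hom f k := by
  obtain ⟨g, k⟩ := φ
  obtain rfl : g = f.unop := base_eq_of_isHomLift _ h
  exact ⟨k, rfl⟩

theorem exists_vert_of_isHomLift {x : Xᵒᵖ} {a b : F.obj ⟨x⟩}
    (φ : (⟨x.unop, a⟩ : ∫ᶜ F) ⟶ ⟨x.unop, b⟩)
    (h : (Pseudofunctor.CoGrothendieck.forget F).IsHomLift (𝟙 x.unop) φ) :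
    ∃ k : a ⟶ b, φ = vert k := by
  obtain ⟨k, rfl⟩ := exists_hom_of_isHomLift (f := 𝟙 x) φ h
  refine ⟨k ≫ (pushId F (𝟙 x) rfl b).hom, ?_⟩
  refine Eq.trans ?_ (vert_eq_hom _ _ rfl).symm
  rw [Category.assoc, Iso.hom_inv_id, Category.comp_id]

theorem vert_isHomLift {x : Xᵒᵖ} {a b : F.obj ⟨x⟩} (k : a ⟶ b) :
    (Pseudofunctor.CoGrothendieck.forget F).IsHomLift (𝟙 x.unop) (vert k) :=
  IsHomLift.map (Pseudofunctor.CoGrothendieck.forget F) (vert k)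

/-- The isomorphism of `∫ᶜ F` given by an isomorphism of the fibre. -/
def vertIso {x : Xᵒᵖ} {a b : F.obj ⟨x⟩} (k : a ≅ b) : (⟨x.unop, a⟩ : ∫ᶜ F) ≅ ⟨x.unop, b⟩ where
  hom := vert k.hom
  inv := vert k.inv
  hom_inv_id := by rw [vert_vert, k.hom_inv_id, vert_id]
  inv_hom_id := by rw [vert_vert, k.inv_hom_id, vert_id]

theorem isIso_of_isIso_vert {x : Xᵒᵖ} {a b : F.obj ⟨x⟩} (k : a ⟶ b)
    (h : IsIso (vert k : (⟨x.unop, a⟩ : ∫ᶜ F) ⟶ ⟨x.unop, b⟩)) : IsIso k := by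
  have : (Pseudofunctor.CoGrothendieck.forget F).IsHomLift (𝟙 x.unop) (asIso (vert k)).hom :=
    vert_isHomLift k
  have e : (Pseudofunctor.CoGrothendieck.forget F).IsHomLift (𝟙 x.unop) (asIso (vert k)).inv :=
    IsHomLift.lift_id_inv (Pseudofunctor.CoGrothendieck.forget F) x.unop (asIso (vert k))
  obtain ⟨l, hl⟩ := exists_vert_of_isHomLift _ e
  refine ⟨l, vert_injective ?_, vert_injective ?_⟩
  · rw [← vert_vert, ← hl, vert_id]
    exact (asIso (vert k)).hom_inv_id
  · rw [← vert_vert, ← hl, vert_id]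
    exact (asIso (vert k)).inv_hom_id

theorem lift_isStronglyCartesian {x y : Xᵒᵖ} (f : y ⟶ x) (b : F.obj ⟨y⟩) :
    (Pseudofunctor.CoGrothendieck.forget F).IsStronglyCartesian f.unop (lift F f b) :=
  Pseudofunctor.CoGrothendieck.isStronglyCartesian_homCartesianLift b f.unop

/-- `hom f k` is `vert k` followed by a cartesian lift. Composition and cancellation reduce the
question to `vert k`, and a cartesian arrow over an identity is an isomorphism. -/
theorem isCart_hom_iff {x y : Xᵒᵖ} {a : F.obj ⟨x⟩} {b : F.obj ⟨y⟩} (f : y ⟶ x)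
    (k : a ⟶ (push F f).obj b) :
    IsCart (Pseudofunctor.CoGrothendieck.forget F) (hom f k) ↔ IsIso k := by
  have h₁ := lift_isStronglyCartesian f b
  have h₂ := vert_isHomLift k
  have h₃ := vert_comp_lift f b k
  change (Pseudofunctor.CoGrothendieck.forget F).IsStronglyCartesian f.unop _ ↔ _
  constructor
  · intro h
    rw [← h₃] at h
    have h' : (Pseudofunctor.CoGrothendieck.forget F).IsStronglyCartesian (𝟙 x.unop ≫ f.unop)
        (vert k ≫ lift F f b) := by rwa [Category.id_comp]
    have := Functor.IsStronglyCartesian.of_comp (p := Pseudofunctor.CoGrothendieck.forget F)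
      (f := 𝟙 x.unop) (g := f.unop) (φ := vert k) (ψ := lift F f b)
    exact isIso_of_isIso_vert k (Functor.IsStronglyCartesian.isIso_of_base_isIso
      (Pseudofunctor.CoGrothendieck.forget F) (𝟙 x.unop) (vert k))
  · intro h
    have : IsIso (vert k : (⟨x.unop, a⟩ : ∫ᶜ F) ⟶ ⟨x.unop, _⟩) := (vertIso (asIso k)).isIso_hom
    have := Functor.IsStronglyCartesian.comp (p := Pseudofunctor.CoGrothendieck.forget F)
      (f := 𝟙 x.unop) (g := f.unop) (φ := vert k) (ψ := lift F f b)
    rwa [Category.id_comp, h₃] at this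

theorem map_hom (τ : F ⟶ G) {x y : Xᵒᵖ} {a : F.obj ⟨x⟩} {b : F.obj ⟨y⟩} (f : y ⟶ x)
    (k : a ⟶ (push F f).obj b) :
    (Pseudofunctor.CoGrothendieck.map τ).map (hom f k) =
      hom f ((comp₁ τ x).map k ≫ (natIso τ f b).hom) := rfl

theorem isCart_map (τ : F ⟶ G) {A B : ∫ᶜ F} (φ : A ⟶ B)
    (h : IsCart (Pseudofunctor.CoGrothendieck.forget F) φ) :
    IsCart (Pseudofunctor.CoGrothendieck.forget G)
      ((Pseudofunctor.CoGrothendieck.map τ).map φ) := by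
  have := (isCart_hom_iff φ.base.op φ.fiber).1 h
  exact (isCart_hom_iff (F := G) (a := (comp₁ τ (op A.base)).obj A.fiber)
    (b := (comp₁ τ (op B.base)).obj B.fiber) φ.base.op
    ((comp₁ τ (op A.base)).map φ.fiber ≫ (natIso τ φ.base.op B.fiber).hom)).2 inferInstance

end Cartesian

section MonoidalFunctor

variable {X : Type u₁} [Category.{v₁} X] [MonoidalCategory X]

theorem isCart_tensorHom (M : LaxMonoidalPseudofunctor.{v₁, u₁, v₂, u₂} Xᵒᵖ)
    {A A' B B' : ∫ᶜ M.toPs} (φ : A ⟶ A') (ψ : B ⟶ B')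
    (h : IsCart (Pseudofunctor.CoGrothendieck.forget M.toPs) φ)
    (h' : IsCart (Pseudofunctor.CoGrothendieck.forget M.toPs) ψ) :
    IsCart (Pseudofunctor.CoGrothendieck.forget M.toPs) (tensorHom M φ ψ) := by
  have := (isCart_hom_iff φ.base.op φ.fiber).1 h
  have := (isCart_hom_iff ψ.base.op ψ.fiber).1 h'
  refine (isCart_hom_iff (F := M.toPs) (φ.base.op ⊗ₘ ψ.base.op)
    ((M.mu (op A.base) (op B.base)).map (φ.fiber ×ₘ ψ.fiber) ≫
      (M.muMap φ.base.op ψ.base.op A'.fiber B'.fiber).inv)).2 ?_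
  have : IsIso (φ.fiber ×ₘ ψ.fiber) := (Iso.prod (asIso φ.fiber) (asIso ψ.fiber)).isIso_hom
  infer_instance

theorem tensorHom_vert (M : LaxMonoidalPseudofunctor.{v₁, u₁, v₂, u₂} Xᵒᵖ) {x y : Xᵒᵖ}
    {a a' : M.toPs.obj ⟨x⟩} {b b' : M.toPs.obj ⟨y⟩} (k : a ⟶ a') (l : b ⟶ b') :
    tensorHom M (vert k) (vert l) = vert (x := x.unop ⊗ y.unop) ((M.mu x y).map (k ×ₘ l)) := by
  refine (congrArg₂ (tensorHom M) (vert_eq_hom k _ rfl) (vert_eq_hom l _ rfl)).trans ?_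
  refine Eq.trans ?_ (vert_eq_hom ((M.mu x y).map (k ×ₘ l)) (𝟙 x ⊗ₘ 𝟙 y)
    (MonoidalCategory.id_tensorHom_id x y)).symm
  rw [tensorHom_hom, ← M.muMap_id_inv, ← Functor.map_comp_assoc]
  rfl

theorem tensorHom_vert_id (M : LaxMonoidalPseudofunctor.{v₁, u₁, v₂, u₂} Xᵒᵖ) {x y : Xᵒᵖ}
    {a a' : M.toPs.obj ⟨x⟩} (k : a ⟶ a') (b : M.toPs.obj ⟨y⟩) :
    tensorHom M (vert k) (𝟙 ⟨y.unop, b⟩) =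
      vert (x := x.unop ⊗ y.unop) ((M.mu x y).map (k ×ₘ 𝟙 b)) := by
  rw [← tensorHom_vert, vert_id]

theorem tensorHom_id_vert (M : LaxMonoidalPseudofunctor.{v₁, u₁, v₂, u₂} Xᵒᵖ) {x y : Xᵒᵖ}
    (a : M.toPs.obj ⟨x⟩) {b b' : M.toPs.obj ⟨y⟩} (l : b ⟶ b') :
    tensorHom M (𝟙 ⟨x.unop, a⟩) (vert l) =
      vert (x := x.unop ⊗ y.unop) ((M.mu x y).map (𝟙 a ×ₘ l)) := by
  rw [← tensorHom_vert, vert_id]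

variable {M N : LaxMonoidalPseudofunctor.{v₁, u₁, v₂, u₂} Xᵒᵖ} (τ : M.toPs ⟶ N.toPs)
  (u : ∀ {x y : Xᵒᵖ} (a : M.toPs.obj ⟨x⟩) (b : M.toPs.obj ⟨y⟩),
    (N.mu x y).obj ((comp₁ τ x).obj a, (comp₁ τ y).obj b) ⟶
      (comp₁ τ (x ⊗ y)).obj ((M.mu x y).obj (a, b)))
  (u0 : N.mu0 ⟶ (comp₁ τ (𝟙_ Xᵒᵖ)).obj M.mu0)

theorem map_tensorHom_comp_vert {x x' y y' : Xᵒᵖ} {a : M.toPs.obj ⟨x⟩} {a' : M.toPs.obj ⟨x'⟩}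
    {b : M.toPs.obj ⟨y⟩} {b' : M.toPs.obj ⟨y'⟩} (f : x' ⟶ x) (k : a ⟶ (push M.toPs f).obj a')
    (g : y' ⟶ y) (l : b ⟶ (push M.toPs g).obj b') :
    tensorHom N ((Pseudofunctor.CoGrothendieck.map τ).map (hom f k))
        ((Pseudofunctor.CoGrothendieck.map τ).map (hom g l)) ≫
          vert (x := x'.unop ⊗ y'.unop) (u a' b') =
      hom (f ⊗ₘ g) ((N.mu x y).map ((comp₁ τ x).map k ×ₘ (comp₁ τ y).map l) ≫
        ((N.mu x y).map ((natIso τ f a').hom ×ₘ (natIso τ g b').hom) ≫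
          (N.muMap f g _ _).inv) ≫ (push N.toPs (f ⊗ₘ g)).map (u a' b')) := by
  refine (hom_comp_vert _ _ _).trans (congrArg (hom _) ?_)
  refine Eq.trans ?_ (_ ≫= (Category.assoc _ _ _).symm)
  refine (Category.assoc _ _ _).trans ?_
  exact (congrArg (· ≫ _) ((N.mu x y).map_comp ((comp₁ τ x).map k ×ₘ (comp₁ τ y).map l)
    ((natIso τ f a').hom ×ₘ (natIso τ g b').hom))).trans (Category.assoc _ _ _)

theorem vert_comp_map_tensorHom {x x' y y' : Xᵒᵖ} {a : M.toPs.obj ⟨x⟩} {a' : M.toPs.obj ⟨x'⟩}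
    {b : M.toPs.obj ⟨y⟩} {b' : M.toPs.obj ⟨y'⟩} (f : x' ⟶ x) (k : a ⟶ (push M.toPs f).obj a')
    (g : y' ⟶ y) (l : b ⟶ (push M.toPs g).obj b') :
    vert (x := x.unop ⊗ y.unop) (u a b) ≫
        (Pseudofunctor.CoGrothendieck.map τ).map (tensorHom M (hom f k) (hom g l)) =
      hom (f ⊗ₘ g) (u a b ≫ (comp₁ τ (x ⊗ y)).map ((M.mu x y).map (k ×ₘ l)) ≫
        (comp₁ τ (x ⊗ y)).map (M.muMap f g a' b').inv ≫ (natIso τ (f ⊗ₘ g) _).hom) := by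
  refine (vert_comp_hom _ _ _).trans (congrArg (hom _) ?_)
  refine _ ≫= ?_
  exact (Functor.map_comp _ _ _ =≫ _).trans (Category.assoc _ _ _)

theorem vert_comp_vert_comp_map_associator_inv {x y z : Xᵒᵖ} (a : M.toPs.obj ⟨x⟩)
    (b : M.toPs.obj ⟨y⟩) (c : M.toPs.obj ⟨z⟩) :
    (tensorHom N (𝟙 (⟨x.unop, (comp₁ τ x).obj a⟩ : ∫ᶜ N.toPs))
          (vert (x := y.unop ⊗ z.unop) (u b c)) ≫
        vert (F := N.toPs) (x := x.unop ⊗ (y.unop ⊗ z.unop)) (u a ((M.mu y z).obj (b, c)))) ≫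
        (Pseudofunctor.CoGrothendieck.map τ).map
          ((tensorStruct M).associator ⟨x.unop, a⟩ ⟨y.unop, b⟩ ⟨z.unop, c⟩).inv =
      hom (α_ x y z).hom (((N.mu x (y ⊗ z)).map (𝟙 _ ×ₘ u b c) ≫ u a ((M.mu y z).obj (b, c))) ≫
        (comp₁ τ (x ⊗ (y ⊗ z))).map (M.omega a b c).inv ≫ (natIso τ (α_ x y z).hom _).hom) :=
  (((tensorHom_id_vert N _ (u b c) =≫ _).trans (vert_vert _ _)) =≫ _).trans (vert_comp_hom _ _ _)

theorem associator_inv_comp_vert_comp_vert {x y z : Xᵒᵖ} (a : M.toPs.obj ⟨x⟩)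
    (b : M.toPs.obj ⟨y⟩) (c : M.toPs.obj ⟨z⟩) :
    ((tensorStruct N).associator ⟨x.unop, (comp₁ τ x).obj a⟩ ⟨y.unop, (comp₁ τ y).obj b⟩
          ⟨z.unop, (comp₁ τ z).obj c⟩).inv ≫
        tensorHom N (vert (x := x.unop ⊗ y.unop) (u a b))
          (𝟙 (⟨z.unop, (comp₁ τ z).obj c⟩ : ∫ᶜ N.toPs)) ≫
            vert (F := N.toPs) (x := (x.unop ⊗ y.unop) ⊗ z.unop) (u ((M.mu x y).obj (a, b)) c) =
      hom (α_ x y z).hom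
        ((N.omega ((comp₁ τ x).obj a) ((comp₁ τ y).obj b) ((comp₁ τ z).obj c)).inv ≫
        (push N.toPs (α_ x y z).hom).map
          ((N.mu (x ⊗ y) z).map (u a b ×ₘ 𝟙 _) ≫ u ((M.mu x y).obj (a, b)) c)) :=
  (_ ≫= ((tensorHom_vert_id N (u a b) _ =≫ _).trans (vert_vert _ _))).trans (hom_comp_vert _ _ _)

theorem rightUnitor_inv_comp_vert_comp_vert {x : Xᵒᵖ} (a : M.toPs.obj ⟨x⟩) :
    ((tensorStruct N).rightUnitor ⟨x.unop, (comp₁ τ x).obj a⟩).inv ≫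
        tensorHom N (𝟙 (⟨x.unop, (comp₁ τ x).obj a⟩ : ∫ᶜ N.toPs)) (vert (x := 𝟙_ X) u0) ≫
          vert (F := N.toPs) (x := x.unop ⊗ 𝟙_ X) (u a M.mu0) =
      hom (ρ_ x).hom ((N.zeta ((comp₁ τ x).obj a)).inv ≫ (push N.toPs (ρ_ x).hom).map
          ((N.mu x (𝟙_ Xᵒᵖ)).map (𝟙 _ ×ₘ u0) ≫ u a M.mu0)) :=
  (_ ≫= ((tensorHom_id_vert N _ u0 =≫ _).trans (vert_vert _ _))).trans (hom_comp_vert _ _ _)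

theorem leftUnitor_inv_comp_vert_comp_vert {x : Xᵒᵖ} (a : M.toPs.obj ⟨x⟩) :
    ((tensorStruct N).leftUnitor ⟨x.unop, (comp₁ τ x).obj a⟩).inv ≫
        tensorHom N (vert (x := 𝟙_ X) u0) (𝟙 (⟨x.unop, (comp₁ τ x).obj a⟩ : ∫ᶜ N.toPs)) ≫
          vert (F := N.toPs) (x := 𝟙_ X ⊗ x.unop) (u M.mu0 a) =
      hom (λ_ x).hom ((N.xi ((comp₁ τ x).obj a)).inv ≫ (push N.toPs (λ_ x).hom).map
          ((N.mu (𝟙_ Xᵒᵖ) x).map (u0 ×ₘ 𝟙 _) ≫ u M.mu0 a)) :=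
  (_ ≫= ((tensorHom_vert_id N u0 _ =≫ _).trans (vert_vert _ _))).trans (hom_comp_vert _ _ _)

end MonoidalFunctor

section TwoFunctor

variable {X : Type u} [Category.{v} X] [MonoidalCategory X]

/-- The monoidal category `∫ᶜ M` over `X`. -/
noncomputable def total (M : LaxMonoidalPseudofunctor.{v, u, v, u} Xᵒᵖ) : MonoidalOver.{v, u} X :=
  grObj M (isMonoidalStruct M) (isStrictMonoidal M)

variable {M N P : LaxMonoidalPseudofunctor.{v, u, v, u} Xᵒᵖ}

section

variable (τ : M.toPs ⟶ N.toPs) (u : ∀ {x y : Xᵒᵖ} (a : M.toPs.obj ⟨x⟩) (b : M.toPs.obj ⟨y⟩),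
    (N.mu x y).obj ((comp₁ τ x).obj a, (comp₁ τ y).obj b) ≅
      (comp₁ τ (x ⊗ y)).obj ((M.mu x y).obj (a, b)))

/-- The second form is naturality of the tensor constraint at two cartesian lifts, so this
translates between the axiom for `u` and naturality in `∫ᶜ`. -/
theorem u_modification_iff {x x' y y' : Xᵒᵖ} (f : x ⟶ x') (g : y ⟶ y') (a : M.toPs.obj ⟨x⟩)
    (b : M.toPs.obj ⟨y⟩) :
    (push N.toPs (f ⊗ₘ g)).map (u a b).hom ≫ (natIso τ (f ⊗ₘ g) _).inv ≫
        (comp₁ τ (x' ⊗ y')).map (M.muMap f g a b).hom =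
      (N.muMap f g _ _).hom ≫
        (N.mu x' y').map ((natIso τ f a).inv ×ₘ (natIso τ g b).inv) ≫
          (u ((push M.toPs f).obj a) ((push M.toPs g).obj b)).hom ↔
    ((N.mu x' y').map ((natIso τ f a).hom ×ₘ (natIso τ g b).hom) ≫ (N.muMap f g _ _).inv) ≫
        (push N.toPs (f ⊗ₘ g)).map (u a b).hom =
      (u ((push M.toPs f).obj a) ((push M.toPs g).obj b)).hom ≫
        (comp₁ τ (x' ⊗ y')).map (M.muMap f g a b).inv ≫ (natIso τ (f ⊗ₘ g) _).hom := by
  rw [← Category.assoc (N.muMap f g _ _).hom]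
  exact comp_inv_comp_hom_eq_iff (natIso τ (f ⊗ₘ g) _)
    ((comp₁ τ (x' ⊗ y')).mapIso (M.muMap f g a b))
    (N.muMap f g _ _ ≪≫ N.muIso (natIso τ f a).symm (natIso τ g b).symm)

end

theorem map_tensorHom_comp_u (τ : MonoidalTrans M N) {A A' B B' : ∫ᶜ M.toPs} (f : A ⟶ A')
    (g : B ⟶ B') :
    tensorHom N ((Pseudofunctor.CoGrothendieck.map τ.toTrans).map f)
        ((Pseudofunctor.CoGrothendieck.map τ.toTrans).map g) ≫
          vert (x := A'.base ⊗ B'.base) (τ.u A'.fiber B'.fiber).hom =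
      vert (x := A.base ⊗ B.base) (τ.u A.fiber B.fiber).hom ≫
        (Pseudofunctor.CoGrothendieck.map τ.toTrans).map (tensorHom M f g) := by
  refine (map_tensorHom_comp_vert τ.toTrans (fun a b => (τ.u a b).hom)
    f.base.op f.fiber g.base.op g.fiber).trans
    (Eq.trans (congrArg (hom _) ?_)
      (vert_comp_map_tensorHom τ.toTrans (fun a b => (τ.u a b).hom)
        f.base.op f.fiber g.base.op g.fiber).symm)
  rw [(u_modification_iff τ.toTrans τ.u f.base.op g.base.op A'.fiber B'.fiber).1
    (τ.u_modification _ _ _ _), reassoc_of% τ.u_natural]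

/-- The functor `∫ᶜ τ` over `X`. -/
noncomputable def totalBased (τ : M.toPs ⟶ N.toPs) : (total M).based ⟶ (total N).based :=
  (gr X).map τ

/-- The functor `∫ᶜ τ` over `X` with the monoidal structure given by `u` and `u₀`. -/
noncomputable def mapCore (τ : MonoidalTrans M N) :
    Functor.CoreMonoidal (totalBased τ.toTrans).toFunctor where
  εIso := vertIso τ.u0
  μIso A B := vertIso (τ.u A.fiber B.fiber)
  μIso_hom_natural_left {A B} f D := by
    exact (congrArg (fun t => tensorHom N _ t ≫ _)
      ((Pseudofunctor.CoGrothendieck.map τ.toTrans).map_id D).symm).trans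
        (map_tensorHom_comp_u τ f (𝟙 D))
  μIso_hom_natural_right {A B} D f := by
    exact (congrArg (fun t => tensorHom N t _ ≫ _)
      ((Pseudofunctor.CoGrothendieck.map τ.toTrans).map_id D).symm).trans
        (map_tensorHom_comp_u τ (𝟙 D) f)
  associativity A B D := by
    -- The law is turned into one for the inverse associators, which are the explicit arrows; its
    -- fibre component is then `u_assoc` rearranged.
    refine (Category.assoc _ _ _).symm.trans (hom_comp_hom_of_inv
      (e := (tensorStruct N).associator _ _ _)
      (e' := (Pseudofunctor.CoGrothendieck.map τ.toTrans).mapIso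
        ((tensorStruct M).associator A B D)) ?_)
    refine (vert_comp_vert_comp_map_associator_inv τ.toTrans (fun a b => (τ.u a b).hom)
      A.fiber B.fiber D.fiber).trans (Eq.trans ?_ (associator_inv_comp_vert_comp_vert τ.toTrans
        (fun a b => (τ.u a b).hom) A.fiber B.fiber D.fiber).symm)
    exact congrArg (hom _) ((comp_inv_comp_hom_eq_iff (natIso τ.toTrans _ _)
      ((comp₁ τ.toTrans _).mapIso (M.omega A.fiber B.fiber D.fiber)) (N.omega _ _ _)).1
        (τ.u_assoc _ _ _).symm).symm
  left_unitality A := by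
    -- The unit law is a triangle; adding an identity side makes it a square, so that the same
    -- inversion lemma applies. The right unit law is handled alike.
    refine Eq.trans ?_ ((hom_comp_hom_of_inv (e := (tensorStruct N).leftUnitor _)
      (e' := (Pseudofunctor.CoGrothendieck.map τ.toTrans).mapIso
        ((tensorStruct M).leftUnitor A)) (g := 𝟙 _) ?_).symm.trans (Category.assoc _ _ _))
    · exact (Category.comp_id _).symm
    · refine (Category.id_comp _).trans (Eq.trans ?_ (leftUnitor_inv_comp_vert_comp_vert τ.toTrans
        (fun a b => (τ.u a b).hom) τ.u0.hom A.fiber).symm)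
      refine congrArg (hom _) ?_
      refine Eq.trans ?_ ((comp_inv_comp_hom_eq_iff (natIso τ.toTrans _ _)
        ((comp₁ τ.toTrans _).mapIso (M.xi A.fiber)) (N.xi _) (q := 𝟙 _)).1
          ((τ.u_left A.fiber).symm.trans (Category.comp_id _).symm)).symm
      exact (Category.id_comp _).symm
  right_unitality A := by
    refine Eq.trans ?_ ((hom_comp_hom_of_inv (e := (tensorStruct N).rightUnitor _)
      (e' := (Pseudofunctor.CoGrothendieck.map τ.toTrans).mapIso
        ((tensorStruct M).rightUnitor A)) (g := 𝟙 _) ?_).symm.trans (Category.assoc _ _ _))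
    · exact (Category.comp_id _).symm
    · refine (Category.id_comp _).trans (Eq.trans ?_ (rightUnitor_inv_comp_vert_comp_vert τ.toTrans
        (fun a b => (τ.u a b).hom) τ.u0.hom A.fiber).symm)
      refine congrArg (hom _) ?_
      refine Eq.trans ?_ ((comp_inv_comp_hom_eq_iff (natIso τ.toTrans _ _)
        ((comp₁ τ.toTrans _).mapIso (M.zeta A.fiber)) (N.zeta _) (q := 𝟙 _)).1
          ((τ.u_right A.fiber).symm.trans (Category.comp_id _).symm)).symm
      exact (Category.id_comp _).symm

/-- The strong monoidal functor `∫ᶜ τ` over `X`. -/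
noncomputable def totalMap (τ : MonoidalTrans M N) : MonoidalOverHom (total M) (total N) where
  based := totalBased τ.toTrans
  monoidal := (mapCore τ).toMonoidal
  lift_ε := vert_isHomLift τ.u0.hom
  lift_μ A B := vert_isHomLift (τ.u A.fiber B.fiber).hom

/-- The monoidal natural transformation over `X` given by a monoidal modification. -/
noncomputable def totalMap₂ {τ σ : MonoidalTrans M N} (m : τ ⟶ σ) : totalMap τ ⟶ totalMap σ where
  based := (gr X).map₂ m.toModification
  monoidal :=
    { unit := (vert_vert _ _).trans (congrArg vert m.unit)
      tensor := fun A B => (vert_vert _ _).trans ((congrArg vert (m.tensor A.fiber B.fiber)).trans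
        ((vert_vert _ _).symm.trans (congrArg (· ≫ _) (tensorHom_vert N _ _).symm))) }

theorem totalMap_id : totalMap (MonoidalTrans.id M) = MonoidalOver.idHom (total M) := by
  refine MonoidalOver.hom_ext ((gr X).map_id M.toPs) (heq_of_eq ?_) (fun A B => heq_of_eq ?_)
  · exact vert_id _
  · exact vert_id _

theorem totalMap_comp (τ : MonoidalTrans M N) (σ : MonoidalTrans N P) :
    totalMap (τ.comp σ) = MonoidalOver.compHom (totalMap τ) (totalMap σ) := by
  refine MonoidalOver.hom_ext ((gr X).map_comp τ.toTrans σ.toTrans) (heq_of_eq ?_)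
    (fun A B => heq_of_eq ?_)
  · exact (vert_vert _ _).symm.trans (congrArg (_ ≫ ·) (map_vert σ.toTrans _).symm)
  · exact (vert_vert _ _).symm.trans (congrArg (_ ≫ ·) (map_vert σ.toTrans _).symm)

/-- The monoidal fibration `∫ᶜ M`. -/
noncomputable def totalObj (M : LaxMonoidalPseudofunctor.{v, u, v, u} Xᵒᵖ) : MonFib.{v, u} X :=
  ⟨total M, inferInstanceAs (Pseudofunctor.CoGrothendieck.forget M.toPs).IsFibered,
    isCart_tensorHom M⟩

/-- The morphism of monoidal fibrations `∫ᶜ τ`. -/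
noncomputable def totalHom (τ : M ⟶ N) : totalObj M ⟶ totalObj N :=
  SubTwoCategory.Hom.mk (S := monFib X) (a := totalObj M) (b := totalObj N) (totalMap τ)
    (isCart_map (MonoidalTrans.toTrans τ))

/-- The 2-cell of monoidal fibrations given by a monoidal modification. -/
noncomputable def totalHom₂ {τ σ : M ⟶ N} (m : τ ⟶ σ) : totalHom τ ⟶ totalHom σ :=
  totalMap₂ m

theorem totalHom_id (M : LaxMonoidalPseudofunctor.{v, u, v, u} Xᵒᵖ) :
    totalHom (𝟙 M) = 𝟙 (totalObj M) :=
  SubTwoCategory.Hom.ext (totalMap_id (M := M))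

theorem totalHom_comp (τ : M ⟶ N) (σ : N ⟶ P) :
    totalHom (τ ≫ σ) = totalHom τ ≫ totalHom σ :=
  SubTwoCategory.Hom.ext (totalMap_comp τ σ)

end TwoFunctor

/-- The Grothendieck construction as a 2-functor from lax monoidal pseudofunctors to monoidal
fibrations. -/
noncomputable def twoFunctor (X : Type u) [Category.{v} X] [MonoidalCategory X] :
    StrictPseudofunctor (LaxMonoidalPseudofunctor.{v, u, v, u} Xᵒᵖ) (MonFib.{v, u} X) :=
  StrictPseudofunctor.mk''
    { obj := totalObj
      map := totalHom
      map₂ := totalHom₂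
      map_id := totalHom_id
      map_comp := totalHom_comp
      map₂_id := fun τ => MonoidalOverHom₂.ext ((gr X).map₂_id (MonoidalTrans.toTrans τ))
      map₂_comp := fun m n => MonoidalOverHom₂.ext ((gr X).map₂_comp
        (MonoidalModification.toModification m) (MonoidalModification.toModification n))
      map₂_whisker_left := fun {M N P} τ {σ ρ} m => by
        rw [conj_eqToHom_iff_heq']
        exact monoidalOver_hom₂_heq (totalHom_comp τ σ) (totalHom_comp τ ρ) (fun a => HEq.rfl)
      map₂_whisker_right := fun {M N P} {τ σ} m ρ => by
        rw [conj_eqToHom_iff_heq']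
        exact monoidalOver_hom₂_heq (totalHom_comp τ ρ) (totalHom_comp σ ρ)
          (fun a => heq_of_eq (map_vert (MonoidalTrans.toTrans ρ) _).symm) }

theorem restricts_twoFunctor (X : Type u) [Category.{v} X] [MonoidalCategory X] :
    Restricts (twoFunctor.{v, u} X) where
  comp_forget := strictPseudofunctor_ext rfl
  obj_eq M := ⟨isMonoidalStruct M, isStrictMonoidal M, rfl⟩
  map_eq {M N} τ := ⟨isMonoidalStruct M, isStrictMonoidal M, isMonoidalStruct N,
    isStrictMonoidal N, totalMap τ, HEq.rfl, rfl, HEq.rfl, fun _ _ => HEq.rfl⟩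

end Contra

end MonGroth

/-! ### Bijectivity on 1-cells and on 2-cells, contravariant case -/

namespace MonGroth

open scoped Pseudofunctor.CoGrothendieck Pseudofunctor.Grothendieck

namespace Contra

section FullyFaithful

variable {X : Type u₁} [Category.{v₁} X] {F G : LocallyDiscrete Xᵒᵖ ⥤ᵖ Cat.{v₂, u₂}}

theorem map_lift (τ : F ⟶ G) {x y : Xᵒᵖ} (f : y ⟶ x) (b : F.obj ⟨y⟩) :
    (Pseudofunctor.CoGrothendieck.map τ).map (lift F f b) = hom f (natIso τ f b).hom := by
  refine (map_hom τ f _).trans (congrArg (hom f) ?_)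
  exact (CategoryTheory.Functor.map_id _ _ =≫ _).trans (Category.id_comp _)

theorem gr₂_injective {τ σ : F ⟶ G} {m n : τ ⟶ σ} (h : gr₂ m = gr₂ n) : m = n :=
  modification_ext fun {x} a => vert_injective (congr(($h).app ⟨x.unop, a⟩))

theorem exists_gr₂_eq {τ σ : F ⟶ G}
    (β : Pseudofunctor.CoGrothendieck.map τ ⟶ Pseudofunctor.CoGrothendieck.map σ)
    (h : ∀ {x : Xᵒᵖ} (a : F.obj ⟨x⟩),
      (Pseudofunctor.CoGrothendieck.forget G).IsHomLift (𝟙 x.unop) (β.app ⟨x.unop, a⟩)) :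
    ∃ m : τ ⟶ σ, gr₂ m = β := by
  choose k hk using fun {x : Xᵒᵖ} (a : F.obj ⟨x⟩) =>
    exists_vert_of_isHomLift (x := x) (a := (comp₁ τ x).obj a) (b := (comp₁ σ x).obj a) _ (h a)
  refine ⟨mkModification k ?_ ?_, ?_⟩
  · intro x a b l
    apply vert_injective
    rw [← vert_vert, ← vert_vert, ← map_vert, ← map_vert, ← hk, ← hk]
    exact β.naturality (vert l)
  · intro x y f a
    have e := β.naturality (lift F f a)
    have e' : hom f (natIso τ f a).hom ≫ (vert (k a) : (⟨x.unop, _⟩ : ∫ᶜ G) ⟶ _) =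
        (vert (k ((push F f).obj a)) : (⟨y.unop, _⟩ : ∫ᶜ G) ⟶ _) ≫ hom f (natIso σ f a).hom := by
      rw [← map_lift, ← map_lift, ← hk, ← hk]
      exact e
    rw [hom_comp_vert, vert_comp_hom] at e'
    exact (hom_injective e').symm
  · exact NatTrans.ext (funext fun ⟨x, a⟩ => (hk (x := op x) a).symm)

theorem hom_heq_injective {x y : Xᵒᵖ} {a a' : F.obj ⟨x⟩} {b b' : F.obj ⟨y⟩} {f : y ⟶ x}
    (ha : a = a') (hb : b = b') {k : a ⟶ (push F f).obj b} {l : a' ⟶ (push F f).obj b'}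
    (h : hom f k ≍ hom f l) : k ≍ l := by
  subst ha hb
  exact heq_of_eq (hom_injective (eq_of_heq h))

theorem vert_heq_injective {x : Xᵒᵖ} {a a' b b' : F.obj ⟨x⟩}
    (ha : a = a') (hb : b = b') {k : a ⟶ b} {l : a' ⟶ b'}
    (h : vert k ≍ vert l) : k ≍ l := by
  subst ha hb
  exact heq_of_eq (vert_injective (eq_of_heq h))

theorem map_injective {τ σ : F ⟶ G}
    (h : Pseudofunctor.CoGrothendieck.map τ = Pseudofunctor.CoGrothendieck.map σ) : τ = σ := by
  have h₀ : ∀ {x : Xᵒᵖ} (a : F.obj ⟨x⟩), (comp₁ τ x).obj a = (comp₁ σ x).obj a := fun {x} a => by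
    have e := congrArg (fun H => H.obj (⟨x.unop, a⟩ : ∫ᶜ F)) h
    injection e
  have h₁ : ∀ {A B : ∫ᶜ F} (φ : A ⟶ B), (Pseudofunctor.CoGrothendieck.map τ).map φ ≍
      (Pseudofunctor.CoGrothendieck.map σ).map φ := fun φ => by rw [h]
  have h₂ : ∀ {x y : Xᵒᵖ} (f : y ⟶ x) (b : F.obj ⟨y⟩),
      (natIso τ f b).hom ≍ (natIso σ f b).hom := fun f b => by
    have e := h₁ (lift F f b)
    rw [map_lift, map_lift] at e
    exact hom_heq_injective (h₀ _) (h₀ _) e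
  refine toTrans_ext' (funext fun ⟨x⟩ => ?_) (fun {x y} f a => ?_)
  · refine Cat.Hom.ext (Functor.hext (fun a => h₀ a) (fun a b k => ?_))
    have e := h₁ (vert k)
    rw [map_vert, map_vert] at e
    exact vert_heq_injective (h₀ a) (h₀ b) e
  -- The images of cartesian lifts determine the forward constraints, while the extensionality lemma
  -- compares their inverses.
  · have e : ∀ {a a' b b' : G.obj ⟨y⟩} (ha : a = a') (hb : b = b') (i : a ≅ b) (j : a' ≅ b'),
        i.hom ≍ j.hom → i.inv ≍ j.inv := by
      rintro _ _ _ _ rfl rfl i j h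
      exact heq_of_eq (inv_eq_inv_of_hom (eq_of_heq h))
    exact e (h₀ _) (congrArg (push G f).obj (h₀ a)) _ _ (h₂ f a)

/-- As in the covariant case, except that the image of a cartesian lift gives an arrow from `t x ((F
f) b)` to `(G f) (t y b)`. This is already the pseudonaturality constraint, and no inverse has to be
taken. -/
theorem exists_map_eq (K : (∫ᶜ F) ⥤ (∫ᶜ G))
    (w : K ⋙ Pseudofunctor.CoGrothendieck.forget G = Pseudofunctor.CoGrothendieck.forget F)
    (h : ∀ {A B : ∫ᶜ F} (φ : A ⟶ B), IsCart (Pseudofunctor.CoGrothendieck.forget F) φ →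
      IsCart (Pseudofunctor.CoGrothendieck.forget G) (K.map φ)) :
    ∃ τ : F ⟶ G, Pseudofunctor.CoGrothendieck.map τ = K := by
  obtain ⟨obj, map, map_id, map_comp⟩ := K
  have h₀ : ∀ (x : Xᵒᵖ) (a : F.obj ⟨x⟩), ∃ b : G.obj ⟨x⟩,
      obj ⟨x.unop, a⟩ = ⟨x.unop, b⟩ := fun x a => by
    have e : (obj ⟨x.unop, a⟩).base = x.unop := Functor.congr_obj w ⟨x.unop, a⟩
    generalize obj ⟨x.unop, a⟩ = A at e
    obtain ⟨y, b⟩ := A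
    obtain rfl : y = x.unop := e
    exact ⟨b, rfl⟩
  choose t ht using h₀
  obtain rfl : obj = fun A => ⟨A.base, t (op A.base) A.fiber⟩ := funext fun ⟨x, a⟩ => ht (op x) a
  have hb : ∀ {A B : ∫ᶜ F} (φ : A ⟶ B), (map φ).base = φ.base := fun {A B} φ => by
    have e := Functor.congr_hom w φ
    exact e.trans ((Category.id_comp _).trans (Category.comp_id _))
  have h_hom : ∀ {x y : Xᵒᵖ} {a : F.obj ⟨x⟩} {b : F.obj ⟨y⟩} (f : y ⟶ x)
      (k : a ⟶ (push F f).obj b), ∃ l : t x a ⟶ (push G f).obj (t y b),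
        map (hom f k) = hom f l := by
    intro x y a b f k
    rcases hm : map (hom f k) with ⟨g, l⟩
    obtain rfl : g = f.unop :=
      (congrArg Pseudofunctor.CoGrothendieck.Hom.base hm).symm.trans (hb _)
    exact ⟨l, rfl⟩
  have h_vert : ∀ {x : Xᵒᵖ} {a b : F.obj ⟨x⟩} (k : a ⟶ b), ∃ l : t x a ⟶ t x b,
      map (vert k) = vert l := by
    intro x a b k
    obtain ⟨l, hl⟩ := h_hom (𝟙 x) (k ≫ (pushId F (𝟙 x) rfl b).inv)
    refine ⟨l ≫ (pushId G (𝟙 x) rfl _).hom, ?_⟩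
    rw [vert_eq_hom k _ rfl, vert_eq_hom _ _ rfl, Category.assoc, Iso.hom_inv_id, Category.comp_id]
    exact hl
  choose l hl using @h_vert
  choose n hn using fun {x y : Xᵒᵖ} (f : y ⟶ x) (b : F.obj ⟨y⟩) => h_hom f (𝟙 ((push F f).obj b))
  have n_iso : ∀ {x y : Xᵒᵖ} (f : y ⟶ x) (b : F.obj ⟨y⟩), IsIso (n f b) := fun f b => by
    have e := h (lift F f b) (lift_isStronglyCartesian f b)
    exact (isCart_hom_iff f (n f b)).1 ((hn f b) ▸ e)
  have l_id : ∀ {x : Xᵒᵖ} (a : F.obj ⟨x⟩), l (𝟙 a) = 𝟙 _ := fun {x} a => by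
    apply vert_injective
    rw [← hl, vert_id, vert_id]
    exact map_id _
  have l_comp : ∀ {x : Xᵒᵖ} {a b c : F.obj ⟨x⟩} (k : a ⟶ b) (k' : b ⟶ c),
      l (k ≫ k') = l k ≫ l k' := fun k k' => by
    apply vert_injective
    rw [← hl, ← vert_vert, ← vert_vert, ← hl, ← hl]
    exact map_comp _ _
  -- The unit and composition laws are obtained with inverse constraints of `F`; this cancellation
  -- brings them to the forward form required of a pseudonatural transformation.
  have l_iso : ∀ {x : Xᵒᵖ} {a b : F.obj ⟨x⟩} (i : a ≅ b) {c : G.obj ⟨x⟩} (k : t x a ⟶ c),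
      l i.hom ≫ l i.inv ≫ k = k := fun i c k => by
    rw [← Category.assoc, ← l_comp, i.hom_inv_id, l_id, Category.id_comp]
  have map_eq : ∀ {x y : Xᵒᵖ} {a : F.obj ⟨x⟩} {b : F.obj ⟨y⟩} (f : y ⟶ x)
      (k : a ⟶ (push F f).obj b), map (hom f k) = hom f (l k ≫ n f b) := fun f k => by
    rw [← vert_comp_lift, ← vert_comp_hom, ← hl, ← hn]
    exact map_comp _ _
  have n_natural : ∀ {x y : Xᵒᵖ} (f : y ⟶ x) {a b : F.obj ⟨y⟩} (k : a ⟶ b),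
      l ((push F f).map k) ≫ n f b = n f a ≫ (push G f).map (l k) := by
    intro x y f a b k
    apply hom_injective
    rw [← hom_comp_vert, ← map_eq, ← hl, ← hn]
    refine Eq.trans (congrArg map (Eq.symm ((hom_comp_vert _ _ _).trans ?_))) (map_comp _ _)
    rw [Category.id_comp]
  have n_id : ∀ {x : Xᵒᵖ} (a : F.obj ⟨x⟩), l (pushId F (𝟙 x) rfl a).inv ≫ n (𝟙 x) a =
      (pushId G (𝟙 x) rfl (t x a)).inv := fun {x} a => by
    apply hom_injective
    rw [← map_eq, ← id_eq_hom, ← id_eq_hom]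
    exact map_id _
  have n_comp : ∀ {x y z : Xᵒᵖ} (f : x ⟶ y) (g : y ⟶ z) (a : F.obj ⟨x⟩),
      l (pushComp F f g _ rfl a).inv ≫ n (f ≫ g) a =
        n g _ ≫ (push G g).map (n f a) ≫ (pushComp G f g _ rfl (t x a)).inv := fun f g a => by
    apply hom_injective
    rw [← map_eq, ← hom_comp_hom, ← hn, ← hn]
    refine Eq.trans ?_ (map_comp (lift F g _) (lift F f a))
    refine congrArg map (Eq.trans ?_ (hom_comp_hom _ _ _ _ _ rfl).symm)
    rw [CategoryTheory.Functor.map_id, Category.id_comp, Category.id_comp]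
  refine ⟨mkTrans (fun x => { obj := t x, map := l, map_id := l_id, map_comp := l_comp })
    (fun f a => asIso (n f a)) ?_ ?_ ?_, ?_⟩
  · exact fun {x y} f {a b} k => n_natural f k
  · intro x a
    refine Eq.trans ?_ ((_ ≫= Iso.inv_hom_id (pushId G (𝟙 x) rfl (t x a))).trans
      (Category.comp_id _))
    refine ((l_iso (pushId F (𝟙 x) rfl a) _).symm =≫ _).trans ?_
    refine ((_ ≫= n_id a) =≫ _).trans (Category.assoc _ _ _)
  · intro x y z f g a
    refine ((l_iso (pushComp F f g _ rfl a) _).symm =≫ _).trans ?_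
    refine ((_ ≫= n_comp f g a) =≫ _).trans ?_
    refine (Category.assoc _ _ _).trans (_ ≫= ?_)
    refine (Category.assoc _ _ _).trans (_ ≫= ?_)
    refine (Category.assoc _ _ _).trans ?_
    exact (_ ≫= Iso.inv_hom_id _).trans (Category.comp_id _)
  · refine CategoryTheory.Functor.ext (fun _ => rfl) ?_
    intro A B φ
    refine Eq.trans ?_ ((Category.id_comp _).trans (Category.comp_id _)).symm
    exact (map_eq (x := op A.base) (y := op B.base) φ.base.op φ.fiber).symm

end FullyFaithful

section MonoidalFullyFaithful

variable {X : Type u} [Category.{v} X] [MonoidalCategory X]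
  {M N : LaxMonoidalPseudofunctor.{v, u, v, u} Xᵒᵖ}

theorem totalHom₂_bijective (τ σ : M ⟶ N) :
    Function.Bijective (totalHom₂ : (τ ⟶ σ) → (totalHom τ ⟶ totalHom σ)) := by
  constructor
  · intro m n h
    refine MonoidalModification.ext (gr₂_injective ?_)
    exact congrArg (fun β : MonoidalOverHom₂ (totalMap τ) (totalMap σ) => β.based.toNatTrans) h
  · intro β
    obtain ⟨⟨β, hβ⟩, mon⟩ := (β : MonoidalOverHom₂ (totalMap τ) (totalMap σ))
    obtain ⟨m, rfl⟩ := exists_gr₂_eq β (fun {x} a => hβ ⟨x.unop, a⟩)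
    refine ⟨⟨m, fun {x y} a b => ?_, ?_⟩, rfl⟩
    · apply vert_injective
      rw [← vert_vert, ← vert_vert]
      exact (mon.tensor ⟨x.unop, a⟩ ⟨y.unop, b⟩).trans (tensorHom_vert N _ _ =≫ _)
    · apply vert_injective
      rw [← vert_vert]
      exact mon.unit

theorem totalHom_injective : Function.Injective (totalHom : (M ⟶ N) → _) := by
  intro τ σ h
  replace h : totalMap τ = totalMap σ := congrArg SubTwoCategory.Hom.hom h
  have h₀ : MonoidalTrans.toTrans τ = MonoidalTrans.toTrans σ :=
    map_injective (congrArg (fun H => H.based.toFunctor) h)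
  have h₁ : ∀ {x : Xᵒᵖ} (a : M.toPs.obj ⟨x⟩),
      (comp₁ (MonoidalTrans.toTrans τ) x).obj a = (comp₁ (MonoidalTrans.toTrans σ) x).obj a :=
    fun a => by rw [h₀]
  refine LaxMonoidalPseudofunctor.trans_ext h₀ (fun {x y} a b => ?_) ?_
  · refine vert_heq_injective (by rw [h₁, h₁]) (h₁ _) ?_
    have e : (totalMap τ).tensorMap ⟨x.unop, a⟩ ⟨y.unop, b⟩ ≍
      (totalMap σ).tensorMap ⟨x.unop, a⟩ ⟨y.unop, b⟩ := by rw [h]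
    exact e
  · refine vert_heq_injective rfl (h₁ _) ?_
    have e : (totalMap τ).unitMap ≍ (totalMap σ).unitMap := by rw [h]
    exact e

theorem exists_vertIso_of_isHomLift {x : Xᵒᵖ} {a b : M.toPs.obj ⟨x⟩}
    (φ : (⟨x.unop, a⟩ : ∫ᶜ M.toPs) ⟶ ⟨x.unop, b⟩)
    (h : (Pseudofunctor.CoGrothendieck.forget M.toPs).IsHomLift (𝟙 x.unop) φ) (h' : IsIso φ) :
    ∃ k : a ≅ b, φ = vert k.hom := by
  obtain ⟨k, rfl⟩ := exists_vert_of_isHomLift φ h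
  have := isIso_of_isIso_vert k h'
  exact ⟨asIso k, rfl⟩

/-- The structure isomorphisms over identities are vertical and give `u` and `u0`. The axioms are
read off from the monoidal functor laws after passing to inverse associators and unitors, whose
fibre components are known explicitly. -/
theorem exists_monoidalTrans (τ : M.toPs ⟶ N.toPs)
    (m : (totalBased τ : (total M).based ⟶ (total N).based).toFunctor.Monoidal)
    (h₀ : (total N).based.p.IsHomLift (𝟙 (𝟙_ X))
      (Functor.LaxMonoidal.ε (totalBased τ : (total M).based ⟶ (total N).based).toFunctor))
    (h₁ : ∀ a b : (total M).based.obj, (total N).based.p.IsHomLift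
      (𝟙 ((total M).based.p.obj a ⊗ (total M).based.p.obj b))
      (Functor.LaxMonoidal.μ (totalBased τ : (total M).based ⟶ (total N).based).toFunctor a b)) :
    ∃ σ : MonoidalTrans M N, totalMap σ = ⟨totalBased τ, m, h₀, h₁⟩ := by
  let K := (totalBased τ : (total M).based ⟶ (total N).based).toFunctor
  obtain ⟨u0, hu0⟩ : ∃ k : N.mu0 ≅ (comp₁ τ (𝟙_ Xᵒᵖ)).obj M.mu0,
      Functor.LaxMonoidal.ε K = vert (x := 𝟙_ X) k.hom :=
    exists_vertIso_of_isHomLift (x := 𝟙_ Xᵒᵖ) _ h₀ (Functor.Monoidal.εIso K).isIso_hom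
  choose u hu using fun {x y : Xᵒᵖ} (a : M.toPs.obj ⟨x⟩) (b : M.toPs.obj ⟨y⟩) =>
    exists_vertIso_of_isHomLift (M := N) (x := x ⊗ y)
      (a := (N.mu x y).obj ((comp₁ τ x).obj a, (comp₁ τ y).obj b))
      (b := (comp₁ τ (x ⊗ y)).obj ((M.mu x y).obj (a, b))) _ (h₁ ⟨x.unop, a⟩ ⟨y.unop, b⟩)
        (Functor.Monoidal.μIso K ⟨x.unop, a⟩ ⟨y.unop, b⟩).isIso_hom
  have h_natural : ∀ {x x' y y' : Xᵒᵖ} {a : M.toPs.obj ⟨x⟩} {a' : M.toPs.obj ⟨x'⟩}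
      {b : M.toPs.obj ⟨y⟩} {b' : M.toPs.obj ⟨y'⟩}
      (φ : (⟨x.unop, a⟩ : ∫ᶜ M.toPs) ⟶ ⟨x'.unop, a'⟩)
      (ψ : (⟨y.unop, b⟩ : ∫ᶜ M.toPs) ⟶ ⟨y'.unop, b'⟩),
      tensorHom N ((Pseudofunctor.CoGrothendieck.map τ).map φ)
          ((Pseudofunctor.CoGrothendieck.map τ).map ψ) ≫
            vert (x := x'.unop ⊗ y'.unop) (u a' b').hom =
        vert (x := x.unop ⊗ y.unop) (u a b).hom ≫
          (Pseudofunctor.CoGrothendieck.map τ).map (tensorHom M φ ψ) := by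
    intro x x' y y' a a' b b' φ ψ
    exact (_ ≫= (hu a' b').symm).trans ((Functor.LaxMonoidal.μ_natural K φ ψ).trans (hu a b =≫ _))
  refine ⟨{ toTrans := τ
            u := u
            u_natural := ?_
            u_modification := ?_
            u0 := u0
            u_assoc := ?_
            u_right := ?_
            u_left := ?_ }, ?_⟩
  · intro x y a a' b b' k l
    apply vert_injective
    refine (vert_vert _ _).symm.trans (Eq.trans ?_ (vert_vert _ _))
    refine ((((congrArg₂ (tensorHom N) (map_vert τ k) (map_vert τ l)).trans
      (tensorHom_vert N _ _)).symm =≫ _).trans (h_natural (vert k) (vert l))).trans (_ ≫= ?_)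
    exact (congrArg _ (tensorHom_vert M k l)).trans (map_vert τ _)
  · intro x x' y y' f g a b
    refine (u_modification_iff τ u f g a b).2 ?_
    have e := (map_tensorHom_comp_vert τ (fun a b => (u a b).hom) f (𝟙 _) g (𝟙 _)).symm.trans
      ((h_natural (lift M.toPs f a) (lift M.toPs g b)).trans
        (vert_comp_map_tensorHom τ (fun a b => (u a b).hom) f (𝟙 _) g (𝟙 _)))
    refine Eq.trans ?_ ((hom_injective e).trans ?_)
    · refine (Category.id_comp _).symm.trans (Eq.symm (?_ =≫ _))
      rw [CategoryTheory.Functor.map_id, CategoryTheory.Functor.map_id]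
      exact (N.mu x' y').map_id _
    · refine _ ≫= (((?_ : _ = 𝟙 _) =≫ _).trans (Category.id_comp _))
      exact (congrArg _ ((M.mu x' y').map_id _)).trans (CategoryTheory.Functor.map_id _ _)
  · intro x y z a b c
    refine ((comp_inv_comp_hom_eq_iff (natIso τ _ _) ((comp₁ τ _).mapIso (M.omega a b c))
      (N.omega _ _ _)).2 ?_).symm
    apply hom_injective (f := (α_ x y z).hom)
    refine (associator_inv_comp_vert_comp_vert τ (fun a b => (u a b).hom) a b c).symm.trans
      (Eq.trans ?_ (vert_comp_vert_comp_map_associator_inv τ (fun a b => (u a b).hom) a b c))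
    -- The associativity law of the monoidal functor, rewritten for the inverse associators.
    have e := (inv_comp_inv_of_hom (e := (tensorStruct N).associator _ _ _)
      (e' := K.mapIso ((tensorStruct M).associator ⟨x.unop, a⟩ ⟨y.unop, b⟩ ⟨z.unop, c⟩))
      ((Category.assoc _ _ _).trans (Functor.LaxMonoidal.associativity K
        (⟨x.unop, a⟩ : ∫ᶜ M.toPs) (⟨y.unop, b⟩ : ∫ᶜ M.toPs) (⟨z.unop, c⟩ : ∫ᶜ M.toPs)))).symm
    refine Eq.trans (_ ≫= ?_) (e.trans (?_ =≫ _))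
    · exact (congrArg₂ (· ≫ ·) (congrArg (fun t => tensorHom N t (𝟙 _)) (hu a b)) (hu _ c)).symm
    · exact congrArg₂ (· ≫ ·) (congrArg (tensorHom N (𝟙 _)) (hu b c)) (hu a _)
  · intro x a
    refine Eq.trans (Category.comp_id _).symm ((comp_inv_comp_hom_eq_iff (natIso τ _ _)
      ((comp₁ τ _).mapIso (M.zeta a)) (N.zeta _) (q := 𝟙 _)).2 ?_).symm
    refine Eq.trans ?_ (Category.id_comp _).symm
    apply hom_injective (f := (ρ_ x).hom)
    refine (rightUnitor_inv_comp_vert_comp_vert τ (fun a b => (u a b).hom) u0.hom a).symm.trans ?_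
    have e := (inv_comp_inv_of_hom (e := (tensorStruct N).rightUnitor _)
      (e' := K.mapIso ((tensorStruct M).rightUnitor ⟨x.unop, a⟩)) (g := 𝟙 _)
      ((Category.assoc _ _ _).trans ((Functor.LaxMonoidal.right_unitality K
        (⟨x.unop, a⟩ : ∫ᶜ M.toPs)).symm.trans (Category.comp_id _).symm))).symm
    refine Eq.trans (_ ≫= ?_) (e.trans (Category.id_comp _))
    exact (congrArg₂ (· ≫ ·) (congrArg (tensorHom N (𝟙 _)) hu0) (hu _ _)).symm
  · intro x a
    refine Eq.trans (Category.comp_id _).symm ((comp_inv_comp_hom_eq_iff (natIso τ _ _)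
      ((comp₁ τ _).mapIso (M.xi a)) (N.xi _) (q := 𝟙 _)).2 ?_).symm
    refine Eq.trans ?_ (Category.id_comp _).symm
    apply hom_injective (f := (λ_ x).hom)
    refine (leftUnitor_inv_comp_vert_comp_vert τ (fun a b => (u a b).hom) u0.hom a).symm.trans ?_
    have e := (inv_comp_inv_of_hom (e := (tensorStruct N).leftUnitor _)
      (e' := K.mapIso ((tensorStruct M).leftUnitor ⟨x.unop, a⟩)) (g := 𝟙 _)
      ((Category.assoc _ _ _).trans ((Functor.LaxMonoidal.left_unitality K
        (⟨x.unop, a⟩ : ∫ᶜ M.toPs)).symm.trans (Category.comp_id _).symm))).symm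
    refine Eq.trans (_ ≫= ?_) (e.trans (Category.id_comp _))
    exact (congrArg₂ (· ≫ ·) (congrArg (fun t => tensorHom N t (𝟙 _)) hu0) (hu _ _)).symm
  · refine MonoidalOver.hom_ext rfl (heq_of_eq ?_) (fun A B => heq_of_eq ?_)
    · exact hu0.symm
    · change vert (x := A.base ⊗ B.base) (u A.fiber B.fiber).hom = _
      exact (hu (x := op A.base) (y := op B.base) A.fiber B.fiber).symm

theorem totalHom_surjective : Function.Surjective (totalHom : (M ⟶ N) → _) := by
  intro K
  obtain ⟨⟨⟨K, w⟩, m, h₀, h₁⟩, hc⟩ :=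
    (K : SubTwoCategory.Hom (S := monFib X) (totalObj M) (totalObj N))
  obtain ⟨τ, rfl⟩ := exists_map_eq K w hc
  obtain ⟨σ, hσ⟩ := exists_monoidalTrans τ m h₀ h₁
  exact ⟨σ, SubTwoCategory.Hom.ext hσ⟩

end MonoidalFullyFaithful

end Contra

end MonGroth

/-! ### The pseudofunctor of a fibration with chosen lifts -/

namespace MonGroth

section Cleavage

variable {A : Type u₁} [Category.{v₁} A] {X : Type u₂} [Category.{v₂} X]

/-- A choice of cartesian lifts. -/
structure Cleavage (p : A ⥤ X) where
  /-- the domain of the chosen lift -/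
  obj {x y : X} (f : x ⟶ y) (b : p.Fiber y) : p.Fiber x
  /-- the chosen lift -/
  lift {x y : X} (f : x ⟶ y) (b : p.Fiber y) : (obj f b).1 ⟶ b.1
  isCart {x y : X} (f : x ⟶ y) (b : p.Fiber y) : p.IsStronglyCartesian f (lift f b)

theorem nonempty_cleavage {p : A ⥤ X} (h : p.IsFibered) : Nonempty (Cleavage p) := by
  have : ∀ {x y : X} (f : x ⟶ y) (b : p.Fiber y), ∃ (a : p.Fiber x) (φ : a.1 ⟶ b.1),
      p.IsStronglyCartesian f φ := by
    rintro x y f ⟨b, rfl⟩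
    obtain ⟨a, φ, hφ⟩ := h.exists_isCartesian' f
    -- The definition of a fibration supplies a cartesian lift; in a fibration every cartesian arrow
    -- is strongly cartesian.
    exact ⟨⟨a, IsHomLift.domain_eq p f φ⟩, φ, inferInstance⟩
  choose a φ h using @this
  exact ⟨⟨a, φ, h⟩⟩

namespace Cleavage

variable {p : A ⥤ X} {x y z w : X}

/-- A cartesian arrow is monic with respect to arrows of the fibre. An arbitrary `φ` is allowed
because the coherence laws are tested against composites of lifts. -/
theorem hom_ext_of_isCart (f : x ⟶ y) {a : A} {b c : p.Fiber x} {φ : c.1 ⟶ a}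
    (h : p.IsStronglyCartesian f φ) {k l : b ⟶ c} (e : k.1 ≫ φ = l.1 ≫ φ) : k = l := by
  have h₁ : p.IsHomLift (𝟙 x) k.1 := k.2
  have h₂ : p.IsHomLift (𝟙 x) l.1 := l.2
  exact Subtype.ext (Functor.IsStronglyCartesian.ext p f φ (𝟙 x) e)

variable (c : Cleavage p)

/-- The morphism of the fibre induced by a morphism over `f`. -/
noncomputable def ind (f : x ⟶ y) {a : p.Fiber x} {b : p.Fiber y} (φ : a.1 ⟶ b.1)
    (_ : p.IsHomLift f φ) : a ⟶ c.obj f b :=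
  have := c.isCart f b
  ⟨Functor.IsStronglyCartesian.map p f (c.lift f b) (Category.id_comp f).symm φ, inferInstance⟩

theorem ind_lift (f : x ⟶ y) {a : p.Fiber x} {b : p.Fiber y} (φ : a.1 ⟶ b.1)
    (h : p.IsHomLift f φ) : (c.ind f φ h).1 ≫ c.lift f b = φ :=
  have := c.isCart f b
  Functor.IsStronglyCartesian.fac p f (c.lift f b) (Category.id_comp f).symm φ

theorem hom_ext (f : x ⟶ y) {a : p.Fiber x} {b : p.Fiber y} {k l : a ⟶ c.obj f b}
    (h : k.1 ≫ c.lift f b = l.1 ≫ c.lift f b) : k = l :=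
  hom_ext_of_isCart f (c.isCart f b) h

/-- Two cartesian arrows over `f` with the same target factor uniquely through each other. -/
theorem exists_indIso (f : x ⟶ y) {a : p.Fiber x} {b : p.Fiber y} (φ : a.1 ⟶ b.1)
    (h : p.IsStronglyCartesian f φ) : ∃ i : c.obj f b ≅ a, i.hom.1 ≫ φ = c.lift f b := by
  have := c.isCart f b
  let k : c.obj f b ⟶ a :=
    ⟨Functor.IsStronglyCartesian.map p f φ (Category.id_comp f).symm (c.lift f b), inferInstance⟩
  have hk : k.1 ≫ φ = c.lift f b :=
    Functor.IsStronglyCartesian.fac p f φ (Category.id_comp f).symm (c.lift f b)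
  have hl := c.ind_lift f φ inferInstance
  refine ⟨⟨k, c.ind f φ inferInstance, c.hom_ext f ?_, hom_ext_of_isCart f h ?_⟩, hk⟩
  · exact (Category.assoc _ _ _).trans ((_ ≫= hl).trans (hk.trans (Category.id_comp _).symm))
  · exact (Category.assoc _ _ _).trans ((_ ≫= hk).trans (hl.trans (Category.id_comp _).symm))

/-- The isomorphism of the fibre induced by a cartesian morphism over `f`. -/
noncomputable def indIso (f : x ⟶ y) {a : p.Fiber x} {b : p.Fiber y} (φ : a.1 ⟶ b.1)
    (h : p.IsStronglyCartesian f φ) : c.obj f b ≅ a := (c.exists_indIso f φ h).choose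

theorem indIso_comp (f : x ⟶ y) {a : p.Fiber x} {b : p.Fiber y} (φ : a.1 ⟶ b.1)
    (h : p.IsStronglyCartesian f φ) : (c.indIso f φ h).hom.1 ≫ φ = c.lift f b :=
  (c.exists_indIso f φ h).choose_spec

/-- The action of pull-back along `f` on morphisms. -/
noncomputable def mapHom (f : x ⟶ y) {a b : p.Fiber y} (k : a ⟶ b) : c.obj f a ⟶ c.obj f b :=
  c.ind f (c.lift f a ≫ k.1) (by
    have := k.2
    have := c.isCart f a
    infer_instance)

theorem mapHom_lift (f : x ⟶ y) {a b : p.Fiber y} (k : a ⟶ b) :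
    (c.mapHom f k).1 ≫ c.lift f b = c.lift f a ≫ k.1 := c.ind_lift f _ _

/-- Pull-back along `f`. -/
noncomputable def map (f : x ⟶ y) : p.Fiber y ⥤ p.Fiber x where
  obj a := c.obj f a
  map k := c.mapHom f k
  map_id a := c.hom_ext f <| (c.mapHom_lift f _).trans
    ((Category.comp_id _).trans (Category.id_comp _).symm)
  map_comp {a b d} k l := c.hom_ext f <| by
    change (c.mapHom f (k ≫ l)).1 ≫ c.lift f d =
      ((c.mapHom f k).1 ≫ (c.mapHom f l).1) ≫ c.lift f d
    rw [mapHom_lift, Category.assoc, mapHom_lift, ← Category.assoc, mapHom_lift, Category.assoc]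
    rfl

theorem isCart_id (a : p.Fiber x) : p.IsStronglyCartesian (𝟙 x) (𝟙 a.1) := by
  have : p.IsHomLift (𝟙 x) (𝟙 a.1) := IsHomLift.id a.2
  exact inferInstance

theorem eqToHom_lift {f f' : x ⟶ y} (h : f = f') (a : p.Fiber y) :
    (eqToHom (congrArg (fun f => c.obj f a) h) : c.obj f a ⟶ c.obj f' a).1 ≫ c.lift f' a =
      c.lift f a := by
  subst h
  exact Category.id_comp _

theorem isCart_comp (g : x ⟶ y) (f : y ⟶ z) (a : p.Fiber z) :
    p.IsStronglyCartesian (g ≫ f) (c.lift g (c.obj f a) ≫ c.lift f a) := by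
  have := c.isCart f a
  have := c.isCart g (c.obj f a)
  infer_instance

/-- The unit constraint. -/
noncomputable def mapId (a : p.Fiber x) : c.obj (𝟙 x) a ≅ a := c.indIso (𝟙 x) (𝟙 a.1) (isCart_id a)

theorem mapId_hom (a : p.Fiber x) : (c.mapId a).hom.1 = c.lift (𝟙 x) a :=
  (Category.comp_id _).symm.trans (c.indIso_comp _ _ (isCart_id a))

/-- The composition constraint. -/
noncomputable def mapComp (g : x ⟶ y) (f : y ⟶ z) (a : p.Fiber z) :
    c.obj (g ≫ f) a ≅ c.obj g (c.obj f a) := c.indIso (g ≫ f) _ (c.isCart_comp g f a)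

theorem mapComp_hom_lift (g : x ⟶ y) (f : y ⟶ z) (a : p.Fiber z) :
    (c.mapComp g f a).hom.1 ≫ c.lift g (c.obj f a) ≫ c.lift f a = c.lift (g ≫ f) a :=
  c.indIso_comp _ _ (c.isCart_comp g f a)

theorem mapId_natural {a b : p.Fiber x} (k : a ⟶ b) :
    c.mapHom (𝟙 x) k ≫ (c.mapId b).hom = (c.mapId a).hom ≫ k :=
  Subtype.ext <| by
    change (c.mapHom (𝟙 x) k).1 ≫ (c.mapId b).hom.1 = (c.mapId a).hom.1 ≫ k.1
    rw [mapId_hom, mapId_hom, mapHom_lift]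

theorem mapComp_natural (g : x ⟶ y) (f : y ⟶ z) {a b : p.Fiber z} (k : a ⟶ b) :
    c.mapHom (g ≫ f) k ≫ (c.mapComp g f b).hom =
      (c.mapComp g f a).hom ≫ c.mapHom g (c.mapHom f k) :=
  hom_ext_of_isCart _ (c.isCart_comp g f b) <| by
    change ((c.mapHom (g ≫ f) k).1 ≫ (c.mapComp g f b).hom.1) ≫ _ =
      ((c.mapComp g f a).hom.1 ≫ (c.mapHom g (c.mapHom f k)).1) ≫ _
    rw [Category.assoc, mapComp_hom_lift, mapHom_lift, Category.assoc,
      ← Category.assoc (c.mapHom g _).1, mapHom_lift, Category.assoc, mapHom_lift,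
      ← c.mapComp_hom_lift, Category.assoc, Category.assoc]

/-- Composed with the three successive lifts, both sides become the single lift of the triple
composite; the `eqToHom` accounts for its two bracketings. This is the associativity law over `Xᵒᵖ`,
with the arrows in reverse order. -/
theorem mapComp_assoc (h : w ⟶ x) (g : x ⟶ y) (f : y ⟶ z) (a : p.Fiber z) :
    (c.mapComp h (g ≫ f) a).hom ≫ c.mapHom h (c.mapComp g f a).hom =
      eqToHom (by rw [Category.assoc]) ≫ (c.mapComp (h ≫ g) f a).hom ≫
        (c.mapComp h g (c.obj f a)).hom :=
  hom_ext_of_isCart (h ≫ g ≫ f) (φ := c.lift h _ ≫ c.lift g _ ≫ c.lift f a) (by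
      have := c.isCart h (c.obj g (c.obj f a))
      have := c.isCart_comp g f a
      infer_instance) <| by
    have e : ((c.mapComp h (g ≫ f) a).hom.1 ≫ (c.mapHom h (c.mapComp g f a).hom).1) ≫
        c.lift h _ ≫ c.lift g _ ≫ c.lift f a = c.lift (h ≫ g ≫ f) a := by
      rw [Category.assoc, ← Category.assoc (c.mapHom h _).1, mapHom_lift, Category.assoc,
        mapComp_hom_lift, mapComp_hom_lift]
    have e' : ((c.mapComp (h ≫ g) f a).hom.1 ≫ (c.mapComp h g (c.obj f a)).hom.1) ≫
        c.lift h _ ≫ c.lift g _ ≫ c.lift f a = c.lift ((h ≫ g) ≫ f) a := by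
      refine (Category.assoc _ _ _).trans (Eq.trans (_ ≫= ?_) (c.mapComp_hom_lift (h ≫ g) f a))
      refine (_ ≫= (Category.assoc _ _ _).symm).trans ((Category.assoc _ _ _).symm.trans ?_)
      exact c.mapComp_hom_lift h g (c.obj f a) =≫ _
    exact e.trans (((Category.assoc _ _ _).trans (_ ≫= e')).trans
      (c.eqToHom_lift (Category.assoc h g f).symm a)).symm

/-- Because composition is reversed, this is the left unit law of the pseudofunctor on `Xᵒᵖ`, and
the next lemma is its right unit law. -/
theorem mapComp_id_right (f : x ⟶ y) (a : p.Fiber y) :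
    (c.mapComp f (𝟙 y) a).hom ≫ c.mapHom f (c.mapId a).hom =
      eqToHom (by rw [Category.comp_id]) :=
  c.hom_ext f <| by
    refine Eq.trans ?_ (c.eqToHom_lift (Category.comp_id f) a).symm
    change ((c.mapComp f (𝟙 y) a).hom.1 ≫ (c.mapHom f (c.mapId a).hom).1) ≫ c.lift f a = _
    rw [Category.assoc, mapHom_lift, mapId_hom, mapComp_hom_lift]

theorem mapComp_id_left (f : x ⟶ y) (a : p.Fiber y) :
    (c.mapComp (𝟙 x) f a).hom ≫ (c.mapId (c.obj f a)).hom =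
      eqToHom (by rw [Category.id_comp]) :=
  c.hom_ext f <| by
    refine Eq.trans ?_ (c.eqToHom_lift (Category.id_comp f) a).symm
    change ((c.mapComp (𝟙 x) f a).hom.1 ≫ (c.mapId (c.obj f a)).hom.1) ≫ c.lift f a = _
    rw [Category.assoc, mapId_hom, mapComp_hom_lift]

/-- The pseudofunctor of a fibration with chosen lifts. -/
noncomputable def pseudo : LocallyDiscrete Xᵒᵖ ⥤ᵖ Cat.{v₁, max u₁ 0} :=
  mkPseudo (fun x => p.Fiber x.unop) (fun f => c.map f.unop) (fun {_} a => c.mapId a)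
    (fun {_x _a _b} k => c.mapId_natural k) (fun f g a => c.mapComp g.unop f.unop a)
    (fun {_x _y _z} f g {_a _b} k => c.mapComp_natural g.unop f.unop k)
    (fun f g h a => c.mapComp_assoc h.unop g.unop f.unop a)
    (fun f a => c.mapComp_id_right f.unop a) (fun f a => c.mapComp_id_left f.unop a)

theorem pushId_pseudo {x : Xᵒᵖ} (a : p.Fiber x.unop) :
    pushId c.pseudo (𝟙 x) rfl a = c.mapId a :=
  Iso.ext (Co.pushId_hom (X := Xᵒᵖ) c.pseudo x a)

theorem pushComp_pseudo {x y z : Xᵒᵖ} (f : x ⟶ y) (g : y ⟶ z) (a : p.Fiber x.unop) :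
    pushComp c.pseudo f g _ rfl a = c.mapComp g.unop f.unop a :=
  Iso.ext (pushComp_hom c.pseudo f g a)

theorem pushId_inv_lift {x : Xᵒᵖ} (a : p.Fiber x.unop) :
    (pushId c.pseudo (𝟙 x) rfl a).inv.1 ≫ c.lift (𝟙 x.unop) a = 𝟙 a.1 := by
  have e : (c.mapId a).inv.1 ≫ c.lift (𝟙 x.unop) a = 𝟙 a.1 := by
    rw [← mapId_hom]
    exact congrArg Subtype.val (c.mapId a).inv_hom_id
  exact (congrArg (fun i : c.obj (𝟙 x.unop) a ≅ a => i.inv.1 ≫ c.lift (𝟙 x.unop) a)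
    (c.pushId_pseudo a)).trans e

theorem pushComp_inv_lift {x y z : Xᵒᵖ} (f : x ⟶ y) (g : y ⟶ z) (a : p.Fiber x.unop) :
    (pushComp c.pseudo f g _ rfl a).inv.1 ≫ c.lift (g.unop ≫ f.unop) a =
      c.lift g.unop (c.obj f.unop a) ≫ c.lift f.unop a := by
  have e : (c.mapComp g.unop f.unop a).inv.1 ≫ c.lift (g.unop ≫ f.unop) a =
      c.lift g.unop (c.obj f.unop a) ≫ c.lift f.unop a := by
    rw [← mapComp_hom_lift, ← Category.assoc]
    exact (congrArg Subtype.val (c.mapComp g.unop f.unop a).inv_hom_id =≫ _).trans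
      (Category.id_comp _)
  exact (congrArg (fun i : c.obj (g.unop ≫ f.unop) a ≅ c.obj g.unop (c.obj f.unop a) =>
    i.inv.1 ≫ c.lift (g.unop ≫ f.unop) a) (c.pushComp_pseudo f g a)).trans e

open scoped Pseudofunctor.CoGrothendieck

/-- The comparison functor from the Grothendieck construction. -/
noncomputable def fromTotal : (∫ᶜ c.pseudo) ⥤ A where
  obj a := a.fiber.1
  map {a b} φ := φ.fiber.1 ≫ c.lift φ.base b.fiber
  map_id a := by
    refine Eq.trans ?_ (c.pushId_inv_lift (x := op a.base) a.fiber)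
    exact congrArg (fun φ : a ⟶ a => φ.fiber.1 ≫ c.lift φ.base a.fiber)
      (Contra.id_eq_hom (F := c.pseudo) (op a.base) a.fiber (𝟙 _) rfl)
  map_comp {a b d} φ ψ := by
    refine (congrArg (fun φ : a ⟶ d => φ.fiber.1 ≫ c.lift φ.base d.fiber)
      (Contra.hom_comp_hom (F := c.pseudo) (a := a.fiber) (b := b.fiber) (c := d.fiber)
        φ.base.op φ.fiber ψ.base.op ψ.fiber _ rfl)).trans ?_
    refine (Category.assoc _ _ _).trans (Eq.trans ?_ (Category.assoc _ _ _).symm)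
    refine _ ≫= ((Category.assoc _ _ _).trans ?_)
    refine (_ ≫= c.pushComp_inv_lift ψ.base.op φ.base.op d.fiber).trans ?_
    refine (Category.assoc _ _ _).symm.trans ((c.mapHom_lift φ.base ψ.fiber =≫ _).trans ?_)
    exact Category.assoc _ _ _

theorem isHomLift_fromTotal_map {a b : ∫ᶜ c.pseudo} (φ : a ⟶ b) :
    p.IsHomLift φ.base (c.fromTotal.map φ) := by
  have h₁ : p.IsHomLift (𝟙 a.base) φ.fiber.1 := φ.fiber.2
  have h₂ : p.IsHomLift φ.base (c.lift φ.base b.fiber) := (c.isCart φ.base b.fiber).toIsHomLift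
  exact isHomLift_id_comp p h₁ h₂

theorem fromTotal_comp : c.fromTotal ⋙ p = Pseudofunctor.CoGrothendieck.forget c.pseudo :=
  CategoryTheory.Functor.ext (fun a => a.fiber.2) (fun a b φ => by
    have := c.isHomLift_fromTotal_map φ
    exact IsHomLift.fac' p φ.base (c.fromTotal.map φ))

theorem fromTotal_obj_bijective : Function.Bijective c.fromTotal.obj := by
  constructor
  · rintro ⟨x, ⟨a, hx⟩⟩ ⟨y, ⟨b, hy⟩⟩ (h : a = b)
    change p.obj a = x at hx
    change p.obj b = y at hy
    subst hx hy h
    rfl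
  · intro a
    exact ⟨⟨p.obj a, ⟨a, rfl⟩⟩, rfl⟩

/-- The base arrow is the image under `p`, and the fibre component is the unique factorization
through the chosen cartesian lift. -/
theorem fromTotal_map_bijective (a b : ∫ᶜ c.pseudo) :
    Function.Bijective (c.fromTotal.map : (a ⟶ b) → _) := by
  constructor
  · intro φ ψ h
    have h₁ := c.isHomLift_fromTotal_map φ
    have h₂ := c.isHomLift_fromTotal_map ψ
    rw [h] at h₁
    obtain ⟨f, k⟩ := φ
    obtain ⟨g, l⟩ := ψ
    obtain rfl : f = g := (@IsHomLift.fac _ _ _ _ p _ _ _ _ f _ h₁).trans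
      (@IsHomLift.fac _ _ _ _ p _ _ _ _ g _ h₂).symm
    exact congrArg (Contra.hom (F := c.pseudo) f.op) (c.hom_ext f h)
  · intro ψ
    obtain ⟨x, ⟨a, hx⟩⟩ := a
    obtain ⟨y, ⟨b, hy⟩⟩ := b
    change p.obj a = x at hx
    change p.obj b = y at hy
    subst hx hy
    change a ⟶ b at ψ
    exact ⟨⟨p.map ψ, c.ind (p.map ψ) ψ (IsHomLift.map p ψ)⟩, c.ind_lift _ _ _⟩

end Cleavage

end Cleavage

end MonGroth

/-! ### Lax monoidal structures from tensor products on the total category, contravariant case -/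

namespace MonGroth

open scoped Pseudofunctor.CoGrothendieck Pseudofunctor.Grothendieck

namespace Contra

section Morphisms

variable {X : Type u₁} [Category.{v₁} X] {F : LocallyDiscrete Xᵒᵖ ⥤ᵖ Cat.{v₂, u₂}}

theorem exists_hom_eq {x y : Xᵒᵖ} {a : F.obj ⟨x⟩} {b : F.obj ⟨y⟩}
    (φ : (⟨x.unop, a⟩ : ∫ᶜ F) ⟶ ⟨y.unop, b⟩) (f : y ⟶ x) (h : φ.base = f.unop) :
    ∃ k, hom f k = φ := by
  obtain ⟨g, k⟩ := φ
  obtain rfl : g = f.unop := h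
  exact ⟨k, rfl⟩

theorem exists_vert_eq {x : Xᵒᵖ} {a b : F.obj ⟨x⟩} (φ : (⟨x.unop, a⟩ : ∫ᶜ F) ⟶ ⟨x.unop, b⟩)
    (h : φ.base = 𝟙 x.unop) : ∃ k : a ⟶ b, vert k = φ := by
  obtain ⟨k, rfl⟩ := exists_hom_eq φ (𝟙 x) h
  refine ⟨k ≫ (pushId F (𝟙 x) rfl b).hom, (vert_eq_hom _ _ rfl).trans ?_⟩
  rw [Category.assoc, Iso.hom_inv_id, Category.comp_id]

theorem isIso_of_isIso_hom {x y : Xᵒᵖ} {a : F.obj ⟨x⟩} {b : F.obj ⟨y⟩} (f : y ⟶ x)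
    (k : a ⟶ (push F f).obj b) (h : IsIso (hom f k)) : IsIso k := by
  refine (isCart_hom_iff f k).1 ?_
  have : (Pseudofunctor.CoGrothendieck.forget F).IsHomLift f.unop (hom f k) :=
    IsHomLift.map (Pseudofunctor.CoGrothendieck.forget F) (hom f k)
  exact Functor.IsStronglyCartesian.of_isIso (Pseudofunctor.CoGrothendieck.forget F) f.unop
    (hom f k)

/-- This bracketing is the one produced by inverting a composite of isomorphisms, so inverted axioms
can be matched with composites in `∫ᶜ F` without reassociation. -/
theorem hom_comp_hom' {x y z : Xᵒᵖ} {a : F.obj ⟨x⟩} {b : F.obj ⟨y⟩} {c : F.obj ⟨z⟩} (f : y ⟶ x)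
    (k : a ⟶ (push F f).obj b) (g : z ⟶ y) (l : b ⟶ (push F g).obj c) (h : z ⟶ x)
    (w : g ≫ f = h) :
    hom f k ≫ hom g l = hom h ((k ≫ (push F f).map l) ≫ (pushComp F g f h w c).inv) :=
  (hom_comp_hom f k g l h w).trans (congrArg (hom h) (Category.assoc _ _ _).symm)

theorem lift_comp_hom {x y z : Xᵒᵖ} (f : y ⟶ x) {b : F.obj ⟨y⟩} {c : F.obj ⟨z⟩} (g : z ⟶ y)
    (l : b ⟶ (push F g).obj c) (h : z ⟶ x) (w : g ≫ f = h) :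
    lift F f b ≫ hom g l = hom h ((push F f).map l ≫ (pushComp F g f h w c).inv) :=
  (hom_comp_hom f _ g l h w).trans (congrArg (hom h) (Category.id_comp _))

theorem lift_comp_vert {x y : Xᵒᵖ} (f : y ⟶ x) {a b : F.obj ⟨y⟩} (k : a ⟶ b) :
    lift F f a ≫ (vert k : (⟨y.unop, a⟩ : ∫ᶜ F) ⟶ _) = vert ((push F f).map k) ≫ lift F f b := by
  rw [vert_comp_lift]
  exact (hom_comp_vert _ _ _).trans (congrArg (hom f) (Category.id_comp _))

theorem lift_comp_lift {x y z : Xᵒᵖ} (f : y ⟶ x) (g : z ⟶ y) (c : F.obj ⟨z⟩) :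
    lift F f _ ≫ lift F g c = hom (g ≫ f) (pushComp F g f _ rfl c).inv := by
  refine (lift_comp_hom f g _ _ rfl).trans (congrArg (hom _) ?_)
  rw [CategoryTheory.Functor.map_id, Category.id_comp]

/-- The fibre isomorphism is extracted from `e.inv`, since it is this direction of `e` that lies
over the forward constraint in `Xᵒᵖ`. -/
theorem exists_iso_of_base {x y : Xᵒᵖ} {a : F.obj ⟨x⟩} {b : F.obj ⟨y⟩}
    (e : (⟨x.unop, a⟩ : ∫ᶜ F) ≅ ⟨y.unop, b⟩) (f : x ≅ y) (h : e.hom.base = f.inv.unop) :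
    ∃ k : (push F f.hom).obj a ≅ b, hom f.hom k.inv = e.inv := by
  have h' : e.inv.base = f.hom.unop :=
    inv_eq_inv_of_hom (i := (Pseudofunctor.CoGrothendieck.forget F).mapIso e) (j := f.symm.unop) h
  obtain ⟨k, hk⟩ := exists_hom_eq e.inv f.hom h'
  have := isIso_of_isIso_hom f.hom k (by rw [hk]; exact e.isIso_inv)
  exact ⟨(asIso k).symm, hk⟩

end Morphisms

section FiberedTensor

variable {X : Type u₁} [Category.{v₁} X] [MonoidalCategory X]

/-- A monoidal structure on `∫ᶜ F` strictly over that of `X` and preserving cartesian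
morphisms. -/
structure FiberedTensor (F : LocallyDiscrete Xᵒᵖ ⥤ᵖ Cat.{v₂, u₂}) where
  /-- the tensor product on fibres -/
  obj {x y : Xᵒᵖ} (a : F.obj ⟨x⟩) (b : F.obj ⟨y⟩) : F.obj ⟨x ⊗ y⟩
  /-- the unit -/
  unit : F.obj ⟨𝟙_ Xᵒᵖ⟩
  /-- the tensor product of morphisms -/
  map {A A' B B' : ∫ᶜ F} (φ : A ⟶ A') (ψ : B ⟶ B') :
    (⟨A.base ⊗ B.base, obj A.fiber B.fiber⟩ : ∫ᶜ F) ⟶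
      ⟨A'.base ⊗ B'.base, obj A'.fiber B'.fiber⟩
  map_base {A A' B B' : ∫ᶜ F} (φ : A ⟶ A') (ψ : B ⟶ B') : (map φ ψ).base = φ.base ⊗ₘ ψ.base
  isCart_map {A A' B B' : ∫ᶜ F} (φ : A ⟶ A') (ψ : B ⟶ B') :
    IsCart (Pseudofunctor.CoGrothendieck.forget F) φ →
    IsCart (Pseudofunctor.CoGrothendieck.forget F) ψ →
    IsCart (Pseudofunctor.CoGrothendieck.forget F) (map φ ψ)
  /-- the associator -/
  ass (A B D : ∫ᶜ F) :
    (⟨(A.base ⊗ B.base) ⊗ D.base, obj (obj A.fiber B.fiber) D.fiber⟩ : ∫ᶜ F) ≅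
      ⟨A.base ⊗ (B.base ⊗ D.base), obj A.fiber (obj B.fiber D.fiber)⟩
  ass_base (A B D : ∫ᶜ F) : (ass A B D).hom.base = (α_ A.base B.base D.base).hom
  /-- the left unitor -/
  left (A : ∫ᶜ F) : (⟨𝟙_ X ⊗ A.base, obj unit A.fiber⟩ : ∫ᶜ F) ≅ A
  left_base (A : ∫ᶜ F) : (left A).hom.base = (λ_ A.base).hom
  /-- the right unitor -/
  right (A : ∫ᶜ F) : (⟨A.base ⊗ 𝟙_ X, obj A.fiber unit⟩ : ∫ᶜ F) ≅ A
  right_base (A : ∫ᶜ F) : (right A).hom.base = (ρ_ A.base).hom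
  isMonoidal : IsMonoidalStruct (tensorStructOf (A := ∫ᶜ F)
    (fun A B => ⟨A.base ⊗ B.base, obj A.fiber B.fiber⟩) ⟨𝟙_ X, unit⟩ map ass left right)

namespace FiberedTensor

variable {F : LocallyDiscrete Xᵒᵖ ⥤ᵖ Cat.{v₂, u₂}} (t : FiberedTensor F)

/-- The monoidal structure on `∫ᶜ F`. -/
abbrev monoidal : MonoidalCategory (∫ᶜ F) := monoidalOfStruct _ t.isMonoidal

section Structure

variable {w x x' x'' y y' y'' z z' : Xᵒᵖ}

/-- The tensor product of morphisms, for objects indexed by `Xᵒᵖ`. -/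
def tensor {a : F.obj ⟨x⟩} {a' : F.obj ⟨x'⟩} {b : F.obj ⟨y⟩} {b' : F.obj ⟨y'⟩}
    (φ : (⟨x.unop, a⟩ : ∫ᶜ F) ⟶ ⟨x'.unop, a'⟩) (ψ : (⟨y.unop, b⟩ : ∫ᶜ F) ⟶ ⟨y'.unop, b'⟩) :
    (⟨(x ⊗ y).unop, t.obj a b⟩ : ∫ᶜ F) ⟶ ⟨(x' ⊗ y').unop, t.obj a' b'⟩ :=
  t.map φ ψ

/-- The associator, for objects indexed by `Xᵒᵖ`. -/
def assIso (a : F.obj ⟨x⟩) (b : F.obj ⟨y⟩) (c : F.obj ⟨z⟩) :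
    (⟨((x ⊗ y) ⊗ z).unop, t.obj (t.obj a b) c⟩ : ∫ᶜ F) ≅
      ⟨(x ⊗ (y ⊗ z)).unop, t.obj a (t.obj b c)⟩ :=
  t.ass ⟨x.unop, a⟩ ⟨y.unop, b⟩ ⟨z.unop, c⟩

/-- The left unitor, for objects indexed by `Xᵒᵖ`. -/
def leftIso (a : F.obj ⟨x⟩) : (⟨(𝟙_ Xᵒᵖ ⊗ x).unop, t.obj t.unit a⟩ : ∫ᶜ F) ≅ ⟨x.unop, a⟩ :=
  t.left ⟨x.unop, a⟩

/-- The right unitor, for objects indexed by `Xᵒᵖ`. -/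
def rightIso (a : F.obj ⟨x⟩) : (⟨(x ⊗ 𝟙_ Xᵒᵖ).unop, t.obj a t.unit⟩ : ∫ᶜ F) ≅ ⟨x.unop, a⟩ :=
  t.right ⟨x.unop, a⟩

theorem tensor_id (a : F.obj ⟨x⟩) (b : F.obj ⟨y⟩) :
    t.tensor (𝟙 (⟨x.unop, a⟩ : ∫ᶜ F)) (𝟙 (⟨y.unop, b⟩ : ∫ᶜ F)) =
      𝟙 (⟨(x ⊗ y).unop, t.obj a b⟩ : ∫ᶜ F) :=
  t.monoidal.id_tensorHom_id ⟨x.unop, a⟩ ⟨y.unop, b⟩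

theorem tensor_comp {a : F.obj ⟨x⟩} {a' : F.obj ⟨x'⟩} {a'' : F.obj ⟨x''⟩} {b : F.obj ⟨y⟩}
    {b' : F.obj ⟨y'⟩} {b'' : F.obj ⟨y''⟩} (φ : (⟨x.unop, a⟩ : ∫ᶜ F) ⟶ ⟨x'.unop, a'⟩)
    (φ' : (⟨x'.unop, a'⟩ : ∫ᶜ F) ⟶ ⟨x''.unop, a''⟩) (ψ : (⟨y.unop, b⟩ : ∫ᶜ F) ⟶ ⟨y'.unop, b'⟩)
    (ψ' : (⟨y'.unop, b'⟩ : ∫ᶜ F) ⟶ ⟨y''.unop, b''⟩) :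
    t.tensor (φ ≫ φ') (ψ ≫ ψ') = t.tensor φ ψ ≫ t.tensor φ' ψ' :=
  (t.monoidal.tensorHom_comp_tensorHom φ ψ φ' ψ').symm

theorem assIso_natural {a : F.obj ⟨x⟩} {a' : F.obj ⟨x'⟩} {b : F.obj ⟨y⟩} {b' : F.obj ⟨y'⟩}
    {c : F.obj ⟨z⟩} {c' : F.obj ⟨z'⟩} (φ : (⟨x.unop, a⟩ : ∫ᶜ F) ⟶ ⟨x'.unop, a'⟩)
    (ψ : (⟨y.unop, b⟩ : ∫ᶜ F) ⟶ ⟨y'.unop, b'⟩) (χ : (⟨z.unop, c⟩ : ∫ᶜ F) ⟶ ⟨z'.unop, c'⟩) :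
    t.tensor φ (t.tensor ψ χ) ≫ (t.assIso a' b' c').inv =
      (t.assIso a b c).inv ≫ t.tensor (t.tensor φ ψ) χ :=
  inv_comp_inv_of_hom (t.monoidal.associator_naturality φ ψ χ)

theorem leftIso_natural {a : F.obj ⟨x⟩} {a' : F.obj ⟨x'⟩}
    (φ : (⟨x.unop, a⟩ : ∫ᶜ F) ⟶ ⟨x'.unop, a'⟩) :
    φ ≫ (t.leftIso a').inv =
      (t.leftIso a).inv ≫ t.tensor (𝟙 (⟨(𝟙_ Xᵒᵖ).unop, t.unit⟩ : ∫ᶜ F)) φ :=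
  inv_comp_inv_of_hom (t.monoidal.leftUnitor_naturality φ)

theorem rightIso_natural {a : F.obj ⟨x⟩} {a' : F.obj ⟨x'⟩}
    (φ : (⟨x.unop, a⟩ : ∫ᶜ F) ⟶ ⟨x'.unop, a'⟩) :
    φ ≫ (t.rightIso a').inv =
      (t.rightIso a).inv ≫ t.tensor φ (𝟙 (⟨(𝟙_ Xᵒᵖ).unop, t.unit⟩ : ∫ᶜ F)) :=
  inv_comp_inv_of_hom (t.monoidal.rightUnitor_naturality φ)

theorem pentagonIso (a : F.obj ⟨w⟩) (b : F.obj ⟨x⟩) (c : F.obj ⟨y⟩) (d : F.obj ⟨z⟩) :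
    (t.tensor (𝟙 (⟨w.unop, a⟩ : ∫ᶜ F)) (t.assIso b c d).inv ≫ (t.assIso a (t.obj b c) d).inv) ≫
        t.tensor (t.assIso a b c).inv (𝟙 (⟨z.unop, d⟩ : ∫ᶜ F)) =
      (t.assIso a b (t.obj c d)).inv ≫ (t.assIso (t.obj a b) c d).inv :=
  letI := t.monoidal
  (Category.assoc _ _ _).trans
    (@MonoidalCategory.pentagon_inv (∫ᶜ F) _ _ ⟨w.unop, a⟩ ⟨x.unop, b⟩ ⟨y.unop, c⟩ ⟨z.unop, d⟩)

theorem triangleIso (a : F.obj ⟨x⟩) (b : F.obj ⟨y⟩) :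
    t.tensor (𝟙 (⟨x.unop, a⟩ : ∫ᶜ F)) (t.leftIso b).inv ≫ (t.assIso a t.unit b).inv =
      t.tensor (t.rightIso a).inv (𝟙 (⟨y.unop, b⟩ : ∫ᶜ F)) :=
  letI := t.monoidal
  MonoidalCategory.triangle_assoc_comp_left_inv (C := ∫ᶜ F) ⟨x.unop, a⟩ ⟨y.unop, b⟩

theorem exists_mapVert {a a' : F.obj ⟨x⟩} {b b' : F.obj ⟨y⟩} (k : a ⟶ a') (l : b ⟶ b') :
    ∃ m : t.obj a b ⟶ t.obj a' b', vert m = t.tensor (vert k) (vert l) :=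
  exists_vert_eq (x := x ⊗ y) _ ((t.map_base _ _).trans (id_tensorHom_id x.unop y.unop))

/-- The tensor product of morphisms of fibres. -/
noncomputable def mapVert {a a' : F.obj ⟨x⟩} {b b' : F.obj ⟨y⟩} (k : a ⟶ a') (l : b ⟶ b') :
    t.obj a b ⟶ t.obj a' b' := (t.exists_mapVert k l).choose

theorem vert_mapVert {a a' : F.obj ⟨x⟩} {b b' : F.obj ⟨y⟩} (k : a ⟶ a') (l : b ⟶ b') :
    vert (t.mapVert k l) = t.tensor (vert k) (vert l) := (t.exists_mapVert k l).choose_spec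

end Structure

/-- The laxator. -/
noncomputable def mu (x y : Xᵒᵖ) : F.obj ⟨x⟩ × F.obj ⟨y⟩ ⥤ F.obj ⟨x ⊗ y⟩ where
  obj p := t.obj p.1 p.2
  map k := t.mapVert k.1 k.2
  map_id p := vert_injective <| by
    rw [vert_mapVert]
    refine Eq.trans ?_ (vert_id _).symm
    exact (congrArg₂ t.tensor (vert_id _) (vert_id _)).trans (t.tensor_id _ _)
  map_comp k l := vert_injective <| by
    rw [← vert_vert, vert_mapVert, vert_mapVert, vert_mapVert, ← tensor_comp, vert_vert, vert_vert]
    rfl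

/-- The isomorphism induced by the laxator. -/
noncomputable def muIso {x y : Xᵒᵖ} {a a' : F.obj ⟨x⟩} {b b' : F.obj ⟨y⟩} (i : a ≅ a')
    (j : b ≅ b') : (t.mu x y).obj (a, b) ≅ (t.mu x y).obj (a', b') := (t.mu x y).mapIso (i.prod j)

/-- The tensor of two cartesian lifts is cartesian, so its fibre component is invertible. That
component points towards the pushed object, so it is the inverse of the constraint. -/
theorem exists_muMap {x x' y y' : Xᵒᵖ} (f : x ⟶ x') (g : y ⟶ y') (a : F.obj ⟨x⟩) (b : F.obj ⟨y⟩) :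
    ∃ k : (push F (f ⊗ₘ g)).obj (t.obj a b) ≅ t.obj ((push F f).obj a) ((push F g).obj b),
      hom (f ⊗ₘ g) k.inv = t.tensor (lift F f a) (lift F g b) := by
  obtain ⟨k, hk⟩ := exists_hom_eq (t.tensor (lift F f a) (lift F g b)) (f ⊗ₘ g) (t.map_base _ _)
  have h : IsCart (Pseudofunctor.CoGrothendieck.forget F) (t.tensor (lift F f a) (lift F g b)) :=
    t.isCart_map (lift F f a) (lift F g b) (lift_isStronglyCartesian f a)
      (lift_isStronglyCartesian g b)
  rw [← hk] at h
  have := (isCart_hom_iff _ _).1 h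
  exact ⟨(asIso k).symm, hk⟩

/-- The pseudonaturality constraint of the laxator. -/
noncomputable def muMap {x x' y y' : Xᵒᵖ} (f : x ⟶ x') (g : y ⟶ y') (a : F.obj ⟨x⟩)
    (b : F.obj ⟨y⟩) : (push F (f ⊗ₘ g)).obj ((t.mu x y).obj (a, b)) ≅
      (t.mu x' y').obj ((push F f).obj a, (push F g).obj b) := (t.exists_muMap f g a b).choose

theorem hom_muMap {x x' y y' : Xᵒᵖ} (f : x ⟶ x') (g : y ⟶ y') (a : F.obj ⟨x⟩)
    (b : F.obj ⟨y⟩) : hom (f ⊗ₘ g) (t.muMap f g a b).inv = t.tensor (lift F f a) (lift F g b) :=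
  (t.exists_muMap f g a b).choose_spec

theorem vert_mu {x y : Xᵒᵖ} {a a' : F.obj ⟨x⟩} {b b' : F.obj ⟨y⟩} (k : a ⟶ a') (l : b ⟶ b') :
    vert ((t.mu x y).map (k ×ₘ l)) = t.tensor (vert k) (vert l) := t.vert_mapVert k l

/-- Factoring both arrows as vertical followed by a lift expresses the given tensor by `mu` and
`muMap`, in the form used for the tensor on `∫ᶜ`. -/
theorem tensor_hom {x x' y y' : Xᵒᵖ} {a : F.obj ⟨x⟩} {a' : F.obj ⟨x'⟩} {b : F.obj ⟨y⟩}
    {b' : F.obj ⟨y'⟩} (f : x' ⟶ x) (k : a ⟶ (push F f).obj a') (g : y' ⟶ y)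
    (l : b ⟶ (push F g).obj b') :
    t.tensor (hom f k) (hom g l) =
      hom (f ⊗ₘ g) ((t.mu x y).map (k ×ₘ l) ≫ (t.muMap f g a' b').inv) := by
  refine (congrArg₂ t.tensor (vert_comp_lift f a' k).symm (vert_comp_lift g b' l).symm).trans ?_
  refine (t.tensor_comp _ _ _ _).trans (Eq.trans ?_ (vert_comp_hom _ _ _))
  exact congrArg₂ (· ≫ ·) (t.vert_mu k l).symm (t.hom_muMap f g a' b').symm

/-- The associativity modification. -/
noncomputable def omega {x y z : Xᵒᵖ} (a : F.obj ⟨x⟩) (b : F.obj ⟨y⟩) (c : F.obj ⟨z⟩) :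
    (push F (α_ x y z).hom).obj ((t.mu (x ⊗ y) z).obj ((t.mu x y).obj (a, b), c)) ≅
      (t.mu x (y ⊗ z)).obj (a, (t.mu y z).obj (b, c)) :=
  (exists_iso_of_base (t.assIso a b c) (α_ x y z) (t.ass_base _ _ _)).choose

theorem hom_omega {x y z : Xᵒᵖ} (a : F.obj ⟨x⟩) (b : F.obj ⟨y⟩) (c : F.obj ⟨z⟩) :
    hom (α_ x y z).hom (t.omega a b c).inv = (t.assIso a b c).inv :=
  (exists_iso_of_base (t.assIso a b c) (α_ x y z) (t.ass_base _ _ _)).choose_spec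

/-- The right unit modification. -/
noncomputable def zeta {x : Xᵒᵖ} (a : F.obj ⟨x⟩) :
    (push F (ρ_ x).hom).obj ((t.mu x (𝟙_ Xᵒᵖ)).obj (a, t.unit)) ≅ a :=
  (exists_iso_of_base (t.rightIso a) (ρ_ x) (t.right_base _)).choose

theorem hom_zeta {x : Xᵒᵖ} (a : F.obj ⟨x⟩) :
    hom (ρ_ x).hom (t.zeta a).inv = (t.rightIso a).inv :=
  (exists_iso_of_base (t.rightIso a) (ρ_ x) (t.right_base _)).choose_spec

/-- The left unit modification. -/
noncomputable def xi {x : Xᵒᵖ} (a : F.obj ⟨x⟩) :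
    (push F (λ_ x).hom).obj ((t.mu (𝟙_ Xᵒᵖ) x).obj (t.unit, a)) ≅ a :=
  (exists_iso_of_base (t.leftIso a) (λ_ x) (t.left_base _)).choose

theorem hom_xi {x : Xᵒᵖ} (a : F.obj ⟨x⟩) :
    hom (λ_ x).hom (t.xi a).inv = (t.leftIso a).inv :=
  (exists_iso_of_base (t.leftIso a) (λ_ x) (t.left_base _)).choose_spec

theorem omega_natural {x y z : Xᵒᵖ} {a a' : F.obj ⟨x⟩} {b b' : F.obj ⟨y⟩} {c c' : F.obj ⟨z⟩}
    (k : a ⟶ a') (l : b ⟶ b') (m : c ⟶ c') :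
    (push F (α_ x y z).hom).map ((t.mu (x ⊗ y) z).map ((t.mu x y).map (k ×ₘ l) ×ₘ m)) ≫
        (t.omega a' b' c').hom =
      (t.omega a b c).hom ≫ (t.mu x (y ⊗ z)).map (k ×ₘ (t.mu y z).map (l ×ₘ m)) := by
  refine hom_comp_hom_of_inv (hom_injective (f := (α_ x y z).hom) ?_)
  rw [← vert_comp_hom, ← hom_comp_vert, hom_omega, hom_omega, vert_mu, vert_mu, vert_mu, vert_mu]
  exact t.assIso_natural _ _ _

/-- After inversion both sides are fibre components of arrows in `∫ᶜ F`, and the equation is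
naturality of the inverse associator at three cartesian lifts. The other axioms are treated
likewise. -/
theorem omega_modification {x x' y y' z z' : Xᵒᵖ} (f : x ⟶ x') (g : y ⟶ y') (h : z ⟶ z')
    (a : F.obj ⟨x⟩) (b : F.obj ⟨y⟩) (c : F.obj ⟨z⟩) :
    (push F (f ⊗ₘ (g ⊗ₘ h))).map (t.omega a b c).hom ≫ (t.muMap f (g ⊗ₘ h) a _).hom ≫
        (t.mu x' (y' ⊗ z')).map (𝟙 _ ×ₘ (t.muMap g h b c).hom) =
      (pushComp F (α_ x y z).hom (f ⊗ₘ (g ⊗ₘ h)) _ rfl _).inv ≫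
        (pushComp F ((f ⊗ₘ g) ⊗ₘ h) (α_ x' y' z').hom _ (by simp) _).hom ≫
          (push F (α_ x' y' z').hom).map ((t.muMap (f ⊗ₘ g) h _ c).hom ≫
            (t.mu (x' ⊗ y') z').map ((t.muMap f g a b).hom ×ₘ 𝟙 _)) ≫
              (t.omega ((push F f).obj a) ((push F g).obj b) ((push F h).obj c)).hom := by
  rw [Iso.eq_inv_comp]
  refine hom_eq_hom_of_inv (i := pushComp F (α_ x y z).hom (f ⊗ₘ (g ⊗ₘ h)) _ rfl _ ≪≫
      (push F _).mapIso (t.omega a b c) ≪≫ t.muMap f (g ⊗ₘ h) a _ ≪≫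
        t.muIso (Iso.refl _) (t.muMap g h b c))
    (j := pushComp F ((f ⊗ₘ g) ⊗ₘ h) (α_ x' y' z').hom _ (by simp) _ ≪≫
        (push F _).mapIso (t.muMap (f ⊗ₘ g) h _ c ≪≫ t.muIso (t.muMap f g a b) (Iso.refl _)) ≪≫
          t.omega _ _ _) (hom_injective ?_)
  refine (hom_comp_hom' _ _ _ _ _ _).symm.trans (Eq.trans ?_ (hom_comp_hom' _ _ _ _ _ _))
  have e₁ := t.tensor_hom f (𝟙 ((push F f).obj a)) (g ⊗ₘ h) (t.muMap g h b c).inv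
  have e₂ := t.tensor_hom (f ⊗ₘ g) (t.muMap f g a b).inv h (𝟙 ((push F h).obj c))
  rw [hom_muMap] at e₁ e₂
  exact (congrArg₂ (· ≫ ·) e₁.symm (t.hom_omega a b c)).trans
    ((t.assIso_natural _ _ _).trans (congrArg₂ (· ≫ ·) (t.hom_omega _ _ _).symm e₂))

theorem zeta_modification {x x' : Xᵒᵖ} (f : x ⟶ x') (a : F.obj ⟨x⟩) :
    (push F f).map (t.zeta a).hom =
      (pushComp F (ρ_ x).hom f _ rfl _).inv ≫
        (pushComp F (f ⊗ₘ 𝟙 (𝟙_ Xᵒᵖ)) (ρ_ x').hom _ (by simp) _).hom ≫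
          (push F (ρ_ x').hom).map ((t.muMap f (𝟙 (𝟙_ Xᵒᵖ)) a t.unit).hom ≫
            (t.mu x' (𝟙_ Xᵒᵖ)).map (𝟙 _ ×ₘ (pushId F (𝟙 (𝟙_ Xᵒᵖ)) rfl t.unit).hom)) ≫
              (t.zeta ((push F f).obj a)).hom := by
  rw [Iso.eq_inv_comp]
  refine hom_eq_hom_of_inv (i := pushComp F (ρ_ x).hom f _ rfl _ ≪≫
      (push F f).mapIso (t.zeta a))
    (j := pushComp F (f ⊗ₘ 𝟙 (𝟙_ Xᵒᵖ)) (ρ_ x').hom _ (by simp) _ ≪≫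
        (push F _).mapIso (t.muMap f (𝟙 (𝟙_ Xᵒᵖ)) a t.unit ≪≫
          t.muIso (Iso.refl _) (pushId F (𝟙 (𝟙_ Xᵒᵖ)) rfl t.unit)) ≪≫ t.zeta _)
    (hom_injective ?_)
  refine (lift_comp_hom _ _ _ _ _).symm.trans (Eq.trans ?_ (hom_comp_hom' _ _ _ _ _ _))
  have e := t.tensor_hom f (𝟙 ((push F f).obj a)) (𝟙 (𝟙_ Xᵒᵖ)) (pushId F (𝟙 (𝟙_ Xᵒᵖ)) rfl t.unit).inv
  rw [← id_eq_hom] at e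
  exact (_ ≫= t.hom_zeta a).trans
    ((t.rightIso_natural _).trans (congrArg₂ (· ≫ ·) (t.hom_zeta _).symm e))

theorem xi_modification {x x' : Xᵒᵖ} (f : x ⟶ x') (a : F.obj ⟨x⟩) :
    (push F f).map (t.xi a).hom =
      (pushComp F (λ_ x).hom f _ rfl _).inv ≫
        (pushComp F (𝟙 (𝟙_ Xᵒᵖ) ⊗ₘ f) (λ_ x').hom _ (by simp) _).hom ≫
          (push F (λ_ x').hom).map ((t.muMap (𝟙 (𝟙_ Xᵒᵖ)) f t.unit a).hom ≫
            (t.mu (𝟙_ Xᵒᵖ) x').map ((pushId F (𝟙 (𝟙_ Xᵒᵖ)) rfl t.unit).hom ×ₘ 𝟙 _)) ≫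
              (t.xi ((push F f).obj a)).hom := by
  rw [Iso.eq_inv_comp]
  refine hom_eq_hom_of_inv (i := pushComp F (λ_ x).hom f _ rfl _ ≪≫
      (push F f).mapIso (t.xi a))
    (j := pushComp F (𝟙 (𝟙_ Xᵒᵖ) ⊗ₘ f) (λ_ x').hom _ (by simp) _ ≪≫
        (push F _).mapIso (t.muMap (𝟙 (𝟙_ Xᵒᵖ)) f t.unit a ≪≫
          t.muIso (pushId F (𝟙 (𝟙_ Xᵒᵖ)) rfl t.unit) (Iso.refl _)) ≪≫ t.xi _)
    (hom_injective ?_)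
  refine (lift_comp_hom _ _ _ _ _).symm.trans (Eq.trans ?_ (hom_comp_hom' _ _ _ _ _ _))
  have e := t.tensor_hom (𝟙 (𝟙_ Xᵒᵖ)) (pushId F (𝟙 (𝟙_ Xᵒᵖ)) rfl t.unit).inv f
    (𝟙 ((push F f).obj a))
  rw [← id_eq_hom] at e
  exact (_ ≫= t.hom_xi a).trans
    ((t.leftIso_natural _).trans (congrArg₂ (· ≫ ·) (t.hom_xi _).symm e))

theorem muMap_natural {x x' y y' : Xᵒᵖ} (f : x ⟶ x') (g : y ⟶ y') {a a' : F.obj ⟨x⟩}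
    {b b' : F.obj ⟨y⟩} (k : a ⟶ a') (l : b ⟶ b') :
    (push F (f ⊗ₘ g)).map ((t.mu x y).map (k ×ₘ l)) ≫ (t.muMap f g a' b').hom =
      (t.muMap f g a b).hom ≫ (t.mu x' y').map ((push F f).map k ×ₘ (push F g).map l) := by
  refine hom_comp_hom_of_inv (hom_injective (f := f ⊗ₘ g) ?_)
  rw [← vert_comp_hom, ← hom_comp_vert, hom_muMap, hom_muMap, vert_mu, vert_mu]
  refine (t.tensor_comp _ _ _ _).symm.trans (Eq.trans ?_ (t.tensor_comp _ _ _ _))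
  exact congrArg₂ t.tensor (lift_comp_vert f k).symm (lift_comp_vert g l).symm

theorem muMap_id {x y : Xᵒᵖ} (a : F.obj ⟨x⟩) (b : F.obj ⟨y⟩) :
    (t.muMap (𝟙 x) (𝟙 y) a b).hom ≫
        (t.mu x y).map ((pushId F (𝟙 x) rfl a).hom ×ₘ (pushId F (𝟙 y) rfl b).hom) =
      (pushId F (𝟙 x ⊗ₘ 𝟙 y) (by simp) ((t.mu x y).obj (a, b))).hom := by
  refine hom_eq_hom_of_inv (i := t.muMap (𝟙 x) (𝟙 y) a b ≪≫
    t.muIso (pushId _ _ rfl a) (pushId _ _ rfl b)) (hom_injective ?_)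
  refine (t.tensor_hom _ _ _ _).symm.trans (Eq.trans ?_ (id_eq_hom _ _ _ _))
  rw [← id_eq_hom, ← id_eq_hom]
  exact t.tensor_id _ _

theorem muMap_comp {x x' x'' y y' y'' : Xᵒᵖ} (f : x ⟶ x') (f' : x' ⟶ x'') (g : y ⟶ y')
    (g' : y' ⟶ y'') (a : F.obj ⟨x⟩) (b : F.obj ⟨y⟩) :
    (t.muMap (f ≫ f') (g ≫ g') a b).hom ≫
        (t.mu x'' y'').map ((pushComp F f f' _ rfl a).hom ×ₘ (pushComp F g g' _ rfl b).hom) =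
      (pushComp F (f ⊗ₘ g) (f' ⊗ₘ g') ((f ≫ f') ⊗ₘ (g ≫ g')) (by simp)
          ((t.mu x y).obj (a, b))).hom ≫
        (push F (f' ⊗ₘ g')).map (t.muMap f g a b).hom ≫ (t.muMap f' g' _ _).hom := by
  refine hom_eq_hom_of_inv
    (i := t.muMap _ _ a b ≪≫ t.muIso (pushComp _ f f' _ rfl a) (pushComp _ g g' _ rfl b))
    (j := pushComp _ _ _ _ _ _ ≪≫ (push F _).mapIso (t.muMap f g a b) ≪≫ t.muMap f' g' _ _)
    (hom_injective ?_)
  refine (t.tensor_hom _ _ _ _).symm.trans (Eq.trans ?_ (hom_comp_hom' _ _ _ _ _ _))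
  refine (congrArg₂ t.tensor (lift_comp_lift _ _ _) (lift_comp_lift _ _ _)).symm.trans ?_
  exact (t.tensor_comp _ _ _ _).trans
    (congrArg₂ (· ≫ ·) (t.hom_muMap _ _ _ _).symm (t.hom_muMap _ _ _ _).symm)

theorem zeta_natural {x : Xᵒᵖ} {a a' : F.obj ⟨x⟩} (k : a ⟶ a') :
    (push F (ρ_ x).hom).map ((t.mu x (𝟙_ Xᵒᵖ)).map (k ×ₘ 𝟙 t.unit)) ≫ (t.zeta a').hom =
      (t.zeta a).hom ≫ k := by
  refine hom_comp_hom_of_inv (hom_injective (f := (ρ_ x).hom) ?_)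
  rw [← vert_comp_hom, ← hom_comp_vert, hom_zeta, hom_zeta, vert_mu, vert_id]
  exact t.rightIso_natural _

theorem xi_natural {x : Xᵒᵖ} {a a' : F.obj ⟨x⟩} (k : a ⟶ a') :
    (push F (λ_ x).hom).map ((t.mu (𝟙_ Xᵒᵖ) x).map (𝟙 t.unit ×ₘ k)) ≫ (t.xi a').hom =
      (t.xi a).hom ≫ k := by
  refine hom_comp_hom_of_inv (hom_injective (f := (λ_ x).hom) ?_)
  rw [← vert_comp_hom, ← hom_comp_vert, hom_xi, hom_xi, vert_mu, vert_id]
  exact t.leftIso_natural _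

theorem pentagon {w x y z : Xᵒᵖ} (a : F.obj ⟨w⟩) (b : F.obj ⟨x⟩) (c : F.obj ⟨y⟩)
    (d : F.obj ⟨z⟩) :
    (pushComp F ((α_ w x y).hom ⊗ₘ 𝟙 z) ((α_ w (x ⊗ y) z).hom ≫ (𝟙 w ⊗ₘ (α_ x y z).hom))
        ((α_ (w ⊗ x) y z).hom ≫ (α_ w x (y ⊗ z)).hom) (by simp)
        ((t.mu _ z).obj ((t.mu _ y).obj ((t.mu w x).obj (a, b), c), d))).hom ≫
      (push F _).map ((t.muMap (α_ w x y).hom (𝟙 z) _ d).hom ≫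
        (t.mu _ z).map ((t.omega a b c).hom ×ₘ (pushId F (𝟙 z) rfl d).hom)) ≫
      (pushComp F (α_ w (x ⊗ y) z).hom (𝟙 w ⊗ₘ (α_ x y z).hom) _ rfl _).hom ≫
      (push F (𝟙 w ⊗ₘ (α_ x y z).hom)).map (t.omega a ((t.mu x y).obj (b, c)) d).hom ≫
      (t.muMap (𝟙 w) (α_ x y z).hom a _).hom ≫
      (t.mu w _).map ((pushId F (𝟙 w) rfl a).hom ×ₘ (t.omega b c d).hom) =
    (pushComp F (α_ (w ⊗ x) y z).hom (α_ w x (y ⊗ z)).hom _ rfl _).hom ≫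
      (push F (α_ w x (y ⊗ z)).hom).map (t.omega ((t.mu w x).obj (a, b)) c d).hom ≫
      (t.omega a b ((t.mu y z).obj (c, d))).hom := by
  refine hom_eq_hom_of_inv
    (i := pushComp F ((α_ w x y).hom ⊗ₘ 𝟙 z) ((α_ w (x ⊗ y) z).hom ≫ (𝟙 w ⊗ₘ (α_ x y z).hom))
        ((α_ (w ⊗ x) y z).hom ≫ (α_ w x (y ⊗ z)).hom) (by simp) _ ≪≫
      (push F _).mapIso (t.muMap (α_ w x y).hom (𝟙 z) _ d ≪≫
        t.muIso (t.omega a b c) (pushId F (𝟙 z) rfl d)) ≪≫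
      pushComp F (α_ w (x ⊗ y) z).hom (𝟙 w ⊗ₘ (α_ x y z).hom) _ rfl _ ≪≫
      (push F (𝟙 w ⊗ₘ (α_ x y z).hom)).mapIso (t.omega a ((t.mu x y).obj (b, c)) d) ≪≫
      t.muMap (𝟙 w) (α_ x y z).hom a _ ≪≫
      t.muIso (pushId F (𝟙 w) rfl a) (t.omega b c d))
    (j := pushComp F (α_ (w ⊗ x) y z).hom (α_ w x (y ⊗ z)).hom _ rfl _ ≪≫
      (push F (α_ w x (y ⊗ z)).hom).mapIso (t.omega ((t.mu w x).obj (a, b)) c d) ≪≫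
      t.omega a b ((t.mu y z).obj (c, d)))
    (hom_injective ?_)
  refine (hom_comp_hom' _ _ _ _ _ _).symm.trans (Eq.trans ?_ (hom_comp_hom' _ _ _ _ _ _))
  refine ((hom_comp_hom' _ _ _ _ _ _).symm =≫ _).trans ?_
  have e₁ := t.tensor_hom (𝟙 w) (pushId F (𝟙 w) rfl a).inv (α_ x y z).hom (t.omega b c d).inv
  have e₂ := t.tensor_hom (α_ w x y).hom (t.omega a b c).inv (𝟙 z) (pushId F (𝟙 z) rfl d).inv
  rw [← id_eq_hom, hom_omega] at e₁ e₂
  refine (congrArg₂ (· ≫ ·) (congrArg₂ (· ≫ ·) e₁.symm (t.hom_omega _ _ _)) e₂.symm).trans ?_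
  exact (t.pentagonIso a b c d).trans
    (congrArg₂ (· ≫ ·) (t.hom_omega _ _ _).symm (t.hom_omega _ _ _).symm)

theorem triangle {x y : Xᵒᵖ} (a : F.obj ⟨x⟩) (b : F.obj ⟨y⟩) :
    (pushComp F (α_ x (𝟙_ Xᵒᵖ) y).hom (𝟙 x ⊗ₘ (λ_ y).hom) ((ρ_ x).hom ⊗ₘ 𝟙 y) (by simp)
        ((t.mu _ y).obj ((t.mu x _).obj (a, t.unit), b))).hom ≫
      (push F (𝟙 x ⊗ₘ (λ_ y).hom)).map (t.omega a t.unit b).hom ≫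
      (t.muMap (𝟙 x) (λ_ y).hom a _).hom ≫
      (t.mu x y).map ((pushId F (𝟙 x) rfl a).hom ×ₘ (t.xi b).hom) =
    (t.muMap (ρ_ x).hom (𝟙 y) _ b).hom ≫
      (t.mu x y).map ((t.zeta a).hom ×ₘ (pushId F (𝟙 y) rfl b).hom) := by
  refine hom_eq_hom_of_inv
    (i := pushComp F (α_ x (𝟙_ Xᵒᵖ) y).hom (𝟙 x ⊗ₘ (λ_ y).hom) ((ρ_ x).hom ⊗ₘ 𝟙 y) (by simp) _ ≪≫
      (push F (𝟙 x ⊗ₘ (λ_ y).hom)).mapIso (t.omega a t.unit b) ≪≫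
      t.muMap (𝟙 x) (λ_ y).hom a _ ≪≫ t.muIso (pushId F (𝟙 x) rfl a) (t.xi b))
    (j := t.muMap (ρ_ x).hom (𝟙 y) _ b ≪≫ t.muIso (t.zeta a) (pushId F (𝟙 y) rfl b))
    (hom_injective ?_)
  refine (hom_comp_hom' _ _ _ _ _ _).symm.trans (Eq.trans ?_ (t.tensor_hom _ _ _ _))
  have e := t.tensor_hom (𝟙 x) (pushId F (𝟙 x) rfl a).inv (λ_ y).hom (t.xi b).inv
  rw [← id_eq_hom, hom_xi] at e
  refine (congrArg₂ (· ≫ ·) e.symm (t.hom_omega _ _ _)).trans ((t.triangleIso a b).trans ?_)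
  exact congrArg₂ t.tensor (t.hom_zeta a).symm (id_eq_hom _ _ _ _)

/-- The lax monoidal pseudofunctor given by a monoidal structure on `∫ᶜ F`. -/
noncomputable def toLax : LaxMonoidalPseudofunctor.{v₁, u₁, v₂, u₂} Xᵒᵖ where
  toPs := F
  mu := t.mu
  muMap := t.muMap
  muMap_natural := t.muMap_natural
  muMap_id := t.muMap_id
  muMap_comp := t.muMap_comp
  mu0 := t.unit
  omega := t.omega
  omega_natural := t.omega_natural
  omega_modification := t.omega_modification
  zeta := t.zeta
  zeta_natural := t.zeta_natural
  zeta_modification := t.zeta_modification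
  xi := t.xi
  xi_natural := t.xi_natural
  xi_modification := t.xi_modification
  pentagon := t.pentagon
  triangle := t.triangle

/-- The constraints are compared through their inverses, which are the arrows with known fibre
components. -/
theorem tensorStruct_toLax : tensorStruct t.toLax = tensorStructOf (A := ∫ᶜ F)
    (fun A B => ⟨A.base ⊗ B.base, t.obj A.fiber B.fiber⟩) ⟨𝟙_ X, t.unit⟩ t.map t.ass t.left
      t.right := by
  exact tensorStructOf_congr
    (fun φ ψ => (t.tensor_hom φ.base.op φ.fiber ψ.base.op ψ.fiber).symm)
    (fun A B D => Iso.ext_inv (t.hom_omega (x := op A.base) (y := op B.base) (z := op D.base)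
      A.fiber B.fiber D.fiber))
    (fun A => Iso.ext_inv (t.hom_xi (x := op A.base) A.fiber))
    (fun A => Iso.ext_inv (t.hom_zeta (x := op A.base) A.fiber))

end FiberedTensor

end FiberedTensor

end Contra

end MonGroth

/-! ### Transport of the tensor product and the 2-equivalence for fibrations -/

namespace MonGroth

open scoped Pseudofunctor.CoGrothendieck Pseudofunctor.Grothendieck

namespace Contra

/-- The structure maps of the monoidal structure on `∫ᶜ F`. -/
abbrev FiberedTensor.struct {X : Type u₁} [Category.{v₁} X] [MonoidalCategory X]
    {F : LocallyDiscrete Xᵒᵖ ⥤ᵖ Cat.{v₂, u₂}} (t : FiberedTensor F) : MonoidalCategoryStruct (∫ᶜ F) :=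
  tensorStructOf (fun A B => ⟨A.base ⊗ B.base, t.obj A.fiber B.fiber⟩) ⟨𝟙_ X, t.unit⟩ t.map t.ass
    t.left t.right

section Transport

theorem isHomLift_map_base {A : Type u₁} [Category.{v₁} A] {X : Type u₂} [Category.{v₂} X]
    {p : A ⥤ X} {F : LocallyDiscrete Xᵒᵖ ⥤ᵖ Cat.{v, u}} {K : (∫ᶜ F) ⥤ A}
    (w : K ⋙ p = Pseudofunctor.CoGrothendieck.forget F) {a b : ∫ᶜ F} (φ : a ⟶ b) :
    p.IsHomLift φ.base (K.map φ) :=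
  IsHomLift.of_fac' p _ _ (congr(($w).obj a) :) (congr(($w).obj b) :)
    (CategoryTheory.Functor.congr_hom w φ)

theorem base_eq_of_isHomLift_map {A : Type u₁} [Category.{v₁} A] {X : Type u₂} [Category.{v₂} X]
    {p : A ⥤ X} {F : LocallyDiscrete Xᵒᵖ ⥤ᵖ Cat.{v, u}} {K : (∫ᶜ F) ⥤ A}
    (w : K ⋙ p = Pseudofunctor.CoGrothendieck.forget F) {a b : ∫ᶜ F} (φ : a ⟶ b)
    {f : a.base ⟶ b.base} (h : p.IsHomLift f (K.map φ)) : φ.base = f :=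
  (@IsHomLift.fac _ _ _ _ p _ _ _ _ _ _ (isHomLift_map_base w φ)).trans
    (@IsHomLift.fac _ _ _ _ p _ _ _ _ _ _ h).symm

theorem exists_obj_eq {A : Type u₁} [Category.{v₁} A] {X : Type u₂} [Category.{v₂} X]
    {p : A ⥤ X} {F : LocallyDiscrete Xᵒᵖ ⥤ᵖ Cat.{v, u}} {K : (∫ᶜ F) ⥤ A}
    (w : K ⋙ p = Pseudofunctor.CoGrothendieck.forget F) (h₀ : Function.Surjective K.obj) {x : X}
    (a : A) (ha : p.obj a = x) : ∃ b : F.obj ⟨op x⟩, K.obj ⟨x, b⟩ = a := by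
  obtain ⟨⟨y, b⟩, rfl⟩ := h₀ a
  have h : p.obj (K.obj ⟨y, b⟩) = y := congr(($w).obj ⟨y, b⟩)
  obtain rfl : y = x := h.symm.trans ha
  exact ⟨b, rfl⟩

/-- The covariant transport argument applies unchanged: it uses only that `K` is bijective on
objects and arrows over the base, now together with reflection and preservation of cartesian arrows.
-/
theorem exists_fiberedTensor {A : Type u₁} [Category.{v₁} A] [MonoidalCategory A] {X : Type u₂}
    [Category.{v₂} X] [MonoidalCategory X] {p : A ⥤ X} [IsStrictMonoidal p]
    {F : LocallyDiscrete Xᵒᵖ ⥤ᵖ Cat.{v₁, u}} {K : (∫ᶜ F) ⥤ A}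
    (w : K ⋙ p = Pseudofunctor.CoGrothendieck.forget F) (h₀ : Function.Surjective K.obj)
    (hK : ∀ a b, Function.Bijective (K.map : (a ⟶ b) → _))
    (hp : ∀ {a b a' b' : A} (φ : a ⟶ b) (ψ : a' ⟶ b'), IsCart p φ → IsCart p ψ →
      IsCart p (φ ⊗ₘ ψ)) :
    ∃ t : FiberedTensor F, letI := t.struct; ∃ D : Monoidal.InducingFunctorData K,
      p.IsHomLift (𝟙 (𝟙_ X)) D.εIso.hom ∧
        ∀ (a b : ∫ᶜ F), p.IsHomLift (𝟙 (a.base ⊗ b.base)) (D.μIso a b).hom := by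
  have hKp : ∀ (a : ∫ᶜ F), p.obj (K.obj a) = a.base := fun a => congr(($w).obj a)
  have hm : ∀ {x y : Xᵒᵖ} (a : F.obj ⟨x⟩) (b : F.obj ⟨y⟩), ∃ m : F.obj ⟨x ⊗ y⟩,
      K.obj ⟨(x ⊗ y).unop, m⟩ = K.obj ⟨x.unop, a⟩ ⊗ K.obj ⟨y.unop, b⟩ := fun a b =>
    exists_obj_eq w h₀ _ (by rw [IsStrictMonoidal.obj_tensor, hKp, hKp])
  choose m hm using @hm
  obtain ⟨e, he⟩ := exists_obj_eq w h₀ (𝟙_ A) IsStrictMonoidal.obj_unit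
  let obj : (∫ᶜ F) → (∫ᶜ F) → ∫ᶜ F := fun a b => ⟨a.base ⊗ b.base, m a.fiber b.fiber⟩
  let unit : ∫ᶜ F := ⟨𝟙_ X, e⟩
  have hobj : ∀ (a b : ∫ᶜ F), K.obj a ⊗ K.obj b = K.obj (obj a b) := fun a b =>
    (hm (x := op a.base) (y := op b.base) a.fiber b.fiber).symm
  let c : ∀ (a b : ∫ᶜ F), K.obj a ⊗ K.obj b ≅ K.obj (obj a b) := fun a b => eqToIso (hobj a b)
  let i : 𝟙_ A ≅ K.obj unit := eqToIso he.symm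
  have hc : ∀ (a b : ∫ᶜ F), p.IsHomLift (𝟙 (a.base ⊗ b.base)) (c a b).hom := fun a b =>
    IsHomLift.eqToHom_codomain_lift_id (hobj a b) (hKp (obj a b))
  have hc' : ∀ (a b : ∫ᶜ F), p.IsHomLift (𝟙 (a.base ⊗ b.base)) (c a b).inv := fun a b =>
    IsHomLift.lift_id_inv p _ (c a b)
  have hε : p.IsHomLift (𝟙 (𝟙_ X)) i.hom :=
    IsHomLift.eqToHom_codomain_lift_id he.symm (hKp unit)
  have hε' : p.IsHomLift (𝟙 (𝟙_ X)) i.inv := IsHomLift.lift_id_inv p _ i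
  have hid : ∀ (a : ∫ᶜ F), p.IsHomLift (𝟙 a.base) (𝟙 (K.obj a)) := fun a => IsHomLift.id (hKp a)
  choose T hT using fun {a a' b b' : ∫ᶜ F} (φ : a ⟶ a') (ψ : b ⟶ b') =>
    (hK (obj a b) (obj a' b')).2 ((c a b).inv ≫ (K.map φ ⊗ₘ K.map ψ) ≫ (c a' b').hom)
  choose ass hass using fun (a b d : ∫ᶜ F) => exists_iso_map_eq K hK
    (((c _ _).symm ≪≫ ((c _ _).symm ⊗ᵢ .refl _)) ≪≫
      MonoidalCategory.associator (K.obj a) (K.obj b) (K.obj d) ≪≫ ((.refl _ ⊗ᵢ c _ _) ≪≫ c _ _) :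
      K.obj (obj (obj a b) d) ≅ K.obj (obj a (obj b d)))
  choose left hleft using fun (a : ∫ᶜ F) => exists_iso_map_eq K hK
    (((c _ _).symm ≪≫ (i.symm ⊗ᵢ .refl _)) ≪≫ MonoidalCategory.leftUnitor (K.obj a) :
      K.obj (obj unit a) ≅ K.obj a)
  choose right hright using fun (a : ∫ᶜ F) => exists_iso_map_eq K hK
    (((c _ _).symm ≪≫ (.refl _ ⊗ᵢ i.symm)) ≪≫ MonoidalCategory.rightUnitor (K.obj a) :
      K.obj (obj a unit) ≅ K.obj a)
  let S : MonoidalCategoryStruct (∫ᶜ F) := tensorStructOf obj unit T ass left right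
  let D : @Monoidal.InducingFunctorData A _ _ (∫ᶜ F) _ S K :=
    { μIso := c
      εIso := i
      whiskerLeft_eq := fun a _ _ f => by
        refine (hT (𝟙 a) f).trans ?_
        rw [K.map_id, id_tensorHom]
      whiskerRight_eq := fun f a => by
        refine (hT f (𝟙 a)).trans ?_
        rw [K.map_id, MonoidalCategory.tensorHom_id]
      tensorHom_eq := hT
      associator_eq := hass
      leftUnitor_eq := hleft
      rightUnitor_eq := hright }
  have hfaith : K.Faithful := ⟨fun h => (hK _ _).1 h⟩
  refine ⟨⟨m, e, T, fun φ ψ => ?_, fun {a a' b b'} φ ψ hφ hψ => ?_, ass, fun a b d => ?_, left,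
    fun a => ?_, right, fun a => ?_, ⟨Monoidal.induced K D, rfl⟩⟩, D, hε, hc⟩
  · refine base_eq_of_isHomLift_map w _ ?_
    rw [hT]
    exact isHomLift_conj p (isHomLift_tensorHom p (isHomLift_map_base w φ)
      (isHomLift_map_base w ψ)) (hobj _ _) (hobj _ _)
  · rw [← w]
    refine isCart_of_isCart_map K p hK _ ?_
    rw [hT]
    rw [← w] at hφ hψ
    exact isCart_conj p (hp _ _ (isCart_map_of_bijective K p h₀ hK φ hφ)
      (isCart_map_of_bijective K p h₀ hK ψ hψ)) (hobj a b) (hobj a' b')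
  · refine base_eq_of_isHomLift_map w _ ?_
    rw [hass]
    have h₁ := isHomLift_associator p (hKp a) (hKp b) (hKp d)
    have h₂ := isHomLift_tensorHom p (hid a) (hc b d)
    have h₃ := isHomLift_tensorHom p (hc' a b) (hid d)
    have h₄ := hc a (obj b d)
    have h₅ := hc' (obj a b) d
    rw [id_tensorHom_id] at h₂ h₃
    exact isHomLift_id_comp p (isHomLift_id_comp p h₅ h₃)
      (isHomLift_comp_id p h₁ (isHomLift_id_comp p h₂ h₄))
  · refine base_eq_of_isHomLift_map w _ ?_
    rw [hleft]
    have h₁ := isHomLift_leftUnitor p (hKp a)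
    have h₂ := isHomLift_tensorHom p hε' (hid a)
    rw [id_tensorHom_id] at h₂
    exact isHomLift_id_comp p (isHomLift_id_comp p (hc' unit a) h₂) h₁
  · refine base_eq_of_isHomLift_map w _ ?_
    rw [hright]
    have h₁ := isHomLift_rightUnitor p (hKp a)
    have h₂ := isHomLift_tensorHom p (hid a) hε'
    rw [id_tensorHom_id] at h₂
    exact isHomLift_id_comp p (isHomLift_id_comp p (hc' a unit) h₂) h₁

end Transport

section Equivalence

variable {X : Type u} [Category.{v} X] [MonoidalCategory X]

theorem exists_monoidalOverHom (M : LaxMonoidalPseudofunctor.{v, u, v, u} Xᵒᵖ)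
    (A : MonoidalOver.{v, u} X) (K : (∫ᶜ M.toPs) ⥤ A.based.obj)
    (w : K ⋙ A.based.p = Pseudofunctor.CoGrothendieck.forget M.toPs) (hK : K.Faithful)
    (h : letI := tensorStruct M; ∃ D : Monoidal.InducingFunctorData K,
      A.based.p.IsHomLift (𝟙 (𝟙_ X)) D.εIso.hom ∧
        ∀ (a b : ∫ᶜ M.toPs), A.based.p.IsHomLift (𝟙 (a.base ⊗ b.base)) (D.μIso a b).hom) :
    ∃ H : MonoidalOverHom (total M) A, H.based = ⟨K, w⟩ := by
  let S := tensorStruct M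
  obtain ⟨D, hε, hμ⟩ := h
  let mon := Monoidal.induced K D
  let m : K.CoreMonoidal := Monoidal.fromInducedCoreMonoidal K D
  exact ⟨⟨⟨K, w⟩, m.toMonoidal, hε, hμ⟩, rfl⟩

/-- Choosing cartesian lifts makes the fibration isomorphic over `X` to a Grothendieck construction,
and the transported tensor product makes this isomorphism strong monoidal. -/
theorem exists_iso_totalObj (A : MonFib.{v, u} X) :
    ∃ (M : LaxMonoidalPseudofunctor.{v, u, v, u} Xᵒᵖ) (i : A ⟶ totalObj M) (j : totalObj M ⟶ A),
      i ≫ j = 𝟙 A ∧ j ≫ i = 𝟙 (totalObj M) := by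
  obtain ⟨c⟩ := nonempty_cleavage A.property.1
  obtain ⟨t, ht⟩ := exists_fiberedTensor c.fromTotal_comp c.fromTotal_obj_bijective.2
    c.fromTotal_map_bijective A.property.2
  have hfaith : c.fromTotal.Faithful := ⟨fun h => (c.fromTotal_map_bijective _ _).1 h⟩
  change letI := t.struct; _ at ht
  rw [FiberedTensor.struct, ← t.tensorStruct_toLax] at ht
  obtain ⟨⟨H, m, h₁, h₂⟩, hH⟩ := exists_monoidalOverHom t.toLax A.obj c.fromTotal c.fromTotal_comp hfaith ht
  obtain rfl : H = _ := hH
  let K : SubTwoCategory.Hom (totalObj t.toLax) A :=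
    ⟨⟨⟨c.fromTotal, c.fromTotal_comp⟩, m, h₁, h₂⟩, fun φ hφ => by
      refine isCart_map_of_bijective c.fromTotal A.obj.based.p c.fromTotal_obj_bijective.2
        c.fromTotal_map_bijective φ ?_
      rw [c.fromTotal_comp]
      exact hφ⟩
  obtain ⟨i, j, h, h'⟩ := exists_inverse_monFib K c.fromTotal_obj_bijective
    c.fromTotal_map_bijective
  exact ⟨t.toLax, j, i, h', h⟩

theorem exists_twoEquivalence_restricts : ∃ E : TwoEquivalence (MonFib.{v, u} X)
    (LaxMonoidalPseudofunctor.{v, u, v, u} Xᵒᵖ), Restricts E.inverse := by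
  obtain ⟨E, hE⟩ := exists_twoEquivalence (twoFunctor X) (fun A => exists_iso_totalObj A)
    (fun M N => ⟨totalHom_injective, totalHom_surjective⟩) totalHom₂_bijective
  exact ⟨E, hE ▸ restricts_twoFunctor X⟩

end Equivalence

end Contra

end MonGroth

theorem mainTheorem6 (X : Type u) [Category.{v} X] [MonoidalCategory X] :
    (∃ E : MonGroth.TwoEquivalence (MonGroth.MonFib.{v, u} X)
        (MonGroth.LaxMonoidalPseudofunctor.{v, u, v, u} Xᵒᵖ),
      MonGroth.Contra.Restricts E.inverse) ∧
    (∃ E : MonGroth.TwoEquivalence (MonGroth.MonOpFib.{v, u} X)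
        (MonGroth.LaxMonoidalPseudofunctor.{v, u, v, u} X),
      MonGroth.Co.Restricts E.inverse) :=
  ⟨MonGroth.Contra.exists_twoEquivalence_restricts, MonGroth.Co.exists_twoEquivalence_restricts⟩
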